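/- Let $n,m,p,q$ be positive integers with $p>q$. Write the homogeneous coordinates on $\mathbb{RP}^{n+m}$ as $[x,y,z]$ with $x\in\mathbb R^n$, $y\in\mathbb R^m$, $z\in\mathbb R$, let $P=[0,0,1]$, and consider the real projective varieties $$V=\{|x|^{2p}=|y|^{2q}z^{2(p-q)}\},\qquad W=\{|x|^{2p}=|y|^{2q}z^{2(p-q)}+|y|^{2p}\}\subset\mathbb{RP}^{n+m}.$$ 1. The singular locus of $W$, as a variety of dimension $n+m-1$, is $\operatorname{sing}W=\{P\}$: the point $P$ is the only point of $W$ at which the Zariski tangent space of $W$, computed from all homogeneous polynomials vanishing on $W$, does not have dimension $n+m-1$. 2. For every smooth Riemannian metric $g$ on $\mathbb{RP}^{n+m}$ there are open neighborhoods $U_1,U_2$ of $P$ such that $(W\cap U_1)\setminus\{P\}$ and $(V\cap U_2)\setminus\{P\}$ are embedded $(n+m-1)$-dimensional smooth submanifolds which, with the metrics induced by $g$, are quasi-isometric, by a diffeomorphism $\Phi$ that extends by $P\mapsto P$ to a homeomorphism $W\cap U_1\to V\cap U_2$. Here $\Phi$ is a quasi-isometry if, for some constant $C>0$, the metric of the source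 and the pullback under $\Phi$ of the metric of the target satisfy $C^{-1}g(v,v)\le(\Phi^*g)(v,v)\le C\,g(v,v)$ for all tangent vectors $v$. 3. The regular part $M=W\setminus\operatorname{sing}W$ is a non-empty embedded $(n+m-1)$-dimensional smooth submanifold of $\mathbb{RP}^{n+m}$. If $p(m-1)=q(n-1)$, then for every smooth Riemannian metric $g$ on $\mathbb{RP}^{n+m}$ the $L^2$-Stokes theorem fails for $M$ with the metric induced by $g$. The $L^2$-Stokes theorem is said to hold for a Riemannian manifold $M$ if, in all degrees, $$(d_{\max}\omega,\eta)=(\omega,d^t_{\max}\eta)\quad\text{for all }\omega\in\operatorname{dom}(d_{\max}),\ \eta\in\operatorname{dom}(d^t_{\max}),$$ where $(\cdot,\cdot)$ is the $L^2$ inner product of differential forms, $d^t$ is the formal adjoint of the exterior derivative $d$, and $d_{\max}$ and $d^t_{\max}$ are the Hilbert space adjoints of the operators $d^t$ and $d$ on smooth compactly supported forms. 4. Positive integers $n,m,p,q$ exist with $p>q$, $p(m-1)=q(n-1)$ and $n+m-1$ even. For such a choice $W$ is an even-dimensional real projective variety with exactly one singular point, for which the $L^2$-Stokes theorem fails (for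 the metrics induced by all Riemannian metrics on $\mathbb{RP}^{n+m}$). -/

import Mathlib

open Set Filter Topology MeasureTheory Module
open scoped Manifold ContDiff LinearAlgebra.Projectivization

noncomputable section

/-! ### Real projective space as a smooth manifold -/

/-- Real projective space of dimension `N`: the space of lines in `ℝ^(N+1)`. -/
abbrev RealProj (N : ℕ) : Type := ℙ ℝ (Fin (N + 1) → ℝ)

namespace RealProj

variable {N : ℕ}

/-- The quotient topology from `ℝ^(N+1) \ {0}`. -/
instance : TopologicalSpace (RealProj N) :=
  TopologicalSpace.coinduced (Projectivization.mk' ℝ) inferInstance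

theorem isQuotientMap_mk' :
    IsQuotientMap (Projectivization.mk' ℝ : {v : Fin (N + 1) → ℝ // v ≠ 0} → RealProj N) where
  surjective := fun x => ⟨⟨x.rep, x.rep_nonzero⟩, by simp⟩
  eq_coinduced := rfl

/-- The `i`-th affine coordinates `(v_j / v_i)`, `j ≠ i`, of the point `[v]`. -/
def affineCoord (i : Fin (N + 1)) (x : RealProj N) : Fin N → ℝ :=
  fun j => x.rep (i.succAbove j) / x.rep i

theorem rep_mk (v : Fin (N + 1) → ℝ) (hv : v ≠ 0) :
    ∃ a : ℝ, a ≠ 0 ∧ (Projectivization.mk ℝ v hv).rep = a • v := by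
  obtain ⟨a, ha⟩ := Projectivization.exists_smul_eq_mk_rep ℝ v hv
  exact ⟨a, a.ne_zero, ha.symm⟩

theorem rep_mk_ne_zero_iff (v : Fin (N + 1) → ℝ) (hv : v ≠ 0) (i : Fin (N + 1)) :
    (Projectivization.mk ℝ v hv).rep i ≠ 0 ↔ v i ≠ 0 := by
  obtain ⟨a, ha, h⟩ := rep_mk v hv
  simp [h, ha]

theorem affineCoord_mk (i : Fin (N + 1)) (v : Fin (N + 1) → ℝ) (hv : v ≠ 0) :
    affineCoord i (Projectivization.mk ℝ v hv) = fun j => v (i.succAbove j) / v i := by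
  obtain ⟨a, ha, h⟩ := rep_mk v hv
  funext j
  simp only [affineCoord, h, Pi.smul_apply, smul_eq_mul]
  exact mul_div_mul_left _ _ ha

theorem insertNth_one_ne_zero (i : Fin (N + 1)) (u : Fin N → ℝ) :
    (i.insertNth (1 : ℝ) u : Fin (N + 1) → ℝ) ≠ 0 := by
  intro h
  have := congrFun h i
  simp at this

/-- The point with homogeneous coordinates `u` and a `1` inserted at place `i`. -/
def ofAffine (i : Fin (N + 1)) (u : Fin N → ℝ) : RealProj N :=
  Projectivization.mk ℝ (i.insertNth (1 : ℝ) u : Fin (N + 1) → ℝ) (insertNth_one_ne_zero i u)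

theorem isOpen_affine (i : Fin (N + 1)) : IsOpen {x : RealProj N | x.rep i ≠ 0} := by
  rw [← isQuotientMap_mk'.isOpen_preimage]
  have : (Projectivization.mk' ℝ ⁻¹' {x : RealProj N | x.rep i ≠ 0}) =
      {v : {v : Fin (N + 1) → ℝ // v ≠ 0} | v.1 i ≠ 0} := by
    ext v
    exact rep_mk_ne_zero_iff v.1 v.2 i
  rw [this]
  exact isOpen_ne_fun ((continuous_apply i).comp continuous_subtype_val) continuous_const

theorem continuous_insertNth_one (i : Fin (N + 1)) :
    Continuous (fun u : Fin N → ℝ => (i.insertNth (1 : ℝ) u : Fin (N + 1) → ℝ)) := by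
  refine continuous_pi fun j => ?_
  refine Fin.succAboveCases i ?_ (fun k => ?_) j
  · simpa using continuous_const
  · simpa using continuous_apply k

/-- The standard affine chart on `{v_i ≠ 0}`. -/
def affineChart (i : Fin (N + 1)) : OpenPartialHomeomorph (RealProj N) (Fin N → ℝ) where
  toFun := affineCoord i
  invFun := ofAffine i
  source := {x | x.rep i ≠ 0}
  target := univ
  map_source' := fun _ _ => mem_univ _
  map_target' := fun u _ => by
    simp only [mem_ofPred_eq, ofAffine]
    rw [rep_mk_ne_zero_iff]
    simp
  left_inv' := fun x hx => by
    simp only [mem_ofPred_eq] at hx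
    conv_rhs => rw [← x.mk_rep]
    rw [ofAffine, Projectivization.mk_eq_mk_iff']
    refine ⟨(x.rep i)⁻¹, ?_⟩
    funext j
    refine Fin.succAboveCases i ?_ (fun k => ?_) j
    · simp [hx]
    · simp [affineCoord, div_eq_inv_mul]
  right_inv' := fun u _ => by
    rw [ofAffine, affineCoord_mk]
    funext j
    simp
  open_source := isOpen_affine i
  open_target := isOpen_univ
  continuousOn_toFun := by
    refine (isQuotientMap_mk'.continuousOn_isOpen_iff (isOpen_affine i)).2 ?_
    have h : (affineCoord i ∘ Projectivization.mk' ℝ) =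
        fun v : {v : Fin (N + 1) → ℝ // v ≠ 0} => fun j => v.1 (i.succAbove j) / v.1 i := by
      funext v
      exact affineCoord_mk i v.1 v.2
    rw [h]
    refine continuousOn_pi.2 fun j => ContinuousOn.div
      ((continuous_apply _).comp continuous_subtype_val).continuousOn
      ((continuous_apply _).comp continuous_subtype_val).continuousOn ?_
    intro v hv
    exact (rep_mk_ne_zero_iff v.1 v.2 i).1 hv
  continuousOn_invFun := by
    refine Continuous.continuousOn ?_
    exact isQuotientMap_mk'.continuous.comp
      ((continuous_insertNth_one i).subtype_mk (insertNth_one_ne_zero i))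

theorem exists_rep_ne_zero (x : RealProj N) : ∃ i, x.rep i ≠ 0 :=
  Function.ne_iff.1 x.rep_nonzero

/-- The atlas of the `N + 1` standard affine charts. -/
instance : ChartedSpace (Fin N → ℝ) (RealProj N) where
  atlas := range affineChart
  chartAt x := affineChart (exists_rep_ne_zero x).choose
  mem_chart_source x := (exists_rep_ne_zero x).choose_spec
  chart_mem_atlas _ := mem_range_self _

instance : IsManifold 𝓘(ℝ, Fin N → ℝ) ∞ (RealProj N) := by
  refine isManifold_of_contDiffOn _ _ _ ?_
  rintro _ _ ⟨i, rfl⟩ ⟨j, rfl⟩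
  have hins : ContDiff ℝ ∞ (fun u : Fin N → ℝ => (i.insertNth (1 : ℝ) u : Fin (N + 1) → ℝ)) := by
    refine contDiff_pi.2 fun l => ?_
    refine Fin.succAboveCases i ?_ (fun k => ?_) l
    · simpa using contDiff_const
    · simpa using contDiff_apply ℝ ℝ k
  have hfun : (𝓘(ℝ, Fin N → ℝ) ∘ ((affineChart i).symm ≫ₕ affineChart j) ∘
      (𝓘(ℝ, Fin N → ℝ)).symm) =
      fun u : Fin N → ℝ => fun k : Fin N =>
        (i.insertNth (1 : ℝ) u : Fin (N + 1) → ℝ) (j.succAbove k) /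
          (i.insertNth (1 : ℝ) u : Fin (N + 1) → ℝ) j := by
    funext u
    exact affineCoord_mk j _ (insertNth_one_ne_zero i u)
  rw [hfun]
  refine contDiffOn_pi.2 fun k => ContDiffOn.div ?_ ?_ ?_
  · exact ((contDiff_apply ℝ ℝ (j.succAbove k)).comp hins).contDiffOn
  · exact ((contDiff_apply ℝ ℝ j).comp hins).contDiffOn
  · intro u hu
    have h1 : u ∈ ((affineChart i).symm ≫ₕ affineChart j).source := hu.1
    rw [OpenPartialHomeomorph.trans_source] at h1
    exact (rep_mk_ne_zero_iff _ (insertNth_one_ne_zero i u) j).1 h1.2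

end RealProj

/-! ### Embedded submanifolds -/

/-- A `d`-dimensional (locally closed, boundaryless) embedded smooth submanifold of a smooth
manifold `X` of dimension `N`: a subset that near each of its points is
`{u_d = ⋯ = u_{N-1} = 0}` in some smooth chart of `X`. -/
structure EmbeddedSubmanifold (X : Type) [TopologicalSpace X] {N : ℕ}
    [ChartedSpace (Fin N → ℝ) X] (d : ℕ) where
  /-- the underlying set -/
  carrier : Set X
  dim_le : d ≤ N
  exists_slice : ∀ x ∈ carrier,
    ∃ e ∈ IsManifold.maximalAtlas 𝓘(ℝ, Fin N → ℝ) ∞ X, x ∈ e.source ∧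
      ∀ y ∈ e.source, y ∈ carrier ↔ ∀ i : Fin N, d ≤ (i : ℕ) → e y i = 0

namespace EmbeddedSubmanifold

variable {X : Type} [TopologicalSpace X] {N : ℕ} [ChartedSpace (Fin N → ℝ) X] {d : ℕ}

/-- `ℝ^d → ℝ^N`, extension by zeros. -/
def pad (N : ℕ) (u : Fin d → ℝ) : Fin N → ℝ :=
  fun i => if h : (i : ℕ) < d then u ⟨i, h⟩ else 0

/-- `ℝ^N → ℝ^d`, the first `d` coordinates. -/
def trunc (h : d ≤ N) (w : Fin N → ℝ) : Fin d → ℝ := fun j => w (Fin.castLE h j)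

theorem trunc_pad (h : d ≤ N) (u : Fin d → ℝ) : trunc h (pad N u) = u := by
  funext j
  simp [trunc, pad]

theorem pad_trunc (h : d ≤ N) (w : Fin N → ℝ) (hw : ∀ i : Fin N, d ≤ (i : ℕ) → w i = 0) :
    pad N (trunc h w) = w := by
  funext i
  by_cases hi : (i : ℕ) < d
  · simp [trunc, pad, hi]
  · simp [pad, hi, hw i (not_lt.1 hi)]

theorem pad_eq_zero (u : Fin d → ℝ) (i : Fin N) (hi : d ≤ (i : ℕ)) : pad N u i = 0 := by
  simp [pad, not_lt.2 hi]

theorem contDiff_pad : ContDiff ℝ ∞ (pad N : (Fin d → ℝ) → (Fin N → ℝ)) := by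
  refine contDiff_pi.2 fun i => ?_
  by_cases hi : (i : ℕ) < d
  · simpa [pad, hi] using contDiff_apply ℝ ℝ (⟨i, hi⟩ : Fin d)
  · simpa [pad, hi] using contDiff_const

theorem contDiff_trunc (h : d ≤ N) :
    ContDiff ℝ ∞ (trunc h : (Fin N → ℝ) → (Fin d → ℝ)) :=
  contDiff_pi.2 fun j => contDiff_apply ℝ ℝ (Fin.castLE h j)

variable (S : EmbeddedSubmanifold X (N := N) d)

/-- The chart `e` of `X` is a slice chart for `S`. -/
def IsSlice (e : OpenPartialHomeomorph X (Fin N → ℝ)) : Prop :=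
  e ∈ IsManifold.maximalAtlas 𝓘(ℝ, Fin N → ℝ) ∞ X ∧
    ∀ y ∈ e.source, y ∈ S.carrier ↔ ∀ i : Fin N, d ≤ (i : ℕ) → e y i = 0

variable {S}

open Classical in
/-- The chart of `S` induced by a slice chart `e`: the first `d` coordinates of `e`. (The base
point `x` only serves as the irrelevant value of the inverse map outside its domain.) -/
def sliceChart (x : S.carrier) (e : OpenPartialHomeomorph X (Fin N → ℝ)) (he : S.IsSlice e) :
    OpenPartialHomeomorph S.carrier (Fin d → ℝ) where
  toFun y := trunc S.dim_le (e y)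
  invFun u := if h : e.symm (pad N u) ∈ S.carrier then ⟨e.symm (pad N u), h⟩ else x
  source := {y | (y : X) ∈ e.source}
  target := {u | pad N u ∈ e.target}
  map_source' := fun y hy => by
    have h0 := (he.2 y hy).1 y.2
    simp only [mem_ofPred_eq, pad_trunc S.dim_le _ h0]
    exact e.map_source hy
  map_target' := fun u hu => by
    have hs := e.map_target hu
    have hm : e.symm (pad N u) ∈ S.carrier := by
      refine (he.2 _ hs).2 fun i hi => ?_
      rw [e.right_inv hu, pad_eq_zero u i hi]
    simpa [hm] using hs
  left_inv' := fun y hy => by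
    have h0 := (he.2 y hy).1 y.2
    have h1 : e.symm (pad N (trunc S.dim_le (e y))) = y := by
      rw [pad_trunc S.dim_le _ h0]
      exact e.left_inv hy
    have h2 : e.symm (pad N (trunc S.dim_le (e y))) ∈ S.carrier := by rw [h1]; exact y.2
    rw [dif_pos h2]
    exact Subtype.ext h1
  right_inv' := fun u hu => by
    have hs := e.map_target hu
    have hm : e.symm (pad N u) ∈ S.carrier := by
      refine (he.2 _ hs).2 fun i hi => ?_
      rw [e.right_inv hu, pad_eq_zero u i hi]
    simp only [hm, dite_true]
    rw [e.right_inv hu, trunc_pad]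
  open_source := e.open_source.preimage continuous_subtype_val
  open_target := e.open_target.preimage contDiff_pad.continuous
  continuousOn_toFun :=
    (contDiff_trunc S.dim_le).continuous.comp_continuousOn
      (e.continuousOn.comp continuous_subtype_val.continuousOn fun _ hy => hy)
  continuousOn_invFun := by
    rw [IsInducing.subtypeVal.continuousOn_iff]
    have h : ContinuousOn (fun u : Fin d → ℝ => e.symm (pad N u)) {u | pad N u ∈ e.target} :=
      e.continuousOn_symm.comp contDiff_pad.continuous.continuousOn fun _ hu => hu
    refine h.congr fun u hu => ?_
    have hs := e.map_target hu
    have hm : e.symm (pad N u) ∈ S.carrier := by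
      refine (he.2 _ hs).2 fun i hi => ?_
      rw [e.right_inv hu, pad_eq_zero u i hi]
    simp [hm]

open Classical in
theorem coe_sliceChart_symm (x : S.carrier) (e : OpenPartialHomeomorph X (Fin N → ℝ))
    (he : S.IsSlice e) (u : Fin d → ℝ) (hu : pad N u ∈ e.target) :
    ((sliceChart x e he).symm u : X) = e.symm (pad N u) := by
  have hs := e.map_target hu
  have hm : e.symm (pad N u) ∈ S.carrier := by
    refine (he.2 _ hs).2 fun i hi => ?_
    rw [e.right_inv hu, pad_eq_zero u i hi]
  change ((if h : e.symm (pad N u) ∈ S.carrier then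
    (⟨e.symm (pad N u), h⟩ : S.carrier) else x : S.carrier) : X) = _
  rw [dif_pos hm]

theorem exists_isSlice (x : S.carrier) :
    ∃ e, S.IsSlice e ∧ (x : X) ∈ e.source := by
  obtain ⟨e, he, hx, h⟩ := S.exists_slice x x.2
  exact ⟨e, ⟨he, h⟩, hx⟩

/-- The manifold structure of an embedded submanifold, with the subspace topology. -/
instance : ChartedSpace (Fin d → ℝ) S.carrier where
  atlas := {c | ∃ x e he, c = sliceChart x e he}
  chartAt x := sliceChart x (exists_isSlice x).choose (exists_isSlice x).choose_spec.1
  mem_chart_source x := (exists_isSlice x).choose_spec.2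
  chart_mem_atlas _ := ⟨_, _, _, rfl⟩

instance : IsManifold 𝓘(ℝ, Fin d → ℝ) ∞ S.carrier := by
  refine isManifold_of_contDiffOn _ _ _ ?_
  rintro _ _ ⟨x, e, he, rfl⟩ ⟨x', e', he', rfl⟩
  have hcd : ContDiffOn ℝ ∞ (fun w : Fin N → ℝ => e' (e.symm w)) (e.symm ≫ₕ e').source :=
    (IsManifold.compatible_of_mem_maximalAtlas he.1 he'.1).1.mono fun w hw => ⟨hw, by simp⟩
  have hmem : ∀ u ∈ 𝓘(ℝ, Fin d → ℝ).symm ⁻¹'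
      ((sliceChart x e he).symm ≫ₕ sliceChart x' e' he').source ∩ range 𝓘(ℝ, Fin d → ℝ),
      pad N u ∈ (e.symm ≫ₕ e').source := by
    rintro u ⟨hu, -⟩
    have hu' : u ∈ ((sliceChart x e he).symm ≫ₕ sliceChart x' e' he').source := hu
    rw [OpenPartialHomeomorph.trans_source] at hu' ⊢
    have h1 : pad N u ∈ e.target := hu'.1
    have h2 : ((sliceChart x e he).symm u : X) ∈ e'.source := hu'.2
    rw [coe_sliceChart_symm x e he u h1] at h2
    exact ⟨h1, h2⟩
  refine ((contDiff_trunc S.dim_le).comp_contDiffOn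
    (hcd.comp contDiff_pad.contDiffOn hmem)).congr fun u hu => ?_
  have h1 : pad N u ∈ e.target := by
    have := hmem u hu
    rw [OpenPartialHomeomorph.trans_source] at this
    exact this.1
  change trunc S.dim_le (e' ((sliceChart x e he).symm u : X)) = _
  rw [coe_sliceChart_symm x e he u h1]
  rfl

/-- The Borel structure. -/
instance : MeasurableSpace S.carrier := borel S.carrier

instance : BorelSpace S.carrier := ⟨rfl⟩

end EmbeddedSubmanifold

/-! ### Metrics, differential forms and the `L²` de Rham complex on a manifold -/

section DeRham

variable (M : Type) [TopologicalSpace M] {d : ℕ} [ChartedSpace (Fin d → ℝ) M]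

/-- A field of bilinear forms on the tangent spaces; below it is always the one underlying a
Riemannian metric. -/
abbrev MetricField : Type :=
  (x : M) → TangentSpace 𝓘(ℝ, Fin d → ℝ) x → TangentSpace 𝓘(ℝ, Fin d → ℝ) x → ℝ

/-- Not necessarily continuous differential `k`-forms. -/
abbrev DiffForm (k : ℕ) : Type :=
  (x : M) → TangentSpace 𝓘(ℝ, Fin d → ℝ) x [⋀^Fin k]→L[ℝ] ℝ

variable {M} {k : ℕ}

/-- Coordinate representation of a form: its pullback under `e⁻¹`, for a chart `e`. -/
def DiffForm.inChart (e : OpenPartialHomeomorph M (Fin d → ℝ)) (θ : DiffForm M (d := d) k)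
    (u : Fin d → ℝ) : (Fin d → ℝ) [⋀^Fin k]→L[ℝ] ℝ :=
  (θ (e.symm u)).compContinuousLinearMap
    (mfderiv 𝓘(ℝ, Fin d → ℝ) 𝓘(ℝ, Fin d → ℝ) e.symm u)

/-- Smooth forms. -/
def DiffForm.IsSmooth (θ : DiffForm M (d := d) k) : Prop :=
  ∀ e ∈ atlas (Fin d → ℝ) M, ContDiffOn ℝ ∞ (θ.inChart e) e.target

/-- Smooth forms with compact support, `Ω₀^k(M)`. -/
def DiffForm.IsTest (θ : DiffForm M (d := d) k) : Prop :=
  θ.IsSmooth ∧ IsCompact (closure {x | θ x ≠ 0})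

/-- The exterior derivative, computed at `x` in the preferred chart at `x`. -/
def DiffForm.extD (θ : DiffForm M (d := d) k) : DiffForm M (d := d) (k + 1) := fun x =>
  (extDeriv (θ.inChart (chartAt (Fin d → ℝ) x))
    (chartAt (Fin d → ℝ) x x)).compContinuousLinearMap
      (mfderiv 𝓘(ℝ, Fin d → ℝ) 𝓘(ℝ, Fin d → ℝ) (chartAt (Fin d → ℝ) x) x)

/-- The standard basis of `T_x M = ℝ^d`. -/
def tangentBasis (x : M) (i : Fin d) : TangentSpace 𝓘(ℝ, Fin d → ℝ) x :=
  (Pi.single i 1 : Fin d → ℝ)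

/-- Gram matrix of the metric at `x` in the standard basis of `T_x M`. -/
def gram (g : MetricField M (d := d)) (x : M) : Matrix (Fin d) (Fin d) ℝ :=
  fun i j => g x (tangentBasis x i) (tangentBasis x j)

/-- The scalar product of `k`-covectors induced by `g`:
`⟨α, β⟩ = 1/k! ∑ g^{i₁j₁} ⋯ g^{i_k j_k} α_{i₁⋯i_k} β_{j₁⋯j_k}`. -/
def formInner (g : MetricField M (d := d)) (x : M)
    (α β : TangentSpace 𝓘(ℝ, Fin d → ℝ) x [⋀^Fin k]→L[ℝ] ℝ) : ℝ :=
  (k.factorial : ℝ)⁻¹ * ∑ I : Fin k → Fin d, ∑ J : Fin k → Fin d,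
    (∏ l, (gram g x)⁻¹ (I l) (J l)) *
      α (fun l => tangentBasis x (I l)) * β (fun l => tangentBasis x (J l))

/-- Coordinate matrix `(g_{ij})` of the metric in a chart `e`. -/
def chartGram (g : MetricField M (d := d)) (e : OpenPartialHomeomorph M (Fin d → ℝ))
    (u : Fin d → ℝ) : Matrix (Fin d) (Fin d) ℝ := fun i j =>
  g (e.symm u)
    (mfderiv 𝓘(ℝ, Fin d → ℝ) 𝓘(ℝ, Fin d → ℝ) e.symm u (tangentBasis u i))
    (mfderiv 𝓘(ℝ, Fin d → ℝ) 𝓘(ℝ, Fin d → ℝ) e.symm u (tangentBasis u j))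

variable [MeasurableSpace M]

/-- The measure `√(det g_{ij}) du` on the domain of a chart `e`, extended by zero to `M`. -/
def chartVolume (g : MetricField M (d := d)) (e : OpenPartialHomeomorph M (Fin d → ℝ)) :
    Measure M :=
  (((volume : Measure (Fin d → ℝ)).restrict e.target).withDensity
    fun u => ENNReal.ofReal (Real.sqrt (chartGram g e u).det)).map e.symm

/-- The Riemannian volume measure: the smallest measure which dominates `√(det g_{ij}) du` in
every chart. (As these measures agree on the overlaps of charts, and `M` is covered by countably
many charts in all our cases, its restriction to the domain of a chart is `√(det g_{ij}) du`.) -/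
def riemannianVolume (g : MetricField M (d := d)) : Measure M :=
  ⨆ e ∈ atlas (Fin d → ℝ) M, chartVolume g e

/-- The `L²` pairing `(θ, η) = ∫_M ⟨θ, η⟩ dvol_g`. -/
def l2Inner (g : MetricField M (d := d)) (θ η : DiffForm M (d := d) k) : ℝ :=
  ∫ x, formInner g x (θ x) (η x) ∂(riemannianVolume g)

/-- `θ` is a measurable form with `∫_M |θ|² dvol_g < ∞`. -/
def MemL2 (g : MetricField M (d := d)) (θ : DiffForm M (d := d) k) : Prop :=
  (∀ e ∈ atlas (Fin d → ℝ) M,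
    AEStronglyMeasurable (θ.inChart e) ((volume : Measure (Fin d → ℝ)).restrict e.target)) ∧
  ∫⁻ x, ENNReal.ofReal (formInner g x (θ x) (θ x)) ∂(riemannianVolume g) < ⊤

/-- `χ = d^t ψ` for the formal adjoint `d^t` of `d` on smooth compactly supported forms. -/
def IsFormalAdjoint (g : MetricField M (d := d)) (ψ : DiffForm M (d := d) (k + 1))
    (χ : DiffForm M (d := d) k) : Prop :=
  ψ.IsTest ∧ χ.IsTest ∧
    ∀ φ : DiffForm M (d := d) k, φ.IsTest → l2Inner g φ.extD ψ = l2Inner g φ χ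

/-- `θ ∈ dom(d_max)` and `d_max θ = ξ`, where `d_max = (d^t)^*` is the Hilbert space adjoint of the
formal adjoint `d^t` with domain the smooth compactly supported forms. -/
def IsDMax (g : MetricField M (d := d)) (θ : DiffForm M (d := d) k)
    (ξ : DiffForm M (d := d) (k + 1)) : Prop :=
  MemL2 g θ ∧ MemL2 g ξ ∧
    ∀ ψ χ, IsFormalAdjoint g ψ χ → l2Inner g ξ ψ = l2Inner g θ χ

/-- `η ∈ dom(d^t_max)` and `d^t_max η = ζ`, where `d^t_max = d^*` is the Hilbert space adjoint of
`d` (the formal adjoint of `d^t`) with domain the smooth compactly supported forms. -/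
def IsDTMax (g : MetricField M (d := d)) (η : DiffForm M (d := d) (k + 1))
    (ζ : DiffForm M (d := d) k) : Prop :=
  MemL2 g η ∧ MemL2 g ζ ∧
    ∀ φ : DiffForm M (d := d) k, φ.IsTest → l2Inner g φ.extD η = l2Inner g φ ζ

/-- The `L²`-Stokes theorem holds for `(M, g)`:
`(d_max θ, η) = (θ, d^t_max η)` for all `θ ∈ dom(d_max)`, `η ∈ dom(d^t_max)`, in all degrees. -/
def L2StokesHolds (g : MetricField M (d := d)) : Prop :=
  ∀ (k : ℕ) (θ ζ : DiffForm M (d := d) k) (ξ η : DiffForm M (d := d) (k + 1)),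
    IsDMax g θ ξ → IsDTMax g η ζ → l2Inner g ξ η = l2Inner g θ ζ

end DeRham

/-! ### Induced metrics and quasi-isometries -/

/-- Smooth Riemannian metrics on `ℝP^N`. -/
abbrev RealProjMetric (N : ℕ) : Type :=
  Bundle.ContMDiffRiemannianMetric 𝓘(ℝ, Fin N → ℝ) ∞ (Fin N → ℝ)
    (fun x : RealProj N => TangentSpace 𝓘(ℝ, Fin N → ℝ) x)

variable {N d : ℕ}

/-- The restriction of a Riemannian metric on `ℝP^N` to an embedded submanifold. -/
def RealProjMetric.induced (g : RealProjMetric N)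
    (S : EmbeddedSubmanifold (RealProj N) (N := N) d) : MetricField S.carrier (d := d) :=
  fun x u v => g.inner (x : RealProj N)
    (mfderiv 𝓘(ℝ, Fin d → ℝ) 𝓘(ℝ, Fin N → ℝ) (Subtype.val : S.carrier → RealProj N) x u)
    (mfderiv 𝓘(ℝ, Fin d → ℝ) 𝓘(ℝ, Fin N → ℝ) (Subtype.val : S.carrier → RealProj N) x v)

/-- The diffeomorphism `Φ : A → B` is a quasi-isometry: the metric `g` of `A` and the pullback
under `Φ` of the metric `h` of `B` bound each other up to a constant factor. -/
def IsQuasiIsometry {A B : Type} [TopologicalSpace A] [ChartedSpace (Fin d → ℝ) A]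
    [TopologicalSpace B] [ChartedSpace (Fin d → ℝ) B]
    (g : MetricField A (d := d)) (h : MetricField B (d := d))
    (Φ : Diffeomorph 𝓘(ℝ, Fin d → ℝ) 𝓘(ℝ, Fin d → ℝ) A B ∞) : Prop :=
  ∃ C : ℝ, 0 < C ∧ ∀ (x : A) (v : TangentSpace 𝓘(ℝ, Fin d → ℝ) x),
    C⁻¹ * g x v v ≤ h (Φ x)
        (mfderiv 𝓘(ℝ, Fin d → ℝ) 𝓘(ℝ, Fin d → ℝ) Φ x v)
        (mfderiv 𝓘(ℝ, Fin d → ℝ) 𝓘(ℝ, Fin d → ℝ) Φ x v) ∧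
    h (Φ x)
        (mfderiv 𝓘(ℝ, Fin d → ℝ) 𝓘(ℝ, Fin d → ℝ) Φ x v)
        (mfderiv 𝓘(ℝ, Fin d → ℝ) 𝓘(ℝ, Fin d → ℝ) Φ x v) ≤ C * g x v v

/-- Some pointed neighborhoods of `P` in `V₁` and in `V₂` are quasi-isometric, for the metrics
induced by `g`: there are open neighborhoods `U₁`, `U₂` of `P` such that `(V₁ ∩ U₁) \ {P}` and
`(V₂ ∩ U₂) \ {P}` are `d`-dimensional submanifolds which are related by a quasi-isometry that
extends by `P ↦ P` to a homeomorphism between `V₁ ∩ U₁` and `V₂ ∩ U₂`. -/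
def HaveQuasiIsometricPointedNhds (d : ℕ) (g : RealProjMetric N) (V₁ V₂ : Set (RealProj N))
    (P : RealProj N) : Prop :=
  ∃ (U₁ U₂ : Set (RealProj N)) (A B : EmbeddedSubmanifold (RealProj N) (N := N) d)
    (Φ : Diffeomorph 𝓘(ℝ, Fin d → ℝ) 𝓘(ℝ, Fin d → ℝ) A.carrier B.carrier ∞),
    IsOpen U₁ ∧ P ∈ U₁ ∧ IsOpen U₂ ∧ P ∈ U₂ ∧
    A.carrier = (V₁ ∩ U₁) \ {P} ∧ B.carrier = (V₂ ∩ U₂) \ {P} ∧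
    IsQuasiIsometry (g.induced A) (g.induced B) Φ ∧
    Tendsto (fun a => (Φ a : RealProj N)) (comap Subtype.val (𝓝 P)) (𝓝 P) ∧
    Tendsto (fun b => (Φ.symm b : RealProj N)) (comap Subtype.val (𝓝 P)) (𝓝 P)

/-! ### Real projective varieties and their singular points -/

open MvPolynomial in
/-- The real projective variety defined by a homogeneous polynomial. -/
def projZeroLocus (F : MvPolynomial (Fin (N + 1)) ℝ) : Set (RealProj N) :=
  {x | eval x.rep F = 0}

/-- The homogeneous polynomials that vanish on `V`. -/
def vanishingForms (V : Set (RealProj N)) : Set (MvPolynomial (Fin (N + 1)) ℝ) :=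
  {G | (∃ k, G.IsHomogeneous k) ∧ ∀ x ∈ V, MvPolynomial.eval x.rep G = 0}

/-- The Zariski tangent space at `v` of the affine cone over `V`. -/
def zariskiTangentCone (V : Set (RealProj N)) (v : Fin (N + 1) → ℝ) :
    Submodule ℝ (Fin (N + 1) → ℝ) where
  carrier := {u | ∀ G ∈ vanishingForms V,
    ∑ i, MvPolynomial.eval v (MvPolynomial.pderiv i G) * u i = 0}
  zero_mem' := fun G _ => by simp
  add_mem' := fun {a b} ha hb G hG => by
    have h1 := ha G hG
    have h2 := hb G hG
    simp only [Pi.add_apply, mul_add, Finset.sum_add_distrib, h1, h2, add_zero]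
  smul_mem' := fun c u hu G hG => by
    have h1 := hu G hG
    simp only [Pi.smul_apply, smul_eq_mul, mul_left_comm _ c, ← Finset.mul_sum, h1, mul_zero]

/-- The singular locus of a real projective variety `V` of (pure) dimension `d`, by the Jacobian
criterion: the points at which the Zariski tangent space of `V` does not have dimension `d`, that
is, at which the affine cone over `V` does not have a Zariski tangent space of dimension `d + 1`. -/
def singularLocus (d : ℕ) (V : Set (RealProj N)) : Set (RealProj N) :=
  {x | x ∈ V ∧ finrank ℝ (zariskiTangentCone V x.rep) ≠ d + 1}

/-! ### The varieties `V` and `W`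

The homogeneous coordinates on `ℝP^(n+m)` are `(x, y, z) ∈ ℝ^n × ℝ^m × ℝ`. -/

section Varieties

open MvPolynomial

/-- `|x|²` -/
def polyX (n m : ℕ) : MvPolynomial (Fin (n + m + 1)) ℝ :=
  ∑ i : Fin n, X (Fin.castSucc (Fin.castAdd m i)) ^ 2

/-- `|y|²` -/
def polyY (n m : ℕ) : MvPolynomial (Fin (n + m + 1)) ℝ :=
  ∑ j : Fin m, X (Fin.castSucc (Fin.natAdd n j)) ^ 2

/-- `z` -/
def polyZ (n m : ℕ) : MvPolynomial (Fin (n + m + 1)) ℝ := X (Fin.last (n + m))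

/-- `V = {|x|^{2p} = |y|^{2q} z^{2(p-q)}}` -/
def varietyV (n m p q : ℕ) : Set (RealProj (n + m)) :=
  projZeroLocus (polyX n m ^ p - polyY n m ^ q * polyZ n m ^ (2 * (p - q)))

/-- `W = {|x|^{2p} = |y|^{2q} z^{2(p-q)} + |y|^{2p}}` -/
def varietyW (n m p q : ℕ) : Set (RealProj (n + m)) :=
  projZeroLocus (polyX n m ^ p - (polyY n m ^ q * polyZ n m ^ (2 * (p - q)) + polyY n m ^ p))

/-- The point `[0, 0, 1]`. -/
def pointP (n m : ℕ) : RealProj (n + m) :=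
  Projectivization.mk ℝ (Pi.single (Fin.last (n + m)) 1) (by simp)

end Varieties

end

/-! Write m = k + 1. In the chart z = 1 the hypersurface W is |x| = R(y) with R = (|y|^{2q} +
|y|^{2p})^{1/2p}, and near P the radius R is comparable with |y|^{q/p}. With r = |x| the metric near
P is therefore comparable with dr² + r² g_{S^{n-1}} + r^{2p/q} g_{S^{m-1}}. The condition p(m-1) =
q(n-1) says that the two spheres of the link shrink with the same volume rate r^{n-1}.

Under this balance the volume form of S^{m-1} is square integrable near P: its square norm is of
order r^{-2(n-1)} and the volume element of order r^{2(n-1)} dr. The same holds for the volume form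
of S^{n-1}. The product of the two has the same non-zero integral over every slice r = const, so
integration by parts between the first form and the Hodge dual of the second leaves a boundary term
at P. In the proof θ is the pullback under y of |y|^{-(k+1)} ι_y det, cut off at |y| = 1
(`radialPullback` with `innerProfile`). The other form η (`coForm`) is dual to the multivector cutUY
∂y_1 ∧ ⋯ ∧ ∂y_m divided by the volume density. Up to sign it is the Hodge star of cutUY du_1 ∧ ⋯ ∧
du_{n-1} in the coordinates u_l = x_l / x_i, y. Then (dθ, η) = 0 because dθ = 0 where η lives
(`l2Inner_extD_coForm`), while (θ, d^t η) is the integral of a non-negative, not identically zero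
function (`l2Inner_codiffForm_pos`). Square integrability of θ, dθ and η reduces to the
integrability of |y|^{q/p-1-k} on ℝ^{k+1} (`exists_density_mul_le`, `exists_detY_le`,
`setLIntegral_box_lt_top`). Membership in the maximal domains is `isDMax_radialPullback` and
`isDTMax_coForm`: the forms used for testing have compact support in W \ {P}, hence vanish near P.

Singular locus. At P the cone over W contains pairs of points that are mirror images in a coordinate
x_i or y_j and converge to P. Every form vanishing on W takes the value 0 at both, so its derivative
at P vanishes along each axis, and the tangent space is everything (`zariskiTangentCone_pointP`).
Elsewhere x ≠ 0, the derivative of the defining polynomial F is non-zero, and each vector of ker dF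
is the velocity of a curve in the cone (`zariskiTangentCone_eq_ker`). Neither argument needs
generators of the vanishing ideal.

Quasi-isometry. The map (x, y) ↦ ((1 + |y|^{2(p-q)})^{-1/2p} x, y) is a diffeomorphism of the whole
affine space that fixes P and takes W to V. On compact sets it and its inverse have bounded
derivatives, so its restriction is a quasi-isometry whatever the singularity
(`isQuasiIsometry_affineDiffeomorph`). -/

noncomputable section

/-! ### Linear algebra of Gram matrices and of alternating forms. -/

/-! ### Determinants of positive definite matrices -/

section Determinants

variable {ι : Type} [Fintype ι] [DecidableEq ι]

-- Applied to an inverse Gram matrix, the rows of the factor form an orthonormal frame.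
open scoped MatrixOrder in
theorem Matrix.PosDef.exists_eq_transpose_mul {A : Matrix ι ι ℝ} (hA : A.PosDef) :
    ∃ S : Matrix ι ι ℝ, IsUnit S.det ∧ A = S.transpose * S := by
  obtain ⟨S, hS⟩ := CStarAlgebra.nonneg_iff_eq_star_mul_self.mp hA.posSemidef.nonneg
  have hS' : A = S.transpose * S := by
    rw [hS, Matrix.star_eq_conjTranspose, Matrix.conjTranspose_eq_transpose_of_trivial]
  refine ⟨S, ?_, hS'⟩
  have h := hA.det_pos
  rw [hS', Matrix.det_mul, Matrix.det_transpose] at h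
  exact isUnit_iff_ne_zero.2 fun h0 => by simp [h0] at h

/-- After diagonalisation the determinant is a product of factors 1 + λ with λ ≥ 0. -/
theorem Matrix.PosSemidef.one_le_det_one_add {A : Matrix ι ι ℝ} (hA : A.PosSemidef) :
    1 ≤ (1 + A).det := by
  have hs := hA.1.spectral_theorem
  set U := hA.1.eigenvectorUnitary
  have h1 : (1 + A) = (U : Matrix ι ι ℝ) *
      (1 + Matrix.diagonal (fun i => hA.1.eigenvalues i)) * (star U : Matrix ι ι ℝ) := by
    rw [mul_add, add_mul, mul_one]
    have hU : (U : Matrix ι ι ℝ) * (star U : Matrix ι ι ℝ) = 1 := by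
      exact Unitary.mul_star_self_of_mem U.2
    conv_lhs => rw [hs]
    rw [hU, Unitary.conjStarAlgAut_apply]
    rfl
  have hU : (U : Matrix ι ι ℝ).det * (star U : Matrix ι ι ℝ).det = 1 := by
    rw [← Matrix.det_mul]
    rw [show (U : Matrix ι ι ℝ) * (star U : Matrix ι ι ℝ) = 1 from
      Unitary.mul_star_self_of_mem U.2, Matrix.det_one]
  rw [h1, Matrix.det_mul, Matrix.det_mul, mul_right_comm, hU, one_mul, ← Matrix.diagonal_one,
    Matrix.diagonal_add, Matrix.det_diagonal]
  refine Finset.one_le_prod fun i => ?_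
  have := hA.eigenvalues_nonneg i
  simpa using this

/-- Conjugation by the inverse of a square root of `A` turns `A` into 1 and `B` into 1 plus a
positive semidefinite matrix. This is how an inequality of metrics becomes one of volume densities.
-/
theorem Matrix.PosDef.det_le_det {A B : Matrix ι ι ℝ} (hA : A.PosDef) (hB : B.IsHermitian)
    (h : ∀ x : ι → ℝ, x ⬝ᵥ A.mulVec x ≤ x ⬝ᵥ B.mulVec x) : A.det ≤ B.det := by
  obtain ⟨S, hS, rfl⟩ := hA.exists_eq_transpose_mul
  have hBS : B.transpose = B := by
    rw [← Matrix.conjTranspose_eq_transpose_of_trivial]; exact hB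
  have hP : (B - S.transpose * S).PosSemidef := by
    refine Matrix.PosSemidef.of_dotProduct_mulVec_nonneg (hB.sub hA.1) fun x => ?_
    rw [Matrix.sub_mulVec, dotProduct_sub, star_trivial]
    exact sub_nonneg.2 (h x)
  have hQ := hP.conjTranspose_mul_mul_same S⁻¹
  have h1 := hQ.one_le_det_one_add
  have h2 : (1 + S⁻¹.conjTranspose * (B - S.transpose * S) * S⁻¹) =
      S⁻¹.transpose * B * S⁻¹ := by
    rw [Matrix.conjTranspose_eq_transpose_of_trivial, Matrix.mul_sub, Matrix.sub_mul,
      ← Matrix.mul_assoc, ← Matrix.transpose_mul, Matrix.mul_nonsing_inv S hS, Matrix.transpose_one,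
      Matrix.one_mul, Matrix.mul_nonsing_inv S hS]
    abel
  rw [h2, Matrix.det_mul, Matrix.det_mul, Matrix.det_transpose, mul_right_comm] at h1
  rw [Matrix.det_mul, Matrix.det_transpose]
  have h3 : S.det * S⁻¹.det = 1 := by
    rw [← Matrix.det_mul, Matrix.mul_nonsing_inv S hS, Matrix.det_one]
  have h4 : 0 ≤ S.det * S.det := mul_self_nonneg _
  calc S.det * S.det = S.det * S.det * 1 := by ring
    _ ≤ S.det * S.det * (S⁻¹.det * S⁻¹.det * B.det) := by gcongr
    _ = (S.det * S⁻¹.det) * (S.det * S⁻¹.det) * B.det := by ring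
    _ = B.det := by rw [h3]; ring

/-- A rank one perturbation. It applies to the model metric of a graph |x| = R(y), which is a
diagonal form plus dR². -/
theorem Matrix.det_diagonal_add_vecMulVec {D v : ι → ℝ} (hD : ∀ i, D i ≠ 0) :
    (Matrix.diagonal D + Matrix.vecMulVec v v).det = (∏ i, D i) * (1 + ∑ i, v i ^ 2 / D i) := by
  have h1 : Matrix.diagonal D + Matrix.vecMulVec v v =
      Matrix.diagonal D * (1 + Matrix.replicateCol Unit (fun i => v i / D i) *
        Matrix.replicateRow Unit v) := by
    rw [Matrix.mul_add, Matrix.mul_one]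
    ext i j
    rw [Matrix.add_apply, Matrix.add_apply, Matrix.diagonal_mul]
    by_cases hij : i = j
    · subst hij
      have := hD i
      simp [Matrix.vecMulVec, Matrix.mul_apply]
      field_simp
    · have := hD i
      simp [Matrix.vecMulVec, Matrix.mul_apply, hij]
      field_simp
  rw [h1, Matrix.det_mul, Matrix.det_diagonal, Matrix.det_one_add_replicateCol_mul_replicateRow]
  congr 2
  refine Finset.sum_congr rfl fun i _ => ?_
  ring

end Determinants

/-! ### The scalar product of covectors -/

section Covectors

variable {d k : ℕ}

/-- The determinant, as a continuous alternating form on `ℝ^k`. -/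
def detForm (k : ℕ) : (Fin k → ℝ) [⋀^Fin k]→L[ℝ] ℝ :=
  { (Matrix.detRowAlternating : (Fin k → ℝ) [⋀^Fin k]→ₗ[ℝ] ℝ) with
    cont := by
      change Continuous fun M : Matrix (Fin k) (Fin k) ℝ => M.det
      exact Continuous.matrix_det continuous_id }

/-- The Gram matrix of a bilinear form on `ℝ^d`. -/
def bilinMatrix (b : (Fin d → ℝ) →L[ℝ] (Fin d → ℝ) →L[ℝ] ℝ) : Matrix (Fin d) (Fin d) ℝ :=
  fun i j => b (Pi.single i 1) (Pi.single j 1)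

/-- The scalar product of `k`-covectors induced by a scalar product with Gram matrix `G`. -/
def covectorInner (G : Matrix (Fin d) (Fin d) ℝ) (α β : (Fin d → ℝ) [⋀^Fin k]→L[ℝ] ℝ) : ℝ :=
  (k.factorial : ℝ)⁻¹ * ∑ I : Fin k → Fin d, ∑ J : Fin k → Fin d,
    (∏ l, G⁻¹ (I l) (J l)) *
      α (fun l => Pi.single (I l) 1) * β (fun l => Pi.single (J l) 1)

/-- The `k`-covector which represents evaluation at `X_1 ∧ ⋯ ∧ X_k`. -/
def flatForm (b : (Fin d → ℝ) →L[ℝ] (Fin d → ℝ) →L[ℝ] ℝ) (X : Fin k → Fin d → ℝ) :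
    (Fin d → ℝ) [⋀^Fin k]→L[ℝ] ℝ :=
  (detForm k).compContinuousLinearMap (ContinuousLinearMap.pi fun i => b (X i))

theorem flatForm_apply (b : (Fin d → ℝ) →L[ℝ] (Fin d → ℝ) →L[ℝ] ℝ) (X w : Fin k → Fin d → ℝ) :
    flatForm b X w = (Matrix.of fun j i => b (X i) (w j)).det := rfl

theorem bilin_apply_eq_sum (b : (Fin d → ℝ) →L[ℝ] (Fin d → ℝ) →L[ℝ] ℝ) (v w : Fin d → ℝ) :
    b v w = ∑ i, ∑ j, v i * w j * bilinMatrix b i j := by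
  conv_lhs => rw [pi_eq_sum_univ' v, pi_eq_sum_univ' w]
  simp only [map_sum, map_smul, sum_apply, smul_apply, smul_eq_mul, bilinMatrix, Finset.mul_sum]
  rw [Finset.sum_comm]
  exact Finset.sum_congr rfl fun i _ => Finset.sum_congr rfl fun j _ => by ring

theorem bilin_apply_eq_dotProduct (b : (Fin d → ℝ) →L[ℝ] (Fin d → ℝ) →L[ℝ] ℝ)
    (v w : Fin d → ℝ) : b v w = v ⬝ᵥ (bilinMatrix b).mulVec w := by
  rw [bilin_apply_eq_sum]
  simp only [dotProduct, Matrix.mulVec, Finset.mul_sum]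
  exact Finset.sum_congr rfl fun i _ => Finset.sum_congr rfl fun j _ => by ring

theorem posDef_bilinMatrix {b : (Fin d → ℝ) →L[ℝ] (Fin d → ℝ) →L[ℝ] ℝ}
    (hs : ∀ v w, b v w = b w v) (hp : ∀ v, v ≠ 0 → 0 < b v v) : (bilinMatrix b).PosDef := by
  refine Matrix.PosDef.of_dotProduct_mulVec_pos ?_ fun {x} hx => ?_
  · ext i j
    simp [Matrix.conjTranspose_apply, bilinMatrix, hs (Pi.single j 1)]
  · rw [star_trivial, ← bilin_apply_eq_dotProduct]
    exact hp x hx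

theorem alternating_apply_eq_sum (α : (Fin d → ℝ) [⋀^Fin k]→L[ℝ] ℝ) (v : Fin k → Fin d → ℝ) :
    α v = ∑ I : Fin k → Fin d, (∏ l, v l (I l)) * α (fun l => Pi.single (I l) 1) := by
  have h : v = fun l => ∑ i : Fin d, v l i • (Pi.single i (1 : ℝ) : Fin d → ℝ) :=
    funext fun l => pi_eq_sum_univ' (v l)
  conv_lhs => rw [h]
  change α.toMultilinearMap (fun l => ∑ i : Fin d, v l i • (Pi.single i (1 : ℝ) : Fin d → ℝ)) = _
  rw [MultilinearMap.map_sum]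
  refine Finset.sum_congr rfl fun I _ => ?_
  exact (α.toMultilinearMap.map_smul_univ (fun l => v l (I l)) _)

/-- Expanding the determinant in `flatForm` gives one term for each of the k! permutations, each
equal to `α X` by antisymmetry; the factor 1/k! compensates. Pairing with a dual form is thus free
of the metric, which then enters an L² pairing only through the volume density. -/
theorem covectorInner_flatForm {b : (Fin d → ℝ) →L[ℝ] (Fin d → ℝ) →L[ℝ] ℝ}
    (hs : ∀ v w, b v w = b w v) (hp : ∀ v, v ≠ 0 → 0 < b v v)
    (α : (Fin d → ℝ) [⋀^Fin k]→L[ℝ] ℝ) (X : Fin k → Fin d → ℝ) :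
    covectorInner (bilinMatrix b) α (flatForm b X) = α X := by
  set G := bilinMatrix b with hG
  have hu : IsUnit G.det := (posDef_bilinMatrix hs hp).det_pos.ne'.isUnit
  have hb : ∀ (v : Fin d → ℝ) (i : Fin d), ∑ j, G⁻¹ i j * b v (Pi.single j 1) = v i := by
    intro v i
    have h1 : (fun j => b v (Pi.single j 1)) = G.mulVec v := by
      funext j
      rw [hs, bilin_apply_eq_dotProduct, single_one_dotProduct]
    have h2 : G⁻¹.mulVec (fun j => b v (Pi.single j 1)) = v := by
      rw [h1, Matrix.mulVec_mulVec, Matrix.nonsing_inv_mul G hu, Matrix.one_mulVec]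
    exact congrFun h2 i
  have h3 : ∀ I : Fin k → Fin d, ∑ J : Fin k → Fin d,
      (∏ l, G⁻¹ (I l) (J l)) * α (fun l => Pi.single (I l) 1) *
        flatForm b X (fun l => Pi.single (J l) 1) =
      ∑ σ : Equiv.Perm (Fin k), (Equiv.Perm.sign σ : ℝ) * ((∏ l, X (σ l) (I l)) *
        α (fun l => Pi.single (I l) 1)) := by
    intro I
    simp only [flatForm_apply]
    have : ∀ J : Fin k → Fin d, (Matrix.of fun j i => b (X i) (Pi.single (J j) 1)).det =
        ∑ σ : Equiv.Perm (Fin k), (Equiv.Perm.sign σ : ℝ) *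
          ∏ l, b (X (σ l)) (Pi.single (J l) 1) := by
      intro J
      rw [← Matrix.det_transpose, Matrix.det_apply']
      rfl
    simp only [this, Finset.mul_sum]
    rw [Finset.sum_comm]
    refine Finset.sum_congr rfl fun σ _ => ?_
    have h4 : ∏ l, X (σ l) (I l) = ∑ J : Fin k → Fin d,
        ∏ l, (G⁻¹ (I l) (J l) * b (X (σ l)) (Pi.single (J l) 1)) := by
      rw [← Fintype.piFinset_univ, ← Finset.prod_univ_sum (fun _ => Finset.univ)
        fun l j => G⁻¹ (I l) j * b (X (σ l)) (Pi.single j 1)]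
      exact Finset.prod_congr rfl fun l _ => (hb _ _).symm
    rw [h4, Finset.sum_mul, Finset.mul_sum]
    refine Finset.sum_congr rfl fun J _ => ?_
    rw [Finset.prod_mul_distrib]
    ring
  rw [covectorInner, Finset.sum_congr rfl fun I _ => h3 I, Finset.sum_comm]
  have h5 : ∀ σ : Equiv.Perm (Fin k), ∑ I : Fin k → Fin d, (Equiv.Perm.sign σ : ℝ) *
      ((∏ l, X (σ l) (I l)) * α (fun l => Pi.single (I l) 1)) = α X := by
    intro σ
    rw [← Finset.mul_sum, ← alternating_apply_eq_sum α (fun l => X (σ l))]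
    have := α.toAlternatingMap.map_perm X σ
    change α (X ∘ σ) = _ at this
    change _ * α (X ∘ σ) = _
    rw [this]
    rcases Int.units_eq_one_or (Equiv.Perm.sign σ) with h | h <;> simp [h]
  rw [Finset.sum_congr rfl fun σ _ => h5 σ, Finset.sum_const, Finset.card_univ,
    Fintype.card_perm, Fintype.card_fin, nsmul_eq_mul, ← mul_assoc,
    inv_mul_cancel₀ (by positivity), one_mul]

/-- The frame consists of the rows of `S`, where the inverse Gram matrix is `SᵀS`. In an orthonormal
frame the norm is a sum of squares, which makes it non-negative and easy to bound. -/
theorem covectorInner_self_eq {b : (Fin d → ℝ) →L[ℝ] (Fin d → ℝ) →L[ℝ] ℝ}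
    (hs : ∀ v w, b v w = b w v) (hp : ∀ v, v ≠ 0 → 0 < b v v) :
    ∃ e : Fin d → Fin d → ℝ, (∀ i, b (e i) (e i) = 1) ∧
      ∀ (k : ℕ) (α : (Fin d → ℝ) [⋀^Fin k]→L[ℝ] ℝ), covectorInner (bilinMatrix b) α α =
        (k.factorial : ℝ)⁻¹ * ∑ a : Fin k → Fin d, α (fun l => e (a l)) ^ 2 := by
  have hG := posDef_bilinMatrix hs hp
  obtain ⟨S, hS, hS'⟩ := hG.inv.exists_eq_transpose_mul
  refine ⟨fun i => S i, fun i => ?_, fun k α => ?_⟩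
  · rw [bilin_apply_eq_dotProduct]
    have hu : IsUnit (bilinMatrix b).det := hG.det_pos.ne'.isUnit
    have h1 : bilinMatrix b = S⁻¹ * S⁻¹.transpose := by
      rw [← Matrix.nonsing_inv_nonsing_inv (bilinMatrix b) hu, hS', Matrix.mul_inv_rev,
        Matrix.transpose_nonsing_inv]
    have h2 : S * bilinMatrix b * S.transpose = 1 := by
      rw [h1, ← Matrix.mul_assoc, Matrix.mul_nonsing_inv S hS, Matrix.one_mul,
        ← Matrix.transpose_mul, Matrix.mul_nonsing_inv S hS, Matrix.transpose_one]
    have h3 := congrFun (congrFun h2 i) i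
    rw [Matrix.one_apply_eq, Matrix.mul_assoc, Matrix.mul_apply] at h3
    rw [← h3]
    rfl
  · rw [covectorInner]
    congr 1
    have h1 : ∀ a : Fin k → Fin d, α (fun l => S (a l)) ^ 2 =
        ∑ I : Fin k → Fin d, ∑ J : Fin k → Fin d, (∏ l, (S (a l) (I l) * S (a l) (J l))) *
          α (fun l => Pi.single (I l) 1) * α (fun l => Pi.single (J l) 1) := by
      intro a
      rw [sq, alternating_apply_eq_sum α (fun l => S (a l)), Finset.sum_mul_sum]
      refine Finset.sum_congr rfl fun I _ => Finset.sum_congr rfl fun J _ => ?_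
      rw [Finset.prod_mul_distrib]
      ring
    rw [Finset.sum_congr rfl fun a _ => h1 a]
    conv_rhs => rw [Finset.sum_comm]
    refine Finset.sum_congr rfl fun I _ => ?_
    conv_rhs => rw [Finset.sum_comm]
    refine Finset.sum_congr rfl fun J _ => ?_
    rw [← Finset.sum_mul, ← Finset.sum_mul]
    congr 2
    rw [hS']
    simp only [Matrix.mul_apply, Matrix.transpose_apply]
    rw [Finset.prod_univ_sum, Fintype.piFinset_univ]

/-- The square norm of a covector that is pulled back by a linear map `f` which is bounded for the
scalar product. -/
theorem covectorInner_pullback_le {F : Type} [NormedAddCommGroup F] [NormedSpace ℝ F]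
    {b : (Fin d → ℝ) →L[ℝ] (Fin d → ℝ) →L[ℝ] ℝ}
    (hs : ∀ v w, b v w = b w v) (hp : ∀ v, v ≠ 0 → 0 < b v v) (f : (Fin d → ℝ) →L[ℝ] F) {K : ℝ}
    (hf : ∀ v, ‖f v‖ ^ 2 ≤ K * b v v) (β : F [⋀^Fin k]→L[ℝ] ℝ) :
    covectorInner (bilinMatrix b) (β.compContinuousLinearMap f) (β.compContinuousLinearMap f) ≤
      (d : ℝ) ^ k * K ^ k * ‖β‖ ^ 2 := by
  obtain ⟨e, he, h⟩ := covectorInner_self_eq hs hp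
  have h1 : ∀ a : Fin k → Fin d, (β.compContinuousLinearMap f) (fun l => e (a l)) ^ 2 ≤
      K ^ k * ‖β‖ ^ 2 := by
    intro a
    have h2 : ‖β (f ∘ fun l => e (a l))‖ ≤ ‖β‖ * ∏ l, ‖f (e (a l))‖ := β.le_opNorm _
    calc (β.compContinuousLinearMap f) (fun l => e (a l)) ^ 2
        = ‖β (f ∘ fun l => e (a l))‖ ^ 2 := by
          rw [Real.norm_eq_abs, sq_abs]; rfl
      _ ≤ (‖β‖ * ∏ l, ‖f (e (a l))‖) ^ 2 := by gcongr
      _ = ‖β‖ ^ 2 * ∏ l, ‖f (e (a l))‖ ^ 2 := by rw [mul_pow, Finset.prod_pow]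
      _ ≤ ‖β‖ ^ 2 * ∏ _l : Fin k, K := by
          gcongr with l
          simpa [he] using hf (e (a l))
      _ = K ^ k * ‖β‖ ^ 2 := by simp [mul_comm]
  rw [h]
  calc (k.factorial : ℝ)⁻¹ * ∑ a : Fin k → Fin d,
        (β.compContinuousLinearMap f) (fun l => e (a l)) ^ 2
      ≤ 1 * ∑ a : Fin k → Fin d, K ^ k * ‖β‖ ^ 2 := by
        gcongr with a
        · exact inv_le_one_of_one_le₀ (by exact_mod_cast k.factorial_pos)
        · exact h1 a
    _ = (d : ℝ) ^ k * K ^ k * ‖β‖ ^ 2 := by simp [mul_assoc]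

/-- Smoothness of the pullback of a field of alternating forms. -/
theorem ContDiffOn.alternating_compContinuousLinearMap {E F G : Type} [NormedAddCommGroup E]
    [NormedSpace ℝ E] [NormedAddCommGroup F] [NormedSpace ℝ F] [NormedAddCommGroup G]
    [NormedSpace ℝ G] {s : Set E} {w : E → G [⋀^Fin k]→L[ℝ] ℝ} {f : E → F →L[ℝ] G}
    {n : WithTop ℕ∞} (hw : ContDiffOn ℝ n w s) (hf : ContDiffOn ℝ n f s) :
    ContDiffOn ℝ n (fun x => (w x).compContinuousLinearMap (f x)) s := by
  -- On all multilinear maps, pulling back is polynomial in the pair formed by the map and the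
  -- linear substitution.
  have h1 : ContDiffOn ℝ n (fun x =>
      ((w x).compContinuousLinearMap (f x)).toContinuousMultilinearMap) s := by
    have h2 : ContDiff ℝ n (fun p : (Fin k → F →L[ℝ] G) ×
        ContinuousMultilinearMap ℝ (fun _ : Fin k => G) ℝ => p.2.compContinuousLinearMap p.1) :=
      contDiff_iff_contDiffAt.2 fun q =>
        (ContinuousMultilinearMap.cpolynomialAt_uncurry_compContinuousLinearMap
          (Fm := fun _ : Fin k => F) (Em := fun _ => G) (q := q)).contDiffAt
    have h3 : ContDiffOn ℝ n (fun x => (fun _ : Fin k => f x)) s := contDiffOn_pi.2 fun _ => hf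
    have h4 := (ContinuousAlternatingMap.toContinuousMultilinearMapCLM (𝕜 := ℝ) ℝ
      (E := G) (F := ℝ) (ι := Fin k)).contDiff (n := n) |>.comp_contDiffOn hw
    exact h2.comp_contDiffOn (h3.prodMk h4)
  -- The return to alternating maps: on an alternating map alternatization is multiplication by k!,
  -- so dividing by k! recovers the map through a bounded linear operator.
  let A : ContinuousMultilinearMap ℝ (fun _ : Fin k => F) ℝ →ₗ[ℝ] F [⋀^Fin k]→L[ℝ] ℝ :=
    { ContinuousMultilinearMap.alternatization with
      map_smul' := fun c g => by
        ext v
        change ContinuousMultilinearMap.alternatization (c • g) v =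
          c • ContinuousMultilinearMap.alternatization g v
        rw [ContinuousMultilinearMap.alternatization_apply_apply,
          ContinuousMultilinearMap.alternatization_apply_apply, Finset.smul_sum]
        exact Finset.sum_congr rfl fun σ _ => smul_comm _ _ _ }
  have hA : ∀ g, ‖A g‖ ≤ (k.factorial : ℝ) * ‖g‖ := by
    intro g
    refine ContinuousAlternatingMap.opNorm_le_bound _ (by positivity) fun v => ?_
    change ‖ContinuousMultilinearMap.alternatization g v‖ ≤ _
    rw [ContinuousMultilinearMap.alternatization_apply_apply]
    refine (norm_sum_le _ _).trans ?_
    have h5 : ∀ σ : Equiv.Perm (Fin k), ‖Equiv.Perm.sign σ • g (v ∘ σ)‖ ≤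
        ‖g‖ * ∏ i, ‖v i‖ := by
      intro σ
      have h6 : ‖Equiv.Perm.sign σ • g (v ∘ σ)‖ = ‖g (v ∘ σ)‖ := by
        rcases Int.units_eq_one_or (Equiv.Perm.sign σ) with h | h <;> simp [h]
      rw [h6]
      refine (g.le_opNorm _).trans_eq ?_
      congr 1
      exact Equiv.prod_comp σ fun i => ‖v i‖
    refine (Finset.sum_le_card_nsmul _ _ _ fun σ _ => h5 σ).trans_eq ?_
    simp [Finset.card_univ, Fintype.card_perm, mul_assoc]
  let A' := A.mkContinuous _ hA
  have h7 : ∀ g : F [⋀^Fin k]→L[ℝ] ℝ,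
      g = (k.factorial : ℝ)⁻¹ • A' g.toContinuousMultilinearMap := by
    intro g
    ext v
    change g v = (k.factorial : ℝ)⁻¹ • (ContinuousMultilinearMap.alternatization
      g.toContinuousMultilinearMap) v
    rw [ContinuousMultilinearMap.alternatization_apply_apply]
    have h8 : ∀ σ : Equiv.Perm (Fin k),
        Equiv.Perm.sign σ • g.toContinuousMultilinearMap (v ∘ σ) = g v := by
      intro σ
      have := g.toAlternatingMap.map_perm v σ
      change g (v ∘ σ) = Equiv.Perm.sign σ • g v at this
      change Equiv.Perm.sign σ • g (v ∘ σ) = g v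
      rw [this, smul_smul, Int.units_mul_self, one_smul]
    rw [Finset.sum_congr rfl fun σ _ => h8 σ, Finset.sum_const, Finset.card_univ,
      Fintype.card_perm, Fintype.card_fin, nsmul_eq_mul, smul_eq_mul, ← mul_assoc,
      inv_mul_cancel₀ (by positivity), one_mul]
  refine ((A'.contDiff.comp_contDiffOn h1).const_smul (k.factorial : ℝ)⁻¹).congr fun x _ => ?_
  exact h7 _

end Covectors

end

/-! ### Exterior calculus on manifolds, independently of the chart. -/

noncomputable section

/-! ### Differential forms in charts -/

theorem minSmoothness_two_le_infty : minSmoothness ℝ 2 ≤ ∞ := by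
  rw [minSmoothness_of_isRCLikeNormedField]
  exact WithTop.coe_le_coe.2 (le_top : (2 : ℕ∞) ≤ ⊤)

section Charts

variable {M : Type} [TopologicalSpace M] {d : ℕ} [ChartedSpace (Fin d → ℝ) M]

/-- The derivative of the inverse of a chart, as an endomorphism of `ℝ^d`. -/
def symmDeriv (e : OpenPartialHomeomorph M (Fin d → ℝ)) (u : Fin d → ℝ) :
    (Fin d → ℝ) →L[ℝ] (Fin d → ℝ) :=
  mfderiv 𝓘(ℝ, Fin d → ℝ) 𝓘(ℝ, Fin d → ℝ) e.symm u

/-- The derivative of a chart, as an endomorphism of `ℝ^d`. -/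
def chartDeriv (e : OpenPartialHomeomorph M (Fin d → ℝ)) (x : M) :
    (Fin d → ℝ) →L[ℝ] (Fin d → ℝ) :=
  mfderiv 𝓘(ℝ, Fin d → ℝ) 𝓘(ℝ, Fin d → ℝ) e x

/-- A form, as a function with values in a fixed space. -/
def DiffForm.toFun {k : ℕ} (θ : DiffForm M (d := d) k) (x : M) : (Fin d → ℝ) [⋀^Fin k]→L[ℝ] ℝ :=
  θ x

theorem DiffForm.inChart_eq {k : ℕ} (θ : DiffForm M (d := d) k)
    (e : OpenPartialHomeomorph M (Fin d → ℝ)) (u : Fin d → ℝ) :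
    θ.inChart e u = (θ.toFun (e.symm u)).compContinuousLinearMap (symmDeriv e u) := rfl

/-- The domain of the transition map from `e` to `e'`. -/
def overlap (e e' : OpenPartialHomeomorph M (Fin d → ℝ)) : Set (Fin d → ℝ) :=
  e.target ∩ e.symm ⁻¹' e'.source

theorem isOpen_overlap (e e' : OpenPartialHomeomorph M (Fin d → ℝ)) : IsOpen (overlap e e') :=
  e.isOpen_inter_preimage_symm e'.open_source

theorem compContinuousLinearMap_comp_apply {k : ℕ} {E F G : Type} [NormedAddCommGroup E]
    [NormedSpace ℝ E] [NormedAddCommGroup F] [NormedSpace ℝ F] [NormedAddCommGroup G]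
    [NormedSpace ℝ G] (α : G [⋀^Fin k]→L[ℝ] ℝ) (f : F →L[ℝ] G) (g : E →L[ℝ] F) :
    (α.compContinuousLinearMap f).compContinuousLinearMap g =
      α.compContinuousLinearMap (f.comp g) := rfl

variable [IsManifold 𝓘(ℝ, Fin d → ℝ) ∞ M]

theorem mdifferentiable_of_atlas {e : OpenPartialHomeomorph M (Fin d → ℝ)}
    (he : e ∈ atlas (Fin d → ℝ) M) :
    e.MDifferentiable 𝓘(ℝ, Fin d → ℝ) 𝓘(ℝ, Fin d → ℝ) := by
  have : IsManifold 𝓘(ℝ, Fin d → ℝ) 1 M := IsManifold.of_le (n := ∞) (by simp)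
  exact mdifferentiable_of_mem_atlas he

theorem contDiffOn_transition {e e' : OpenPartialHomeomorph M (Fin d → ℝ)}
    (he : e ∈ atlas (Fin d → ℝ) M) (he' : e' ∈ atlas (Fin d → ℝ) M) :
    ContDiffOn ℝ ∞ (e' ∘ e.symm) (overlap e e') := by
  have h1 := contMDiffOn_symm_of_mem_maximalAtlas
    (IsManifold.subset_maximalAtlas (I := 𝓘(ℝ, Fin d → ℝ)) (n := ∞) he)
  have h2 := contMDiffOn_of_mem_maximalAtlas
    (IsManifold.subset_maximalAtlas (I := 𝓘(ℝ, Fin d → ℝ)) (n := ∞) he')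
  exact contMDiffOn_iff_contDiffOn.1 (h2.comp (h1.mono inter_subset_left) fun u hu => hu.2)

theorem symmDeriv_comp_chartDeriv {e : OpenPartialHomeomorph M (Fin d → ℝ)}
    (he : e ∈ atlas (Fin d → ℝ) M) {x : M} (hx : x ∈ e.source) :
    (symmDeriv e (e x)).comp (chartDeriv e x) = ContinuousLinearMap.id ℝ _ :=
  (mdifferentiable_of_atlas he).symm_comp_deriv hx

theorem chartDeriv_comp_symmDeriv {e : OpenPartialHomeomorph M (Fin d → ℝ)}
    (he : e ∈ atlas (Fin d → ℝ) M) {u : Fin d → ℝ} (hu : u ∈ e.target) :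
    (chartDeriv e (e.symm u)).comp (symmDeriv e u) = ContinuousLinearMap.id ℝ _ :=
  (mdifferentiable_of_atlas he).comp_symm_deriv hu

theorem fderiv_transition {e e' : OpenPartialHomeomorph M (Fin d → ℝ)}
    (he : e ∈ atlas (Fin d → ℝ) M) (he' : e' ∈ atlas (Fin d → ℝ) M) {u : Fin d → ℝ}
    (hu : u ∈ overlap e e') :
    fderiv ℝ (e' ∘ e.symm) u = (chartDeriv e' (e.symm u)).comp (symmDeriv e u) := by
  rw [← mfderiv_eq_fderiv]
  exact mfderiv_comp u ((mdifferentiable_of_atlas he').mdifferentiableAt hu.2)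
    ((mdifferentiable_of_atlas he).mdifferentiableAt_symm hu.1)

theorem symmDeriv_transition {e e' : OpenPartialHomeomorph M (Fin d → ℝ)}
    (he : e ∈ atlas (Fin d → ℝ) M) (he' : e' ∈ atlas (Fin d → ℝ) M) {u : Fin d → ℝ}
    (hu : u ∈ overlap e e') :
    symmDeriv e u = (symmDeriv e' (e' (e.symm u))).comp (fderiv ℝ (e' ∘ e.symm) u) := by
  rw [fderiv_transition he he' hu, ← ContinuousLinearMap.comp_assoc,
    symmDeriv_comp_chartDeriv he' hu.2, ContinuousLinearMap.id_comp]

variable {k : ℕ}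

theorem DiffForm.inChart_transition (θ : DiffForm M (d := d) k)
    {e e' : OpenPartialHomeomorph M (Fin d → ℝ)}
    (he : e ∈ atlas (Fin d → ℝ) M) (he' : e' ∈ atlas (Fin d → ℝ) M) {u : Fin d → ℝ}
    (hu : u ∈ overlap e e') :
    θ.inChart e u = (θ.inChart e' ((e' ∘ e.symm) u)).compContinuousLinearMap
      (fderiv ℝ (e' ∘ e.symm) u) := by
  rw [θ.inChart_eq, θ.inChart_eq, compContinuousLinearMap_comp_apply, Function.comp_apply,
    ← symmDeriv_transition he he' hu, e'.left_inv hu.2]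

theorem DiffForm.inChart_eventuallyEq {θ θ' : DiffForm M (d := d) k}
    {e : OpenPartialHomeomorph M (Fin d → ℝ)} {u : Fin d → ℝ} (hu : u ∈ e.target)
    (h : ∀ᶠ y in 𝓝 (e.symm u), θ y = θ' y) : θ.inChart e =ᶠ[𝓝 u] θ'.inChart e := by
  filter_upwards [(e.continuousAt_symm hu).eventually h] with v hv
  change (θ (e.symm v)).compContinuousLinearMap _ = (θ' (e.symm v)).compContinuousLinearMap _
  rw [hv]

theorem DiffForm.extD_congr {θ θ' : DiffForm M (d := d) k} {x : M} (h : ∀ᶠ y in 𝓝 x, θ y = θ' y) :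
    θ.extD x = θ'.extD x := by
  have hx := mem_chart_source (Fin d → ℝ) x
  have h1 : θ.inChart (chartAt (Fin d → ℝ) x) =ᶠ[𝓝 (chartAt (Fin d → ℝ) x x)]
      θ'.inChart (chartAt (Fin d → ℝ) x) :=
    DiffForm.inChart_eventuallyEq ((chartAt (Fin d → ℝ) x).map_source hx)
      (by rwa [(chartAt (Fin d → ℝ) x).left_inv hx])
  unfold DiffForm.extD
  rw [h1.extDeriv_eq]

/-- The exterior derivative, computed in any chart. -/
theorem DiffForm.extD_inChart {θ : DiffForm M (d := d) k}
    {e : OpenPartialHomeomorph M (Fin d → ℝ)} (he : e ∈ atlas (Fin d → ℝ) M)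
    {u : Fin d → ℝ} (hu : u ∈ e.target) (h : DifferentiableAt ℝ (θ.inChart e) u) :
    θ.extD.inChart e u = extDeriv (θ.inChart e) u := by
  set x := e.symm u with hx
  set e' := chartAt (Fin d → ℝ) x with he'
  have hea := chart_mem_atlas (Fin d → ℝ) x
  have hxe : x ∈ e.source := e.map_target hu
  have hxe' : x ∈ e'.source := mem_chart_source (Fin d → ℝ) x
  have hu' : e' x ∈ overlap e' e :=
    ⟨e'.map_source hxe', by rw [mem_preimage, e'.left_inv hxe']; exact hxe⟩
  have huτ : (e ∘ e'.symm) (e' x) = u := by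
    rw [Function.comp_apply, e'.left_inv hxe', hx, e.right_inv hu]
  have h1 : θ.inChart e' =ᶠ[𝓝 (e' x)] fun v =>
      (θ.inChart e ((e ∘ e'.symm) v)).compContinuousLinearMap (fderiv ℝ (e ∘ e'.symm) v) := by
    filter_upwards [(isOpen_overlap e' e).mem_nhds hu'] with v hv
    exact θ.inChart_transition hea he hv
  -- Naturality of the exterior derivative under the transition map from the preferred chart to `e`.
  -- What remains afterwards is a product of derivatives of charts that collapses to the identity.
  have h2 : extDeriv (θ.inChart e') (e' x) =
      (extDeriv (θ.inChart e) u).compContinuousLinearMap (fderiv ℝ (e ∘ e'.symm) (e' x)) := by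
    rw [h1.extDeriv_eq, extDeriv_pullback (r := ∞) (by rwa [huτ])
      ((contDiffOn_transition hea he).contDiffAt ((isOpen_overlap e' e).mem_nhds hu'))
      minSmoothness_two_le_infty,
      huτ]
  have h3 : θ.extD.inChart e u = ((extDeriv (θ.inChart e') (e' x)).compContinuousLinearMap
      (chartDeriv e' x)).compContinuousLinearMap (symmDeriv e u) := rfl
  rw [h3, h2, compContinuousLinearMap_comp_apply, compContinuousLinearMap_comp_apply,
    fderiv_transition hea he hu', e'.left_inv hxe']
  have h4 : ((chartDeriv e x).comp (symmDeriv e' (e' x))).comp ((chartDeriv e' x).comp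
      (symmDeriv e u)) = ContinuousLinearMap.id ℝ _ := by
    rw [ContinuousLinearMap.comp_assoc, ← ContinuousLinearMap.comp_assoc (symmDeriv e' (e' x)),
      symmDeriv_comp_chartDeriv hea hxe', ContinuousLinearMap.id_comp,
      chartDeriv_comp_symmDeriv he hu]
  rw [h4]
  rfl

theorem DiffForm.IsSmooth.contDiffAt {θ : DiffForm M (d := d) k} (hθ : θ.IsSmooth)
    {e : OpenPartialHomeomorph M (Fin d → ℝ)} (he : e ∈ atlas (Fin d → ℝ) M)
    {u : Fin d → ℝ} (hu : u ∈ e.target) : ContDiffAt ℝ ∞ (θ.inChart e) u :=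
  (hθ e he).contDiffAt (e.open_target.mem_nhds hu)

/-! ### Pullbacks of forms on a vector space -/

variable {F : Type} [NormedAddCommGroup F] [NormedSpace ℝ F]

/-- The derivative of a map from a manifold to a vector space. -/
def manifoldDeriv (f : M → F) (x : M) : (Fin d → ℝ) →L[ℝ] F :=
  mfderiv 𝓘(ℝ, Fin d → ℝ) 𝓘(ℝ, F) f x

/-- The pullback of a form on a vector space. -/
def pullbackForm (f : M → F) (w : F → F [⋀^Fin k]→L[ℝ] ℝ) : DiffForm M (d := d) k := fun x =>
  (w (f x)).compContinuousLinearMap (manifoldDeriv f x)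

theorem fderiv_comp_symm {f : M → F} {e : OpenPartialHomeomorph M (Fin d → ℝ)}
    (he : e ∈ atlas (Fin d → ℝ) M) {u : Fin d → ℝ} (hu : u ∈ e.target)
    (hf : MDifferentiableAt 𝓘(ℝ, Fin d → ℝ) 𝓘(ℝ, F) f (e.symm u)) :
    fderiv ℝ (f ∘ e.symm) u = (manifoldDeriv f (e.symm u)).comp (symmDeriv e u) := by
  rw [← mfderiv_eq_fderiv]
  exact mfderiv_comp u hf ((mdifferentiable_of_atlas he).mdifferentiableAt_symm hu)

theorem pullbackForm_inChart {f : M → F} {w : F → F [⋀^Fin k]→L[ℝ] ℝ}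
    {e : OpenPartialHomeomorph M (Fin d → ℝ)}
    (he : e ∈ atlas (Fin d → ℝ) M) {u : Fin d → ℝ} (hu : u ∈ e.target)
    (hf : MDifferentiableAt 𝓘(ℝ, Fin d → ℝ) 𝓘(ℝ, F) f (e.symm u)) :
    (pullbackForm f w).inChart e u =
      (w ((f ∘ e.symm) u)).compContinuousLinearMap (fderiv ℝ (f ∘ e.symm) u) := by
  rw [fderiv_comp_symm he hu hf]
  rfl

theorem contDiffOn_comp_symm {f : M → F} {A : Set M}
    (hf : ContMDiffOn 𝓘(ℝ, Fin d → ℝ) 𝓘(ℝ, F) ∞ f A)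
    {e : OpenPartialHomeomorph M (Fin d → ℝ)} (he : e ∈ atlas (Fin d → ℝ) M) :
    ContDiffOn ℝ ∞ (f ∘ e.symm) (e.target ∩ e.symm ⁻¹' A) := by
  have h1 := contMDiffOn_symm_of_mem_maximalAtlas
    (IsManifold.subset_maximalAtlas (I := 𝓘(ℝ, Fin d → ℝ)) (n := ∞) he)
  exact contMDiffOn_iff_contDiffOn.1 (hf.comp (h1.mono inter_subset_left) fun u hu => hu.2)

theorem mdifferentiableAt_of_contMDiffOn {f : M → F} {A : Set M} (hA : IsOpen A)
    (hf : ContMDiffOn 𝓘(ℝ, Fin d → ℝ) 𝓘(ℝ, F) ∞ f A) {x : M} (hx : x ∈ A) :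
    MDifferentiableAt 𝓘(ℝ, Fin d → ℝ) 𝓘(ℝ, F) f x :=
  (hf.contMDiffAt (hA.mem_nhds hx)).mdifferentiableAt (by simp)

theorem contDiffOn_pullbackForm {f : M → F} {w : F → F [⋀^Fin k]→L[ℝ] ℝ} {A : Set M}
    (hA : IsOpen A) (hf : ContMDiffOn 𝓘(ℝ, Fin d → ℝ) 𝓘(ℝ, F) ∞ f A) {Ω : Set F}
    (hw : ContDiffOn ℝ ∞ w Ω) (hAΩ : MapsTo f A Ω)
    {e : OpenPartialHomeomorph M (Fin d → ℝ)} (he : e ∈ atlas (Fin d → ℝ) M) :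
    ContDiffOn ℝ ∞ ((pullbackForm f w).inChart e) (e.target ∩ e.symm ⁻¹' A) := by
  have hO : IsOpen (e.target ∩ e.symm ⁻¹' A) := e.isOpen_inter_preimage_symm hA
  have h1 := contDiffOn_comp_symm hf he
  refine ((hw.comp h1 fun u hu => hAΩ hu.2).alternating_compContinuousLinearMap
    (h1.fderiv_of_isOpen hO (m := ∞) (by simp))).congr fun u hu => ?_
  exact pullbackForm_inChart he hu.1 (mdifferentiableAt_of_contMDiffOn hA hf hu.2)

/-- A pullback is smooth if it vanishes away from the domain of smoothness. -/
theorem isSmooth_pullbackForm {f : M → F} {w : F → F [⋀^Fin k]→L[ℝ] ℝ} {A : Set M}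
    (hA : IsOpen A) (hf : ContMDiffOn 𝓘(ℝ, Fin d → ℝ) 𝓘(ℝ, F) ∞ f A) {Ω : Set F}
    (hw : ContDiffOn ℝ ∞ w Ω) (hAΩ : MapsTo f A Ω)
    (h0 : ∀ x ∉ A, ∀ᶠ y in 𝓝 x, pullbackForm (d := d) f w y = 0) :
    (pullbackForm (d := d) f w).IsSmooth := by
  intro e he u hu
  by_cases hx : e.symm u ∈ A
  · exact ((contDiffOn_pullbackForm hA hf hw hAΩ he).contDiffAt
      ((e.isOpen_inter_preimage_symm hA).mem_nhds ⟨hu, hx⟩)).contDiffWithinAt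
  · have h1 := DiffForm.inChart_eventuallyEq hu (h0 _ hx)
    refine ContDiffAt.contDiffWithinAt ?_
    refine ContDiffAt.congr_of_eventuallyEq (f := fun _ => 0) contDiffAt_const ?_
    filter_upwards [h1] with v hv
    rw [hv]
    rfl

theorem extD_pullbackForm_inChart {f : M → F} {w : F → F [⋀^Fin k]→L[ℝ] ℝ} {A : Set M}
    (hA : IsOpen A) (hf : ContMDiffOn 𝓘(ℝ, Fin d → ℝ) 𝓘(ℝ, F) ∞ f A) {Ω : Set F}
    (hΩ : IsOpen Ω) (hw : ContDiffOn ℝ ∞ w Ω) (hAΩ : MapsTo f A Ω)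
    {e : OpenPartialHomeomorph M (Fin d → ℝ)} (he : e ∈ atlas (Fin d → ℝ) M)
    {u : Fin d → ℝ} (hu : u ∈ e.target) (hx : e.symm u ∈ A) :
    (pullbackForm f w).extD.inChart e u = (pullbackForm f (extDeriv w)).inChart e u := by
  have hO : IsOpen (e.target ∩ e.symm ⁻¹' A) := e.isOpen_inter_preimage_symm hA
  have h1 := contDiffOn_comp_symm hf he
  have h2 := (contDiffOn_pullbackForm hA hf hw hAΩ he).contDiffAt (hO.mem_nhds ⟨hu, hx⟩)
  rw [DiffForm.extD_inChart he hu (h2.differentiableAt (by simp)),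
    pullbackForm_inChart he hu (mdifferentiableAt_of_contMDiffOn hA hf hx)]
  have h3 : (pullbackForm f w).inChart e =ᶠ[𝓝 u] fun v =>
      (w ((f ∘ e.symm) v)).compContinuousLinearMap (fderiv ℝ (f ∘ e.symm) v) := by
    filter_upwards [hO.mem_nhds ⟨hu, hx⟩] with v hv
    exact pullbackForm_inChart he hv.1 (mdifferentiableAt_of_contMDiffOn hA hf hv.2)
  rw [h3.extDeriv_eq, extDeriv_pullback (r := ∞) ?_ (h1.contDiffAt (hO.mem_nhds ⟨hu, hx⟩))
    minSmoothness_two_le_infty]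
  exact (hw.contDiffAt (hΩ.mem_nhds (hAΩ hx))).differentiableAt (by simp)

theorem DiffForm.eq_of_inChart_eq {θ θ' : DiffForm M (d := d) k}
    {e : OpenPartialHomeomorph M (Fin d → ℝ)} (he : e ∈ atlas (Fin d → ℝ) M)
    {x : M} (hx : x ∈ e.source) (h : θ.inChart e (e x) = θ'.inChart e (e x)) : θ x = θ' x := by
  have h1 := congrArg (fun α => ContinuousAlternatingMap.compContinuousLinearMap α
    (chartDeriv e x)) h
  simp only [DiffForm.inChart_eq, compContinuousLinearMap_comp_apply,
    symmDeriv_comp_chartDeriv he hx, e.left_inv hx] at h1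
  exact h1

/-- The exterior derivative commutes with pullbacks. -/
theorem extD_pullbackForm {f : M → F} {w : F → F [⋀^Fin k]→L[ℝ] ℝ} {A : Set M}
    (hA : IsOpen A) (hf : ContMDiffOn 𝓘(ℝ, Fin d → ℝ) 𝓘(ℝ, F) ∞ f A) {Ω : Set F}
    (hΩ : IsOpen Ω) (hw : ContDiffOn ℝ ∞ w Ω) (hAΩ : MapsTo f A Ω) {x : M} (hx : x ∈ A) :
    (pullbackForm (d := d) f w).extD x = pullbackForm f (extDeriv w) x := by
  have hxs := mem_chart_source (Fin d → ℝ) x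
  have hl := (chartAt (Fin d → ℝ) x).left_inv hxs
  refine DiffForm.eq_of_inChart_eq (chart_mem_atlas (Fin d → ℝ) x) hxs ?_
  exact extD_pullbackForm_inChart hA hf hΩ hw hAΩ (chart_mem_atlas (Fin d → ℝ) x)
    ((chartAt (Fin d → ℝ) x).map_source hxs) (by rwa [hl])

end Charts

end

noncomputable section

/-! ### The Riemannian volume in charts -/

section Volume

theorem det_bilinMatrix_bilinearComp {d : ℕ} (b : (Fin d → ℝ) →L[ℝ] (Fin d → ℝ) →L[ℝ] ℝ)
    (L : (Fin d → ℝ) →L[ℝ] (Fin d → ℝ)) :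
    (bilinMatrix (b.bilinearComp L L)).det = L.det ^ 2 * (bilinMatrix b).det := by
  have h1 : bilinMatrix (b.bilinearComp L L) =
      (LinearMap.toMatrix' (L : (Fin d → ℝ) →ₗ[ℝ] (Fin d → ℝ))).transpose * bilinMatrix b *
        LinearMap.toMatrix' (L : (Fin d → ℝ) →ₗ[ℝ] (Fin d → ℝ)) := by
    ext i j
    change b (L (Pi.single i 1)) (L (Pi.single j 1)) = _
    rw [bilin_apply_eq_sum, Finset.sum_comm]
    simp only [Matrix.mul_apply, Matrix.transpose_apply, LinearMap.toMatrix'_apply,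
      Finset.sum_mul, ContinuousLinearMap.coe_coe]
    refine Finset.sum_congr rfl fun k _ => Finset.sum_congr rfl fun l _ => ?_
    ring
  rw [h1, Matrix.det_mul, Matrix.det_mul, Matrix.det_transpose, LinearMap.det_toMatrix']
  change _ = (LinearMap.det (L : (Fin d → ℝ) →ₗ[ℝ] (Fin d → ℝ))) ^ 2 * _
  ring

variable {M : Type} [TopologicalSpace M] {d : ℕ} [ChartedSpace (Fin d → ℝ) M]

/-- The field of bilinear forms `g` is given by the field `b` of scalar products. -/
structure IsScalarProduct (g : MetricField M (d := d))
    (b : M → (Fin d → ℝ) →L[ℝ] (Fin d → ℝ) →L[ℝ] ℝ) : Prop where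
  apply_eq : ∀ (x : M) (v w : Fin d → ℝ), g x v w = b x v w
  symm : ∀ x v w, b x v w = b x w v
  pos : ∀ x v, v ≠ 0 → 0 < b x v v

/-- The coordinate representation of a field of bilinear forms. -/
def chartBilin (b : M → (Fin d → ℝ) →L[ℝ] (Fin d → ℝ) →L[ℝ] ℝ)
    (e : OpenPartialHomeomorph M (Fin d → ℝ)) (u : Fin d → ℝ) :
    (Fin d → ℝ) →L[ℝ] (Fin d → ℝ) →L[ℝ] ℝ :=
  (b (e.symm u)).bilinearComp (symmDeriv e u) (symmDeriv e u)

variable {g : MetricField M (d := d)} {b : M → (Fin d → ℝ) →L[ℝ] (Fin d → ℝ) →L[ℝ] ℝ}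

theorem IsScalarProduct.gram_eq (hg : IsScalarProduct g b) (x : M) :
    gram g x = bilinMatrix (b x) := by
  ext i j
  exact hg.apply_eq x _ _

theorem IsScalarProduct.chartGram_eq (hg : IsScalarProduct g b)
    (e : OpenPartialHomeomorph M (Fin d → ℝ)) (u : Fin d → ℝ) :
    chartGram g e u = bilinMatrix (chartBilin b e u) := by
  ext i j
  exact hg.apply_eq _ _ _

theorem IsScalarProduct.formInner_eq {k : ℕ} (hg : IsScalarProduct g b) (x : M)
    (α β : (Fin d → ℝ) [⋀^Fin k]→L[ℝ] ℝ) :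
    formInner g x α β = covectorInner (bilinMatrix (b x)) α β := by
  rw [← hg.gram_eq]
  rfl

theorem IsScalarProduct.formInner_flatForm {k : ℕ} (hg : IsScalarProduct g b) (x : M)
    (α : (Fin d → ℝ) [⋀^Fin k]→L[ℝ] ℝ) (X : Fin k → Fin d → ℝ) :
    formInner g x α (flatForm (b x) X) = α X := by
  rw [hg.formInner_eq]
  exact covectorInner_flatForm (hg.symm x) (hg.pos x) α X

theorem formInner_smul_right {k : ℕ} (g : MetricField M (d := d)) (x : M)
    (α β : (Fin d → ℝ) [⋀^Fin k]→L[ℝ] ℝ) (c : ℝ) :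
    formInner g x α (c • β) = c * formInner g x α β := by
  change (k.factorial : ℝ)⁻¹ * ∑ I : Fin k → Fin d, ∑ J : Fin k → Fin d,
    (∏ l, (gram g x)⁻¹ (I l) (J l)) *
      α (fun l => Pi.single (I l) 1) * (c * β (fun l => Pi.single (J l) 1)) =
    c * ((k.factorial : ℝ)⁻¹ * ∑ I : Fin k → Fin d, ∑ J : Fin k → Fin d,
    (∏ l, (gram g x)⁻¹ (I l) (J l)) *
      α (fun l => Pi.single (I l) 1) * β (fun l => Pi.single (J l) 1))
  simp only [Finset.mul_sum]
  refine Finset.sum_congr rfl fun k _ => Finset.sum_congr rfl fun l _ => ?_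
  ring

theorem formInner_add_right {k : ℕ} (g : MetricField M (d := d)) (x : M)
    (α β γ : (Fin d → ℝ) [⋀^Fin k]→L[ℝ] ℝ) :
    formInner g x α (β + γ) = formInner g x α β + formInner g x α γ := by
  change (k.factorial : ℝ)⁻¹ * ∑ I : Fin k → Fin d, ∑ J : Fin k → Fin d,
    (∏ l, (gram g x)⁻¹ (I l) (J l)) *
      α (fun l => Pi.single (I l) 1) * (β (fun l => Pi.single (J l) 1) +
        γ (fun l => Pi.single (J l) 1)) =
    (k.factorial : ℝ)⁻¹ * ∑ I : Fin k → Fin d, ∑ J : Fin k → Fin d,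
    (∏ l, (gram g x)⁻¹ (I l) (J l)) *
      α (fun l => Pi.single (I l) 1) * β (fun l => Pi.single (J l) 1) +
    (k.factorial : ℝ)⁻¹ * ∑ I : Fin k → Fin d, ∑ J : Fin k → Fin d,
    (∏ l, (gram g x)⁻¹ (I l) (J l)) *
      α (fun l => Pi.single (I l) 1) * γ (fun l => Pi.single (J l) 1)
  simp only [mul_add, Finset.sum_add_distrib]

theorem formInner_zero_right {k : ℕ} (g : MetricField M (d := d)) (x : M)
    (α : (Fin d → ℝ) [⋀^Fin k]→L[ℝ] ℝ) : formInner g x α 0 = 0 := by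
  have h := formInner_smul_right g x α 0 0
  rw [zero_mul, zero_smul] at h
  exact h

variable [IsManifold 𝓘(ℝ, Fin d → ℝ) ∞ M]

theorem chartBilin_transition (b : M → (Fin d → ℝ) →L[ℝ] (Fin d → ℝ) →L[ℝ] ℝ)
    {e e' : OpenPartialHomeomorph M (Fin d → ℝ)}
    (he : e ∈ atlas (Fin d → ℝ) M) (he' : e' ∈ atlas (Fin d → ℝ) M) {u : Fin d → ℝ}
    (hu : u ∈ overlap e e') :
    chartBilin b e u = (chartBilin b e' ((e' ∘ e.symm) u)).bilinearComp
      (fderiv ℝ (e' ∘ e.symm) u) (fderiv ℝ (e' ∘ e.symm) u) := by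
  ext v w
  have h : symmDeriv e u = (symmDeriv e' (e' (e.symm u))).comp (fderiv ℝ (e' ∘ e.symm) u) :=
    symmDeriv_transition he he' hu
  change b (e.symm u) (symmDeriv e u v) (symmDeriv e u w) =
    b (e'.symm (e' (e.symm u))) (symmDeriv e' (e' (e.symm u)) (fderiv ℝ (e' ∘ e.symm) u v))
      (symmDeriv e' (e' (e.symm u)) (fderiv ℝ (e' ∘ e.symm) u w))
  rw [e'.left_inv hu.2, h]
  rfl

theorem IsScalarProduct.det_chartGram_transition (hg : IsScalarProduct g b)
    {e e' : OpenPartialHomeomorph M (Fin d → ℝ)}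
    (he : e ∈ atlas (Fin d → ℝ) M) (he' : e' ∈ atlas (Fin d → ℝ) M) {u : Fin d → ℝ}
    (hu : u ∈ overlap e e') :
    (chartGram g e u).det =
      (fderiv ℝ (e' ∘ e.symm) u).det ^ 2 * (chartGram g e' ((e' ∘ e.symm) u)).det := by
  rw [hg.chartGram_eq, hg.chartGram_eq, chartBilin_transition b he he' hu,
    det_bilinMatrix_bilinearComp]

theorem IsScalarProduct.chartBilin_symm (hg : IsScalarProduct g b)
    (e : OpenPartialHomeomorph M (Fin d → ℝ)) (u v w : Fin d → ℝ) :
    chartBilin b e u v w = chartBilin b e u w v := hg.symm _ _ _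

theorem IsScalarProduct.chartBilin_pos (hg : IsScalarProduct g b)
    {e : OpenPartialHomeomorph M (Fin d → ℝ)} (he : e ∈ atlas (Fin d → ℝ) M)
    {u : Fin d → ℝ} (hu : u ∈ e.target) (v : Fin d → ℝ) (hv : v ≠ 0) :
    0 < chartBilin b e u v v := by
  refine hg.pos _ _ fun h => hv ?_
  have h1 := DFunLike.congr_fun (chartDeriv_comp_symmDeriv he hu) v
  have h2 : symmDeriv e u v = 0 := h
  rw [ContinuousLinearMap.comp_apply, h2, map_zero] at h1
  exact h1.symm

variable [MeasurableSpace M] [BorelSpace M]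

theorem aemeasurable_chart_symm (e : OpenPartialHomeomorph M (Fin d → ℝ)) (ρ : (Fin d → ℝ) → ENNReal) :
    AEMeasurable e.symm (((volume : Measure (Fin d → ℝ)).restrict e.target).withDensity ρ) :=
  (e.continuousOn_symm.aemeasurable e.open_target.measurableSet).mono_ac
    (withDensity_absolutelyContinuous _ _)

theorem measurableSet_target_inter (e : OpenPartialHomeomorph M (Fin d → ℝ)) {A : Set M}
    (hA : MeasurableSet A) : MeasurableSet (e.target ∩ e.symm ⁻¹' A) := by
  have h1 := (continuousOn_iff_continuous_domRestrict.1 e.continuousOn_symm).measurable hA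
  have h2 := e.open_target.measurableSet.subtype_image h1
  convert h2 using 1
  ext u
  simp [and_comm]

theorem chartVolume_apply (g : MetricField M (d := d)) (e : OpenPartialHomeomorph M (Fin d → ℝ))
    {A : Set M} (hA : MeasurableSet A) :
    chartVolume g e A = ∫⁻ u in e.target ∩ e.symm ⁻¹' A,
      ENNReal.ofReal (Real.sqrt (chartGram g e u).det) := by
  have hm2 := measurableSet_target_inter e hA
  rw [chartVolume, Measure.map_apply_of_aemeasurable (aemeasurable_chart_symm e _) hA]
  have h3 : ((volume : Measure (Fin d → ℝ)).restrict e.target).withDensity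
      (fun u => ENNReal.ofReal (Real.sqrt (chartGram g e u).det)) e.targetᶜ = 0 := by
    refine withDensity_absolutelyContinuous _ _ ?_
    rw [Measure.restrict_apply e.open_target.measurableSet.compl, compl_inter_self, measure_empty]
  have h4 : ((volume : Measure (Fin d → ℝ)).restrict e.target).withDensity
      (fun u => ENNReal.ofReal (Real.sqrt (chartGram g e u).det)) (e.symm ⁻¹' A) =
      ((volume : Measure (Fin d → ℝ)).restrict e.target).withDensity
      (fun u => ENNReal.ofReal (Real.sqrt (chartGram g e u).det)) (e.target ∩ e.symm ⁻¹' A) := by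
    rw [← measure_inter_add_sdiff (e.symm ⁻¹' A) e.open_target.measurableSet, inter_comm, measure_mono_null (s := e.symm ⁻¹' A \ e.target) (t := e.targetᶜ)
        (fun u hu => hu.2) h3, add_zero]
  rw [h4, withDensity_apply _ hm2, Measure.restrict_restrict hm2,
    inter_eq_left.2 (inter_subset_left)]

/-- Change of variables: the square root of the Gram determinant changes by exactly the Jacobian of
the transition map. The inequality is enough, since it can be used with the charts exchanged. -/
theorem IsScalarProduct.chartVolume_le (hg : IsScalarProduct g b)
    {e e' : OpenPartialHomeomorph M (Fin d → ℝ)}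
    (he : e ∈ atlas (Fin d → ℝ) M) (he' : e' ∈ atlas (Fin d → ℝ) M) {A : Set M}
    (hA : MeasurableSet A) (hAe' : A ⊆ e'.source) :
    chartVolume g e A ≤ chartVolume g e' A := by
  rw [chartVolume_apply g e hA, chartVolume_apply g e' hA]
  have hm2 := measurableSet_target_inter e hA
  have hsub : e.target ∩ e.symm ⁻¹' A ⊆ overlap e e' := fun u hu => ⟨hu.1, hAe' hu.2⟩
  have hd : ∀ u ∈ e.target ∩ e.symm ⁻¹' A, HasFDerivWithinAt (e' ∘ e.symm)
      (fderiv ℝ (e' ∘ e.symm) u) (e.target ∩ e.symm ⁻¹' A) u := fun u hu =>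
    (((contDiffOn_transition he he').contDiffAt
      ((isOpen_overlap e e').mem_nhds (hsub hu))).differentiableAt (by simp)).hasFDerivAt.hasFDerivWithinAt
  have hinj : InjOn (e' ∘ e.symm) (e.target ∩ e.symm ⁻¹' A) := by
    intro u hu v hv huv
    exact e.symm.injOn hu.1 hv.1 (e'.injOn (hAe' hu.2) (hAe' hv.2) huv)
  have himg : (e' ∘ e.symm) '' (e.target ∩ e.symm ⁻¹' A) ⊆ e'.target ∩ e'.symm ⁻¹' A := by
    rintro _ ⟨u, hu, rfl⟩
    refine ⟨e'.map_source (hAe' hu.2), ?_⟩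
    rw [mem_preimage, Function.comp_apply, e'.left_inv (hAe' hu.2)]
    exact hu.2
  calc ∫⁻ u in e.target ∩ e.symm ⁻¹' A, ENNReal.ofReal (Real.sqrt (chartGram g e u).det)
      = ∫⁻ u in e.target ∩ e.symm ⁻¹' A, ENNReal.ofReal |(fderiv ℝ (e' ∘ e.symm) u).det| *
          ENNReal.ofReal (Real.sqrt (chartGram g e' ((e' ∘ e.symm) u)).det) := by
        refine setLIntegral_congr_fun hm2 fun u hu => ?_
        rw [hg.det_chartGram_transition he he' (hsub hu), Real.sqrt_mul (sq_nonneg _),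
          Real.sqrt_sq_eq_abs, ENNReal.ofReal_mul (abs_nonneg _)]
    _ = ∫⁻ u in (e' ∘ e.symm) '' (e.target ∩ e.symm ⁻¹' A),
          ENNReal.ofReal (Real.sqrt (chartGram g e' u).det) :=
        (lintegral_image_eq_lintegral_abs_det_fderiv_mul volume hm2 hd hinj
          fun u => ENNReal.ofReal (Real.sqrt (chartGram g e' u).det)).symm
    _ ≤ _ := lintegral_mono_set himg

theorem IsScalarProduct.riemannianVolume_restrict (hg : IsScalarProduct g b)
    {e : OpenPartialHomeomorph M (Fin d → ℝ)} (he : e ∈ atlas (Fin d → ℝ) M) :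
    (riemannianVolume g).restrict e.source = chartVolume g e := by
  have hms := e.open_source.measurableSet
  have h0 : chartVolume g e e.sourceᶜ = 0 := by
    rw [chartVolume_apply g e hms.compl]
    have : e.target ∩ e.symm ⁻¹' e.sourceᶜ = ∅ := by
      ext u
      simp only [mem_inter_iff, mem_preimage, mem_compl_iff, mem_empty_iff_false, iff_false,
        not_and, not_not]
      exact fun hu => e.map_target hu
    rw [this]
    simp
  -- The supremum need not be computed. Each chart measure lies below that of `e` plus a measure
  -- carried by the complement of the domain of `e`, and the restriction kills the second summand.
  have h1 : riemannianVolume g ≤ chartVolume g e + (⊤ : Measure M).restrict e.sourceᶜ := by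
    refine iSup₂_le fun e' he' => ?_
    refine Measure.le_iff.2 fun A hA => ?_
    rw [Measure.add_apply, ← measure_inter_add_sdiff A hms]
    refine add_le_add ?_ ?_
    · refine (hg.chartVolume_le he' he (hA.inter hms) inter_subset_right).trans ?_
      exact measure_mono inter_subset_left
    · rw [Measure.restrict_apply hA]
      exact Measure.le_iff.1 le_top (A \ e.source) (hA.diff hms)
  ext A hA
  rw [Measure.restrict_apply hA]
  refine le_antisymm ?_ ?_
  · refine (Measure.le_iff.1 h1 _ (hA.inter hms)).trans ?_
    rw [Measure.add_apply, Measure.restrict_apply (hA.inter hms), inter_assoc, inter_compl_self,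
      inter_empty, measure_empty, add_zero]
    exact measure_mono inter_subset_left
  · rw [← measure_inter_add_sdiff A hms, measure_mono_null (s := A \ e.source) (t := e.sourceᶜ)
      (fun u hu => hu.2) h0, add_zero]
    exact Measure.le_iff.1 (le_iSup₂_of_le e he le_rfl) _ (hA.inter hms)

/-- The embedding of the range of a chart. -/
theorem measurableEmbedding_chart_symm (e : OpenPartialHomeomorph M (Fin d → ℝ)) :
    MeasurableEmbedding (fun u : e.target => e.symm u) := by
  have h1 : IsOpenEmbedding (fun u : e.target => e.symm u) := by
    have h2 := e.toHomeomorphSourceTarget.symm.isOpenEmbedding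
    exact e.open_source.isOpenEmbedding_subtypeVal.comp h2
  exact h1.measurableEmbedding

/-- The pushforward is rewritten along a measurable embedding of the subtype `e.target`. Integrals
of arbitrary functions can then be transported, with no measurability assumption on the integrand.
-/
theorem chartVolume_eq_map (g : MetricField M (d := d))
    (e : OpenPartialHomeomorph M (Fin d → ℝ)) :
    chartVolume g e = (((volume : Measure (Fin d → ℝ)).withDensity
      fun u => ENNReal.ofReal (Real.sqrt (chartGram g e u).det)).comap
        (Subtype.val : e.target → Fin d → ℝ)).map (fun u : e.target => e.symm u) := by
  ext A hA
  have hm2 := measurableSet_target_inter e hA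
  rw [(measurableEmbedding_chart_symm e).map_apply, chartVolume_apply g e hA,
    (MeasurableEmbedding.subtype_coe e.open_target.measurableSet).comap_apply]
  have h3 : (Subtype.val '' ((fun u : e.target => e.symm u) ⁻¹' A)) = e.target ∩ e.symm ⁻¹' A := by
    ext u
    simp [and_comm]
  rw [h3, withDensity_apply _ hm2]

theorem lintegral_chartVolume {e : OpenPartialHomeomorph M (Fin d → ℝ)}
    (hc : ContinuousOn (fun u => (chartGram g e u).det) e.target) (f : M → ENNReal) :
    ∫⁻ x, f x ∂(chartVolume g e) =
      ∫⁻ u in e.target, ENNReal.ofReal (Real.sqrt (chartGram g e u).det) * f (e.symm u) := by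
  have hd : AEMeasurable (fun u => ENNReal.ofReal (Real.sqrt (chartGram g e u).det))
      ((volume : Measure (Fin d → ℝ)).restrict e.target) :=
    ((Real.continuous_sqrt.comp_continuousOn hc).aemeasurable
      e.open_target.measurableSet).ennreal_ofReal
  rw [chartVolume_eq_map, (measurableEmbedding_chart_symm e).lintegral_map,
    lintegral_subtype_comap e.open_target.measurableSet (fun u => f (e.symm u)),
    restrict_withDensity e.open_target.measurableSet,
    lintegral_withDensity_eq_lintegral_mul_non_measurable₀ _ hd
      (Eventually.of_forall fun _ => ENNReal.ofReal_lt_top)]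
  rfl

theorem integral_chartVolume {e : OpenPartialHomeomorph M (Fin d → ℝ)}
    (hc : ContinuousOn (fun u => (chartGram g e u).det) e.target) (f : M → ℝ) :
    ∫ x, f x ∂(chartVolume g e) =
      ∫ u in e.target, Real.sqrt (chartGram g e u).det * f (e.symm u) := by
  have hd : AEMeasurable (fun u => ENNReal.ofReal (Real.sqrt (chartGram g e u).det))
      ((volume : Measure (Fin d → ℝ)).restrict e.target) :=
    ((Real.continuous_sqrt.comp_continuousOn hc).aemeasurable
      e.open_target.measurableSet).ennreal_ofReal
  rw [chartVolume_eq_map, (measurableEmbedding_chart_symm e).integral_map,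
    integral_subtype_comap e.open_target.measurableSet (fun u => f (e.symm u)),
    restrict_withDensity e.open_target.measurableSet,
    integral_withDensity_eq_integral_toReal_smul₀ hd
      (Eventually.of_forall fun _ => ENNReal.ofReal_lt_top)]
  simp only [ENNReal.toReal_ofReal (Real.sqrt_nonneg _), smul_eq_mul]

/-- The integral of a function which vanishes outside the domain of a chart. -/
theorem IsScalarProduct.integral_eq (hg : IsScalarProduct g b)
    {e : OpenPartialHomeomorph M (Fin d → ℝ)} (he : e ∈ atlas (Fin d → ℝ) M)
    (hc : ContinuousOn (fun u => (chartGram g e u).det) e.target) {f : M → ℝ}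
    (hf : ∀ x ∉ e.source, f x = 0) :
    ∫ x, f x ∂(riemannianVolume g) =
      ∫ u in e.target, Real.sqrt (chartGram g e u).det * f (e.symm u) := by
  rw [← setIntegral_eq_integral_of_forall_compl_eq_zero hf, hg.riemannianVolume_restrict he,
    integral_chartVolume hc]

theorem IsScalarProduct.setLIntegral_eq (hg : IsScalarProduct g b)
    {e : OpenPartialHomeomorph M (Fin d → ℝ)} (he : e ∈ atlas (Fin d → ℝ) M)
    (hc : ContinuousOn (fun u => (chartGram g e u).det) e.target) (f : M → ENNReal) :
    ∫⁻ x in e.source, f x ∂(riemannianVolume g) =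
      ∫⁻ u in e.target, ENNReal.ofReal (Real.sqrt (chartGram g e u).det) * f (e.symm u) := by
  rw [hg.riemannianVolume_restrict he, lintegral_chartVolume hc]

/-- Extension by zero across the boundary of the domain of `e'` may be discontinuous, but on the
open overlap with another chart the form is continuous, and it is zero on the rest. -/
theorem DiffForm.aestronglyMeasurable_inChart {k : ℕ} {θ : DiffForm M (d := d) k}
    {e' : OpenPartialHomeomorph M (Fin d → ℝ)} (he' : e' ∈ atlas (Fin d → ℝ) M)
    (h : ContinuousOn (θ.inChart e') e'.target) (h0 : ∀ x ∉ e'.source, θ x = 0)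
    {e : OpenPartialHomeomorph M (Fin d → ℝ)} (he : e ∈ atlas (Fin d → ℝ) M) :
    AEStronglyMeasurable (θ.inChart e) ((volume : Measure (Fin d → ℝ)).restrict e.target) := by
  have hO := isOpen_overlap e e'
  have hτ := contDiffOn_transition he he'
  have h1 : ContinuousOn (θ.inChart e) (overlap e e') := by
    have h2 : ContinuousOn (fun u => (θ.inChart e' ((e' ∘ e.symm) u)).compContinuousLinearMap
        (fderiv ℝ (e' ∘ e.symm) u)) (overlap e e') := by
      refine (ContDiffOn.alternating_compContinuousLinearMap (n := 0) (contDiffOn_zero.2 ?_)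
        (contDiffOn_zero.2 ?_)).continuousOn
      · exact h.comp hτ.continuousOn fun u hu => e'.map_source hu.2
      · exact hτ.continuousOn_fderiv_of_isOpen hO (by simp)
    exact h2.congr fun u hu => θ.inChart_transition he he' hu
  have h3 : AEStronglyMeasurable ((overlap e e').indicator (θ.inChart e))
      ((volume : Measure (Fin d → ℝ)).restrict e.target) := by
    rw [aestronglyMeasurable_indicator_iff hO.measurableSet, Measure.restrict_restrict
      hO.measurableSet]
    exact (h1.mono inter_subset_left).aestronglyMeasurable
      (hO.inter e.open_target).measurableSet
  refine h3.congr ?_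
  filter_upwards [ae_restrict_mem e.open_target.measurableSet] with u hu
  by_cases hx : u ∈ overlap e e'
  · rw [indicator_of_mem hx]
  · rw [indicator_of_notMem hx, θ.inChart_eq]
    have h4 : θ.toFun (e.symm u) = 0 := h0 _ fun h => hx ⟨hu, h⟩
    rw [h4]
    rfl

end Volume

end

/-! ### Submanifolds of projective space and their induced metrics. -/

noncomputable section

/-! ### The inclusion of an embedded submanifold -/

namespace EmbeddedSubmanifold

variable {X : Type} [TopologicalSpace X] {N : ℕ} [ChartedSpace (Fin N → ℝ) X] {d : ℕ}
  {S : EmbeddedSubmanifold X (N := N) d}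

theorem sliceChart_mem_atlas (x : S.carrier) (e : OpenPartialHomeomorph X (Fin N → ℝ))
    (he : S.IsSlice e) : sliceChart x e he ∈ atlas (Fin d → ℝ) S.carrier := ⟨x, e, he, rfl⟩

theorem contMDiff_val :
    ContMDiff 𝓘(ℝ, Fin d → ℝ) 𝓘(ℝ, Fin N → ℝ) ∞ (Subtype.val : S.carrier → X) := by
  intro x
  obtain ⟨e, he, hx⟩ := exists_isSlice x
  have h1 : ContMDiffOn 𝓘(ℝ, Fin d → ℝ) 𝓘(ℝ, Fin d → ℝ) ∞ (sliceChart x e he)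
      (sliceChart x e he).source := contMDiffOn_of_mem_maximalAtlas
    (IsManifold.subset_maximalAtlas (sliceChart_mem_atlas x e he))
  have h2 : ContMDiffOn 𝓘(ℝ, Fin d → ℝ) 𝓘(ℝ, Fin N → ℝ) ∞ (fun y => pad N (sliceChart x e he y))
      (sliceChart x e he).source := contDiff_pad.contMDiff.comp_contMDiffOn h1
  have h3 := (contMDiffOn_symm_of_mem_maximalAtlas he.1).comp h2
    fun y hy => (sliceChart x e he).map_source hy
  have hs : (x : S.carrier) ∈ (sliceChart x e he).source := hx
  refine ((h3.congr fun y hy => ?_).contMDiffAt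
    ((sliceChart x e he).open_source.mem_nhds hs))
  have h0 := (he.2 (y : X) hy).1 y.2
  have h4 : pad N (sliceChart x e he y) = e y := pad_trunc S.dim_le _ h0
  rw [Function.comp_apply, h4]
  exact (e.left_inv hy).symm

/-- A map to a submanifold is smooth if it is smooth as a map to the ambient manifold. -/
theorem contMDiff_of_val {n : ℕ} {Z : Type} [TopologicalSpace Z] [ChartedSpace (Fin n → ℝ) Z]
    {f : Z → S.carrier}
    (hf : ContMDiff 𝓘(ℝ, Fin n → ℝ) 𝓘(ℝ, Fin N → ℝ) ∞ (fun z => (f z : X))) :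
    ContMDiff 𝓘(ℝ, Fin n → ℝ) 𝓘(ℝ, Fin d → ℝ) ∞ f := by
  intro z
  have hc : Continuous f := continuous_induced_rng.2 hf.continuous
  obtain ⟨e, he, hx⟩ := exists_isSlice (f z)
  set c := sliceChart (f z) e he with hcdef
  have h1 : ContMDiffAt 𝓘(ℝ, Fin n → ℝ) 𝓘(ℝ, Fin d → ℝ) ∞ (fun y => trunc S.dim_le (e (f y))) z :=
    ((contDiff_trunc S.dim_le).contMDiff.contMDiffAt).comp z
      ((contMDiffAt_of_mem_maximalAtlas he.1 hx).comp z hf.contMDiffAt)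
  have hs : f z ∈ c.source := hx
  have h2 : ContMDiffAt 𝓘(ℝ, Fin d → ℝ) 𝓘(ℝ, Fin d → ℝ) ∞ c.symm (trunc S.dim_le (e (f z))) :=
    contMDiffAt_symm_of_mem_maximalAtlas
      (IsManifold.subset_maximalAtlas (sliceChart_mem_atlas (f z) e he)) (c.map_source hs)
  refine (h2.comp z h1).congr_of_eventuallyEq ?_
  filter_upwards [hc.continuousAt.preimage_mem_nhds (c.open_source.mem_nhds hs)] with y hy
  exact (c.left_inv hy).symm

/-- The derivative of the inclusion. -/
def valDeriv (x : S.carrier) : (Fin d → ℝ) →L[ℝ] (Fin N → ℝ) :=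
  mfderiv 𝓘(ℝ, Fin d → ℝ) 𝓘(ℝ, Fin N → ℝ) (Subtype.val : S.carrier → X) x

/-- The first `d` coordinates of a slice chart are functions on the ambient space whose composite
with the inclusion is a chart of `S`, so the derivative of the inclusion has a left inverse. -/
theorem valDeriv_injective [IsManifold 𝓘(ℝ, Fin N → ℝ) ∞ X] (x : S.carrier) (v : Fin d → ℝ)
    (hv : valDeriv x v = 0) : v = 0 := by
  obtain ⟨e, he, hx⟩ := exists_isSlice x
  have hs : (x : S.carrier) ∈ (sliceChart x e he).source := hx
  have h1 : MDifferentiableAt 𝓘(ℝ, Fin N → ℝ) 𝓘(ℝ, Fin d → ℝ) (fun y => trunc S.dim_le (e y))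
      (x : X) :=
    (((contDiff_trunc S.dim_le).contMDiff.contMDiffAt).comp (x : X)
      (contMDiffAt_of_mem_maximalAtlas he.1 hx)).mdifferentiableAt (by simp)
  let D : (Fin N → ℝ) →L[ℝ] (Fin d → ℝ) :=
    mfderiv 𝓘(ℝ, Fin N → ℝ) 𝓘(ℝ, Fin d → ℝ) (fun y => trunc S.dim_le (e y)) (x : X)
  have h2 : chartDeriv (sliceChart x e he) x = D.comp (valDeriv x) :=
    mfderiv_comp x h1 (contMDiff_val.contMDiffAt.mdifferentiableAt (by simp))
  have h5 := DFunLike.congr_fun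
    (symmDeriv_comp_chartDeriv (sliceChart_mem_atlas x e he) hs) v
  rw [ContinuousLinearMap.comp_apply, h2, ContinuousLinearMap.comp_apply, hv, map_zero,
    map_zero] at h5
  exact h5.symm

end EmbeddedSubmanifold

/-! ### Affine charts of projective space -/

namespace RealProj

variable {N : ℕ}

/-- The entries v_i v_j / |v|² of the orthogonal projection onto a line depend continuously on it
and determine it. The Hausdorff property is what makes the closure of a subset of a compact set
compact, hence supports of cut-off forms compact. -/
instance : T2Space (RealProj N) := by
  let f : RealProj N → (Fin (N + 1) → Fin (N + 1) → ℝ) := fun x i j =>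
    x.rep i * x.rep j / ∑ k, x.rep k ^ 2
  have hpos : ∀ v : Fin (N + 1) → ℝ, v ≠ 0 → 0 < ∑ k, v k ^ 2 := by
    intro v hv
    obtain ⟨i, hi⟩ := Function.ne_iff.1 hv
    exact Finset.sum_pos' (fun _ _ => sq_nonneg _) ⟨i, Finset.mem_univ _, by
      have : v i ≠ 0 := hi
      positivity⟩
  have hf : Continuous f := by
    refine isQuotientMap_mk'.continuous_iff.2 ?_
    have h : f ∘ Projectivization.mk' ℝ = fun v : {v : Fin (N + 1) → ℝ // v ≠ 0} =>
        fun i j => v.1 i * v.1 j / ∑ k, v.1 k ^ 2 := by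
      funext v i j
      obtain ⟨a, ha, h⟩ := rep_mk v.1 v.2
      have h' : (Projectivization.mk' ℝ v).rep = a • v.1 := h
      have hs := (hpos v.1 v.2).ne'
      simp only [f, Function.comp_apply, h', Pi.smul_apply, smul_eq_mul, mul_pow,
        ← Finset.mul_sum]
      field_simp
    rw [h]
    refine continuous_pi fun i => continuous_pi fun j => Continuous.div ?_ ?_ fun v =>
      (hpos v.1 v.2).ne'
    · exact ((continuous_apply i).comp continuous_subtype_val).mul
        ((continuous_apply j).comp continuous_subtype_val)
    · exact continuous_finsetSum _ fun k _ =>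
        ((continuous_apply k).comp continuous_subtype_val).pow 2
  refine T2Space.of_injective_continuous (f := f) (fun x y hxy => ?_) hf
  obtain ⟨i, hi⟩ := exists_rep_ne_zero x
  have hx := hpos _ x.rep_nonzero
  have hy := hpos _ y.rep_nonzero
  have h1 : ∀ j, x.rep i * x.rep j / ∑ k, x.rep k ^ 2 = y.rep i * y.rep j / ∑ k, y.rep k ^ 2 :=
    fun j => congrFun (congrFun hxy i) j
  have hyi : y.rep i ≠ 0 := by
    intro h0
    have := h1 i
    rw [h0, zero_mul, zero_div, div_eq_zero_iff] at this
    rcases this with h | h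
    · exact hi (mul_self_eq_zero.1 h)
    · exact hx.ne' h
  rw [← x.mk_rep, ← y.mk_rep, Projectivization.mk_eq_mk_iff']
  refine ⟨(∑ k, x.rep k ^ 2) * y.rep i / ((∑ k, y.rep k ^ 2) * x.rep i), ?_⟩
  funext j
  have := h1 j
  rw [div_eq_div_iff hx.ne' hy.ne'] at this
  simp only [Pi.smul_apply, smul_eq_mul]
  rw [div_mul_eq_mul_div, div_eq_iff (mul_ne_zero hy.ne' hi)]
  linarith

theorem affineChart_mem_maximalAtlas (l : Fin (N + 1)) :
    affineChart l ∈ IsManifold.maximalAtlas 𝓘(ℝ, Fin N → ℝ) ∞ (RealProj N) :=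
  IsManifold.subset_maximalAtlas (mem_range_self l)

theorem affineChart_mem_atlas (l : Fin (N + 1)) :
    affineChart l ∈ atlas (Fin N → ℝ) (RealProj N) := mem_range_self l

theorem contMDiff_affineChart_symm (l : Fin (N + 1)) :
    ContMDiff 𝓘(ℝ, Fin N → ℝ) 𝓘(ℝ, Fin N → ℝ) ∞ (affineChart l).symm :=
  contMDiffOn_univ.1 (contMDiffOn_symm_of_mem_maximalAtlas (affineChart_mem_maximalAtlas l))

theorem contMDiffOn_affineChart (l : Fin (N + 1)) :
    ContMDiffOn 𝓘(ℝ, Fin N → ℝ) 𝓘(ℝ, Fin N → ℝ) ∞ (affineChart l) (affineChart l).source :=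
  contMDiffOn_of_mem_maximalAtlas (affineChart_mem_maximalAtlas l)

end RealProj

/-! ### Riemannian metrics in affine charts -/

namespace RealProjMetric

open RealProj

variable {N : ℕ} (g : RealProjMetric N)

/-- The scalar product at a point of projective space. -/
def innerCLM (x : RealProj N) : (Fin N → ℝ) →L[ℝ] (Fin N → ℝ) →L[ℝ] ℝ := g.inner x

theorem innerCLM_pos (x : RealProj N) (v : Fin N → ℝ) (hv : v ≠ 0) :
    0 < g.innerCLM x v v := g.pos x v hv

/-- The metric in an affine chart. -/
def affine (l : Fin (N + 1)) : (Fin N → ℝ) → (Fin N → ℝ) →L[ℝ] (Fin N → ℝ) →L[ℝ] ℝ :=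
  chartBilin g.innerCLM (affineChart l)

theorem affine_pos (l : Fin (N + 1)) (w v : Fin N → ℝ) (hv : v ≠ 0) : 0 < g.affine l w v v := by
  refine g.innerCLM_pos _ _ fun h => hv ?_
  have h1 := DFunLike.congr_fun (chartDeriv_comp_symmDeriv (affineChart_mem_atlas l)
    (u := w) (mem_univ _)) v
  have h2 : symmDeriv (affineChart l) w v = 0 := h
  rw [ContinuousLinearMap.comp_apply, h2, map_zero] at h1
  exact h1.symm

/-- A Riemannian metric is given as a smooth section of a bundle of bilinear forms. Evaluating it on
the images of constant vector fields under the chart turns this into continuity of the coefficients.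
-/
theorem continuous_affine (l : Fin (N + 1)) : Continuous (g.affine l) := by
  rw [continuous_clm_apply]
  intro v
  rw [continuous_clm_apply]
  intro v'
  have hc : Continuous (fun b : RealProj N => Bundle.TotalSpace.mk'
      ((Fin N → ℝ) →L[ℝ] (Fin N → ℝ) →L[ℝ] ℝ)
      (E := fun x : RealProj N => TangentSpace 𝓘(ℝ, Fin N → ℝ) x →L[ℝ]
        TangentSpace 𝓘(ℝ, Fin N → ℝ) x →L[ℝ] ℝ) b (g.inner b)) := g.contMDiff.continuous
  have hcs : Continuous (affineChart l).symm := (contMDiff_affineChart_symm l).continuous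
  have ht : ∀ v : Fin N → ℝ, Continuous (fun w : Fin N → ℝ =>
      (⟨(affineChart l).symm w, mfderiv 𝓘(ℝ, Fin N → ℝ) 𝓘(ℝ, Fin N → ℝ) (affineChart l).symm w v⟩ :
        Bundle.TotalSpace (Fin N → ℝ) (fun x : RealProj N => TangentSpace 𝓘(ℝ, Fin N → ℝ) x))) := by
    intro v
    have h1 := (contMDiff_affineChart_symm l).continuous_tangentMap (by simp)
    have h2 : Continuous (fun w : Fin N → ℝ =>
        (⟨w, v⟩ : TangentBundle 𝓘(ℝ, Fin N → ℝ) (Fin N → ℝ))) :=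
      (tangentBundleModelSpaceHomeomorph 𝓘(ℝ, Fin N → ℝ)).symm.continuous.comp
        (continuous_id.prodMk continuous_const)
    exact h1.comp h2
  rw [continuous_iff_continuousAt]
  intro w
  have h3 := ContinuousWithinAt.clm_bundle_apply₂ (F₁ := Fin N → ℝ) (F₂ := Fin N → ℝ) (F₃ := ℝ)
    (E₃ := Bundle.Trivial (RealProj N) ℝ) (s := univ)
    ((hc.comp hcs).continuousAt (x := w)).continuousWithinAt
    ((ht v).continuousAt (x := w)).continuousWithinAt
    ((ht v').continuousAt (x := w)).continuousWithinAt
  rw [FiberBundle.continuousWithinAt_totalSpace, continuousWithinAt_univ] at h3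
  exact (continuousWithinAt_univ _ _).1 h3.2

/-- On compact sets, the metric is comparable with the standard metric. -/
theorem exists_affine_bounds (l : Fin (N + 1)) {K : Set (Fin N → ℝ)} (hK : IsCompact K) :
    ∃ C : ℝ, 0 < C ∧ ∀ w ∈ K, ∀ v, C⁻¹ * ‖v‖ ^ 2 ≤ g.affine l w v v ∧
      g.affine l w v v ≤ C * ‖v‖ ^ 2 := by
  have hc := g.continuous_affine l
  have hc2 : Continuous fun p : (Fin N → ℝ) × (Fin N → ℝ) => g.affine l p.1 p.2 p.2 := by
    exact ((hc.comp continuous_fst).clm_apply continuous_snd).clm_apply continuous_snd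
  have hKS : IsCompact (K ×ˢ Metric.sphere (0 : Fin N → ℝ) 1) := hK.prod (isCompact_sphere 0 1)
  have h1 : ∃ C₁ : ℝ, 0 < C₁ ∧ ∀ p ∈ K ×ˢ Metric.sphere (0 : Fin N → ℝ) 1,
      C₁ ≤ g.affine l p.1 p.2 p.2 := by
    rcases (K ×ˢ Metric.sphere (0 : Fin N → ℝ) 1).eq_empty_or_nonempty with h | h
    · exact ⟨1, one_pos, by simp [h]⟩
    · obtain ⟨p, hp, hmin⟩ := hKS.exists_isMinOn h hc2.continuousOn
      refine ⟨_, g.affine_pos l p.1 p.2 ?_, fun q hq => hmin hq⟩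
      have := hp.2
      rintro h0
      simp [h0] at this
  obtain ⟨C₁, hC₁, h1⟩ := h1
  obtain ⟨C₂, hC₂⟩ := hKS.bddAbove_image hc2.continuousOn
  refine ⟨max C₁⁻¹ C₂, lt_max_of_lt_left (by positivity), fun w hw v => ?_⟩
  by_cases hv : v = 0
  · subst hv
    simp
  have hn : 0 < ‖v‖ := norm_pos_iff.2 hv
  have hmem : (w, ‖v‖⁻¹ • v) ∈ K ×ˢ Metric.sphere (0 : Fin N → ℝ) 1 := by
    refine ⟨hw, ?_⟩
    simp [norm_smul, hn.ne']
  have h3 := h1 _ hmem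
  have h4 := hC₂ (mem_image_of_mem _ hmem)
  have h5 : g.affine l w v v = ‖v‖ ^ 2 * g.affine l w (‖v‖⁻¹ • v) (‖v‖⁻¹ • v) := by
    simp only [map_smul, smul_apply, smul_eq_mul]
    field_simp
  simp only at h3 h4
  constructor
  · rw [h5, mul_comm]
    gcongr
    refine le_trans ?_ h3
    rw [inv_le_comm₀ (lt_max_of_lt_left (by positivity)) hC₁]
    exact le_max_left _ _
  · rw [h5, mul_comm]
    gcongr
    exact h4.trans (le_max_right _ _)

variable {d : ℕ} (S : EmbeddedSubmanifold (RealProj N) (N := N) d)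

/-- The field of scalar products of the induced metric. -/
def inducedCLM (x : S.carrier) : (Fin d → ℝ) →L[ℝ] (Fin d → ℝ) →L[ℝ] ℝ :=
  (g.innerCLM (x : RealProj N)).bilinearComp (EmbeddedSubmanifold.valDeriv x)
    (EmbeddedSubmanifold.valDeriv x)

theorem isScalarProduct_induced : IsScalarProduct (g.induced S) (g.inducedCLM S) where
  apply_eq _ _ _ := rfl
  symm _ _ _ := g.symm _ _ _
  pos x v hv := g.pos _ _ fun h => hv (EmbeddedSubmanifold.valDeriv_injective x v h)

/-- Affine coordinates on a submanifold. -/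
def _root_.EmbeddedSubmanifold.affineMap (l : Fin (N + 1)) (x : S.carrier) : Fin N → ℝ :=
  affineCoord l (x : RealProj N)

theorem _root_.EmbeddedSubmanifold.isOpen_affine (l : Fin (N + 1)) :
    IsOpen {x : S.carrier | (x : RealProj N).rep l ≠ 0} :=
  (RealProj.isOpen_affine l).preimage continuous_subtype_val

theorem _root_.EmbeddedSubmanifold.contMDiffOn_affineMap (l : Fin (N + 1)) :
    ContMDiffOn 𝓘(ℝ, Fin d → ℝ) 𝓘(ℝ, Fin N → ℝ) ∞ (S.affineMap l)
      {x | (x : RealProj N).rep l ≠ 0} :=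
  (contMDiffOn_affineChart l).comp EmbeddedSubmanifold.contMDiff_val.contMDiffOn fun _ hx => hx

theorem manifoldDeriv_affineMap (l : Fin (N + 1)) {x : S.carrier}
    (hx : (x : RealProj N).rep l ≠ 0) : manifoldDeriv (S.affineMap l) x =
      (chartDeriv (affineChart l) (x : RealProj N)).comp (EmbeddedSubmanifold.valDeriv x) :=
  mfderiv_comp x ((mdifferentiable_of_atlas (affineChart_mem_atlas l)).mdifferentiableAt hx)
    (EmbeddedSubmanifold.contMDiff_val.contMDiffAt.mdifferentiableAt (by simp))

theorem symmDeriv_manifoldDeriv_affineMap (l : Fin (N + 1)) {x : S.carrier}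
    (hx : (x : RealProj N).rep l ≠ 0) (v : Fin d → ℝ) :
    symmDeriv (affineChart l) (S.affineMap l x) (manifoldDeriv (S.affineMap l) x v) =
      EmbeddedSubmanifold.valDeriv x v := by
  have h4 := symmDeriv_comp_chartDeriv (affineChart_mem_atlas l) (x := (x : RealProj N)) hx
  rw [manifoldDeriv_affineMap S l hx]
  exact DFunLike.congr_fun h4 (EmbeddedSubmanifold.valDeriv x v)

theorem inducedCLM_apply (l : Fin (N + 1)) {x : S.carrier} (hx : (x : RealProj N).rep l ≠ 0)
    (v w : Fin d → ℝ) : g.inducedCLM S x v w = g.affine l (S.affineMap l x)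
      (manifoldDeriv (S.affineMap l) x v) (manifoldDeriv (S.affineMap l) x w) := by
  have h1 : (affineChart l).symm (S.affineMap l x) = x := (affineChart l).left_inv hx
  change g.innerCLM x (EmbeddedSubmanifold.valDeriv x v) (EmbeddedSubmanifold.valDeriv x w) =
    g.innerCLM ((affineChart l).symm (S.affineMap l x))
    (symmDeriv (affineChart l) (S.affineMap l x) (manifoldDeriv (S.affineMap l) x v))
    (symmDeriv (affineChart l) (S.affineMap l x) (manifoldDeriv (S.affineMap l) x w))
  rw [h1, symmDeriv_manifoldDeriv_affineMap S l hx, symmDeriv_manifoldDeriv_affineMap S l hx]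

theorem chartBilin_induced_apply (l : Fin (N + 1))
    {e : OpenPartialHomeomorph S.carrier (Fin d → ℝ)} (he : e ∈ atlas (Fin d → ℝ) S.carrier)
    {u : Fin d → ℝ} (hu : u ∈ e.target) (hx : (e.symm u : RealProj N).rep l ≠ 0)
    (v w : Fin d → ℝ) : chartBilin (g.inducedCLM S) e u v w =
      g.affine l ((S.affineMap l ∘ e.symm) u)
        (fderiv ℝ (S.affineMap l ∘ e.symm) u v) (fderiv ℝ (S.affineMap l ∘ e.symm) u w) := by
  rw [fderiv_comp_symm he hu (mdifferentiableAt_of_contMDiffOn (S.isOpen_affine l)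
    (S.contMDiffOn_affineMap l) hx)]
  exact g.inducedCLM_apply S l hx _ _

theorem continuousOn_chartBilin_induced (l : Fin (N + 1))
    {e : OpenPartialHomeomorph S.carrier (Fin d → ℝ)} (he : e ∈ atlas (Fin d → ℝ) S.carrier)
    (hx : ∀ u ∈ e.target, (e.symm u : RealProj N).rep l ≠ 0) :
    ContinuousOn (chartBilin (g.inducedCLM S) e) e.target := by
  have h1 : ContDiffOn ℝ ∞ (S.affineMap l ∘ e.symm) e.target :=
    (contDiffOn_comp_symm (S.contMDiffOn_affineMap l) he).mono fun u hu => ⟨hu, hx u hu⟩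
  have h2 := h1.continuousOn_fderiv_of_isOpen e.open_target (by simp)
  rw [continuousOn_clm_apply]
  intro v
  rw [continuousOn_clm_apply]
  intro w
  refine ContinuousOn.congr (f := fun u => g.affine l ((S.affineMap l ∘ e.symm) u)
        (fderiv ℝ (S.affineMap l ∘ e.symm) u v) (fderiv ℝ (S.affineMap l ∘ e.symm) u w)) ?_
    fun u hu => g.chartBilin_induced_apply S l he hu (hx u hu) v w
  exact (((g.continuous_affine l).comp_continuousOn h1.continuousOn).clm_apply
    (h2.clm_apply continuousOn_const)).clm_apply (h2.clm_apply continuousOn_const)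

end RealProjMetric

end

noncomputable section

/-! ### Hypersurfaces `|x| = R(y)` in `ℝ^n × ℝ^(k+1)` -/

namespace GraphChart

variable {n k : ℕ}

/-- The position of the coordinate `x_i`. -/
def ix (i : Fin n) : Fin (n + k + 1) := ⟨i, by omega⟩

/-- The position of the coordinate `y_j`. -/
def jy (j : Fin (k + 1)) : Fin (n + k + 1) := ⟨n + j, by omega⟩

/-- `|x|²` -/
def sqX (w : Fin (n + k + 1) → ℝ) : ℝ := ∑ i : Fin n, w (ix i) ^ 2

/-- The `y`-coordinates. -/
def projY : (Fin (n + k + 1) → ℝ) →L[ℝ] (Fin (k + 1) → ℝ) :=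
  ContinuousLinearMap.pi fun j => ContinuousLinearMap.proj (jy j)

theorem projY_apply (w : Fin (n + k + 1) → ℝ) (j : Fin (k + 1)) :
    projY (n := n) w j = w (jy j) := rfl

/-- The `j`-th of the coordinates other than `x_i` is one of the `x`-coordinates. -/
def IsX (i : Fin n) (j : Fin (n + k)) : Prop := ((ix i).succAbove j : ℕ) < n

instance (i : Fin n) (j : Fin (n + k)) : Decidable (IsX i j) := Nat.decLt _ _

/-- The position of `y_j` among the coordinates other than `x_i`. -/
def iy (i : Fin n) (j : Fin (k + 1)) : Fin (n + k) := ⟨n - 1 + j, by have := i.2; omega⟩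

theorem succAbove_val (i : Fin n) (j : Fin (n + k)) :
    ((ix (k := k) i).succAbove j : ℕ) = if (j : ℕ) < i then (j : ℕ) else j + 1 := by
  by_cases h : (j : ℕ) < i
  · rw [Fin.succAbove_of_castSucc_lt _ _ (by simpa [Fin.lt_def, ix] using h)]
    simp [h]
  · rw [Fin.succAbove_of_le_castSucc _ _ (by simpa [Fin.le_def, ix] using h)]
    simp [h]

theorem isX_iff (i : Fin n) (j : Fin (n + k)) : IsX i j ↔ (j : ℕ) + 1 < n := by
  have := i.2
  rw [IsX, succAbove_val]
  split_ifs <;> omega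

theorem succAbove_iy (i : Fin n) (j : Fin (k + 1)) :
    (ix (k := k) i).succAbove (iy i j) = jy j := by
  have := i.2
  apply Fin.ext
  rw [succAbove_val]
  have h : ¬ ((iy i j : Fin (n + k)) : ℕ) < i := by simp only [iy]; omega
  rw [if_neg h]
  simp only [iy, jy]
  omega

theorem not_isX_iy (i : Fin n) (j : Fin (k + 1)) : ¬ IsX (k := k) i (iy i j) := by
  have := i.2
  rw [isX_iff]
  simp only [iy]
  omega

theorem exists_eq_iy (i : Fin n) {j : Fin (n + k)} (hj : ¬ IsX i j) : ∃ l, j = iy i l := by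
  have := i.2
  have := j.2
  rw [isX_iff] at hj
  refine ⟨⟨j - (n - 1), by omega⟩, Fin.ext ?_⟩
  simp only [iy]
  omega

theorem iy_injective (i : Fin n) : Function.Injective (iy (k := k) i) := by
  intro j l h
  have := congrArg Fin.val h
  simp only [iy] at this
  exact Fin.ext (by omega)

theorem sqX_eq (i : Fin n) (w : Fin (n + k + 1) → ℝ) :
    sqX w = w (ix i) ^ 2 +
      ∑ j : Fin (n + k), if IsX i j then w ((ix i).succAbove j) ^ 2 else 0 := by
  have h1 : sqX w = ∑ b : Fin (n + k + 1), if (b : ℕ) < n then w b ^ 2 else 0 := by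
    change _ = ∑ b : Fin (n + (k + 1)), _
    rw [Fin.sum_univ_add]
    simp [sqX]
    rfl
  rw [h1, Fin.sum_univ_succAbove _ (ix i), if_pos (show ((ix i : Fin (n + k + 1)) : ℕ) < n from i.2)]
  rfl

theorem sqX_nonneg (w : Fin (n + k + 1) → ℝ) : 0 ≤ sqX w := Finset.sum_nonneg fun _ _ => sq_nonneg _

/-- `|u|²`, for the coordinates `u_l = x_l / x_i`. -/
def sqU (i : Fin n) (u : Fin (n + k) → ℝ) : ℝ := ∑ j, if IsX i j then u j ^ 2 else 0

theorem sqU_nonneg (i : Fin n) (u : Fin (n + k) → ℝ) : 0 ≤ sqU i u :=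
  Finset.sum_nonneg fun _ _ => by split_ifs <;> positivity

/-- The `y`-coordinates, from the coordinates other than `x_i`. -/
def coordY (i : Fin n) : (Fin (n + k) → ℝ) →L[ℝ] (Fin (k + 1) → ℝ) :=
  ContinuousLinearMap.pi fun j => ContinuousLinearMap.proj (iy i j)

theorem coordY_apply (i : Fin n) (u : Fin (n + k) → ℝ) (j : Fin (k + 1)) :
    coordY i u j = u (iy i j) := rfl

variable (i : Fin n) (s : ℝ) (R : (Fin (k + 1) → ℝ) → ℝ)

/-- The coordinates `u_l = x_l / x_i` for `l ≠ i` and `y`. -/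
def angular (w : Fin (n + k + 1) → ℝ) : Fin (n + k) → ℝ := fun j =>
  if IsX i j then w ((ix i).succAbove j) / w (ix i) else w ((ix i).succAbove j)

/-- The coordinates `u_l = x_l / x_i` for `l ≠ i`, `y`, and `t = |x|² / R(y)² - 1`. -/
def toGraph (w : Fin (n + k + 1) → ℝ) : Fin (n + k + 1) → ℝ :=
  Fin.snoc (α := fun _ => ℝ) (angular i w) (sqX w / R (projY w) ^ 2 - 1)

/-- The value of `x_i` in terms of the other coordinates. -/
def height (u : Fin (n + k) → ℝ) (t : ℝ) : ℝ :=
  s * R (coordY i u) * Real.sqrt ((1 + t) / (1 + sqU i u))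

/-- The point with coordinates `u`, `y` and `t`. -/
def param (u : Fin (n + k) → ℝ) (t : ℝ) : Fin (n + k + 1) → ℝ :=
  (ix i).insertNth (α := fun _ => ℝ) (height i s R u t)
    (fun j => if IsX i j then u j * height i s R u t else u j)

theorem param_self (u : Fin (n + k) → ℝ) (t : ℝ) : param i s R u t (ix i) = height i s R u t := by
  simp [param]

theorem param_succAbove (u : Fin (n + k) → ℝ) (t : ℝ) (j : Fin (n + k)) :
    param i s R u t ((ix i).succAbove j) =
      if IsX i j then u j * height i s R u t else u j := by
  simp [param]

theorem projY_param (u : Fin (n + k) → ℝ) (t : ℝ) : projY (param i s R u t) = coordY i u := by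
  funext j
  rw [projY_apply, ← succAbove_iy i j, param_succAbove, if_neg (not_isX_iy i j), coordY_apply]

theorem coordY_angular (w : Fin (n + k + 1) → ℝ) : coordY i (angular i w) = projY w := by
  funext j
  rw [coordY_apply, angular, if_neg (not_isX_iy i j), succAbove_iy, projY_apply]

theorem sqX_param (u : Fin (n + k) → ℝ) (t : ℝ) :
    sqX (param i s R u t) = height i s R u t ^ 2 * (1 + sqU i u) := by
  rw [sqX_eq i, param_self, sqU, mul_add, mul_one, Finset.mul_sum]
  congr 1
  refine Finset.sum_congr rfl fun j _ => ?_
  rw [param_succAbove]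
  split_ifs <;> ring

theorem height_sq (hs : s ^ 2 = 1) (u : Fin (n + k) → ℝ) {t : ℝ} (ht : -1 < t) :
    height i s R u t ^ 2 = R (coordY i u) ^ 2 * ((1 + t) / (1 + sqU i u)) := by
  have h1 : 0 ≤ (1 + t) / (1 + sqU i u) :=
    div_nonneg (by linarith) (by linarith [sqU_nonneg i u])
  rw [height, mul_pow, mul_pow, hs, Real.sq_sqrt h1, one_mul]

theorem sqU_angular {w : Fin (n + k + 1) → ℝ} (hw : w (ix i) ≠ 0) :
    1 + sqU i (angular i w) = sqX w / w (ix i) ^ 2 := by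
  rw [sqX_eq i, add_div, div_self (pow_ne_zero 2 hw), sqU, Finset.sum_div]
  congr 1
  refine Finset.sum_congr rfl fun j _ => ?_
  by_cases h : IsX i j
  · simp [h, angular, div_pow]
  · simp [h]

/-- By definition of the coordinates |x|² = x_i² (1 + |u|²) and |x|² = R² (1 + t). Together with the
sign `s` of x_i this determines x_i as `height`, and then x_l = u_l x_i. -/
theorem param_angular (hs : s ^ 2 = 1) {w : Fin (n + k + 1) → ℝ} (hw : 0 < s * w (ix i))
    (hR : 0 < R (projY w)) : param i s R (angular i w) (sqX w / R (projY w) ^ 2 - 1) = w := by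
  have hw0 : w (ix i) ≠ 0 := by
    rintro h
    simp [h] at hw
  have hX : 0 < sqX w := by
    rw [sqX_eq i]
    have : 0 ≤ ∑ j : Fin (n + k), if IsX i j then w ((ix i).succAbove j) ^ 2 else 0 :=
      Finset.sum_nonneg fun _ _ => by split_ifs <;> positivity
    positivity
  have hh : height i s R (angular i w) (sqX w / R (projY w) ^ 2 - 1) = w (ix i) := by
    rw [height, coordY_angular, sqU_angular i hw0]
    have h1 : (1 + (sqX w / R (projY w) ^ 2 - 1)) / (sqX w / w (ix i) ^ 2) =
        (s * w (ix i) / R (projY w)) ^ 2 := by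
      rw [div_pow, mul_pow, hs]
      field_simp
      ring
    rw [h1, Real.sqrt_sq (by positivity)]
    field_simp
    rw [hs]
  funext b
  refine Fin.succAboveCases (ix i) ?_ (fun j => ?_) b
  · rw [param_self, hh]
  · rw [param_succAbove, hh, angular]
    by_cases h : IsX i j
    · simp only [if_pos h]
      field_simp
    · simp only [if_neg h]

theorem angular_param (u : Fin (n + k) → ℝ) {t : ℝ} (h0 : height i s R u t ≠ 0) :
    angular i (param i s R u t) = u := by
  funext j
  rw [angular, param_self, param_succAbove]
  split_ifs
  · field_simp
  · rfl

variable (Ω : Set (Fin (k + 1) → ℝ))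

theorem contDiffOn_sqX : ContDiff ℝ ∞ (sqX : (Fin (n + k + 1) → ℝ) → ℝ) :=
  ContDiff.sum fun i _ => (contDiff_apply ℝ ℝ (ix i)).pow 2

theorem contDiff_sqU : ContDiff ℝ ∞ (sqU i : (Fin (n + k) → ℝ) → ℝ) := by
  refine ContDiff.sum fun j _ => ?_
  by_cases h : IsX i j
  · simpa only [if_pos h] using (contDiff_apply ℝ ℝ j).pow 2
  · simpa only [if_neg h] using contDiff_const

theorem contDiffOn_toGraph (hR : ContDiffOn ℝ ∞ R Ω) (hpos : ∀ y ∈ Ω, 0 < R y) :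
    ContDiffOn ℝ ∞ (toGraph i R) {w | 0 < s * w (ix i) ∧ projY w ∈ Ω} := by
  refine contDiffOn_pi.2 fun b => ?_
  refine Fin.lastCases ?_ (fun j => ?_) b
  · simp only [toGraph, Fin.snoc_last]
    refine (ContDiffOn.div contDiffOn_sqX.contDiffOn ((hR.comp projY.contDiff.contDiffOn
      fun w hw => hw.2).pow 2) fun w hw => ?_).sub contDiffOn_const
    exact pow_ne_zero 2 (hpos _ hw.2).ne'
  · simp only [toGraph, Fin.snoc_castSucc, angular]
    by_cases h : IsX i j
    · simp only [if_pos h]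
      refine (contDiff_apply ℝ ℝ _).contDiffOn.div (contDiff_apply ℝ ℝ _).contDiffOn fun w hw => ?_
      rintro h0
      have := hw.1
      simp [h0] at this
    · simp only [if_neg h]
      exact (contDiff_apply ℝ ℝ _).contDiffOn

theorem contDiffOn_height (hR : ContDiffOn ℝ ∞ R Ω) :
    ContDiffOn ℝ ∞ (fun p : (Fin (n + k) → ℝ) × ℝ => height i s R p.1 p.2)
      {p | coordY i p.1 ∈ Ω ∧ -1 < p.2} := by
  have h1 : ∀ p : (Fin (n + k) → ℝ) × ℝ, 0 < 1 + sqU i p.1 := fun p => by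
    linarith [sqU_nonneg i p.1]
  refine (contDiffOn_const.mul ?_).mul ?_
  · exact hR.comp ((coordY i).contDiff.comp contDiff_fst).contDiffOn fun p hp => hp.1
  · refine ContDiffOn.sqrt ?_ fun p hp => ?_
    · exact ((contDiff_const.add contDiff_snd).div
        (contDiff_const.add ((contDiff_sqU i).comp contDiff_fst)) fun p => (h1 p).ne').contDiffOn
    · exact (div_pos (by linarith [hp.2]) (h1 p)).ne'

theorem contDiffOn_param (hR : ContDiffOn ℝ ∞ R Ω) :
    ContDiffOn ℝ ∞ (fun p : (Fin (n + k) → ℝ) × ℝ => param i s R p.1 p.2)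
      {p | coordY i p.1 ∈ Ω ∧ -1 < p.2} := by
  refine contDiffOn_pi.2 fun b => ?_
  refine Fin.succAboveCases (ix i) ?_ (fun j => ?_) b
  · simp only [param_self]
    exact contDiffOn_height i s R Ω hR
  · simp only [param_succAbove]
    have h2 : ContDiffOn ℝ ∞ (fun p : (Fin (n + k) → ℝ) × ℝ => p.1 j)
        {p | coordY i p.1 ∈ Ω ∧ -1 < p.2} :=
      ((contDiff_apply ℝ ℝ j).comp contDiff_fst).contDiffOn
    by_cases h : IsX i j
    · simp only [if_pos h]
      exact h2.mul (contDiffOn_height i s R Ω hR)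
    · simp only [if_neg h]
      exact h2

/-- The graph coordinates, as a chart of `ℝ^n × ℝ^(k+1)`. -/
def chart (hs : s ^ 2 = 1) (hΩ : IsOpen Ω) (hR : ContDiffOn ℝ ∞ R Ω) (hpos : ∀ y ∈ Ω, 0 < R y) :
    OpenPartialHomeomorph (Fin (n + k + 1) → ℝ) (Fin (n + k + 1) → ℝ) where
  toFun := toGraph i R
  invFun v := param i s R (fun j => v j.castSucc) (v (Fin.last _))
  source := {w | 0 < s * w (ix i) ∧ projY w ∈ Ω}
  target := {v | coordY i (fun j => v j.castSucc) ∈ Ω ∧ -1 < v (Fin.last _)}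
  map_source' := fun w hw => by
    have h1 := hpos _ hw.2
    have h2 : w (ix i) ≠ 0 := by
      rintro h
      have := hw.1
      simp [h] at this
    have hX : 0 < sqX w := by
      have := sqU_angular i h2
      have h3 := sqU_nonneg i (angular i w)
      by_contra h4
      have : sqX w / w (ix i) ^ 2 ≤ 0 := div_nonpos_of_nonpos_of_nonneg (not_lt.1 h4) (sq_nonneg _)
      linarith
    simp only [mem_ofPred_eq, toGraph, Fin.snoc_castSucc, Fin.snoc_last]
    refine ⟨?_, ?_⟩
    · rw [coordY_angular]
      exact hw.2
    · have : 0 < sqX w / R (projY w) ^ 2 := by positivity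
      linarith
  map_target' := fun v hv => by
    have h1 := hpos _ hv.1
    have h2 : 0 < 1 + v (Fin.last _) := by linarith [hv.2]
    refine ⟨?_, ?_⟩
    · rw [param_self, height, ← mul_assoc, ← mul_assoc, ← sq, hs, one_mul]
      have h3 : 0 < 1 + sqU i (fun j => v j.castSucc) := by
        linarith [sqU_nonneg i (fun j => v j.castSucc)]
      have : 0 < Real.sqrt ((1 + v (Fin.last _)) / (1 + sqU i fun j => v j.castSucc)) :=
        Real.sqrt_pos.2 (div_pos h2 h3)
      positivity
    · rw [projY_param]
      exact hv.1
  left_inv' := fun w hw => by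
    simp only [toGraph, Fin.snoc_castSucc, Fin.snoc_last]
    exact param_angular i s R hs hw.1 (hpos _ hw.2)
  right_inv' := fun v hv => by
    have h1 := hpos _ hv.1
    have h2 : 0 < 1 + v (Fin.last _) := by linarith [hv.2]
    have h3 : 0 < 1 + sqU i (fun j => v j.castSucc) := by
      linarith [sqU_nonneg i (fun j => v j.castSucc)]
    have h4 : height i s R (fun j => v j.castSucc) (v (Fin.last _)) ≠ 0 := by
      intro h0
      have := height_sq i s R hs (fun j => v j.castSucc) hv.2
      rw [h0] at this
      have h5 : 0 < R (coordY i fun j => v j.castSucc) ^ 2 *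
        ((1 + v (Fin.last _)) / (1 + sqU i fun j => v j.castSucc)) := by positivity
      simp only [ne_eq, OfNat.ofNat_ne_zero, not_false_eq_true, zero_pow] at this
      linarith
    funext b
    refine Fin.lastCases ?_ (fun j => ?_) b
    · rw [toGraph, Fin.snoc_last, projY_param, sqX_param, height_sq i s R hs _ hv.2]
      field_simp
      ring
    · rw [toGraph, Fin.snoc_castSucc, angular_param i s R _ h4]
  open_source := by
    refine IsOpen.inter ?_ (hΩ.preimage projY.continuous)
    exact isOpen_lt continuous_const (continuous_const.mul (continuous_apply _))
  open_target := by
    refine IsOpen.inter (hΩ.preimage ((coordY i).continuous.comp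
      (continuous_pi fun j => continuous_apply _))) ?_
    exact isOpen_lt continuous_const (continuous_apply _)
  continuousOn_toFun := (contDiffOn_toGraph i s R Ω hR hpos).continuousOn
  continuousOn_invFun := by
    exact (contDiffOn_param i s R Ω hR).continuousOn.comp
      (f := fun v : Fin (n + k + 1) → ℝ => ((fun j : Fin (n + k) => v j.castSucc), v (Fin.last _)))
      (Continuous.continuousOn (by fun_prop)) fun v hv => hv

theorem chart_mem_groupoid (hs : s ^ 2 = 1) (hΩ : IsOpen Ω) (hR : ContDiffOn ℝ ∞ R Ω)
    (hpos : ∀ y ∈ Ω, 0 < R y) :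
    chart i s R Ω hs hΩ hR hpos ∈ contDiffGroupoid ∞ 𝓘(ℝ, Fin (n + k + 1) → ℝ) := by
  rw [contDiffGroupoid, mem_groupoid_of_pregroupoid]
  refine ⟨?_, ?_⟩
  · change ContDiffOn ℝ ∞ _ _
    simp only [modelWithCornersSelf_coe, modelWithCornersSelf_coe_symm, range_id, inter_univ,
      Function.id_comp, Function.comp_id, preimage_id]
    exact contDiffOn_toGraph i s R Ω hR hpos
  · change ContDiffOn ℝ ∞ _ _
    simp only [modelWithCornersSelf_coe, modelWithCornersSelf_coe_symm, range_id, inter_univ,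
      Function.id_comp, Function.comp_id, preimage_id]
    exact (contDiffOn_param i s R Ω hR).comp
      (f := fun v : Fin (n + k + 1) → ℝ => ((fun j : Fin (n + k) => v j.castSucc), v (Fin.last _)))
      (ContDiff.contDiffOn ((contDiff_pi.2 fun j => contDiff_apply ℝ ℝ _).prodMk
        (contDiff_apply ℝ ℝ _))) fun v hv => hv

/-! ### Graph charts of projective space -/

open RealProj

/-- The graph coordinates in an affine chart of projective space. -/
def projChart (l : Fin (n + k + 1 + 1)) (hs : s ^ 2 = 1) (hΩ : IsOpen Ω) (hR : ContDiffOn ℝ ∞ R Ω)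
    (hpos : ∀ y ∈ Ω, 0 < R y) :
    OpenPartialHomeomorph (RealProj (n + k + 1)) (Fin (n + k + 1) → ℝ) :=
  (affineChart l).trans (chart i s R Ω hs hΩ hR hpos)

theorem _root_.StructureGroupoid.trans_mem_maximalAtlas {H X : Type} [TopologicalSpace H]
    [TopologicalSpace X] [ChartedSpace H X] {G : StructureGroupoid H} {e : OpenPartialHomeomorph X H}
    (he : e ∈ G.maximalAtlas X) {f : OpenPartialHomeomorph H H} (hf : f ∈ G) :
    e.trans f ∈ G.maximalAtlas X := by
  rw [mem_maximalAtlas_iff] at he ⊢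
  intro e' he'
  obtain ⟨h1, h2⟩ := he e' he'
  refine ⟨?_, ?_⟩
  · rw [OpenPartialHomeomorph.trans_symm_eq_symm_trans_symm, OpenPartialHomeomorph.trans_assoc]
    exact G.trans (G.symm hf) h1
  · rw [← OpenPartialHomeomorph.trans_assoc]
    exact G.trans h2 hf

theorem projChart_mem_maximalAtlas (l : Fin (n + k + 1 + 1)) (hs : s ^ 2 = 1) (hΩ : IsOpen Ω)
    (hR : ContDiffOn ℝ ∞ R Ω) (hpos : ∀ y ∈ Ω, 0 < R y) :
    projChart i s R Ω l hs hΩ hR hpos ∈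
      IsManifold.maximalAtlas 𝓘(ℝ, Fin (n + k + 1) → ℝ) ∞ (RealProj (n + k + 1)) :=
  StructureGroupoid.trans_mem_maximalAtlas (affineChart_mem_maximalAtlas l)
    (chart_mem_groupoid i s R Ω hs hΩ hR hpos)

theorem mem_projChart_source (l : Fin (n + k + 1 + 1)) (hs : s ^ 2 = 1) (hΩ : IsOpen Ω)
    (hR : ContDiffOn ℝ ∞ R Ω) (hpos : ∀ y ∈ Ω, 0 < R y) (x : RealProj (n + k + 1)) :
    x ∈ (projChart i s R Ω l hs hΩ hR hpos).source ↔
      x.rep l ≠ 0 ∧ 0 < s * affineCoord l x (ix i) ∧ projY (affineCoord l x) ∈ Ω := by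
  rw [projChart, OpenPartialHomeomorph.trans_source]
  rfl

theorem mem_projChart_target (l : Fin (n + k + 1 + 1)) (hs : s ^ 2 = 1) (hΩ : IsOpen Ω)
    (hR : ContDiffOn ℝ ∞ R Ω) (hpos : ∀ y ∈ Ω, 0 < R y) (v : Fin (n + k + 1) → ℝ) :
    v ∈ (projChart i s R Ω l hs hΩ hR hpos).target ↔
      coordY i (fun j => v j.castSucc) ∈ Ω ∧ -1 < v (Fin.last _) := by
  rw [projChart, OpenPartialHomeomorph.trans_target]
  exact ⟨fun h => h.1, fun h => ⟨h, mem_univ _⟩⟩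

theorem forall_last_iff {d : ℕ} (P : Fin (d + 1) → Prop) :
    (∀ i : Fin (d + 1), d ≤ (i : ℕ) → P i) ↔ P (Fin.last d) := by
  refine ⟨fun h => h _ le_rfl, fun h i hi => ?_⟩
  have : i = Fin.last d := Fin.ext (by have := i.2; simp; omega)
  rwa [this]

/-- Graph charts are slice charts of a set which is locally of the form `|x| = R(y)`. -/
theorem projChart_slice_iff (l : Fin (n + k + 1 + 1)) (hs : s ^ 2 = 1) (hΩ : IsOpen Ω)
    (hR : ContDiffOn ℝ ∞ R Ω) (hpos : ∀ y ∈ Ω, 0 < R y) {x : RealProj (n + k + 1)}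
    (hx : x ∈ (projChart i s R Ω l hs hΩ hR hpos).source) :
    (∀ b : Fin (n + k + 1), n + k ≤ (b : ℕ) → projChart i s R Ω l hs hΩ hR hpos x b = 0) ↔
      sqX (affineCoord l x) = R (projY (affineCoord l x)) ^ 2 := by
  rw [forall_last_iff]
  rw [mem_projChart_source] at hx
  change toGraph i R (affineCoord l x) (Fin.last _) = 0 ↔ _
  rw [toGraph, Fin.snoc_last, sub_eq_zero, div_eq_one_iff_eq]
  exact pow_ne_zero 2 (hpos _ hx.2.2).ne'

end GraphChart

end

/-! ### The varieties V and W as local graphs |x|^{2p} = Q(y). -/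

noncomputable section

namespace GraphChart

open RealProj

variable {n k : ℕ}

/-! ### The equations of the varieties in affine coordinates -/

/-- `|y|²` -/
def sqY (y : Fin (k + 1) → ℝ) : ℝ := ∑ j, y j ^ 2

theorem sqY_nonneg (y : Fin (k + 1) → ℝ) : 0 ≤ sqY y := Finset.sum_nonneg fun _ _ => sq_nonneg _

theorem sqY_eq_zero_iff {y : Fin (k + 1) → ℝ} : sqY y = 0 ↔ y = 0 := by
  rw [sqY, Finset.sum_eq_zero_iff_of_nonneg fun _ _ => sq_nonneg _]
  simp [funext_iff]

theorem sqY_pos {y : Fin (k + 1) → ℝ} (hy : y ≠ 0) : 0 < sqY y :=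
  (sqY_nonneg y).lt_of_ne fun h => hy (sqY_eq_zero_iff.1 h.symm)

theorem contDiff_sqY : ContDiff ℝ ∞ (sqY : (Fin (k + 1) → ℝ) → ℝ) :=
  ContDiff.sum fun j _ => (contDiff_apply ℝ ℝ j).pow 2

theorem rep_succAbove {N : ℕ} {l : Fin (N + 1)} {x : RealProj N} (hl : x.rep l ≠ 0) (j : Fin N) :
    x.rep (l.succAbove j) = x.rep l * affineCoord l x j := by
  rw [affineCoord]
  field_simp

/-- The position of `x_i` among the homogeneous coordinates. -/
def hx (i : Fin n) : Fin (n + k + 1 + 1) := (ix i).castSucc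

/-- The position of `y_j` among the homogeneous coordinates. -/
def hy (j : Fin (k + 1)) : Fin (n + k + 1 + 1) := (jy j).castSucc

/-- The sum of the squares of the `x`-coordinates of a vector of `ℝ^n × ℝ^(k+1) × ℝ`. -/
def coneX (v : Fin (n + k + 1 + 1) → ℝ) : ℝ := ∑ i : Fin n, v (hx i) ^ 2

/-- The sum of the squares of the `y`-coordinates of a vector of `ℝ^n × ℝ^(k+1) × ℝ`. -/
def coneY (v : Fin (n + k + 1 + 1) → ℝ) : ℝ := ∑ j : Fin (k + 1), v (hy j) ^ 2

theorem eval_polyX (v : Fin (n + k + 1 + 1) → ℝ) :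
    MvPolynomial.eval v (polyX n (k + 1)) = coneX v := by
  simp only [polyX, map_sum, map_pow, MvPolynomial.eval_X]
  rfl

theorem eval_polyY (v : Fin (n + k + 1 + 1) → ℝ) :
    MvPolynomial.eval v (polyY n (k + 1)) = coneY v := by
  simp only [polyY, map_sum, map_pow, MvPolynomial.eval_X]
  rfl

theorem eval_polyZ (v : Fin (n + k + 1 + 1) → ℝ) :
    MvPolynomial.eval v (polyZ n (k + 1)) = v (Fin.last _) := by
  simp only [polyZ, MvPolynomial.eval_X]
  rfl

variable {p q : ℕ}

theorem mem_varietyW {x : RealProj (n + k + 1)} : x ∈ varietyW n (k + 1) p q ↔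
    coneX x.rep ^ p =
      coneY x.rep ^ q * x.rep (Fin.last _) ^ (2 * (p - q)) + coneY x.rep ^ p := by
  change MvPolynomial.eval x.rep (polyX n (k + 1) ^ p - (polyY n (k + 1) ^ q *
    polyZ n (k + 1) ^ (2 * (p - q)) + polyY n (k + 1) ^ p)) = 0 ↔ _
  rw [map_sub, map_add, map_mul, map_pow, map_pow, map_pow, map_pow, eval_polyX, eval_polyY,
    eval_polyZ, sub_eq_zero]

theorem mem_varietyV {x : RealProj (n + k + 1)} : x ∈ varietyV n (k + 1) p q ↔
    coneX x.rep ^ p = coneY x.rep ^ q * x.rep (Fin.last _) ^ (2 * (p - q)) := by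
  change MvPolynomial.eval x.rep (polyX n (k + 1) ^ p - polyY n (k + 1) ^ q *
    polyZ n (k + 1) ^ (2 * (p - q))) = 0 ↔ _
  rw [map_sub, map_mul, map_pow, map_pow, map_pow, eval_polyX, eval_polyY, eval_polyZ, sub_eq_zero]

theorem coneX_rep_last {x : RealProj (n + k + 1)} (hl : x.rep (Fin.last _) ≠ 0) :
    coneX x.rep = x.rep (Fin.last _) ^ 2 * sqX (affineCoord (Fin.last _) x) := by
  rw [coneX, sqX, Finset.mul_sum]
  refine Finset.sum_congr rfl fun i _ => ?_
  rw [hx, ← Fin.succAbove_last, rep_succAbove hl, mul_pow]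

theorem coneY_rep_last {x : RealProj (n + k + 1)} (hl : x.rep (Fin.last _) ≠ 0) :
    coneY x.rep = x.rep (Fin.last _) ^ 2 * sqY (projY (affineCoord (Fin.last _) x)) := by
  rw [coneY, sqY, Finset.mul_sum]
  refine Finset.sum_congr rfl fun i _ => ?_
  rw [hy, ← Fin.succAbove_last, rep_succAbove hl, mul_pow]
  rfl

/-- `|y|^{2q} + |y|^{2p}` -/
def profileW (p q : ℕ) (y : Fin (k + 1) → ℝ) : ℝ := sqY y ^ q + sqY y ^ p

/-- `|y|^{2q}` -/
def profileV (q : ℕ) (y : Fin (k + 1) → ℝ) : ℝ := sqY y ^ q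

theorem eq_iff_eq_of_eq_mul {a b a' b' c : ℝ} (hc : c ≠ 0) (ha : a' = c * a) (hb : b' = c * b) :
    a' = b' ↔ a = b := by
  rw [ha, hb, mul_right_inj' hc]

/-- The equation is homogeneous of degree 2p, so it can be divided by the corresponding power of the
coordinate that does not vanish. -/
theorem mem_varietyW_last (hqp : q < p) {x : RealProj (n + k + 1)} (hl : x.rep (Fin.last _) ≠ 0) :
    x ∈ varietyW n (k + 1) p q ↔ sqX (affineCoord (Fin.last _) x) ^ p =
      profileW p q (projY (affineCoord (Fin.last _) x)) := by
  obtain ⟨r, rfl⟩ := Nat.exists_eq_add_of_le hqp.le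
  rw [mem_varietyW, coneX_rep_last hl, coneY_rep_last hl, profileW, add_tsub_cancel_left]
  generalize x.rep (Fin.last _) = c at hl
  exact eq_iff_eq_of_eq_mul (pow_ne_zero (2 * (q + r)) hl) (by ring) (by ring)

theorem mem_varietyV_last (hqp : q < p) {x : RealProj (n + k + 1)} (hl : x.rep (Fin.last _) ≠ 0) :
    x ∈ varietyV n (k + 1) p q ↔ sqX (affineCoord (Fin.last _) x) ^ p =
      profileV q (projY (affineCoord (Fin.last _) x)) := by
  obtain ⟨r, rfl⟩ := Nat.exists_eq_add_of_le hqp.le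
  rw [mem_varietyV, coneX_rep_last hl, coneY_rep_last hl, profileV, add_tsub_cancel_left]
  generalize x.rep (Fin.last _) = c at hl
  exact eq_iff_eq_of_eq_mul (pow_ne_zero (2 * (q + r)) hl) (by ring) (by ring)

/-- `1 + ∑ y_j²`, over all but the last of the coordinates. -/
def sqInit (y : Fin (k + 1) → ℝ) : ℝ := 1 + ∑ j : Fin k, y j.castSucc ^ 2

theorem sqInit_pos (y : Fin (k + 1) → ℝ) : 0 < sqInit y := by
  have : 0 ≤ ∑ j : Fin k, y j.castSucc ^ 2 := Finset.sum_nonneg fun _ _ => sq_nonneg _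
  rw [sqInit]
  linarith

/-- The equation of `W` in the affine coordinates with `y_j = 1`. -/
def profileInfty (p q : ℕ) (y : Fin (k + 1) → ℝ) : ℝ :=
  sqInit y ^ q * y (Fin.last k) ^ (2 * (p - q)) + sqInit y ^ p

/-- When y_j is normalised to 1, the remaining coordinates are the x_i, then the k other y's, then
z. The block that plays the role of `y` in the graph charts thus carries z in its last place, which
explains the form of `profileInfty`. -/
theorem hy_succAbove_ix (j : Fin (k + 1)) (i : Fin n) :
    (hy (n := n) j).succAbove (ix i) = hx i := by
  rw [Fin.succAbove_of_castSucc_lt]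
  · rfl
  · simp only [hy, jy, ix, Fin.lt_def, Fin.val_castSucc]
    omega

theorem hy_succAbove_last (j : Fin (k + 1)) :
    (hy (n := n) j).succAbove (jy (Fin.last k)) = Fin.last _ := by
  rw [Fin.succAbove_of_le_castSucc]
  · apply Fin.ext
    simp [jy]
  · simp only [hy, jy, Fin.le_def, Fin.val_castSucc, Fin.val_last]
    omega

theorem hy_succAbove_castSucc (j : Fin (k + 1)) (b : Fin k) :
    (hy (n := n) j).succAbove (jy b.castSucc) = hy (j.succAbove b) := by
  apply Fin.ext
  by_cases h : (b : ℕ) < j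
  · rw [Fin.succAbove_of_castSucc_lt j b (by simpa [Fin.lt_def] using h),
      Fin.succAbove_of_castSucc_lt _ _ (by
        simp only [hy, jy, Fin.lt_def, Fin.val_castSucc]
        omega)]
    rfl
  · rw [Fin.succAbove_of_le_castSucc j b (by simpa [Fin.le_def] using h),
      Fin.succAbove_of_le_castSucc _ _ (by
        simp only [hy, jy, Fin.le_def, Fin.val_castSucc]
        omega)]
    rfl

theorem coneX_rep_hy {x : RealProj (n + k + 1)} {j : Fin (k + 1)} (hl : x.rep (hy j) ≠ 0) :
    coneX x.rep = x.rep (hy j) ^ 2 * sqX (affineCoord (hy j) x) := by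
  rw [coneX, sqX, Finset.mul_sum]
  refine Finset.sum_congr rfl fun i _ => ?_
  rw [← hy_succAbove_ix j i, rep_succAbove hl, mul_pow]

theorem coneY_rep_hy {x : RealProj (n + k + 1)} {j : Fin (k + 1)} (hl : x.rep (hy j) ≠ 0) :
    coneY x.rep = x.rep (hy j) ^ 2 * sqInit (projY (affineCoord (hy j) x)) := by
  rw [coneY, Fin.sum_univ_succAbove _ j, sqInit, mul_add, mul_one, Finset.mul_sum]
  congr 1
  refine Finset.sum_congr rfl fun b _ => ?_
  rw [← hy_succAbove_castSucc j b, rep_succAbove hl, mul_pow]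
  rfl

theorem mem_varietyW_hy (hqp : q < p) {x : RealProj (n + k + 1)} {j : Fin (k + 1)}
    (hl : x.rep (hy j) ≠ 0) :
    x ∈ varietyW n (k + 1) p q ↔ sqX (affineCoord (hy j) x) ^ p =
      profileInfty p q (projY (affineCoord (hy j) x)) := by
  rw [mem_varietyW, coneX_rep_hy hl, coneY_rep_hy hl, profileInfty, projY_apply,
    ← hy_succAbove_last j, rep_succAbove hl]
  obtain ⟨r, rfl⟩ := Nat.exists_eq_add_of_le hqp.le
  rw [add_tsub_cancel_left]
  generalize x.rep (hy j) = c at hl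
  exact eq_iff_eq_of_eq_mul (pow_ne_zero (2 * (q + r)) hl) (by ring) (by ring)

/-! ### The radius function -/

/-- `Q^(1/2p)` -/
def radius (p : ℕ) (Q : (Fin (k + 1) → ℝ) → ℝ) (y : Fin (k + 1) → ℝ) : ℝ :=
  Q y ^ (1 / (2 * p) : ℝ)

theorem radius_pos {Q : (Fin (k + 1) → ℝ) → ℝ} {y : Fin (k + 1) → ℝ} (h : 0 < Q y) :
    0 < radius p Q y := Real.rpow_pos_of_pos h _

theorem radius_pow (hp : 0 < p) {Q : (Fin (k + 1) → ℝ) → ℝ} {y : Fin (k + 1) → ℝ} (h : 0 ≤ Q y) :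
    (radius p Q y ^ 2) ^ p = Q y := by
  rw [← pow_mul, radius, ← Real.rpow_natCast, ← Real.rpow_mul h]
  have : (p : ℝ) ≠ 0 := by positivity
  push_cast
  rw [one_div, inv_mul_cancel₀ (by positivity), Real.rpow_one]

theorem eq_radius_sq_iff (hp : 0 < p) {Q : (Fin (k + 1) → ℝ) → ℝ} {y : Fin (k + 1) → ℝ}
    (h : 0 ≤ Q y) {X : ℝ} (hX : 0 ≤ X) : X = radius p Q y ^ 2 ↔ X ^ p = Q y := by
  rw [← radius_pow hp h]
  exact (pow_left_inj₀ hX (sq_nonneg _) hp.ne').symm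

theorem contDiffOn_radius {Q : (Fin (k + 1) → ℝ) → ℝ} {Ω : Set (Fin (k + 1) → ℝ)}
    (hQ : ContDiffOn ℝ ∞ Q Ω) (h : ∀ y ∈ Ω, 0 < Q y) : ContDiffOn ℝ ∞ (radius p Q) Ω :=
  hQ.rpow_const_of_ne fun y hy => (h y hy).ne'

theorem contDiff_profileW : ContDiff ℝ ∞ (profileW p q : (Fin (k + 1) → ℝ) → ℝ) :=
  (contDiff_sqY.pow q).add (contDiff_sqY.pow p)

theorem contDiff_profileV : ContDiff ℝ ∞ (profileV q : (Fin (k + 1) → ℝ) → ℝ) :=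
  contDiff_sqY.pow q

theorem contDiff_profileInfty : ContDiff ℝ ∞ (profileInfty p q : (Fin (k + 1) → ℝ) → ℝ) := by
  have h : ContDiff ℝ ∞ (sqInit : (Fin (k + 1) → ℝ) → ℝ) :=
    contDiff_const.add (ContDiff.sum fun j _ => (contDiff_apply ℝ ℝ _).pow 2)
  exact ((h.pow q).mul ((contDiff_apply ℝ ℝ _).pow _)).add (h.pow p)

theorem profileW_pos {y : Fin (k + 1) → ℝ} (hy : y ∈ ({0}ᶜ : Set (Fin (k + 1) → ℝ))) :
    0 < profileW p q y :=
  add_pos (pow_pos (sqY_pos hy) _) (pow_pos (sqY_pos hy) _)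

theorem profileV_pos {y : Fin (k + 1) → ℝ} (hy : y ∈ ({0}ᶜ : Set (Fin (k + 1) → ℝ))) :
    0 < profileV q y := pow_pos (sqY_pos hy) _

theorem profileInfty_pos (y : Fin (k + 1) → ℝ) : 0 < profileInfty p q y := by
  have := sqInit_pos y
  have : 0 ≤ y (Fin.last k) ^ (2 * (p - q)) := by
    rw [pow_mul]
    positivity
  rw [profileInfty]
  positivity

/-! ### Submanifolds with graph charts -/

/-- Near each of its points, `S` has an equation `|x|^{2p} = Q(y)` in some affine coordinates. -/
def IsLocallyGraph (p : ℕ) (S : Set (RealProj (n + k + 1))) : Prop :=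
  ∀ x ∈ S, ∃ (l : Fin (n + k + 1 + 1)) (Q : (Fin (k + 1) → ℝ) → ℝ) (Ω : Set (Fin (k + 1) → ℝ))
    (U : Set (RealProj (n + k + 1))), IsOpen Ω ∧ IsOpen U ∧ ContDiffOn ℝ ∞ Q Ω ∧
    (∀ y ∈ Ω, 0 < Q y) ∧ x ∈ U ∧ x.rep l ≠ 0 ∧ projY (affineCoord l x) ∈ Ω ∧
    ∀ y ∈ U, y.rep l ≠ 0 → projY (affineCoord l y) ∈ Ω →
      (y ∈ S ↔ sqX (affineCoord l y) ^ p = Q (projY (affineCoord l y)))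

theorem exists_sign_of_sqX_pos {w : Fin (n + k + 1) → ℝ} (h : 0 < sqX w) :
    ∃ (i : Fin n) (s : ℝ), s ^ 2 = 1 ∧ 0 < s * w (ix i) := by
  obtain ⟨i, -, hi⟩ := Finset.exists_ne_zero_of_sum_ne_zero h.ne'
  have hi : w (ix i) ≠ 0 := fun h0 => hi (by simp [h0])
  rcases hi.lt_or_gt with h1 | h1
  · exact ⟨i, -1, by norm_num, by linarith⟩
  · exact ⟨i, 1, by norm_num, by linarith⟩

/-- Positivity of `Q` forces x ≠ 0, so some x_i has a definite sign and the graph chart belonging to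
i and that sign is available. Its last coordinate |x|² / R² - 1 is the slice equation. -/
theorem IsLocallyGraph.exists_slice (hp : 0 < p) {S : Set (RealProj (n + k + 1))}
    (hS : IsLocallyGraph p S) : ∀ x ∈ S,
    ∃ e ∈ IsManifold.maximalAtlas 𝓘(ℝ, Fin (n + k + 1) → ℝ) ∞ (RealProj (n + k + 1)),
      x ∈ e.source ∧ ∀ y ∈ e.source, y ∈ S ↔
        ∀ i : Fin (n + k + 1), n + k ≤ (i : ℕ) → e y i = 0 := by
  intro x hx
  obtain ⟨l, Q, Ω, U, hΩ, hU, hQ, hpos, hxU, hl, hxΩ, h⟩ := hS x hx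
  have hX : 0 < sqX (affineCoord l x) := by
    refine (sqX_nonneg _).lt_of_ne fun h0 => ?_
    have h1 := (h x hxU hl hxΩ).1 hx
    rw [← h0, zero_pow hp.ne'] at h1
    exact (hpos _ hxΩ).ne h1
  obtain ⟨i, s, hs, his⟩ := exists_sign_of_sqX_pos hX
  have hR := contDiffOn_radius (p := p) hQ hpos
  have hRpos : ∀ y ∈ Ω, 0 < radius p Q y := fun y hy => radius_pos (hpos y hy)
  refine ⟨(projChart i s (radius p Q) Ω l hs hΩ hR hRpos).restr U, ?_, ?_, ?_⟩
  · exact restr_mem_maximalAtlas _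
      (projChart_mem_maximalAtlas i s _ Ω l hs hΩ hR hRpos) hU
  · rw [OpenPartialHomeomorph.restr_source' _ _ hU]
    exact ⟨(mem_projChart_source i s _ Ω l hs hΩ hR hRpos x).2 ⟨hl, his, hxΩ⟩, hxU⟩
  · intro y hy
    rw [OpenPartialHomeomorph.restr_source' _ _ hU] at hy
    have h2 := (mem_projChart_source i s _ Ω l hs hΩ hR hRpos y).1 hy.1
    rw [OpenPartialHomeomorph.restr_apply, projChart_slice_iff i s _ Ω l hs hΩ hR hRpos hy.1,
      h y hy.2 h2.1 h2.2.2, eq_radius_sq_iff hp (hpos _ h2.2.2).le (sqX_nonneg _)]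

/-- The submanifold structure. -/
def IsLocallyGraph.toSubmanifold (hp : 0 < p) {S : Set (RealProj (n + k + 1))}
    (hS : IsLocallyGraph p S) :
    EmbeddedSubmanifold (RealProj (n + k + 1)) (N := n + k + 1) (n + k) where
  carrier := S
  dim_le := by omega
  exists_slice := hS.exists_slice hp

theorem hx_ne_last (i : Fin n) : hx (k := k) i ≠ Fin.last (n + k + 1) :=
  (Fin.castSucc_lt_last _).ne

theorem hy_ne_last (j : Fin (k + 1)) : hy (n := n) j ≠ Fin.last (n + k + 1) :=
  (Fin.castSucc_lt_last _).ne

theorem eq_pointP_iff {x : RealProj (n + k + 1)} : x = pointP n (k + 1) ↔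
    coneX x.rep = 0 ∧ coneY x.rep = 0 := by
  constructor
  · rintro rfl
    obtain ⟨a, -, h⟩ := rep_mk (Pi.single (Fin.last (n + k + 1)) (1 : ℝ)) (by simp)
    have h' : (pointP n (k + 1) : RealProj (n + k + 1)).rep =
      a • Pi.single (Fin.last (n + k + 1)) (1 : ℝ) := h
    rw [h']
    constructor
    · refine Finset.sum_eq_zero fun i _ => ?_
      rw [Pi.smul_apply, Pi.single_apply, if_neg (hx_ne_last i), smul_zero, zero_pow two_ne_zero]
    · refine Finset.sum_eq_zero fun i _ => ?_
      rw [Pi.smul_apply, Pi.single_apply, if_neg (hy_ne_last i), smul_zero, zero_pow two_ne_zero]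
  · rintro ⟨h1, h2⟩
    rw [coneX, Finset.sum_eq_zero_iff_of_nonneg fun _ _ => sq_nonneg _] at h1
    rw [coneY, Finset.sum_eq_zero_iff_of_nonneg fun _ _ => sq_nonneg _] at h2
    have h3 : ∀ b : Fin (n + k + 1), x.rep b.castSucc = 0 := by
      intro b
      by_cases hb : (b : ℕ) < n
      · exact pow_eq_zero_iff (two_ne_zero) |>.1 (h1 ⟨b, hb⟩ (Finset.mem_univ _))
      · have h4 := pow_eq_zero_iff (two_ne_zero) |>.1 (h2 ⟨b - n, by omega⟩ (Finset.mem_univ _))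
        have h5 : jy (n := n) (k := k) ⟨b - n, by omega⟩ = b :=
          Fin.ext (by simp only [jy]; omega)
        rwa [hy, h5] at h4
    conv_lhs => rw [← x.mk_rep]
    change Projectivization.mk ℝ _ _ = Projectivization.mk ℝ (Pi.single (Fin.last (n + k + 1)) 1) _
    rw [Projectivization.mk_eq_mk_iff']
    refine ⟨x.rep (Fin.last _), ?_⟩
    funext b
    refine Fin.lastCases ?_ (fun b => ?_) b
    · simp
    · rw [h3 b, Pi.smul_apply, Pi.single_eq_of_ne (Fin.castSucc_lt_last _).ne]
      simp

/-- On W, y = 0 forces x = 0, and only P is left. -/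
theorem eq_pointP_iff_of_mem_varietyW (hq : 0 < q) (hqp : q < p) {x : RealProj (n + k + 1)}
    (hW : x ∈ varietyW n (k + 1) p q) : x = pointP n (k + 1) ↔ coneY x.rep = 0 := by
  rw [eq_pointP_iff, and_iff_right_iff_imp]
  intro h
  rw [mem_varietyW, h, zero_pow hq.ne', zero_pow (hq.trans hqp).ne', zero_mul, zero_add] at hW
  exact eq_zero_of_pow_eq_zero hW

theorem exists_rep_hy_ne_zero {x : RealProj (n + k + 1)} (h : coneY x.rep ≠ 0) :
    ∃ j, x.rep (hy j) ≠ 0 := by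
  obtain ⟨j, -, hj⟩ := Finset.exists_ne_zero_of_sum_ne_zero h
  exact ⟨j, fun h0 => hj (by simp [h0])⟩

theorem coneY_rep_pos {x : RealProj (n + k + 1)} {j : Fin (k + 1)} (h : x.rep (hy j) ≠ 0) :
    0 < coneY x.rep := by
  rw [coneY_rep_hy h]
  have := sqInit_pos (projY (affineCoord (hy j) x))
  positivity

/-- Away from P some y_j is non-zero, and in the chart y_j = 1 the profile is a polynomial that is
positive on the whole affine space. Points with z = 0 need no separate treatment. -/
theorem isLocallyGraph_varietyW (hq : 0 < q) (hqp : q < p) {U : Set (RealProj (n + k + 1))}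
    (hU : IsOpen U) :
    IsLocallyGraph p ((varietyW n (k + 1) p q ∩ U) \ {pointP n (k + 1)} :
      Set (RealProj (n + k + 1))) := by
  rintro x ⟨⟨hxW, hxU⟩, hxP⟩
  have h0 : coneY x.rep ≠ 0 := fun h => hxP ((eq_pointP_iff_of_mem_varietyW hq hqp hxW).2 h)
  obtain ⟨j, hj⟩ := exists_rep_hy_ne_zero h0
  refine ⟨hy j, profileInfty p q, univ, U, isOpen_univ, hU, contDiff_profileInfty.contDiffOn,
    fun y _ => profileInfty_pos y, hxU, hj, mem_univ _, fun y hyU hyj _ => ?_⟩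
  rw [← mem_varietyW_hy hqp hyj]
  refine ⟨fun h => h.1.1, fun h => ⟨⟨h, hyU⟩, fun hP => (coneY_rep_pos hyj).ne' ?_⟩⟩
  exact (eq_pointP_iff_of_mem_varietyW hq hqp h).1 hP

theorem eq_pointP_iff_projY {x : RealProj (n + k + 1)}
    {Q : (Fin (k + 1) → ℝ) → ℝ} (hQ : Q 0 = 0) (hl : x.rep (Fin.last _) ≠ 0)
    (h : sqX (affineCoord (Fin.last _) x) ^ p = Q (projY (affineCoord (Fin.last _) x))) :
    x = pointP n (k + 1) ↔ projY (affineCoord (Fin.last _) x) = 0 := by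
  rw [eq_pointP_iff, coneX_rep_last hl, coneY_rep_last hl]
  constructor
  · rintro ⟨-, h2⟩
    exact sqY_eq_zero_iff.1 ((mul_eq_zero.1 h2).resolve_left (pow_ne_zero 2 hl))
  · intro h2
    rw [h2, hQ] at h
    rw [eq_zero_of_pow_eq_zero h, h2, mul_zero, sqY_eq_zero_iff.2 rfl, mul_zero]
    exact ⟨rfl, rfl⟩

theorem profileW_zero (hq : 0 < q) (hp : 0 < p) : profileW p q (0 : Fin (k + 1) → ℝ) = 0 := by
  rw [profileW, sqY_eq_zero_iff.2 rfl, zero_pow hq.ne', zero_pow hp.ne', add_zero]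

theorem profileV_zero (hq : 0 < q) : profileV q (0 : Fin (k + 1) → ℝ) = 0 := by
  rw [profileV, sqY_eq_zero_iff.2 rfl, zero_pow hq.ne']

theorem mem_varietyW_diff_last (hq : 0 < q) (hqp : q < p) {x : RealProj (n + k + 1)}
    (hl : x.rep (Fin.last _) ≠ 0) (h0 : projY (affineCoord (Fin.last _) x) ≠ 0) :
    x ∈ varietyW n (k + 1) p q \ {(pointP n (k + 1) : RealProj (n + k + 1))} ↔
      sqX (affineCoord (Fin.last _) x) ^ p = profileW p q (projY (affineCoord (Fin.last _) x)) := by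
  rw [← mem_varietyW_last hqp hl]
  refine ⟨fun h => h.1, fun h => ⟨h, fun hP => h0 ?_⟩⟩
  exact (eq_pointP_iff_projY (profileW_zero hq (hq.trans hqp)) hl
    ((mem_varietyW_last hqp hl).1 h)).1 hP

theorem mem_varietyV_diff_last (hq : 0 < q) (hqp : q < p) {x : RealProj (n + k + 1)}
    (hl : x.rep (Fin.last _) ≠ 0) (h0 : projY (affineCoord (Fin.last _) x) ≠ 0) :
    x ∈ varietyV n (k + 1) p q \ {(pointP n (k + 1) : RealProj (n + k + 1))} ↔
      sqX (affineCoord (Fin.last _) x) ^ p = profileV q (projY (affineCoord (Fin.last _) x)) := by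
  rw [← mem_varietyV_last hqp hl]
  refine ⟨fun h => h.1, fun h => ⟨h, fun hP => h0 ?_⟩⟩
  exact (eq_pointP_iff_projY (profileV_zero hq) hl
    ((mem_varietyV_last hqp hl).1 h)).1 hP

/-- Here only the chart z = 1 is available: the profile |y|^{2q} z^{2(p-q)} of V vanishes on z = 0,
where its root need not be smooth. -/
theorem isLocallyGraph_varietyV (hq : 0 < q) (hqp : q < p) {U : Set (RealProj (n + k + 1))}
    (hU : IsOpen U) (hUl : ∀ x ∈ U, x.rep (Fin.last _) ≠ 0) :
    IsLocallyGraph p ((varietyV n (k + 1) p q ∩ U) \ {pointP n (k + 1)} :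
      Set (RealProj (n + k + 1))) := by
  rintro x ⟨⟨hxV, hxU⟩, hxP⟩
  have hl := hUl x hxU
  refine ⟨Fin.last _, profileV q, {0}ᶜ, U, isOpen_compl_singleton, hU,
    contDiff_profileV.contDiffOn, fun y hy => profileV_pos hy, hxU, hl, fun h0 => hxP ?_,
    fun y hyU hyl hy0 => ?_⟩
  · exact (eq_pointP_iff_projY (profileV_zero hq) hl
      ((mem_varietyV_last hqp hl).1 hxV)).2 h0
  · rw [← mem_varietyV_diff_last hq hqp hyl hy0]
    exact ⟨fun h => ⟨h.1.1, h.2⟩, fun h => ⟨⟨h.1, hyU⟩, h.2⟩⟩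

theorem varietyW_diff_nonempty (hn : 0 < n) (hq : 0 < q) (hqp : q < p) :
    (varietyW n (k + 1) p q \ {(pointP n (k + 1) : RealProj (n + k + 1))}).Nonempty := by
  -- For z = 0 the equation of W reduces to |x| = |y|.
  set v : Fin (n + k + 1 + 1) → ℝ := Pi.single (hx ⟨0, hn⟩) 1 + Pi.single (hy 0) 1 with hv
  have hxy : ∀ (i : Fin n) (j : Fin (k + 1)), hx (k := k) i ≠ hy j := by
    intro i j h
    have h1 := congrArg Fin.val h
    simp only [hx, hy, ix, jy, Fin.val_castSucc] at h1
    omega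
  have h1 : ∀ i : Fin n, v (hx i) = if i = ⟨0, hn⟩ then 1 else 0 := by
    intro i
    have : hx (k := k) i = hx ⟨0, hn⟩ ↔ i = ⟨0, hn⟩ := by
      simp [hx, ix, Fin.ext_iff]
    rw [hv, Pi.add_apply, Pi.single_apply, Pi.single_apply, if_neg (hxy i 0), add_zero]
    simp only [this]
  have h2 : ∀ j : Fin (k + 1), v (hy j) = if j = 0 then 1 else 0 := by
    intro j
    have : hy (n := n) j = hy 0 ↔ j = 0 := by
      rw [Fin.ext_iff, Fin.ext_iff]
      simp only [hy, jy, Fin.val_castSucc, Fin.val_zero]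
      omega
    rw [hv, Pi.add_apply, Pi.single_apply, Pi.single_apply, if_neg (hxy _ j).symm, zero_add]
    simp only [this]
  have h3 : v (Fin.last _) = 0 := by
    rw [hv, Pi.add_apply, Pi.single_apply, Pi.single_apply, if_neg (hx_ne_last _).symm,
      if_neg (hy_ne_last _).symm, add_zero]
  have hv0 : v ≠ 0 := by
    intro h
    have := congrFun h (hy 0)
    rw [h2] at this
    simp at this
  obtain ⟨a, ha, h⟩ := rep_mk v hv0
  have hX : coneX (Projectivization.mk ℝ v hv0).rep = a ^ 2 := by
    rw [h, coneX]
    simp [h1]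
  have hY : coneY (Projectivization.mk ℝ v hv0).rep = a ^ 2 := by
    rw [h, coneY]
    simp [h2]
  have hp := hq.trans hqp
  have hW : Projectivization.mk ℝ v hv0 ∈ varietyW n (k + 1) p q := by
    rw [mem_varietyW, hX, hY, h, Pi.smul_apply, h3, smul_zero, zero_pow (by omega), mul_zero,
      zero_add]
  refine ⟨Projectivization.mk ℝ v hv0, hW, fun hP => ?_⟩
  have := (eq_pointP_iff_of_mem_varietyW hq hqp hW).1 hP
  rw [hY] at this
  exact pow_ne_zero 2 ha this

end GraphChart

end

/-! ### The Zariski tangent spaces of W. -/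

noncomputable section

/-! ### The derivative of a polynomial function -/

section Polynomial

variable {ι : Type} [Fintype ι]

/-- The derivative of a polynomial function. -/
def MvPolynomial.evalDeriv (G : MvPolynomial ι ℝ) (v : ι → ℝ) : (ι → ℝ) →L[ℝ] ℝ :=
  ∑ i, MvPolynomial.eval v (MvPolynomial.pderiv i G) • ContinuousLinearMap.proj i

theorem MvPolynomial.evalDeriv_apply (G : MvPolynomial ι ℝ) (v u : ι → ℝ) :
    G.evalDeriv v u = ∑ i, MvPolynomial.eval v (MvPolynomial.pderiv i G) * u i := by
  simp [MvPolynomial.evalDeriv]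

/-- Strict differentiability is needed at P, where values at two moving points are compared. -/
theorem MvPolynomial.hasStrictFDerivAt_eval (G : MvPolynomial ι ℝ) (v : ι → ℝ) :
    HasStrictFDerivAt (fun v => MvPolynomial.eval v G) (G.evalDeriv v) v := by
  classical
  induction G using MvPolynomial.induction_on with
  | C a =>
    have h : (MvPolynomial.C a : MvPolynomial ι ℝ).evalDeriv v = 0 := by
      ext u
      simp [MvPolynomial.evalDeriv_apply]
    rw [h]
    simpa using hasStrictFDerivAt_const a v
  | add G H hG hH =>
    have h : (G + H).evalDeriv v = G.evalDeriv v + H.evalDeriv v := by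
      ext u
      simp [MvPolynomial.evalDeriv_apply, add_mul, Finset.sum_add_distrib]
    rw [h]
    have h2 : HasStrictFDerivAt (fun v => MvPolynomial.eval v G + MvPolynomial.eval v H)
      (G.evalDeriv v + H.evalDeriv v) v := hG.add hH
    simpa only [map_add] using h2
  | mul_X G i hG =>
    have h1 := hG.mul (ContinuousLinearMap.proj (R := ℝ) (φ := fun _ : ι => ℝ) i).hasStrictFDerivAt
    have h : (G * MvPolynomial.X i).evalDeriv v =
        MvPolynomial.eval v G • ContinuousLinearMap.proj (R := ℝ) (φ := fun _ : ι => ℝ) i +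
          v i • G.evalDeriv v := by
      ext u
      simp only [MvPolynomial.evalDeriv_apply, Derivation.leibniz, MvPolynomial.pderiv_X,
        smul_eq_mul, map_add, map_mul, MvPolynomial.eval_X, add_mul, Finset.sum_add_distrib,
        add_apply, smul_apply, ContinuousLinearMap.proj_apply, Finset.mul_sum]
      congr 1
      · rw [Finset.sum_eq_single i]
        · simp
        · intro j _ hj
          simp [Pi.single_eq_of_ne hj.symm]
        · simp
      · exact Finset.sum_congr rfl fun j _ => by ring
    rw [h]
    have h2 : HasStrictFDerivAt (fun v => MvPolynomial.eval v G * v i)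
      (MvPolynomial.eval v G • ContinuousLinearMap.proj (R := ℝ) (φ := fun _ : ι => ℝ) i +
          v i • G.evalDeriv v) v := h1
    simpa only [map_mul, MvPolynomial.eval_X] using h2

/-- If a function with a strict derivative takes equal values at pairs of points in the
direction `c`, then its derivative in this direction vanishes. -/
theorem HasStrictFDerivAt.apply_eq_zero {E : Type} [NormedAddCommGroup E] [NormedSpace ℝ E]
    {f : E → ℝ} {L : E →L[ℝ] ℝ} {v : E} (h : HasStrictFDerivAt f L v) {α β : ℝ → E} {r : ℝ → ℝ}
    {c : E} (hα : Tendsto α (𝓝[>] 0) (𝓝 v)) (hβ : Tendsto β (𝓝[>] 0) (𝓝 v))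
    (hr : ∀ t, 0 < t → r t ≠ 0) (hd : ∀ t, 0 < t → α t - β t = r t • c)
    (hf : ∀ t, 0 < t → f (α t) = f (β t)) : L c = 0 := by
  have h1 := h.isLittleO.comp_tendsto (hα.prodMk_nhds hβ)
  by_contra hne
  have hc : 0 < ‖L c‖ := norm_pos_iff.2 hne
  have h2 := h1.def (c := ‖L c‖ / (2 * (‖c‖ + 1))) (by positivity)
  obtain ⟨t, ht, ht0⟩ := (h2.and self_mem_nhdsWithin).exists
  simp only [Function.comp_apply, hf t ht0, hd t ht0, sub_self, zero_sub, norm_neg, map_smul,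
    norm_smul] at ht
  have hrt : 0 < ‖r t‖ := norm_pos_iff.2 (hr t ht0)
  have h3 : ‖L c‖ ≤ ‖L c‖ / (2 * (‖c‖ + 1)) * ‖c‖ := by
    refine le_of_mul_le_mul_left ?_ hrt
    linarith
  have h4 : ‖L c‖ / (2 * (‖c‖ + 1)) * ‖c‖ ≤ ‖L c‖ / 2 := by
    rw [div_mul_eq_mul_div, div_le_div_iff₀ (by positivity) (by positivity)]
    nlinarith [norm_nonneg c]
  linarith

end Polynomial

namespace GraphChart

open RealProj

variable {n k p q : ℕ}

/-- The polynomial defining `W`. -/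
def polyW (n k p q : ℕ) : MvPolynomial (Fin (n + k + 1 + 1)) ℝ :=
  polyX n (k + 1) ^ p - (polyY n (k + 1) ^ q * polyZ n (k + 1) ^ (2 * (p - q)) +
    polyY n (k + 1) ^ p)

theorem eval_polyW (v : Fin (n + k + 1 + 1) → ℝ) : MvPolynomial.eval v (polyW n k p q) =
    coneX v ^ p - (coneY v ^ q * v (Fin.last _) ^ (2 * (p - q)) + coneY v ^ p) := by
  rw [polyW, map_sub, map_add, map_mul, map_pow, map_pow, map_pow, map_pow, eval_polyX, eval_polyY,
    eval_polyZ]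

theorem coneX_smul (a : ℝ) (v : Fin (n + k + 1 + 1) → ℝ) : coneX (a • v) = a ^ 2 * coneX v := by
  simp [coneX, Finset.mul_sum, mul_pow]

theorem coneY_smul (a : ℝ) (v : Fin (n + k + 1 + 1) → ℝ) : coneY (a • v) = a ^ 2 * coneY v := by
  simp [coneY, Finset.mul_sum, mul_pow]

theorem eval_polyW_smul (hqp : q < p) (a : ℝ) (v : Fin (n + k + 1 + 1) → ℝ) :
    MvPolynomial.eval (a • v) (polyW n k p q) =
      a ^ (2 * p) * MvPolynomial.eval v (polyW n k p q) := by
  obtain ⟨r, rfl⟩ := Nat.exists_eq_add_of_le hqp.le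
  rw [eval_polyW, eval_polyW, coneX_smul, coneY_smul, Pi.smul_apply, smul_eq_mul,
    add_tsub_cancel_left]
  ring

theorem eval_smul_of_isHomogeneous {ι : Type} {G : MvPolynomial ι ℝ} {d : ℕ}
    (hG : G.IsHomogeneous d) (a : ℝ) (v : ι → ℝ) :
    MvPolynomial.eval (a • v) G = a ^ d * MvPolynomial.eval v G := by
  rw [MvPolynomial.eval_eq, MvPolynomial.eval_eq, Finset.mul_sum]
  refine Finset.sum_congr rfl fun m hm => ?_
  have h1 : ∑ i ∈ m.support, m i = d := by
    have := hG (MvPolynomial.mem_support_iff.1 hm)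
    rw [← Finsupp.degree_apply, Finsupp.degree_eq_weight_one]
    exact this
  simp only [Pi.smul_apply, smul_eq_mul, mul_pow, Finset.prod_mul_distrib,
    Finset.prod_pow_eq_pow_sum, h1]
  ring

theorem mem_varietyW_iff_eval {x : RealProj (n + k + 1)} :
    x ∈ varietyW n (k + 1) p q ↔ MvPolynomial.eval x.rep (polyW n k p q) = 0 := Iff.rfl

theorem polyW_mem_vanishingForms (hqp : q < p) :
    polyW n k p q ∈ vanishingForms (N := n + k + 1) (varietyW n (k + 1) p q) := by
  refine ⟨⟨2 * p, ?_⟩, fun x hx => hx⟩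
  have hX : (polyX n (k + 1)).IsHomogeneous 2 :=
    MvPolynomial.IsHomogeneous.sum _ _ _ fun i _ => by
      simpa using (MvPolynomial.isHomogeneous_X ℝ (Fin.castSucc (Fin.castAdd (k + 1) i))).pow 2
  have hY : (polyY n (k + 1)).IsHomogeneous 2 :=
    MvPolynomial.IsHomogeneous.sum _ _ _ fun i _ => by
      simpa using (MvPolynomial.isHomogeneous_X ℝ (Fin.castSucc (Fin.natAdd n i))).pow 2
  have hZ : (polyZ n (k + 1)).IsHomogeneous 1 := MvPolynomial.isHomogeneous_X ℝ _
  refine (hX.pow p).sub (MvPolynomial.IsHomogeneous.add ?_ (hY.pow p))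
  have := (hY.pow q).mul (hZ.pow (2 * (p - q)))
  have h2 : 2 * q + 1 * (2 * (p - q)) = 2 * p := by omega
  rwa [h2] at this

/-- Forms vanishing on `W` vanish on the cone over `W`. -/
theorem eval_eq_zero_of_mem_vanishingForms (hqp : q < p) {G : MvPolynomial (Fin (n + k + 1 + 1)) ℝ}
    (hG : G ∈ vanishingForms (N := n + k + 1) (varietyW n (k + 1) p q))
    {v : Fin (n + k + 1 + 1) → ℝ} (hv : v ≠ 0)
    (h : MvPolynomial.eval v (polyW n k p q) = 0) : MvPolynomial.eval v G = 0 := by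
  obtain ⟨⟨d, hd⟩, hG⟩ := hG
  obtain ⟨a, ha, hrep⟩ := rep_mk v hv
  have h1 := hG (Projectivization.mk ℝ v hv) (by
    rw [mem_varietyW_iff_eval, hrep, eval_polyW_smul hqp, h, mul_zero])
  rw [hrep, eval_smul_of_isHomogeneous hd] at h1
  exact (mul_eq_zero.1 h1).resolve_left (pow_ne_zero _ ha)

theorem mem_zariskiTangentCone {V : Set (RealProj (n + k + 1))} {v u : Fin (n + k + 1 + 1) → ℝ} :
    u ∈ zariskiTangentCone V v ↔ ∀ G ∈ vanishingForms V, G.evalDeriv v u = 0 := by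
  simp only [MvPolynomial.evalDeriv_apply]
  rfl

theorem hx_injective : Function.Injective (hx (n := n) (k := k)) := by
  intro i j h
  have := congrArg Fin.val h
  exact Fin.ext (by simpa [hx, ix] using this)

theorem hy_injective : Function.Injective (hy (n := n) (k := k)) := by
  intro i j h
  have := congrArg Fin.val h
  exact Fin.ext (by simpa [hy, jy] using this)

theorem hx_ne_hy (i : Fin n) (j : Fin (k + 1)) : hx (k := k) i ≠ hy j := by
  intro h
  have h1 := congrArg Fin.val h
  simp only [hx, hy, ix, jy, Fin.val_castSucc] at h1
  omega

/-- The vector `b e_{x_i} + c e_{y_j} + a e_z`. -/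
def crossVec (i : Fin n) (j : Fin (k + 1)) (a b c : ℝ) : Fin (n + k + 1 + 1) → ℝ :=
  b • Pi.single (hx i) 1 + c • Pi.single (hy j) 1 + a • Pi.single (Fin.last _) 1

theorem crossVec_hx (i : Fin n) (j : Fin (k + 1)) (a b c : ℝ) (l : Fin n) :
    crossVec i j a b c (hx l) = if l = i then b else 0 := by
  simp [crossVec, Pi.single_apply, hx_injective.eq_iff, hx_ne_hy, hx_ne_last]

theorem crossVec_hy (i : Fin n) (j : Fin (k + 1)) (a b c : ℝ) (l : Fin (k + 1)) :
    crossVec i j a b c (hy l) = if l = j then c else 0 := by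
  simp [crossVec, Pi.single_apply, hy_injective.eq_iff, (hx_ne_hy _ _).symm, hy_ne_last]

theorem crossVec_last (i : Fin n) (j : Fin (k + 1)) (a b c : ℝ) :
    crossVec i j a b c (Fin.last _) = a := by
  simp [crossVec, (hx_ne_last _).symm, (hy_ne_last _).symm]

theorem coneX_crossVec (i : Fin n) (j : Fin (k + 1)) (a b c : ℝ) :
    coneX (crossVec i j a b c) = b ^ 2 := by
  simp [coneX, crossVec_hx]

theorem coneY_crossVec (i : Fin n) (j : Fin (k + 1)) (a b c : ℝ) :
    coneY (crossVec i j a b c) = c ^ 2 := by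
  simp [coneY, crossVec_hy]

theorem forall_coord {P : Fin (n + k + 1 + 1) → Prop} (h1 : ∀ i, P (hx i)) (h2 : ∀ j, P (hy j))
    (h3 : P (Fin.last _)) (b : Fin (n + k + 1 + 1)) : P b := by
  refine Fin.lastCases h3 (fun b => ?_) b
  by_cases hb : (b : ℕ) < n
  · exact h1 ⟨b, hb⟩
  · have h5 : jy (n := n) (k := k) ⟨b - n, by omega⟩ = b :=
      Fin.ext (by simp only [jy]; omega)
    have := h2 ⟨b - n, by omega⟩
    rwa [hy, h5] at this

theorem rep_pointP (n k : ℕ) (hn : 0 < n) : ∃ a : ℝ, a ≠ 0 ∧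
    (pointP n (k + 1) : RealProj (n + k + 1)).rep = crossVec ⟨0, hn⟩ 0 a 0 0 := by
  obtain ⟨a, ha, h⟩ := rep_mk (Pi.single (Fin.last (n + k + 1)) (1 : ℝ)) (by simp)
  refine ⟨a, ha, ?_⟩
  rw [crossVec, zero_smul, zero_smul, zero_add, zero_add]
  exact h

theorem continuous_crossVec (i : Fin n) (j : Fin (k + 1)) :
    Continuous fun x : ℝ × ℝ × ℝ => crossVec i j x.1 x.2.1 x.2.2 := by
  unfold crossVec
  fun_prop

theorem pointP_mem_varietyW (hq : 0 < q) (hqp : q < p) :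
    (pointP n (k + 1) : RealProj (n + k + 1)) ∈ varietyW n (k + 1) p q := by
  obtain ⟨h1, h2⟩ := eq_pointP_iff.1 (rfl : (pointP n (k + 1) : RealProj (n + k + 1)) = _)
  rw [mem_varietyW, h1, h2, zero_pow hq.ne', zero_pow (hq.trans hqp).ne', zero_mul, zero_add]

/-- The equation only involves squares, so the cone over W contains the points with x = ±r e_i, y =
±t e_j, z = a. The chord between two mirror images is parallel to a coordinate axis, and a form
vanishing on W is zero at both ends, so its strict derivative at P vanishes along this axis. For the
z-axis the line through P itself serves. -/
theorem zariskiTangentCone_pointP (hn : 0 < n) (hq : 0 < q) (hqp : q < p) :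
    zariskiTangentCone (N := n + k + 1) (varietyW n (k + 1) p q)
      (pointP n (k + 1) : RealProj (n + k + 1)).rep = ⊤ := by
  have hp := hq.trans hqp
  obtain ⟨a, ha, hrep⟩ := rep_pointP n k hn
  rw [hrep, eq_top_iff]
  rintro u -
  rw [mem_zariskiTangentCone]
  intro G hG
  -- All these vectors represent P, whichever axes are singled out.
  have hcross : ∀ (i : Fin n) (j : Fin (k + 1)), crossVec i j a 0 0 =
      crossVec (n := n) (k := k) ⟨0, hn⟩ 0 a 0 0 := fun i j => by simp [crossVec]
  set v0 : Fin (n + k + 1 + 1) → ℝ := crossVec ⟨0, hn⟩ 0 a 0 0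
  have hL := G.hasStrictFDerivAt_eval v0
  -- The value of |x| on the cone over W at |y| = t and z = a.
  set r : ℝ → ℝ := fun t => ((t ^ 2) ^ q * a ^ (2 * (p - q)) + (t ^ 2) ^ p) ^ (1 / (2 * p) : ℝ)
    with hr
  have hin : ∀ t : ℝ, 0 ≤ (t ^ 2) ^ q * a ^ (2 * (p - q)) + (t ^ 2) ^ p := fun t => by
    rw [pow_mul]
    positivity
  have hrpos : ∀ t, 0 < t → 0 < r t := fun t ht => by
    have : 0 ≤ (t ^ 2) ^ q * a ^ (2 * (p - q)) := by
      rw [pow_mul a]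
      positivity
    exact Real.rpow_pos_of_pos (by positivity) _
  have hrpow : ∀ t, ((r t) ^ 2) ^ p = (t ^ 2) ^ q * a ^ (2 * (p - q)) + (t ^ 2) ^ p := fun t => by
    rw [← pow_mul, hr, ← Real.rpow_natCast, ← Real.rpow_mul (hin t)]
    have : (p : ℝ) ≠ 0 := by positivity
    push_cast
    rw [one_div, inv_mul_cancel₀ (by positivity), Real.rpow_one]
  have hrt : Tendsto r (𝓝[>] 0) (𝓝 0) := by
    have h1 : Continuous r := by
      refine Continuous.rpow_const (by fun_prop) fun t => Or.inr (by positivity)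
    have h2 := h1.tendsto 0
    have h3 : r 0 = 0 := by
      simp only [hr]
      rw [zero_pow two_ne_zero, zero_pow hq.ne', zero_pow hp.ne', zero_mul, zero_add,
        Real.zero_rpow (by positivity)]
    rw [h3] at h2
    exact h2.mono_left nhdsWithin_le_nhds
  have htt : Tendsto (fun t : ℝ => t) (𝓝[>] 0) (𝓝 0) := tendsto_id.mono_left nhdsWithin_le_nhds
  have hzero : ∀ i j (b c : ℝ), (b ^ 2) ^ p = (c ^ 2) ^ q * a ^ (2 * (p - q)) + (c ^ 2) ^ p →
      MvPolynomial.eval (crossVec i j a b c) G = 0 := by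
    intro i j b c h
    refine eval_eq_zero_of_mem_vanishingForms hqp hG (fun h0 => ha ?_) ?_
    · rw [← crossVec_last i j a b c, h0, Pi.zero_apply]
    · rw [eval_polyW, coneX_crossVec, coneY_crossVec, crossVec_last, h, sub_self]
  have hlim : ∀ i j (b c : ℝ → ℝ), Tendsto b (𝓝[>] 0) (𝓝 0) → Tendsto c (𝓝[>] 0) (𝓝 0) →
      Tendsto (fun t => crossVec (n := n) (k := k) i j a (b t) (c t)) (𝓝[>] 0) (𝓝 v0) := by
    intro i j b c hb hc
    have := ((continuous_crossVec i j).tendsto (a, 0, 0)).comp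
      ((tendsto_const_nhds (x := a) (f := 𝓝[>] (0 : ℝ))).prodMk_nhds (hb.prodMk_nhds hc))
    rw [hcross i j] at this
    exact this
  have hL0 : ∀ b, G.evalDeriv v0 (Pi.single b 1) = 0 := by
    refine forall_coord (fun i => ?_) (fun j => ?_) ?_
    · refine hL.apply_eq_zero (r := fun t => 2 * r t) (hlim i 0 r (fun t => t) hrt htt)
        (hlim i 0 (fun t => - r t) (fun t => t) (by simpa using hrt.neg) htt)
        (fun t ht => by have := hrpos t ht; positivity) (fun t ht => ?_) (fun t ht => ?_)
      · simp only [crossVec]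
        module
      · rw [hzero _ _ _ _ (hrpow t), hzero _ _ _ _ (by rw [neg_sq]; exact hrpow t)]
    · refine hL.apply_eq_zero (r := fun t => 2 * t) (hlim ⟨0, hn⟩ j r (fun t => t) hrt htt)
        (hlim ⟨0, hn⟩ j r (fun t => -t) hrt (by simpa using htt.neg))
        (fun t ht => by positivity) (fun t ht => ?_) (fun t ht => ?_)
      · simp only [crossVec]
        module
      · rw [hzero _ _ _ _ (hrpow t), hzero _ _ _ _ (by rw [neg_sq t]; exact hrpow t)]
    -- The direction of the z-axis is radial at P, and forms vanish along the line spanned by a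
    -- point of W.
    · refine hL.apply_eq_zero (α := fun t => (1 + t) • v0) (β := fun _ => v0)
        (r := fun t => t * a) ?_ tendsto_const_nhds (fun t ht => mul_ne_zero (ne_of_gt ht) ha)
        (fun t ht => ?_) (fun t ht => ?_)
      · have : Tendsto (fun t : ℝ => (1 + t) • v0) (𝓝[>] 0) (𝓝 ((1 + 0 : ℝ) • v0)) :=
          (tendsto_const_nhds.add htt).smul_const _
        simpa using this
      · simp only [v0, crossVec]
        module
      · obtain ⟨d, hd⟩ := hG.1
        have h0 : MvPolynomial.eval v0 G = 0 := hzero ⟨0, hn⟩ 0 0 0 (by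
          rw [zero_pow two_ne_zero, zero_pow hq.ne', zero_pow hp.ne', zero_mul, zero_add])
        rw [eval_smul_of_isHomogeneous hd, h0, mul_zero]
  have hu : u = ∑ b, u b • Pi.single b (1 : ℝ) := by
    funext b
    simp [Finset.sum_apply, Pi.single_apply]
  rw [hu, map_sum]
  exact Finset.sum_eq_zero fun b _ => by rw [map_smul, hL0, smul_zero]

/-- The `x`-part of a vector of `ℝ^n × ℝ^(k+1) × ℝ`. -/
def partX (v : Fin (n + k + 1 + 1) → ℝ) : Fin (n + k + 1 + 1) → ℝ :=
  fun b => if (b : ℕ) < n then v b else 0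

theorem partX_hx (v : Fin (n + k + 1 + 1) → ℝ) (i : Fin n) : partX v (hx i) = v (hx i) :=
  if_pos i.2

theorem partX_hy (v : Fin (n + k + 1 + 1) → ℝ) (j : Fin (k + 1)) : partX v (hy j) = 0 :=
  if_neg (by simp [hy, jy])

theorem partX_last (v : Fin (n + k + 1 + 1) → ℝ) : partX v (Fin.last _) = 0 :=
  if_neg (by simp; omega)

theorem coneX_add_smul_partX (v : Fin (n + k + 1 + 1) → ℝ) (t : ℝ) :
    coneX (v + t • partX v) = (1 + t) ^ 2 * coneX v := by
  rw [coneX, coneX, Finset.mul_sum]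
  refine Finset.sum_congr rfl fun i _ => ?_
  rw [Pi.add_apply, Pi.smul_apply, partX_hx, smul_eq_mul]
  ring

theorem coneY_add_smul_partX (v : Fin (n + k + 1 + 1) → ℝ) (t : ℝ) :
    coneY (v + t • partX v) = coneY v := by
  refine Finset.sum_congr rfl fun i _ => ?_
  rw [Pi.add_apply, Pi.smul_apply, partX_hy, smul_zero, add_zero]

theorem eval_polyW_add_smul_partX (v : Fin (n + k + 1 + 1) → ℝ) (t : ℝ) :
    MvPolynomial.eval (v + t • partX v) (polyW n k p q) =
      MvPolynomial.eval v (polyW n k p q) + (((1 + t) ^ 2) ^ p - 1) * coneX v ^ p := by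
  rw [eval_polyW, eval_polyW, coneX_add_smul_partX, coneY_add_smul_partX, Pi.add_apply,
    Pi.smul_apply, partX_last, smul_zero, add_zero, mul_pow]
  ring

theorem hasDerivAt_eval_line {ι : Type} [Fintype ι] (G : MvPolynomial ι ℝ) (v u : ι → ℝ) :
    HasDerivAt (fun t : ℝ => MvPolynomial.eval (v + t • u) G) (G.evalDeriv v u) 0 := by
  have h1 : HasDerivAt (fun t : ℝ => v + t • u) u 0 := by
    simpa using ((hasDerivAt_id (0 : ℝ)).smul_const u).const_add v
  have h2 := (G.hasStrictFDerivAt_eval v).hasFDerivAt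
  have h3 : HasFDerivAt (fun v => MvPolynomial.eval v G) (G.evalDeriv v) (v + (0 : ℝ) • u) := by
    simpa using h2
  exact h3.comp_hasDerivAt (0 : ℝ) h1

/-- Euler's relation in the variables x alone. It shows that the derivative of the defining
polynomial is non-zero wherever x ≠ 0. -/
theorem evalDeriv_polyW_partX (v : Fin (n + k + 1 + 1) → ℝ) :
    (polyW n k p q).evalDeriv v (partX v) = 2 * p * coneX v ^ p := by
  refine (hasDerivAt_eval_line (polyW n k p q) v (partX v)).unique ?_
  simp only [eval_polyW_add_smul_partX]
  have h1 : HasDerivAt (fun t : ℝ => (1 + t) ^ (2 * p)) ((2 * p : ℕ) * (1 + 0) ^ (2 * p - 1) * 1)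
      0 := ((hasDerivAt_id (0 : ℝ)).const_add 1).pow (2 * p)
  have h2 := ((h1.sub_const 1).mul_const (coneX v ^ p)).const_add
    (MvPolynomial.eval v (polyW n k p q))
  simp only [← pow_mul]
  convert h2 using 1
  simp

/-- For the inclusion that is not formal, a vector u of the kernel is realised as the velocity of a
curve in the cone over W: the line v + t u, with its x-part rescaled by a factor λ(t). As the
defining polynomial vanishes to first order along the line, λ'(0) = 0 and the velocity is still u.
Every form vanishing on W is constant along this curve. -/
theorem zariskiTangentCone_eq_ker (hqp : q < p) {v : Fin (n + k + 1 + 1) → ℝ}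
    (hX : 0 < coneX v) (hF : MvPolynomial.eval v (polyW n k p q) = 0) :
    zariskiTangentCone (N := n + k + 1) (varietyW n (k + 1) p q) v =
      LinearMap.ker ((polyW n k p q).evalDeriv v : (Fin (n + k + 1 + 1) → ℝ) →ₗ[ℝ] ℝ) := by
  ext u
  rw [mem_zariskiTangentCone, LinearMap.mem_ker]
  constructor
  · intro h
    exact h _ (polyW_mem_vanishingForms hqp)
  intro hu G hG
  have hp : (p : ℝ) ≠ 0 := by
    have : 0 < p := by omega
    positivity
  have hXd : ContinuousAt (fun t : ℝ => coneX (v + t • u)) 0 := by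
    unfold coneX
    simp only [Pi.add_apply, Pi.smul_apply]
    fun_prop
  have hXdiff : DifferentiableAt ℝ (fun t : ℝ => coneX (v + t • u) ^ p) 0 := by
    unfold coneX
    simp only [Pi.add_apply, Pi.smul_apply]
    fun_prop
  have hX0 : coneX (v + (0 : ℝ) • u) = coneX v := by simp
  have hFd := hasDerivAt_eval_line (polyW n k p q) v u
  have hu' : (polyW n k p q).evalDeriv v u = 0 := hu
  rw [hu'] at hFd
  have hquot := hFd.div hXdiff.hasDerivAt (by rw [hX0]; positivity)
  have hF0 : MvPolynomial.eval (v + (0 : ℝ) • u) (polyW n k p q) = 0 := by simpa using hF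
  simp only [hF0, zero_mul, sub_zero, zero_div] at hquot
  -- Scaling the x-part by λ adds (λ^{2p} - 1) |x|^{2p} to the polynomial, so the corrected point
  -- lies on the cone exactly when λ^{2p} = a(t).
  set a : ℝ → ℝ := fun t =>
    1 - MvPolynomial.eval (v + t • u) (polyW n k p q) / coneX (v + t • u) ^ p with ha
  have ha0 : a 0 = 1 := by
    simp only [ha]
    rw [hF0]
    simp
  have had : HasDerivAt a 0 0 := by simpa using hquot.const_sub 1
  set lam : ℝ → ℝ := fun t => a t ^ (1 / (2 * p) : ℝ) with hlam
  have hlam0 : lam 0 = 1 := by simp [hlam, ha0]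
  have hlamd : HasDerivAt lam 0 0 := by
    have := had.rpow_const (p := (1 / (2 * p) : ℝ)) (Or.inl (by rw [ha0]; exact one_ne_zero))
    rwa [zero_mul, zero_mul] at this
  set γ : ℝ → Fin (n + k + 1 + 1) → ℝ := fun t =>
    (v + t • u) + (lam t - 1) • partX (v + t • u) with hγ
  have hγ0 : γ 0 = v := by simp [hγ, hlam0]
  have hγd : HasDerivAt γ u 0 := by
    rw [hasDerivAt_pi]
    intro b
    have h1 : HasDerivAt (fun t : ℝ => v b + t * u b) (u b) 0 := by
      simpa using ((hasDerivAt_id (0 : ℝ)).mul_const (u b)).const_add (v b)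
    simp only [hγ, Pi.add_apply, Pi.smul_apply, partX, smul_eq_mul]
    by_cases hb : (b : ℕ) < n
    · simp only [if_pos hb]
      have h2 : HasDerivAt (fun t => v b + t * u b + (lam t - 1) * (v b + t * u b)) _ 0 :=
        h1.add ((hlamd.sub_const 1).mul h1)
      simpa [hlam0] using h2
    · simpa only [if_neg hb, mul_zero, add_zero] using h1
  have hev1 : ∀ᶠ t in 𝓝 (0 : ℝ), 0 < coneX (v + t • u) := by
    have : ∀ᶠ y in 𝓝 (coneX (v + (0 : ℝ) • u)), 0 < y := by
      rw [hX0]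
      exact lt_mem_nhds hX
    exact hXd.eventually this
  have hev2 : ∀ᶠ t in 𝓝 (0 : ℝ), 0 < a t := by
    have : ∀ᶠ y in 𝓝 (a 0), 0 < y := by
      rw [ha0]
      exact lt_mem_nhds one_pos
    exact had.continuousAt.eventually this
  have hev : (fun t => MvPolynomial.eval (γ t) G) =ᶠ[𝓝 0] fun _ => 0 := by
    filter_upwards [hev1, hev2] with t h1 h2
    have hpow : (lam t ^ 2) ^ p = a t := by
      rw [← pow_mul, hlam, ← Real.rpow_natCast, ← Real.rpow_mul h2.le]
      push_cast
      rw [one_div, inv_mul_cancel₀ (by positivity), Real.rpow_one]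
    refine eval_eq_zero_of_mem_vanishingForms hqp hG ?_ ?_
    · intro h0
      have h3 : coneX (γ t) = (1 + (lam t - 1)) ^ 2 * coneX (v + t • u) :=
        coneX_add_smul_partX _ _
      rw [h0, add_sub_cancel] at h3
      have h4 : coneX (0 : Fin (n + k + 1 + 1) → ℝ) = 0 := by simp [coneX]
      have h5 : lam t ≠ 0 := (Real.rpow_pos_of_pos h2 _).ne'
      have : 0 < lam t ^ 2 * coneX (v + t • u) := by positivity
      rw [h4] at h3
      linarith
    · rw [hγ, eval_polyW_add_smul_partX, add_sub_cancel, hpow]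
      simp only [ha]
      field_simp
      ring
  have h1 := (hγd.continuousAt.tendsto)
  have h2 : HasFDerivAt (fun v => MvPolynomial.eval v G) (G.evalDeriv v) (γ 0) := by
    rw [hγ0]
    exact (G.hasStrictFDerivAt_eval v).hasFDerivAt
  have h3 := h2.comp_hasDerivAt (0 : ℝ) hγd
  exact h3.unique ((hasDerivAt_const (0 : ℝ) (0 : ℝ)).congr_of_eventuallyEq hev)

/-- The singular locus of `W` is `{P}`. -/
theorem singularLocus_varietyW (hn : 0 < n) (hq : 0 < q) (hqp : q < p) :
    singularLocus (N := n + k + 1) (n + k) (varietyW n (k + 1) p q) = {pointP n (k + 1)} := by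
  ext x
  rw [mem_singleton_iff]
  constructor
  · rintro ⟨hW, hfin⟩
    by_contra hP
    have hY : coneY x.rep ≠ 0 := fun h => hP ((eq_pointP_iff_of_mem_varietyW hq hqp hW).2 h)
    have hY0 : 0 < coneY x.rep :=
      (Finset.sum_nonneg fun _ _ => sq_nonneg _).lt_of_ne hY.symm
    have hp : 0 < p := hq.trans hqp
    have hX : 0 < coneX x.rep := by
      refine (Finset.sum_nonneg fun _ _ => sq_nonneg _ : 0 ≤ coneX x.rep).lt_of_ne fun h => ?_
      have h1 := mem_varietyW.1 hW
      change 0 = coneX x.rep at h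
      rw [← h, zero_pow hp.ne', pow_mul] at h1
      have : 0 < coneY x.rep ^ q * (x.rep (Fin.last _) ^ 2) ^ (p - q) + coneY x.rep ^ p := by
        positivity
      exact this.ne h1
    refine hfin ?_
    rw [zariskiTangentCone_eq_ker hqp hX hW]
    have hne : ((polyW n k p q).evalDeriv x.rep : (Fin (n + k + 1 + 1) → ℝ) →ₗ[ℝ] ℝ) ≠ 0 := by
      intro h
      have h1 := evalDeriv_polyW_partX (p := p) (q := q) x.rep
      have h2 : (polyW n k p q).evalDeriv x.rep (partX x.rep) = 0 := LinearMap.congr_fun h _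
      rw [h2] at h1
      have : (0 : ℝ) < 2 * p * coneX x.rep ^ p := by positivity
      linarith
    have := Module.Dual.finrank_ker_add_one_of_ne_zero hne
    rw [finrank_fin_fun] at this
    omega
  · rintro rfl
    refine ⟨pointP_mem_varietyW hq hqp, ?_⟩
    rw [zariskiTangentCone_pointP hn hq hqp, finrank_top, finrank_fin_fun]
    omega

end GraphChart

end

/-! ### Comparison of W and V near P. -/

noncomputable section

/-! ### Quasi-isometries given by diffeomorphisms of affine space -/

namespace RealProj

variable {N : ℕ}

theorem affineCoord_ofAffine (l : Fin (N + 1)) (w : Fin N → ℝ) :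
    affineCoord l (ofAffine l w) = w := (affineChart l).right_inv (mem_univ w)

theorem rep_ofAffine_ne_zero (l : Fin (N + 1)) (w : Fin N → ℝ) : (ofAffine l w).rep l ≠ 0 :=
  (affineChart l).map_target (mem_univ w)

theorem ofAffine_affineCoord {l : Fin (N + 1)} {x : RealProj N} (hx : x.rep l ≠ 0) :
    ofAffine l (affineCoord l x) = x := (affineChart l).left_inv hx

end RealProj

open RealProj

section

variable {N d : ℕ} {S T : EmbeddedSubmanifold (RealProj N) (N := N) d} {l : Fin (N + 1)}
  {F G : (Fin N → ℝ) → Fin N → ℝ}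

theorem contMDiff_affine_map (hS : ∀ x : S.carrier, (x : RealProj N).rep l ≠ 0)
    (hF : ContDiff ℝ ∞ F) (hFT : ∀ x : S.carrier, ofAffine l (F (S.affineMap l x)) ∈ T.carrier) :
    ContMDiff 𝓘(ℝ, Fin d → ℝ) 𝓘(ℝ, Fin d → ℝ) ∞
      (fun x : S.carrier => (⟨_, hFT x⟩ : T.carrier)) := by
  refine EmbeddedSubmanifold.contMDiff_of_val ?_
  have h1 : ContMDiff 𝓘(ℝ, Fin d → ℝ) 𝓘(ℝ, Fin N → ℝ) ∞ (S.affineMap l) :=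
    contMDiffOn_univ.1 ((S.contMDiffOn_affineMap l).mono fun x _ => hS x)
  exact (contMDiff_affineChart_symm l).comp (hF.contMDiff.comp h1)

/-- The derivative of a map between manifolds. -/
def mapDeriv {M M' : Type} [TopologicalSpace M] [ChartedSpace (Fin d → ℝ) M] [TopologicalSpace M']
    [ChartedSpace (Fin d → ℝ) M'] (f : M → M') (x : M) : (Fin d → ℝ) →L[ℝ] (Fin d → ℝ) :=
  mfderiv 𝓘(ℝ, Fin d → ℝ) 𝓘(ℝ, Fin d → ℝ) f x

/-- The restriction of a diffeomorphism of an affine chart. -/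
def affineDiffeomorph (hS : ∀ x : S.carrier, (x : RealProj N).rep l ≠ 0)
    (hT : ∀ x : T.carrier, (x : RealProj N).rep l ≠ 0)
    (hF : ContDiff ℝ ∞ F) (hG : ContDiff ℝ ∞ G) (hGF : ∀ w, G (F w) = w) (hFG : ∀ w, F (G w) = w)
    (hFT : ∀ x : S.carrier, ofAffine l (F (S.affineMap l x)) ∈ T.carrier)
    (hGS : ∀ x : T.carrier, ofAffine l (G (T.affineMap l x)) ∈ S.carrier) :
    Diffeomorph 𝓘(ℝ, Fin d → ℝ) 𝓘(ℝ, Fin d → ℝ) S.carrier T.carrier ∞ where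
  toFun x := ⟨_, hFT x⟩
  invFun x := ⟨_, hGS x⟩
  left_inv x := Subtype.ext <| by
    change ofAffine l (G (affineCoord l (ofAffine l (F (affineCoord l (x : RealProj N)))))) = x
    rw [affineCoord_ofAffine, hGF, ofAffine_affineCoord (hS x)]
  right_inv x := Subtype.ext <| by
    change ofAffine l (F (affineCoord l (ofAffine l (G (affineCoord l (x : RealProj N)))))) = x
    rw [affineCoord_ofAffine, hFG, ofAffine_affineCoord (hT x)]
  contMDiff_toFun := contMDiff_affine_map hS hF hFT
  contMDiff_invFun := contMDiff_affine_map hT hG hGS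

theorem exists_norm_fderiv_le {E F : Type} [NormedAddCommGroup E] [NormedSpace ℝ E]
    [NormedAddCommGroup F] [NormedSpace ℝ F] {f : E → F} (hf : ContDiff ℝ ∞ f) {K : Set E}
    (hK : IsCompact K) : ∃ C : ℝ, 0 < C ∧ ∀ w ∈ K, ∀ v, ‖fderiv ℝ f w v‖ ≤ C * ‖v‖ := by
  obtain ⟨C, hC⟩ := hK.exists_bound_of_continuousOn (hf.continuous_fderiv (by simp)).continuousOn
  refine ⟨max C 1, by positivity, fun w hw v => ?_⟩
  exact ((fderiv ℝ f w).le_opNorm v).trans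
    (mul_le_mul_of_nonneg_right ((hC w hw).trans (le_max_left _ _)) (norm_nonneg _))

/-- Over a compact set the metric is comparable with a norm, and both `F` and its inverse have
bounded derivatives. The constant comes from the ambient space only, so the behaviour of the
submanifolds near a singular point is irrelevant. -/
theorem isQuasiIsometry_affineDiffeomorph (g : RealProjMetric N)
    (hS : ∀ x : S.carrier, (x : RealProj N).rep l ≠ 0)
    (hT : ∀ x : T.carrier, (x : RealProj N).rep l ≠ 0)
    (hF : ContDiff ℝ ∞ F) (hG : ContDiff ℝ ∞ G) (hGF : ∀ w, G (F w) = w) (hFG : ∀ w, F (G w) = w)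
    (hFT : ∀ x : S.carrier, ofAffine l (F (S.affineMap l x)) ∈ T.carrier)
    (hGS : ∀ x : T.carrier, ofAffine l (G (T.affineMap l x)) ∈ S.carrier)
    {K : Set (Fin N → ℝ)} (hK : IsCompact K) (hSK : ∀ x : S.carrier, S.affineMap l x ∈ K) :
    IsQuasiIsometry (g.induced S) (g.induced T)
      (affineDiffeomorph hS hT hF hG hGF hFG hFT hGS) := by
  set Φ := affineDiffeomorph hS hT hF hG hGF hFG hFT hGS with hΦ
  have hK' : IsCompact (F '' K) := hK.image hF.continuous
  obtain ⟨C₁, hC₁, hg₁⟩ := g.exists_affine_bounds l hK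
  obtain ⟨C₂, hC₂, hg₂⟩ := g.exists_affine_bounds l hK'
  obtain ⟨L₁, hL₁, hd₁⟩ := exists_norm_fderiv_le hF hK
  obtain ⟨L₂, hL₂, hd₂⟩ := exists_norm_fderiv_le hG hK'
  set C := max (C₂ * L₁ ^ 2 * C₁) (C₁ * L₂ ^ 2 * C₂) with hC
  have hCpos : 0 < C := lt_max_of_lt_left (by positivity)
  have key : ∀ (x : S.carrier) (v : Fin d → ℝ),
      g.inducedCLM S x v v ≤ C * g.inducedCLM T (Φ x) (mapDeriv (d := d) Φ x v) (mapDeriv (d := d) Φ x v) ∧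
      g.inducedCLM T (Φ x) (mapDeriv (d := d) Φ x v) (mapDeriv (d := d) Φ x v) ≤ C * g.inducedCLM S x v v := by
    intro x v
    set D := mapDeriv (d := d) Φ x with hD
    have hcomp : T.affineMap l ∘ Φ = F ∘ S.affineMap l := by
      funext y
      exact affineCoord_ofAffine l _
    have hdT := mdifferentiableAt_of_contMDiffOn (T.isOpen_affine l)
      (T.contMDiffOn_affineMap l) (hT (Φ x))
    have hdS := mdifferentiableAt_of_contMDiffOn (S.isOpen_affine l)
      (S.contMDiffOn_affineMap l) (hS x)
    have hdΦ : MDifferentiableAt 𝓘(ℝ, Fin d → ℝ) 𝓘(ℝ, Fin d → ℝ) Φ x :=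
      Φ.contMDiff.contMDiffAt.mdifferentiableAt (by simp)
    have hFd : ∀ w, HasFDerivAt F (fderiv ℝ F w) w := fun w =>
      (hF.differentiable (by simp) w).hasFDerivAt
    have hGd : ∀ w, HasFDerivAt G (fderiv ℝ G w) w := fun w =>
      (hG.differentiable (by simp) w).hasFDerivAt
    have h1 : (manifoldDeriv (T.affineMap l) (Φ x)).comp D =
        (fderiv ℝ F (S.affineMap l x)).comp (manifoldDeriv (S.affineMap l) x) := by
      have h2 : manifoldDeriv (T.affineMap l ∘ Φ) x = (manifoldDeriv (T.affineMap l) (Φ x)).comp D :=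
        mfderiv_comp x hdT hdΦ
      have h3 : manifoldDeriv (F ∘ S.affineMap l) x =
          (mfderiv 𝓘(ℝ, Fin N → ℝ) 𝓘(ℝ, Fin N → ℝ) F (S.affineMap l x) :
            (Fin N → ℝ) →L[ℝ] (Fin N → ℝ)).comp (manifoldDeriv (S.affineMap l) x) :=
        mfderiv_comp x (hFd _).differentiableAt.mdifferentiableAt hdS
      rw [mfderiv_eq_fderiv] at h3
      rw [← h2, hcomp]
      exact h3
    set w := S.affineMap l x
    have hwF : T.affineMap l (Φ x) = F w := congrFun hcomp x
    set v' := manifoldDeriv (S.affineMap l) x v with hv'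
    have h4 : manifoldDeriv (T.affineMap l) (Φ x) (D v) = fderiv ℝ F w v' :=
      DFunLike.congr_fun h1 v
    have h5 : fderiv ℝ G (F w) (fderiv ℝ F w v') = v' := by
      have h6 : HasFDerivAt (G ∘ F) ((fderiv ℝ G (F w)).comp (fderiv ℝ F w)) w :=
        (hGd (F w)).comp w (hFd w)
      have h7 : G ∘ F = id := funext hGF
      rw [h7] at h6
      exact DFunLike.congr_fun (h6.unique (hasFDerivAt_id w)) v'
    rw [g.inducedCLM_apply S l (hS x), g.inducedCLM_apply T l (hT (Φ x)), h4, hwF]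
    have hwK : w ∈ K := hSK x
    have hw' : F w ∈ F '' K := mem_image_of_mem F hwK
    have b1 := hd₁ w hwK v'
    have b2 := hd₂ (F w) hw' (fderiv ℝ F w v')
    rw [h5] at b2
    obtain ⟨a1, a2⟩ := hg₁ w hwK v'
    obtain ⟨a3, a4⟩ := hg₂ (F w) hw' (fderiv ℝ F w v')
    set α := ‖v'‖
    set β := ‖fderiv ℝ F w v'‖
    set q₁ := g.affine l w v' v'
    set q₂ := g.affine l (F w) (fderiv ℝ F w v') (fderiv ℝ F w v')
    rw [inv_mul_le_iff₀ hC₁] at a1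
    rw [inv_mul_le_iff₀ hC₂] at a3
    have hα : 0 ≤ α := norm_nonneg _
    have hβ : 0 ≤ β := norm_nonneg _
    have c1 : β ^ 2 ≤ L₁ ^ 2 * α ^ 2 := by
      rw [← mul_pow]
      exact pow_le_pow_left₀ hβ b1 2
    have c2 : α ^ 2 ≤ L₂ ^ 2 * β ^ 2 := by
      rw [← mul_pow]
      exact pow_le_pow_left₀ hα b2 2
    have hq₁ : 0 ≤ q₁ := by
      by_contra h
      nlinarith [sq_nonneg α]
    have hq₂ : 0 ≤ q₂ := by
      by_contra h
      nlinarith [sq_nonneg β]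
    constructor
    · calc q₁ ≤ C₁ * (L₂ ^ 2 * (C₂ * q₂)) := a2.trans (by gcongr; exact c2.trans (by gcongr))
        _ = (C₁ * L₂ ^ 2 * C₂) * q₂ := by ring
        _ ≤ C * q₂ := mul_le_mul_of_nonneg_right (le_max_right _ _) hq₂
    · calc q₂ ≤ C₂ * (L₁ ^ 2 * (C₁ * q₁)) := a4.trans (by gcongr; exact c1.trans (by gcongr))
        _ = (C₂ * L₁ ^ 2 * C₁) * q₁ := by ring
        _ ≤ C * q₁ := mul_le_mul_of_nonneg_right (le_max_left _ _) hq₁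
  refine ⟨C, hCpos, fun x v => ⟨?_, (key x v).2⟩⟩
  rw [inv_mul_le_iff₀ hCpos]
  exact (key x v).1

end

namespace GraphChart

variable {n k p q : ℕ}

/-- The map `(x, y) ↦ ((1 + |y|^{2r})^a x, y)`. -/
def scaleMap (r : ℕ) (a : ℝ) (w : Fin (n + k + 1) → ℝ) : Fin (n + k + 1) → ℝ := fun b =>
  if (b : ℕ) < n then (1 + sqY (projY w) ^ r) ^ a * w b else w b

theorem one_add_sqY_pos (r : ℕ) (y : Fin (k + 1) → ℝ) : 0 < 1 + sqY y ^ r := by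
  have := sqY_nonneg y
  positivity

theorem projY_scaleMap (r : ℕ) (a : ℝ) (w : Fin (n + k + 1) → ℝ) :
    projY (scaleMap r a w) = projY w := by
  funext j
  rw [projY_apply, projY_apply, scaleMap, if_neg (by simp [jy])]

theorem scaleMap_scaleMap (r : ℕ) {a b : ℝ} (h : a + b = 0) (w : Fin (n + k + 1) → ℝ) :
    scaleMap r a (scaleMap r b w) = w := by
  funext c
  rw [scaleMap, projY_scaleMap, scaleMap]
  split_ifs
  · rw [← mul_assoc, ← Real.rpow_add (one_add_sqY_pos r _), h, Real.rpow_zero, one_mul]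
  · rfl

theorem contDiff_scaleMap (r : ℕ) (a : ℝ) :
    ContDiff ℝ ∞ (scaleMap r a : (Fin (n + k + 1) → ℝ) → _) := by
  refine contDiff_pi.2 fun b => ?_
  unfold scaleMap
  by_cases hb : (b : ℕ) < n
  · simp only [if_pos hb]
    refine ContDiff.mul ?_ (contDiff_apply ℝ ℝ b)
    exact (contDiff_const.add ((contDiff_sqY.comp projY.contDiff).pow r)).rpow_const_of_ne
      fun w => (one_add_sqY_pos r _).ne'
  · simp only [if_neg hb]
    exact contDiff_apply ℝ ℝ b

theorem sqX_scaleMap (r : ℕ) (a : ℝ) (w : Fin (n + k + 1) → ℝ) :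
    sqX (scaleMap r a w) = ((1 + sqY (projY w) ^ r) ^ a) ^ 2 * sqX w := by
  rw [sqX, sqX, Finset.mul_sum]
  refine Finset.sum_congr rfl fun i _ => ?_
  rw [scaleMap, if_pos (show ((ix i : Fin (n + k + 1)) : ℕ) < n from i.2), mul_pow]

theorem scaleMap_zero (r : ℕ) (a : ℝ) : scaleMap r a (0 : Fin (n + k + 1) → ℝ) = 0 := by
  funext b
  simp [scaleMap]

/-- The neighborhood `{z ≠ 0, |y|² < |z|²}` of `P`. -/
def conicNhd (n k : ℕ) : Set (RealProj (n + k + 1)) :=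
  {x | x.rep (Fin.last _) ≠ 0 ∧ sqY (projY (affineCoord (Fin.last _) x)) < 1}

theorem isOpen_conicNhd : IsOpen (conicNhd n k) := by
  have h := (affineChart (Fin.last (n + k + 1))).isOpen_inter_preimage
    (isOpen_lt (contDiff_sqY.continuous.comp (projY (n := n) (k := k)).continuous)
      (continuous_const (y := (1 : ℝ))))
  exact h

theorem rep_last_pointP_ne_zero :
    (pointP n (k + 1) : RealProj (n + k + 1)).rep (Fin.last (n + k + 1)) ≠ 0 :=
  (rep_mk_ne_zero_iff (Pi.single (Fin.last (n + k + 1)) (1 : ℝ)) (by simp)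
    (Fin.last (n + k + 1))).2 (by simp)

theorem affineCoord_pointP :
    affineCoord (Fin.last (n + k + 1)) (pointP n (k + 1) : RealProj (n + k + 1)) = 0 := by
  refine (affineCoord_mk (Fin.last _) (Pi.single (Fin.last (n + k + 1)) (1 : ℝ)) (by simp)).trans ?_
  funext j
  simp [(Fin.castSucc_lt_last j).ne]

theorem pointP_mem_conicNhd : (pointP n (k + 1) : RealProj (n + k + 1)) ∈ conicNhd n k := by
  refine ⟨rep_last_pointP_ne_zero, ?_⟩
  rw [affineCoord_pointP, map_zero, sqY_eq_zero_iff.2 rfl]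
  exact one_pos

theorem abs_le_of_sq_add_le (w : Fin (n + k + 1) → ℝ) (hX : sqX w ≤ 4) (hY : sqY (projY w) ≤ 4) :
    w ∈ Metric.closedBall (0 : Fin (n + k + 1) → ℝ) 2 := by
  rw [mem_closedBall_zero_iff, pi_norm_le_iff_of_nonneg (by norm_num)]
  intro b
  have h : w b ^ 2 ≤ 2 ^ 2 := by
    by_cases hb : (b : ℕ) < n
    · refine le_trans ?_ (hX.trans (by norm_num))
      exact Finset.single_le_sum (f := fun i : Fin n => w (ix i) ^ 2) (fun _ _ => sq_nonneg _)
        (Finset.mem_univ (⟨b, hb⟩ : Fin n))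
    · refine le_trans ?_ (hY.trans (by norm_num))
      have h5 : jy (n := n) (k := k) ⟨b - n, by omega⟩ = b :=
        Fin.ext (by simp only [jy]; omega)
      have := Finset.single_le_sum (f := fun j : Fin (k + 1) => projY w j ^ 2)
        (fun _ _ => sq_nonneg _) (Finset.mem_univ (⟨b - n, by omega⟩ : Fin (k + 1)))
      simp only [projY_apply, h5] at this
      exact this
  rw [Real.norm_eq_abs]
  exact abs_le_of_sq_le_sq h (by norm_num)

theorem rpow_pow_eq (hp : 0 < p) {c : ℝ} (hc : 0 < c) : ((c ^ (1 / (2 * p) : ℝ)) ^ 2) ^ p = c := by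
  have : (p : ℝ) ≠ 0 := by positivity
  rw [← pow_mul, ← Real.rpow_natCast, ← Real.rpow_mul hc.le]
  push_cast
  rw [one_div, inv_mul_cancel₀ (by positivity), Real.rpow_one]

theorem rpow_neg_pow_eq (hp : 0 < p) {c : ℝ} (hc : 0 < c) :
    ((c ^ (-(1 / (2 * p) : ℝ))) ^ 2) ^ p = c⁻¹ := by
  rw [Real.rpow_neg hc.le, inv_pow, inv_pow, rpow_pow_eq hp hc]

/-- Pointed neighborhoods of `P` in `W` and `V` are quasi-isometric. -/
theorem haveQuasiIsometricPointedNhds (hq : 0 < q) (hqp : q < p) (g : RealProjMetric (n + k + 1)) :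
    HaveQuasiIsometricPointedNhds (N := n + k + 1) (n + k) g (varietyW n (k + 1) p q)
      (varietyV n (k + 1) p q) (pointP n (k + 1)) := by
  have hp : 0 < p := hq.trans hqp
  set A := (isLocallyGraph_varietyW (n := n) (k := k) hq hqp isOpen_conicNhd).toSubmanifold hp
    with hA
  set B := (isLocallyGraph_varietyV (n := n) (k := k) hq hqp isOpen_conicNhd
    fun x hx => hx.1).toSubmanifold hp with hB
  set r := p - q with hr
  set a : ℝ := 1 / (2 * p) with ha
  -- The first factor is smooth and positive; dividing x by its 2p-th root therefore carries the
  -- equation of W into that of V.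
  have hprof : ∀ y : Fin (k + 1) → ℝ, profileW p q y = (1 + sqY y ^ r) * profileV q y := by
    intro y
    rw [profileW, profileV, add_mul, one_mul, ← pow_add, hr, Nat.sub_add_cancel hqp.le]
  have hSl : ∀ x : A.carrier, (x : RealProj (n + k + 1)).rep (Fin.last _) ≠ 0 := fun x => x.2.1.2.1
  have hTl : ∀ x : B.carrier, (x : RealProj (n + k + 1)).rep (Fin.last _) ≠ 0 := fun x => x.2.1.2.1
  have hmapsW : ∀ x : A.carrier,
      ofAffine (Fin.last _) (scaleMap r (-a) (A.affineMap (Fin.last _) x)) ∈ B.carrier := by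
    rintro ⟨x, ⟨hxW, hxl, hxU⟩, hxP⟩
    have h1 := (mem_varietyW_last hqp hxl).1 hxW
    have h0 : projY (affineCoord (Fin.last _) x) ≠ 0 := fun h => hxP <|
      (eq_pointP_iff_projY (profileW_zero hq hp) hxl h1).2 h
    have hm : ofAffine (Fin.last _) (scaleMap r (-a) (affineCoord (Fin.last _) x)) ∈
        varietyV n (k + 1) p q \ {(pointP n (k + 1) : RealProj (n + k + 1))} := by
      rw [mem_varietyV_diff_last hq hqp (rep_ofAffine_ne_zero _ _) (by
        rwa [affineCoord_ofAffine, projY_scaleMap]), affineCoord_ofAffine, projY_scaleMap,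
        sqX_scaleMap, mul_pow, h1, hprof, rpow_neg_pow_eq hp (one_add_sqY_pos r _),
        inv_mul_cancel_left₀ (one_add_sqY_pos r _).ne']
    refine ⟨⟨hm.1, rep_ofAffine_ne_zero _ _, ?_⟩, hm.2⟩
    change sqY (projY (affineCoord (Fin.last _) (ofAffine (Fin.last _) (scaleMap r (-a)
      (affineCoord (Fin.last _) x))))) < 1
    rw [affineCoord_ofAffine, projY_scaleMap]
    exact hxU
  have hmapsV : ∀ x : B.carrier,
      ofAffine (Fin.last _) (scaleMap r a (B.affineMap (Fin.last _) x)) ∈ A.carrier := by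
    rintro ⟨x, ⟨hxV, hxl, hxU⟩, hxP⟩
    have h1 := (mem_varietyV_last hqp hxl).1 hxV
    have h0 : projY (affineCoord (Fin.last _) x) ≠ 0 := fun h => hxP <|
      (eq_pointP_iff_projY (profileV_zero hq) hxl h1).2 h
    have hm : ofAffine (Fin.last _) (scaleMap r a (affineCoord (Fin.last _) x)) ∈
        varietyW n (k + 1) p q \ {(pointP n (k + 1) : RealProj (n + k + 1))} := by
      rw [mem_varietyW_diff_last hq hqp (rep_ofAffine_ne_zero _ _) (by
        rwa [affineCoord_ofAffine, projY_scaleMap]), affineCoord_ofAffine, projY_scaleMap,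
        sqX_scaleMap, mul_pow, h1, hprof, rpow_pow_eq hp (one_add_sqY_pos r _)]
    refine ⟨⟨hm.1, rep_ofAffine_ne_zero _ _, ?_⟩, hm.2⟩
    change sqY (projY (affineCoord (Fin.last _) (ofAffine (Fin.last _) (scaleMap r a
      (affineCoord (Fin.last _) x))))) < 1
    rw [affineCoord_ofAffine, projY_scaleMap]
    exact hxU
  -- In this neighborhood |y| < 1, so |x|^{2p} is at most 2, hence at most 4^p.
  have hK : ∀ x : A.carrier, A.affineMap (Fin.last _) x ∈
      Metric.closedBall (0 : Fin (n + k + 1) → ℝ) 2 := by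
    rintro ⟨x, ⟨hxW, hxl, hxU⟩, hxP⟩
    have h1 := (mem_varietyW_last hqp hxl).1 hxW
    change affineCoord (Fin.last _) x ∈ _
    have hs := sqY_nonneg (projY (affineCoord (Fin.last _) x))
    refine abs_le_of_sq_add_le _ ?_ (hxU.le.trans (by norm_num))
    have h2 : sqX (affineCoord (Fin.last _) x) ^ p ≤ 4 ^ p := by
      rw [h1, profileW]
      have h3 := pow_le_one₀ (n := q) hs hxU.le
      have h4 := pow_le_one₀ (n := p) hs hxU.le
      have h5 : (4 : ℝ) ^ 1 ≤ 4 ^ p := pow_le_pow_right₀ (by norm_num) hp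
      linarith
    exact le_of_pow_le_pow_left₀ hp.ne' (by norm_num) h2
  -- The scaling maps are continuous on the affine space and fix the origin, which is P; this gives
  -- the extension to a homeomorphism.
  have hcont : ∀ b : ℝ, Tendsto
      (fun x : RealProj (n + k + 1) => ofAffine (Fin.last _) (scaleMap r b (affineCoord (Fin.last _) x)))
      (𝓝 (pointP n (k + 1))) (𝓝 (pointP n (k + 1))) := by
    intro b
    have h1 : ContinuousAt (affineCoord (Fin.last (n + k + 1)))
        (pointP n (k + 1) : RealProj (n + k + 1)) :=
      (affineChart (Fin.last (n + k + 1))).continuousAt rep_last_pointP_ne_zero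
    have h2 : Continuous (ofAffine (Fin.last (n + k + 1))) :=
      (contMDiff_affineChart_symm (Fin.last (n + k + 1))).continuous
    have h3 := ((h2.comp (contDiff_scaleMap (n := n) (k := k) r b).continuous).continuousAt.comp h1)
    have h4 := h3.tendsto
    simp only [Function.comp_apply, affineCoord_pointP, scaleMap_zero] at h4
    have h5 : ofAffine (Fin.last (n + k + 1)) 0 = (pointP n (k + 1) : RealProj (n + k + 1)) := by
      have := ofAffine_affineCoord (rep_last_pointP_ne_zero (n := n) (k := k))
      rwa [affineCoord_pointP] at this
    rw [h5] at h4
    exact h4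
  exact ⟨conicNhd n k, conicNhd n k, A, B,
    affineDiffeomorph hSl hTl (contDiff_scaleMap r (-a)) (contDiff_scaleMap r a)
      (scaleMap_scaleMap r (by ring)) (scaleMap_scaleMap r (by ring)) hmapsW hmapsV,
    isOpen_conicNhd, pointP_mem_conicNhd, isOpen_conicNhd, pointP_mem_conicNhd, rfl, rfl,
    isQuasiIsometry_affineDiffeomorph g _ _ _ _ _ _ _ _ (isCompact_closedBall _ _) hK,
    (hcont (-a)).comp tendsto_comap, (hcont a).comp tendsto_comap⟩

end GraphChart

end

/-! ### The regular part of W in graph coordinates. -/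

noncomputable section

namespace GraphChart

open RealProj

variable {n k p q : ℕ}

theorem isLocallyGraph_regularPart (hq : 0 < q) (hqp : q < p) :
    IsLocallyGraph p (varietyW n (k + 1) p q \ {pointP n (k + 1)} :
      Set (RealProj (n + k + 1))) := by
  have h := isLocallyGraph_varietyW (n := n) (k := k) hq hqp isOpen_univ
  rwa [inter_univ] at h

/-- The regular part `W \ {P}` of `W`. -/
def regularPart (hq : 0 < q) (hqp : q < p) :
    EmbeddedSubmanifold (RealProj (n + k + 1)) (N := n + k + 1) (n + k) :=
  (isLocallyGraph_regularPart hq hqp).toSubmanifold (hq.trans hqp)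

/-- The radius function of `W`. -/
abbrev radiusW (p q : ℕ) : (Fin (k + 1) → ℝ) → ℝ := radius p (profileW p q)

theorem contDiffOn_radiusW : ContDiffOn ℝ ∞ (radiusW (k := k) p q) {0}ᶜ :=
  contDiffOn_radius contDiff_profileW.contDiffOn fun _ hy => profileW_pos hy

theorem radiusW_pos (y : Fin (k + 1) → ℝ) (hy : y ∈ ({0}ᶜ : Set (Fin (k + 1) → ℝ))) :
    0 < radiusW p q y := radius_pos (profileW_pos hy)

section Chart

variable (hq : 0 < q) (hqp : q < p) (i : Fin n) {s : ℝ} (hs : s ^ 2 = 1)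

/-- The graph coordinates of `W` in the affine chart `z = 1`. -/
def ambientChart (p q : ℕ) (i : Fin n) {s : ℝ} (hs : s ^ 2 = 1) :
    OpenPartialHomeomorph (RealProj (n + k + 1)) (Fin (n + k + 1) → ℝ) :=
  projChart i s (radiusW p q) {0}ᶜ (Fin.last _) hs isOpen_compl_singleton contDiffOn_radiusW
    radiusW_pos

theorem isSlice_ambientChart :
    (regularPart (n := n) (k := k) hq hqp).IsSlice (ambientChart p q i hs) := by
  refine ⟨projChart_mem_maximalAtlas _ _ _ _ _ _ _ _ _, fun y hy => ?_⟩
  have h2 := (mem_projChart_source i s (radiusW p q) {0}ᶜ (Fin.last _) hs isOpen_compl_singleton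
    contDiffOn_radiusW radiusW_pos y).1 hy
  rw [ambientChart, projChart_slice_iff i s _ _ _ hs isOpen_compl_singleton contDiffOn_radiusW
    radiusW_pos hy, eq_radius_sq_iff (hq.trans hqp) (profileW_pos h2.2.2).le (sqX_nonneg _)]
  exact mem_varietyW_diff_last hq hqp h2.1 h2.2.2

/-- The coordinates `x_l / x_i`, `l ≠ i`, and `y` of `W`, in the region `s x_i > 0`. -/
def coords (x₀ : (regularPart (n := n) (k := k) hq hqp).carrier) :
    OpenPartialHomeomorph (regularPart (n := n) (k := k) hq hqp).carrier (Fin (n + k) → ℝ) :=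
  EmbeddedSubmanifold.sliceChart x₀ (ambientChart p q i hs) (isSlice_ambientChart hq hqp i hs)

variable (x₀ : (regularPart (n := n) (k := k) hq hqp).carrier)

theorem coords_mem_atlas : coords hq hqp i hs x₀ ∈
    atlas (Fin (n + k) → ℝ) (regularPart (n := n) (k := k) hq hqp).carrier :=
  EmbeddedSubmanifold.sliceChart_mem_atlas _ _ _

theorem pad_castSucc (u : Fin (n + k) → ℝ) :
    (fun j : Fin (n + k) => EmbeddedSubmanifold.pad (n + k + 1) u j.castSucc) = u := by
  funext j
  simp [EmbeddedSubmanifold.pad]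

theorem pad_last (u : Fin (n + k) → ℝ) :
    EmbeddedSubmanifold.pad (n + k + 1) u (Fin.last _) = 0 := by
  simp [EmbeddedSubmanifold.pad]

theorem mem_coords_target {u : Fin (n + k) → ℝ} :
    u ∈ (coords hq hqp i hs x₀).target ↔ coordY i u ≠ 0 := by
  change EmbeddedSubmanifold.pad (n + k + 1) u ∈ (projChart i s (radiusW p q) {0}ᶜ (Fin.last _)
    hs isOpen_compl_singleton contDiffOn_radiusW radiusW_pos).target ↔ _
  rw [mem_projChart_target, pad_castSucc, pad_last]
  exact ⟨fun h => h.1, fun h => ⟨h, by norm_num⟩⟩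

/-- The points of `W \ {P}` with `z ≠ 0`. -/
def finitePart : Set (regularPart (n := n) (k := k) hq hqp).carrier :=
  {x | (x : RealProj (n + k + 1)).rep (Fin.last _) ≠ 0}

/-- The `y`-coordinates, on the part of `W \ {P}` where `z ≠ 0`. -/
def mapY (x : (regularPart (n := n) (k := k) hq hqp).carrier) : Fin (k + 1) → ℝ :=
  projY ((regularPart (n := n) (k := k) hq hqp).affineMap (Fin.last _) x)

theorem isOpen_finitePart : IsOpen (finitePart (n := n) (k := k) hq hqp) :=
  EmbeddedSubmanifold.isOpen_affine _ _

theorem contMDiffOn_mapY : ContMDiffOn 𝓘(ℝ, Fin (n + k) → ℝ) 𝓘(ℝ, Fin (k + 1) → ℝ) ∞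
    (mapY (n := n) (k := k) hq hqp) (finitePart hq hqp) :=
  projY.contDiff.contMDiff.comp_contMDiffOn (EmbeddedSubmanifold.contMDiffOn_affineMap _ _)

theorem sqX_affineMap {x : (regularPart (n := n) (k := k) hq hqp).carrier}
    (hx : x ∈ finitePart hq hqp) :
    sqX ((regularPart (n := n) (k := k) hq hqp).affineMap (Fin.last _) x) ^ p =
      profileW p q (mapY hq hqp x) :=
  (mem_varietyW_last hqp hx).1 x.2.1

theorem mapY_ne_zero {x : (regularPart (n := n) (k := k) hq hqp).carrier}
    (hx : x ∈ finitePart hq hqp) : mapY hq hqp x ≠ 0 := fun h => x.2.2 <|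
  (eq_pointP_iff_projY (profileW_zero hq (hq.trans hqp)) hx (sqX_affineMap hq hqp hx)).2 h

/-- A default value: at z = 0 the affine coordinates are quotients by zero. The true y tends to
infinity there, so `mapY` is not continuous at these points, and forms pulled back by it have to
vanish for large |y|. -/
theorem mapY_eq_zero {x : (regularPart (n := n) (k := k) hq hqp).carrier}
    (hx : x ∉ finitePart hq hqp) : mapY hq hqp x = 0 := by
  have h : (x : RealProj (n + k + 1)).rep (Fin.last _) = 0 := not_not.1 hx
  funext j
  change affineCoord (Fin.last _) (x : RealProj (n + k + 1)) (jy j) = 0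
  rw [affineCoord, h, div_zero]

theorem mem_coords_source {x : (regularPart (n := n) (k := k) hq hqp).carrier} :
    x ∈ (coords hq hqp i hs x₀).source ↔ x ∈ finitePart hq hqp ∧
      0 < s * (regularPart (n := n) (k := k) hq hqp).affineMap (Fin.last _) x (ix i) := by
  change (x : RealProj (n + k + 1)) ∈ (projChart i s (radiusW p q) {0}ᶜ (Fin.last _)
    hs isOpen_compl_singleton contDiffOn_radiusW radiusW_pos).source ↔ _
  rw [mem_projChart_source]
  exact ⟨fun h => ⟨h.1, h.2.1⟩, fun h => ⟨h.1, h.2, mapY_ne_zero hq hqp h.1⟩⟩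

theorem coords_apply (x : (regularPart (n := n) (k := k) hq hqp).carrier) :
    coords hq hqp i hs x₀ x =
      angular i ((regularPart (n := n) (k := k) hq hqp).affineMap (Fin.last _) x) := by
  funext j
  change toGraph i (radiusW p q) ((regularPart (n := n) (k := k) hq hqp).affineMap (Fin.last _) x)
    j.castSucc = _
  rw [toGraph, Fin.snoc_castSucc]

theorem affineMap_coords_symm {u : Fin (n + k) → ℝ} (hu : coordY i u ≠ 0) :
    (regularPart (n := n) (k := k) hq hqp).affineMap (Fin.last _)
      ((coords hq hqp i hs x₀).symm u) = param i s (radiusW p q) u 0 := by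
  have hu' := (mem_coords_target hq hqp i hs x₀).2 hu
  have h1 : (((coords hq hqp i hs x₀).symm u :
      (regularPart (n := n) (k := k) hq hqp).carrier) : RealProj (n + k + 1)) =
      (ambientChart p q i hs).symm (EmbeddedSubmanifold.pad (n + k + 1) u) :=
    EmbeddedSubmanifold.coe_sliceChart_symm x₀ _ (isSlice_ambientChart hq hqp i hs) u hu'
  have h2 : (ambientChart p q i hs).symm (EmbeddedSubmanifold.pad (n + k + 1) u) =
      ofAffine (Fin.last _) (param i s (radiusW p q) u 0) := by
    change ofAffine (Fin.last _) (param i s (radiusW p q)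
      (fun j => EmbeddedSubmanifold.pad (n + k + 1) u j.castSucc)
      (EmbeddedSubmanifold.pad (n + k + 1) u (Fin.last _))) = _
    rw [pad_castSucc, pad_last]
  rw [EmbeddedSubmanifold.affineMap, h1, h2]
  exact affineCoord_ofAffine _ _

theorem coords_symm_mem_finitePart {u : Fin (n + k) → ℝ} (hu : coordY i u ≠ 0) :
    (coords hq hqp i hs x₀).symm u ∈ finitePart hq hqp :=
  ((mem_coords_source hq hqp i hs x₀).1 ((coords hq hqp i hs x₀).map_target
    ((mem_coords_target hq hqp i hs x₀).2 hu))).1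

theorem mapY_coords_symm {u : Fin (n + k) → ℝ} (hu : coordY i u ≠ 0) :
    mapY hq hqp ((coords hq hqp i hs x₀).symm u) = coordY i u := by
  rw [mapY, affineMap_coords_symm hq hqp i hs x₀ hu, projY_param]

/-! ### Compact subsets -/

/-- The function `z² / |y|²`. -/
def invSqY (x : (regularPart (n := n) (k := k) hq hqp).carrier) : ℝ :=
  (x : RealProj (n + k + 1)).rep (Fin.last _) ^ 2 / coneY (x : RealProj (n + k + 1)).rep

theorem coneY_ne_zero (x : (regularPart (n := n) (k := k) hq hqp).carrier) :
    coneY (x : RealProj (n + k + 1)).rep ≠ 0 := fun h =>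
  x.2.2 ((eq_pointP_iff_of_mem_varietyW hq hqp x.2.1).2 h)

/-- On W \ {P} the vector y does not vanish, so z² / |y|² is globally defined and continuous. It
replaces 1 / |y|² and takes the value 0 at z = 0. Its boundedness on compact sets keeps them away
from P. -/
theorem continuous_invSqY : Continuous (invSqY (n := n) (k := k) hq hqp) := by
  refine continuous_iff_continuousAt.2 fun x => ?_
  obtain ⟨j, hj⟩ := exists_rep_hy_ne_zero (coneY_ne_zero hq hqp x)
  have h1 : ContinuousAt (fun x : (regularPart (n := n) (k := k) hq hqp).carrier =>
      affineCoord (hy j) (x : RealProj (n + k + 1))) x :=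
    ContinuousAt.comp (f := Subtype.val) ((affineChart (hy j)).continuousAt hj)
      continuous_subtype_val.continuousAt
  have h2 : Continuous fun w : Fin (n + k + 1) → ℝ =>
      w (jy (Fin.last k)) ^ 2 / sqInit (projY w) := by
    refine Continuous.div (by fun_prop) ?_ fun w => (sqInit_pos _).ne'
    unfold sqInit
    fun_prop
  refine (h2.continuousAt.comp h1).congr ?_
  filter_upwards [((RealProj.isOpen_affine (hy j)).preimage continuous_subtype_val).mem_nhds hj]
    with x' (hx' : (x' : RealProj (n + k + 1)).rep (hy j) ≠ 0)
  rw [invSqY, coneY_rep_hy hx', ← hy_succAbove_last j, rep_succAbove hx', Function.comp_apply,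
    mul_pow, mul_div_mul_left _ _ (pow_ne_zero 2 hx')]

theorem invSqY_eq {x : (regularPart (n := n) (k := k) hq hqp).carrier}
    (hx : x ∈ finitePart hq hqp) : invSqY hq hqp x = (sqY (mapY hq hqp x))⁻¹ := by
  have hx' : (x : RealProj (n + k + 1)).rep (Fin.last _) ≠ 0 := hx
  rw [invSqY, coneY_rep_last hx', ← div_div, div_self (pow_ne_zero 2 hx'), one_div]
  rfl

theorem invSqY_eq_zero {x : (regularPart (n := n) (k := k) hq hqp).carrier}
    (hx : x ∉ finitePart hq hqp) : invSqY hq hqp x = 0 := by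
  have h : (x : RealProj (n + k + 1)).rep (Fin.last _) = 0 := not_not.1 hx
  rw [invSqY, h, zero_pow two_ne_zero, zero_div]

/-- Near the points with `z = 0`, the coordinate `y` is large. -/
theorem eventually_one_lt_sqY {x : (regularPart (n := n) (k := k) hq hqp).carrier}
    (hx : x ∉ finitePart hq hqp) :
    ∀ᶠ y in 𝓝 x, y ∈ finitePart hq hqp → 1 < sqY (mapY hq hqp y) := by
  have h := (continuous_invSqY hq hqp).continuousAt (x := x)
  have h1 : ∀ᶠ y in 𝓝 x, invSqY hq hqp y < 1 := by
    refine h.eventually (gt_mem_nhds ?_)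
    rw [invSqY_eq_zero hq hqp hx]
    exact one_pos
  filter_upwards [h1] with y hy hyf
  rw [invSqY_eq hq hqp hyf] at hy
  exact (inv_lt_one₀ (sqY_pos (mapY_ne_zero hq hqp hyf))).1 hy

/-- On compact subsets of `W \ {P}`, the coordinate `y` is bounded away from zero. -/
theorem exists_le_sqY {K : Set (regularPart (n := n) (k := k) hq hqp).carrier} (hK : IsCompact K) :
    ∃ δ > 0, ∀ x ∈ K, ∀ᶠ y in 𝓝 x, y ∈ finitePart hq hqp → δ < sqY (mapY hq hqp y) := by
  obtain ⟨C, hC⟩ := hK.exists_bound_of_continuousOn (continuous_invSqY hq hqp).continuousOn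
  have hC' : 0 < max C 0 + 1 := by positivity
  refine ⟨(max C 0 + 1)⁻¹, by positivity, fun x hx => ?_⟩
  have h1 : invSqY hq hqp x < max C 0 + 1 := by
    have := (le_abs_self _).trans (hC x hx)
    have := le_max_left C 0
    linarith
  filter_upwards [(continuous_invSqY hq hqp).continuousAt.eventually (gt_mem_nhds h1)] with y hy hyf
  rw [invSqY_eq hq hqp hyf] at hy
  exact inv_lt_of_inv_lt₀ (sqY_pos (mapY_ne_zero hq hqp hyf)) hy

/-- The points with `δ ≤ |y|² ≤ 1` form a compact set. -/
theorem isCompact_annulus {δ : ℝ} (hδ : 0 < δ) : IsCompact {x | x ∈ finitePart hq hqp ∧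
    δ ≤ sqY (mapY (n := n) (k := k) hq hqp x) ∧ sqY (mapY hq hqp x) ≤ 1} := by
  have hp := hq.trans hqp
  rw [Subtype.isCompact_iff]
  have hK : IsCompact {w : Fin (n + k + 1) → ℝ | sqX w ^ p = profileW p q (projY w) ∧
      δ ≤ sqY (projY w) ∧ sqY (projY w) ≤ 1} := by
    refine (isCompact_closedBall (0 : Fin (n + k + 1) → ℝ) 2).of_isClosed_subset ?_ ?_
    · have h1 : Continuous (sqX : (Fin (n + k + 1) → ℝ) → ℝ) := contDiffOn_sqX.continuous
      have h2 : Continuous fun w : Fin (n + k + 1) → ℝ => sqY (projY w) :=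
        contDiff_sqY.continuous.comp projY.continuous
      have h3 : Continuous fun w : Fin (n + k + 1) → ℝ => profileW p q (projY w) :=
        contDiff_profileW.continuous.comp projY.continuous
      exact (isClosed_eq (h1.pow p) h3).inter ((isClosed_le continuous_const h2).inter
        (isClosed_le h2 continuous_const))
    · rintro w ⟨h1, -, h3⟩
      have hs := sqY_nonneg (projY w)
      refine abs_le_of_sq_add_le _ ?_ (h3.trans (by norm_num))
      have h2 : sqX w ^ p ≤ 4 ^ p := by
        rw [h1, profileW]
        have h3 := pow_le_one₀ (n := q) hs h3
        have h4 := pow_le_one₀ (n := p) hs ‹_›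
        have h5 : (4 : ℝ) ^ 1 ≤ 4 ^ p := pow_le_pow_right₀ (by norm_num) hp
        linarith
      exact le_of_pow_le_pow_left₀ hp.ne' (by norm_num) h2
  convert hK.image (contMDiff_affineChart_symm (Fin.last (n + k + 1))).continuous using 1
  ext x
  constructor
  · rintro ⟨y, ⟨h1, h2, h3⟩, rfl⟩
    exact ⟨_, ⟨sqX_affineMap hq hqp h1, h2, h3⟩, ofAffine_affineCoord h1⟩
  · rintro ⟨w, ⟨h1, h2, h3⟩, rfl⟩
    have h4 : affineCoord (Fin.last _) ((affineChart (Fin.last (n + k + 1))).symm w) = w :=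
      affineCoord_ofAffine _ _
    have h5 : ((affineChart (Fin.last (n + k + 1))).symm w).rep (Fin.last _) ≠ 0 :=
      rep_ofAffine_ne_zero _ _
    have h0 : projY w ≠ 0 := fun h => by
      rw [h, sqY_eq_zero_iff.2 rfl] at h2
      linarith
    have h6 : (affineChart (Fin.last (n + k + 1))).symm w ∈
        (regularPart (n := n) (k := k) hq hqp).carrier := by
      refine (mem_varietyW_diff_last hq hqp h5 ?_).2 ?_
      · rwa [h4]
      · rwa [h4]
    refine ⟨⟨_, h6⟩, ⟨h5, ?_, ?_⟩, rfl⟩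
    · change δ ≤ sqY (projY (affineCoord (Fin.last _) _))
      rwa [h4]
    · change sqY (projY (affineCoord (Fin.last _) _)) ≤ 1
      rwa [h4]

end Chart

end GraphChart

end

/-! ### Asymptotics of the induced metric at the singular point. -/

noncomputable section

namespace GraphChart

variable {n k p q : ℕ}

/-! ### The radius function near the singular point -/

theorem hasFDerivAt_sqY (y : Fin (k + 1) → ℝ) :
    HasFDerivAt sqY (∑ j, (2 * y j) • ContinuousLinearMap.proj (R := ℝ)
      (φ := fun _ : Fin (k + 1) => ℝ) j) y := by
  refine HasFDerivAt.fun_sum fun j _ => ?_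
  have h := (ContinuousLinearMap.proj (R := ℝ) (φ := fun _ : Fin (k + 1) => ℝ) j).hasFDerivAt
    (x := y) |>.pow 2
  simpa using h

/-- `|∇f|²` -/
def gradSq (f : (Fin (k + 1) → ℝ) → ℝ) (y : Fin (k + 1) → ℝ) : ℝ :=
  ∑ j, fderiv ℝ f y (Pi.single j 1) ^ 2

theorem gradSq_nonneg (f : (Fin (k + 1) → ℝ) → ℝ) (y : Fin (k + 1) → ℝ) : 0 ≤ gradSq f y :=
  Finset.sum_nonneg fun _ _ => sq_nonneg _

/-- With σ = |y|² and f = σ^q + σ^p one has R^{2p} = f and σ f' = q σ^q + p σ^p ≤ p f. Hence the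
radial derivative of R is at most R / |y|. -/
theorem gradSq_radiusW_le (hq : 0 < q) (hqp : q < p) {y : Fin (k + 1) → ℝ} (hy : y ≠ 0) :
    gradSq (radiusW p q) y ≤ radiusW p q y ^ 2 / sqY y := by
  have hs := sqY_pos hy
  have hp : 0 < p := hq.trans hqp
  have hp' : (0 : ℝ) < p := by positivity
  set s := sqY y with hsdef
  have hQ : 0 < s ^ q + s ^ p := by positivity
  have h1 : HasDerivAt (fun t : ℝ => t ^ q + t ^ p) (q * s ^ (q - 1) + p * s ^ (p - 1)) s :=
    (hasDerivAt_pow q s).add (hasDerivAt_pow p s)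
  -- The derivative of R with respect to |y|²; the gradient of R is 2 c y.
  set c : ℝ := (q * s ^ (q - 1) + p * s ^ (p - 1)) * (1 / (2 * p)) *
    (s ^ q + s ^ p) ^ ((1 / (2 * p) : ℝ) - 1) with hc
  have h3 : HasFDerivAt (radiusW p q) (c • ∑ j, (2 * y j) • ContinuousLinearMap.proj (R := ℝ)
      (φ := fun _ : Fin (k + 1) => ℝ) j) y := by
    have h2 : HasDerivAt (fun t : ℝ => (t ^ q + t ^ p) ^ (1 / (2 * p) : ℝ)) c (sqY y) :=
      h1.rpow_const (p := (1 / (2 * p) : ℝ)) (Or.inl hQ.ne')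
    exact h2.comp_hasFDerivAt y (hasFDerivAt_sqY y)
  have h4 : ∀ j, fderiv ℝ (radiusW p q) y (Pi.single j 1) = 2 * c * y j := by
    intro j
    rw [h3.fderiv]
    simp only [smul_apply, sum_apply, ContinuousLinearMap.proj_apply, smul_eq_mul, Pi.single_apply]
    simp
    ring
  have hc0 : 0 ≤ c := by positivity
  have hR : radiusW p q y = (s ^ q + s ^ p) ^ (1 / (2 * p) : ℝ) := rfl
  have h5 : 2 * c * s ≤ radiusW p q y := by
    have h6 : radiusW p q y = (s ^ q + s ^ p) * (s ^ q + s ^ p) ^ ((1 / (2 * p) : ℝ) - 1) := by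
      rw [hR, Real.rpow_sub_one hQ.ne']
      field_simp
    have h7 : s ^ (q - 1) * s = s ^ q := pow_sub_one_mul hq.ne' s
    have h8 : s ^ (p - 1) * s = s ^ p := pow_sub_one_mul hp.ne' s
    have h9 : 2 * c * s = ((q * s ^ q + p * s ^ p) / p) *
        (s ^ q + s ^ p) ^ ((1 / (2 * p) : ℝ) - 1) := by
      rw [hc, ← h7, ← h8]
      field_simp
    rw [h9, h6]
    refine mul_le_mul_of_nonneg_right ?_ (by positivity)
    rw [div_le_iff₀ hp']
    have : (q : ℝ) ≤ p := by exact_mod_cast hqp.le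
    nlinarith [pow_pos hs q]
  have h10 : gradSq (radiusW p q) y = (2 * c) ^ 2 * s := by
    rw [gradSq, hsdef, sqY, Finset.mul_sum]
    exact Finset.sum_congr rfl fun j _ => by rw [h4 j, mul_pow]
  rw [h10, le_div_iff₀ hs]
  calc (2 * c) ^ 2 * s * s = (2 * c * s) ^ 2 := by ring
    _ ≤ radiusW p q y ^ 2 := by gcongr

theorem radiusW_sq_pow (hq : 0 < q) (hqp : q < p) {y : Fin (k + 1) → ℝ} (hy : y ≠ 0) :
    (radiusW p q y ^ 2) ^ p = sqY y ^ q + sqY y ^ p :=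
  radius_pow (hq.trans hqp) (profileW_pos hy).le

theorem sqY_le_radiusW_sq (hq : 0 < q) (hqp : q < p) {y : Fin (k + 1) → ℝ} (hy : y ≠ 0) :
    sqY y ≤ radiusW p q y ^ 2 := by
  refine le_of_pow_le_pow_left₀ (hq.trans hqp).ne' (sq_nonneg _) ?_
  rw [radiusW_sq_pow hq hqp hy]
  have := pow_pos (sqY_pos hy) q
  linarith

theorem rpow_div_pow {s : ℝ} (hs : 0 ≤ s) (hp : 0 < p) : (s ^ (q / p : ℝ)) ^ p = s ^ q := by
  have : (p : ℝ) ≠ 0 := by positivity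
  rw [← Real.rpow_natCast, ← Real.rpow_mul hs, div_mul_cancel₀ _ this, Real.rpow_natCast]

theorem rpow_le_radiusW_sq (hq : 0 < q) (hqp : q < p) {y : Fin (k + 1) → ℝ} (hy : y ≠ 0) :
    sqY y ^ (q / p : ℝ) ≤ radiusW p q y ^ 2 := by
  have hs := sqY_pos hy
  refine le_of_pow_le_pow_left₀ (hq.trans hqp).ne' (sq_nonneg _) ?_
  rw [radiusW_sq_pow hq hqp hy, rpow_div_pow hs.le (hq.trans hqp)]
  have := pow_pos hs p
  linarith

/-- For |y| ≤ 1 the lower power dominates, so R^{2p} ≤ 2 |y|^{2q} ≤ 2^p |y|^{2q}. Together with the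
previous bound, R is of the exact order |y|^{q/p} near P. -/
theorem radiusW_sq_le (hq : 0 < q) (hqp : q < p) {y : Fin (k + 1) → ℝ} (hy : y ≠ 0)
    (h1 : sqY y ≤ 1) : radiusW p q y ^ 2 ≤ 2 * sqY y ^ (q / p : ℝ) := by
  have hs := sqY_pos hy
  refine le_of_pow_le_pow_left₀ (hq.trans hqp).ne' (by positivity) ?_
  rw [radiusW_sq_pow hq hqp hy, mul_pow, rpow_div_pow hs.le (hq.trans hqp)]
  have h2 : sqY y ^ p ≤ sqY y ^ q := pow_le_pow_of_le_one hs.le h1 hqp.le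
  have h3 : (2 : ℝ) ^ 1 ≤ 2 ^ p := pow_le_pow_right₀ (by norm_num) (hq.trans hqp)
  nlinarith [pow_pos hs q]

/-! ### The derivative of the graph parametrization -/

variable (i : Fin n) (s : ℝ) (R : (Fin (k + 1) → ℝ) → ℝ)

/-- The quadratic form `∑ R² v_l² + ∑ v_j² + (dR v)²` to which the metric is comparable. -/
def quadQ (u v : Fin (n + k) → ℝ) : ℝ :=
  ∑ j, (if IsX i j then R (coordY i u) ^ 2 else 1) * v j ^ 2 +
    fderiv ℝ R (coordY i u) (coordY i v) ^ 2

/-- The factor `(1 + |u|²)^(-1/2)`. -/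
def cosFactor (u : Fin (n + k) → ℝ) : ℝ := Real.sqrt ((1 + 0) / (1 + sqU i u))

theorem cosFactor_pos (u : Fin (n + k) → ℝ) : 0 < cosFactor i u := by
  have := sqU_nonneg i u
  exact Real.sqrt_pos.2 (by positivity)

theorem cosFactor_sq (u : Fin (n + k) → ℝ) : cosFactor i u ^ 2 * (1 + sqU i u) = 1 := by
  have := sqU_nonneg i u
  rw [cosFactor, Real.sq_sqrt (by positivity)]
  field_simp
  ring

theorem cosFactor_le_one (u : Fin (n + k) → ℝ) : cosFactor i u ≤ 1 := by
  have h1 := cosFactor_sq i u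
  have h2 := cosFactor_pos i u
  have h3 := sqU_nonneg i u
  by_contra h
  nlinarith

theorem hasFDerivAt_sqU (u : Fin (n + k) → ℝ) :
    HasFDerivAt (sqU i) (∑ j, (if IsX i j then 2 * u j else 0) • ContinuousLinearMap.proj (R := ℝ)
      (φ := fun _ : Fin (n + k) => ℝ) j) u := by
  refine HasFDerivAt.fun_sum fun j _ => ?_
  have h := (ContinuousLinearMap.proj (R := ℝ) (φ := fun _ : Fin (n + k) => ℝ) j).hasFDerivAt
    (x := u) |>.pow 2
  by_cases hj : IsX i j
  · simpa [hj] using h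
  · simpa [hj] using hasFDerivAt_const (0 : ℝ) u

theorem differentiableAt_cosFactor (u : Fin (n + k) → ℝ) : DifferentiableAt ℝ (cosFactor i) u := by
  have h1 := sqU_nonneg i u
  have h2 := (hasFDerivAt_sqU i u).differentiableAt
  unfold cosFactor
  have h3 : 1 + sqU i u ≠ 0 := by positivity
  have h4 : (1 + 0) / (1 + sqU i u) ≠ 0 := by positivity
  have h5 : DifferentiableAt ℝ (fun w => (1 + 0) / (1 + sqU i w)) u := by
    fun_prop (disch := exact h3)
  exact h5.sqrt h4

/-- Obtained by differentiating the identity `cosFactor_sq` instead of the square root. -/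
theorem fderiv_cosFactor (u v : Fin (n + k) → ℝ) : fderiv ℝ (cosFactor i) u v =
    - cosFactor i u ^ 3 * ∑ j, if IsX i j then u j * v j else 0 := by
  have h1 := ((differentiableAt_cosFactor i u).hasFDerivAt.pow 2).mul
    ((hasFDerivAt_sqU i u).const_add 1)
  have h2 : ((fun x => cosFactor i x ^ 2) * fun u : Fin (n + k) → ℝ => 1 + sqU i u) =
      fun _ => 1 := by
    funext w
    exact cosFactor_sq i w
  rw [h2] at h1
  have h3 := DFunLike.congr_fun (h1.unique (hasFDerivAt_const (1 : ℝ) u)) v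
  have h4 : ∑ j, (if IsX i j then 2 * u j else 0) * v j =
      2 * ∑ j, if IsX i j then u j * v j else 0 := by
    rw [Finset.mul_sum]
    refine Finset.sum_congr rfl fun j _ => ?_
    split_ifs <;> ring
  simp only [add_apply, smul_apply, sum_apply, ContinuousLinearMap.proj_apply, smul_eq_mul, h4,
    zero_apply, nsmul_eq_mul, Nat.cast_ofNat, pow_one, Nat.add_one_sub_one] at h3
  have h5 := cosFactor_sq i u
  have h6 := (cosFactor_pos i u).ne'
  have h7 : cosFactor i u * fderiv ℝ (cosFactor i) u v * (1 + sqU i u) =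
      - cosFactor i u ^ 2 * ∑ j, if IsX i j then u j * v j else 0 := by
    linarith
  have h8 : cosFactor i u * (fderiv ℝ (cosFactor i) u v) = cosFactor i u *
      (- cosFactor i u ^ 3 * ∑ j, if IsX i j then u j * v j else 0) := by
    linear_combination (cosFactor i u ^ 2) * h7 -
      (cosFactor i u * fderiv ℝ (cosFactor i) u v) * h5
  exact mul_left_cancel₀ h6 h8

theorem hasFDerivAt_height {u : Fin (n + k) → ℝ} (hR : DifferentiableAt ℝ R (coordY i u)) :
    HasFDerivAt (fun u => height i s R u 0)
      (s • (R (coordY i u) • fderiv ℝ (cosFactor i) u +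
        cosFactor i u • (fderiv ℝ R (coordY i u)).comp (coordY i))) u := by
  have h1 : HasFDerivAt (fun u => R (coordY i u)) ((fderiv ℝ R (coordY i u)).comp (coordY i)) u :=
    hR.hasFDerivAt.comp u (coordY i).hasFDerivAt
  have h2 := (h1.mul (differentiableAt_cosFactor i u).hasFDerivAt).const_mul s
  refine h2.congr_of_eventuallyEq (Eventually.of_forall fun w => ?_)
  change s * R (coordY i w) * cosFactor i w = s * (R (coordY i w) * cosFactor i w)
  ring

theorem differentiableAt_param {u : Fin (n + k) → ℝ} (hR : DifferentiableAt ℝ R (coordY i u)) :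
    DifferentiableAt ℝ (fun u => param i s R u 0) u := by
  have hh := (hasFDerivAt_height i s R hR).differentiableAt
  refine differentiableAt_pi.2 fun b => ?_
  refine Fin.succAboveCases (ix i) ?_ (fun j => ?_) b
  · simpa only [param_self] using hh
  · simp only [param_succAbove]
    by_cases h : IsX i j
    · simp only [if_pos h]
      fun_prop
    · simp only [if_neg h]
      fun_prop

theorem fderiv_param_self {u : Fin (n + k) → ℝ} (hR : DifferentiableAt ℝ R (coordY i u))
    (v : Fin (n + k) → ℝ) : fderiv ℝ (fun u => param i s R u 0) u v (ix i) =
      s * (R (coordY i u) * fderiv ℝ (cosFactor i) u v +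
        cosFactor i u * fderiv ℝ R (coordY i u) (coordY i v)) := by
  have h1 := hasFDerivAt_pi'.1 (differentiableAt_param i s R hR).hasFDerivAt (ix i)
  simp only [param_self] at h1
  exact DFunLike.congr_fun (h1.unique (hasFDerivAt_height i s R hR)) v

theorem fderiv_param_succAbove {u : Fin (n + k) → ℝ} (hR : DifferentiableAt ℝ R (coordY i u))
    (v : Fin (n + k) → ℝ) (j : Fin (n + k)) :
    fderiv ℝ (fun u => param i s R u 0) u v ((ix i).succAbove j) =
      if IsX i j then u j * fderiv ℝ (fun u => param i s R u 0) u v (ix i) +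
        height i s R u 0 * v j else v j := by
  have h1 := hasFDerivAt_pi'.1 (differentiableAt_param i s R hR).hasFDerivAt ((ix i).succAbove j)
  have h0 := hasFDerivAt_pi'.1 (differentiableAt_param i s R hR).hasFDerivAt (ix i)
  simp only [param_self] at h0
  simp only [param_succAbove] at h1
  have h2 := (ContinuousLinearMap.proj (R := ℝ) (φ := fun _ : Fin (n + k) => ℝ) j).hasFDerivAt
    (x := u)
  by_cases h : IsX i j
  · simp only [if_pos h] at h1 ⊢
    exact DFunLike.congr_fun (h1.unique (h2.mul h0)) v
  · simp only [if_neg h] at h1 ⊢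
    exact DFunLike.congr_fun (h1.unique h2) v

theorem sum_isX_le {u v : Fin (n + k) → ℝ} (hu : ∀ j, IsX i j → |u j| ≤ 2) {r B : ℝ} (hr : 0 ≤ r)
    (hB : ∀ j, IsX i j → r * |v j| ≤ B) (hB0 : 0 ≤ B) :
    r * |∑ j, if IsX i j then u j * v j else 0| ≤ (n + k) * (2 * B) := by
  calc r * |∑ j, if IsX i j then u j * v j else 0|
      ≤ r * ∑ j, |if IsX i j then u j * v j else 0| := by
        gcongr
        exact Finset.abs_sum_le_sum_abs _ _
    _ = ∑ j, r * |if IsX i j then u j * v j else 0| := Finset.mul_sum _ _ _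
    _ ≤ ∑ _j : Fin (n + k), 2 * B := by
        refine Finset.sum_le_sum fun j _ => ?_
        by_cases h : IsX i j
        · rw [if_pos h, abs_mul]
          have := hB j h
          have := hu j h
          have h1 := mul_nonneg hr (abs_nonneg (v j))
          nlinarith [abs_nonneg (u j)]
        · rw [if_neg h, abs_zero, mul_zero]
          positivity
    _ = (n + k) * (2 * B) := by simp

theorem abs_fderiv_cosFactor_le {u v : Fin (n + k) → ℝ} (hu : ∀ j, IsX i j → |u j| ≤ 2) {r B : ℝ}
    (hr : 0 ≤ r) (hB : ∀ j, IsX i j → r * |v j| ≤ B) (hB0 : 0 ≤ B) :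
    r * |fderiv ℝ (cosFactor i) u v| ≤ (n + k) * (2 * B) := by
  rw [fderiv_cosFactor, abs_mul, abs_neg, abs_of_pos (pow_pos (cosFactor_pos i u) 3)]
  have h1 := sum_isX_le i hu hr hB hB0
  have h2 : cosFactor i u ^ 3 ≤ 1 := pow_le_one₀ (cosFactor_pos i u).le (cosFactor_le_one i u)
  refine le_trans ?_ h1
  have h3 : cosFactor i u ^ 3 * |∑ j, if IsX i j then u j * v j else 0| ≤
      1 * |∑ j, if IsX i j then u j * v j else 0| := by gcongr
  rw [one_mul] at h3
  gcongr

/-- From x_i = s R c(u) and x_l = u_l x_i the differentials are built from R du, dR and dy, each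
bounded by the root of `quadQ`. The constant arises as 2 (1 + 2d) + 1, because |u_l| ≤ 2 multiplies
the bound (1 + 2d) for dx_i and the term R du_l is added. -/
theorem norm_fderiv_param_sq_le (hs : s ^ 2 = 1) {u : Fin (n + k) → ℝ}
    (hR : DifferentiableAt ℝ R (coordY i u)) (hpos : 0 < R (coordY i u))
    (hu : ∀ j, IsX i j → |u j| ≤ 2) (v : Fin (n + k) → ℝ) :
    ‖fderiv ℝ (fun u => param i s R u 0) u v‖ ^ 2 ≤ (3 + 4 * (n + k)) ^ 2 * quadQ i R u v := by
  set S := quadQ i R u v with hS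
  set r := R (coordY i u) with hr
  set d : ℝ := n + k with hd
  have hd0 : 0 ≤ d := by positivity
  have hterm : ∀ j, (if IsX i j then r ^ 2 else 1) * v j ^ 2 ≤ S := by
    intro j
    have h1 := Finset.single_le_sum (f := fun j => (if IsX i j then r ^ 2 else 1) * v j ^ 2)
      (fun j _ => by split_ifs <;> positivity) (Finset.mem_univ j)
    have h2 := sq_nonneg (fderiv ℝ R (coordY i u) (coordY i v))
    rw [hS, quadQ]
    linarith
  have hS0 : 0 ≤ S := by
    refine add_nonneg (Finset.sum_nonneg fun j _ => ?_) (sq_nonneg _)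
    split_ifs <;> positivity
  set B := Real.sqrt S with hB
  have hB0 : 0 ≤ B := Real.sqrt_nonneg _
  have hx : ∀ j, IsX i j → r * |v j| ≤ B := by
    intro j hj
    have h1 := hterm j
    rw [if_pos hj, ← mul_pow] at h1
    have := Real.abs_le_sqrt h1
    rwa [abs_mul, abs_of_pos hpos] at this
  have hy : ∀ j, ¬ IsX i j → |v j| ≤ B := by
    intro j hj
    have h1 := hterm j
    rw [if_neg hj, one_mul] at h1
    exact Real.abs_le_sqrt h1
  have hg : |fderiv ℝ R (coordY i u) (coordY i v)| ≤ B := by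
    refine Real.abs_le_sqrt ?_
    have : 0 ≤ ∑ j, (if IsX i j then r ^ 2 else 1) * v j ^ 2 :=
      Finset.sum_nonneg fun j _ => by split_ifs <;> positivity
    rw [hS, quadQ]
    linarith
  have hsabs : |s| = 1 := by
    rw [← sq_abs] at hs
    exact (pow_eq_one_iff_of_nonneg (abs_nonneg s) two_ne_zero).1 hs
  have hcos := cosFactor_pos i u
  have hcos1 := cosFactor_le_one i u
  have hself : |fderiv ℝ (fun u => param i s R u 0) u v (ix i)| ≤ (1 + 2 * d) * B := by
    rw [fderiv_param_self i s R hR, abs_mul, hsabs, one_mul]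
    refine (abs_add_le _ _).trans ?_
    rw [abs_mul, abs_mul, abs_of_pos hcos, abs_of_pos hpos]
    have h1 := abs_fderiv_cosFactor_le i (v := v) hu hpos.le hx hB0
    have h2 : cosFactor i u * |fderiv ℝ R (coordY i u) (coordY i v)| ≤ 1 * B := by gcongr
    linarith
  have hh : |height i s R u 0| ≤ r := by
    change |s * R (coordY i u) * cosFactor i u| ≤ r
    rw [abs_mul, abs_mul, hsabs, one_mul, abs_of_pos hpos, abs_of_pos hcos]
    exact mul_le_of_le_one_right hpos.le hcos1
  have hnorm : ‖fderiv ℝ (fun u => param i s R u 0) u v‖ ≤ (3 + 4 * d) * B := by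
    rw [pi_norm_le_iff_of_nonneg (by positivity)]
    intro b
    rw [Real.norm_eq_abs]
    refine Fin.succAboveCases (ix i) ?_ (fun j => ?_) b
    · refine hself.trans ?_
      gcongr <;> linarith
    · rw [fderiv_param_succAbove i s R hR]
      by_cases hj : IsX i j
      · rw [if_pos hj]
        refine (abs_add_le _ _).trans ?_
        rw [abs_mul, abs_mul]
        have h1 := hu j hj
        have h2 := hx j hj
        have h3 : |u j| * |fderiv ℝ (fun u => param i s R u 0) u v (ix i)| ≤
            2 * ((1 + 2 * d) * B) := by gcongr
        have h4 : |height i s R u 0| * |v j| ≤ r * |v j| := by gcongr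
        linarith
      · rw [if_neg hj]
        have h1 := hy j hj
        nlinarith
  calc ‖fderiv ℝ (fun u => param i s R u 0) u v‖ ^ 2 ≤ ((3 + 4 * d) * B) ^ 2 := by gcongr
    _ = (3 + 4 * d) ^ 2 * S := by rw [mul_pow, hB, Real.sq_sqrt hS0]

/-- A constant that depends only on the dimension. -/
def quadConst (d : ℝ) : ℝ := (1 + 4 * d) * (3 + 6 * d * (1 + 4 * d))

/-- The converse comparison solves for the parts one after another: dy is read off directly, R du_l
from dx_l - u_l dx_i, and finally dR from dx_i. The bound on u keeps the factor c(u), by which one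
divides, away from zero. -/
theorem quadQ_le (hs : s ^ 2 = 1) {u : Fin (n + k) → ℝ}
    (hR : DifferentiableAt ℝ R (coordY i u)) (hpos : 0 < R (coordY i u))
    (hu : ∀ j, IsX i j → |u j| ≤ 2) (v : Fin (n + k) → ℝ) :
    quadQ i R u v ≤ ((n + k + 1) * quadConst (n + k) ^ 2) *
      ‖fderiv ℝ (fun u => param i s R u 0) u v‖ ^ 2 := by
  set m := ‖fderiv ℝ (fun u => param i s R u 0) u v‖ with hm
  set r := R (coordY i u) with hr
  set d : ℝ := n + k with hd
  set D := fderiv ℝ (fun u => param i s R u 0) u v with hD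
  have hd0 : 0 ≤ d := by positivity
  have hm0 : 0 ≤ m := norm_nonneg _
  have hDb : ∀ b, |D b| ≤ m := fun b => norm_le_pi_norm D b
  have hsabs : |s| = 1 := by
    rw [← sq_abs] at hs
    exact (pow_eq_one_iff_of_nonneg (abs_nonneg s) two_ne_zero).1 hs
  have hcos := cosFactor_pos i u
  have hcos1 := cosFactor_le_one i u
  -- From c² (1 + |u|²) = 1 with |u|² ≤ 4d and c² ≤ c.
  have hcoslow : 1 ≤ (1 + 4 * d) * cosFactor i u := by
    have h1 := cosFactor_sq i u
    have h2 : sqU i u ≤ 4 * d := by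
      calc sqU i u ≤ ∑ _j : Fin (n + k), (4 : ℝ) := by
            refine Finset.sum_le_sum fun j _ => ?_
            by_cases hj : IsX i j
            · rw [if_pos hj, ← sq_abs]
              have := hu j hj
              nlinarith [abs_nonneg (u j)]
            · rw [if_neg hj]
              norm_num
        _ = 4 * d := by
            rw [Finset.sum_const, Finset.card_univ, Fintype.card_fin, nsmul_eq_mul, hd]
            push_cast
            ring
    calc (1 : ℝ) = cosFactor i u ^ 2 * (1 + sqU i u) := h1.symm
      _ ≤ cosFactor i u * (1 + 4 * d) := by
          have h3 : cosFactor i u ^ 2 ≤ cosFactor i u := by nlinarith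
          have h4 := sqU_nonneg i u
          gcongr
      _ = _ := mul_comm _ _
  have hh : |height i s R u 0| = r * cosFactor i u := by
    change |s * R (coordY i u) * cosFactor i u| = _
    rw [abs_mul, abs_mul, hsabs, one_mul, abs_of_pos hpos, abs_of_pos hcos]
  have hx : ∀ j, IsX i j → r * |v j| ≤ 3 * (1 + 4 * d) * m := by
    intro j hj
    have h1 := fderiv_param_succAbove i s R hR v j
    rw [if_pos hj] at h1
    have h2 : height i s R u 0 * v j = D ((ix i).succAbove j) - u j * D (ix i) := by
      rw [hD, h1]
      ring
    have h3 : |height i s R u 0 * v j| ≤ 3 * m := by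
      rw [h2]
      refine (abs_sub _ _).trans ?_
      rw [abs_mul]
      have h4 := hDb ((ix i).succAbove j)
      have h5 : |u j| * |D (ix i)| ≤ 2 * m := by
        have := hu j hj
        have := hDb (ix i)
        gcongr
      linarith
    rw [abs_mul, hh] at h3
    have h6 : r * |v j| * 1 ≤ r * |v j| * ((1 + 4 * d) * cosFactor i u) :=
      mul_le_mul_of_nonneg_left hcoslow (by positivity)
    nlinarith
  have hy : ∀ j, ¬ IsX i j → |v j| ≤ m := by
    intro j hj
    have h1 := fderiv_param_succAbove i s R hR v j
    rw [if_neg hj] at h1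
    rw [← h1]
    exact hDb _
  have hg : |fderiv ℝ R (coordY i u) (coordY i v)| ≤ quadConst d * m := by
    have h1 := fderiv_param_self i s R hR v
    have h2 := abs_fderiv_cosFactor_le i (v := v) hu hpos.le hx (by positivity)
    have h3 : cosFactor i u * fderiv ℝ R (coordY i u) (coordY i v) =
        s * D (ix i) - r * fderiv ℝ (cosFactor i) u v := by
      rw [hD, h1, ← mul_assoc, ← sq, hs]
      ring
    have h4 : cosFactor i u * |fderiv ℝ R (coordY i u) (coordY i v)| ≤
        (1 + 6 * d * (1 + 4 * d)) * m := by
      have h5 : cosFactor i u * |fderiv ℝ R (coordY i u) (coordY i v)| =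
          |cosFactor i u * fderiv ℝ R (coordY i u) (coordY i v)| := by
        rw [abs_mul, abs_of_pos hcos]
      rw [h5, h3]
      refine (abs_sub _ _).trans ?_
      rw [abs_mul, abs_mul, hsabs, one_mul, abs_of_pos hpos]
      have := hDb (ix i)
      nlinarith
    set G := |fderiv ℝ R (coordY i u) (coordY i v)| with hG
    have hG0 : 0 ≤ G := abs_nonneg _
    calc G ≤ ((1 + 4 * d) * cosFactor i u) * G := le_mul_of_one_le_left hG0 hcoslow
      _ = (1 + 4 * d) * (cosFactor i u * G) := by ring
      _ ≤ (1 + 4 * d) * ((1 + 6 * d * (1 + 4 * d)) * m) := by gcongr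
      _ ≤ quadConst d * m := by
          rw [quadConst, mul_assoc (1 + 4 * d)]
          have h5 : 0 ≤ 1 + 4 * d := by positivity
          refine mul_le_mul_of_nonneg_left (mul_le_mul_of_nonneg_right ?_ hm0) h5
          linarith
  -- The summand 3 in `quadConst`, where the bound on dR would only need 1, makes the same constant
  -- serve for R du.
  have hc1 : 3 * (1 + 4 * d) ≤ quadConst d := by
    rw [quadConst]
    have : 0 ≤ (1 + 4 * d) * (6 * d * (1 + 4 * d)) := by positivity
    nlinarith
  have hc2 : 1 ≤ quadConst d := by linarith
  have hterm : ∀ j, (if IsX i j then r ^ 2 else 1) * v j ^ 2 ≤ (quadConst d * m) ^ 2 := by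
    intro j
    by_cases hj : IsX i j
    · rw [if_pos hj, ← sq_abs (v j), ← mul_pow]
      refine pow_le_pow_left₀ (by positivity) ((hx j hj).trans ?_) 2
      gcongr
    · rw [if_neg hj, one_mul, ← sq_abs (v j)]
      refine pow_le_pow_left₀ (by positivity) ((hy j hj).trans ?_) 2
      exact le_mul_of_one_le_left hm0 hc2
  calc quadQ i R u v ≤ ∑ _j : Fin (n + k), (quadConst d * m) ^ 2 + (quadConst d * m) ^ 2 := by
        rw [quadQ]
        refine add_le_add (Finset.sum_le_sum fun j _ => hterm j) ?_
        rw [← sq_abs]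
        gcongr
    _ = ((d + 1) * quadConst d ^ 2) * m ^ 2 := by
        rw [Finset.sum_const, Finset.card_univ, Fintype.card_fin, nsmul_eq_mul, hd]
        push_cast
        ring

end GraphChart

end

/-! ### The volume density near P and an integrable weight. -/

noncomputable section

namespace GraphChart

variable {n k p q : ℕ}

/-! ### Comparison of determinants -/

section Matrices

variable (i : Fin n) (R : (Fin (k + 1) → ℝ) → ℝ)

/-- The coefficients of the quadratic form `quadQ`. -/
def quadDiag (u : Fin (n + k) → ℝ) (j : Fin (n + k)) : ℝ :=
  if IsX i j then R (coordY i u) ^ 2 else 1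

/-- The differential of `R(y)`. -/
def quadVec (u : Fin (n + k) → ℝ) (j : Fin (n + k)) : ℝ :=
  fderiv ℝ R (coordY i u) (coordY i (Pi.single j 1))

/-- The matrix of the quadratic form `quadQ`. -/
def quadMatrix (u : Fin (n + k) → ℝ) : Matrix (Fin (n + k)) (Fin (n + k)) ℝ :=
  Matrix.diagonal (quadDiag i R u) + Matrix.vecMulVec (quadVec i R u) (quadVec i R u)

theorem isHermitian_quadMatrix (u : Fin (n + k) → ℝ) : (quadMatrix i R u).IsHermitian := by
  refine (Matrix.isHermitian_diagonal _).add ?_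
  ext a c
  simp [Matrix.conjTranspose_apply, Matrix.vecMulVec_apply, mul_comm]

theorem sum_quadVec (u v : Fin (n + k) → ℝ) :
    ∑ j, quadVec i R u j * v j = fderiv ℝ R (coordY i u) (coordY i v) := by
  conv_rhs => rw [pi_eq_sum_univ' v]
  rw [map_sum, map_sum]
  refine Finset.sum_congr rfl fun j _ => ?_
  rw [map_smul, map_smul, smul_eq_mul, quadVec, mul_comm]

theorem dotProduct_quadMatrix (u v : Fin (n + k) → ℝ) :
    v ⬝ᵥ (quadMatrix i R u).mulVec v = quadQ i R u v := by
  rw [quadMatrix, Matrix.add_mulVec, dotProduct_add, Matrix.vecMulVec_mulVec, quadQ,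
    ← sum_quadVec]
  congr 1
  · simp only [dotProduct, Matrix.mulVec_diagonal, quadDiag]
    exact Finset.sum_congr rfl fun j _ => by ring
  · have h : v ⬝ᵥ (MulOpposite.op (quadVec i R u ⬝ᵥ v)) • quadVec i R u =
        (quadVec i R u ⬝ᵥ v) * (quadVec i R u ⬝ᵥ v) := by
      rw [dotProduct_smul, dotProduct_comm v]
      rfl
    rw [h, sq]
    rfl

theorem coordY_single_isX {j : Fin (n + k)} (hj : IsX i j) :
    coordY i (Pi.single j 1) = 0 := by
  funext l
  rw [coordY_apply, Pi.single_apply, if_neg]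
  · rfl
  · rintro rfl
    exact not_isX_iy i l hj

theorem coordY_single_iy (l : Fin (k + 1)) :
    coordY (n := n) i (Pi.single (iy i l) 1) = Pi.single l 1 := by
  funext m
  rw [coordY_apply, Pi.single_apply, Pi.single_apply]
  simp only [(iy_injective i).eq_iff]

/-- A sum over the `y`-coordinates. -/
theorem sum_not_isX {f : Fin (n + k) → ℝ} (hf : ∀ j, IsX i j → f j = 0) :
    ∑ j, f j = ∑ l, f (iy i l) := by
  symm
  refine Fintype.sum_of_injective (iy i) (iy_injective i) _ _ (fun j hj => ?_) fun _ => rfl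
  refine hf j ?_
  by_contra h
  obtain ⟨l, rfl⟩ := exists_eq_iy i h
  exact hj ⟨l, rfl⟩

theorem prod_isX (a : ℝ) : ∏ j : Fin (n + k), (if IsX i j then a else 1) = a ^ (n - 1) := by
  have h : ∀ j : Fin (n + k), (if IsX i j then a else 1) = if (j : ℕ) < n - 1 then a else 1 := by
    intro j
    have : IsX i j ↔ (j : ℕ) < n - 1 := by
      rw [isX_iff]
      omega
    simp only [this]
  rw [Finset.prod_congr rfl fun j _ => h j, Fin.prod_univ_eq_prod_range
    (fun j => if j < n - 1 then a else 1), Finset.prod_ite, Finset.prod_const_one, mul_one,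
    Finset.prod_const]
  congr 1
  have : (Finset.range (n + k)).filter (· < n - 1) = Finset.range (n - 1) := by
    ext j
    simp only [Finset.mem_filter, Finset.mem_range]
    omega
  rw [this, Finset.card_range]

/-- Each of the n - 1 angular directions contributes R², and dR has components in the y-directions
only. -/
theorem det_quadMatrix {u : Fin (n + k) → ℝ} (hR : R (coordY i u) ≠ 0) :
    (quadMatrix i R u).det = (R (coordY i u) ^ 2) ^ (n - 1) * (1 + gradSq R (coordY i u)) := by
  rw [quadMatrix, Matrix.det_diagonal_add_vecMulVec]
  · congr 2
    · exact prod_isX i _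
    · rw [sum_not_isX i]
      · refine Finset.sum_congr rfl fun l _ => ?_
        rw [quadDiag, if_neg (not_isX_iy i l), div_one, quadVec, coordY_single_iy]
      · intro j hj
        rw [quadVec, coordY_single_isX i hj, map_zero]
        simp
  · intro j
    rw [quadDiag]
    split_ifs
    · exact pow_ne_zero 2 hR
    · exact one_ne_zero

/-- The inclusion of the `y`-coordinates. -/
def inclY : (Fin (k + 1) → ℝ) →L[ℝ] (Fin (n + k) → ℝ) :=
  ∑ l, (ContinuousLinearMap.proj (R := ℝ) (φ := fun _ : Fin (k + 1) => ℝ) l).smulRight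
    (Pi.single (iy i l) 1 : Fin (n + k) → ℝ)

theorem inclY_apply (y : Fin (k + 1) → ℝ) :
    inclY (n := n) i y = ∑ l, y l • (Pi.single (iy i l) 1 : Fin (n + k) → ℝ) := by
  simp [inclY]

theorem inclY_single (l : Fin (k + 1)) :
    inclY (n := n) i (Pi.single l 1) = Pi.single (iy i l) 1 := by
  rw [inclY_apply, Finset.sum_eq_single l]
  · simp
  · intro m _ hm
    simp [hm]
  · simp

theorem coordY_inclY (y : Fin (k + 1) → ℝ) : coordY (n := n) i (inclY i y) = y := by
  rw [inclY_apply, map_sum]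
  simp only [map_smul, coordY_single_iy]
  exact (pi_eq_sum_univ' y).symm

theorem inclY_isX (y : Fin (k + 1) → ℝ) {j : Fin (n + k)} (hj : IsX i j) : inclY i y j = 0 := by
  rw [inclY_apply, Finset.sum_apply]
  refine Finset.sum_eq_zero fun l _ => ?_
  have : j ≠ iy i l := by
    rintro rfl
    exact not_isX_iy i l hj
  simp [this]

theorem quadQ_inclY_le (u : Fin (n + k) → ℝ) (y : Fin (k + 1) → ℝ) :
    quadQ i R u (inclY i y) ≤ y ⬝ᵥ (Matrix.diagonal (fun _ => 1) + Matrix.vecMulVec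
      (fun l => fderiv ℝ R (coordY i u) (Pi.single l 1))
      (fun l => fderiv ℝ R (coordY i u) (Pi.single l 1))).mulVec y := by
  have h1 : fderiv ℝ R (coordY i u) y = ∑ l, fderiv ℝ R (coordY i u) (Pi.single l 1) * y l := by
    conv_lhs => rw [pi_eq_sum_univ' y]
    rw [map_sum]
    exact Finset.sum_congr rfl fun l _ => by rw [map_smul, smul_eq_mul, mul_comm]
  rw [Matrix.add_mulVec, dotProduct_add, Matrix.vecMulVec_mulVec, quadQ, coordY_inclY, h1,
    sum_not_isX i]
  · refine le_of_eq ?_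
    congr 1
    · simp only [dotProduct, Matrix.mulVec_diagonal]
      refine Finset.sum_congr rfl fun l _ => ?_
      have h2 : inclY (n := n) i y (iy i l) = y l := congrFun (coordY_inclY (n := n) i y) l
      rw [if_neg (not_isX_iy i l), h2]
      ring
    · have h : ∀ r : Fin (k + 1) → ℝ, y ⬝ᵥ (MulOpposite.op (r ⬝ᵥ y)) • r =
          (r ⬝ᵥ y) * (r ⬝ᵥ y) := by
        intro r
        rw [dotProduct_smul, dotProduct_comm y]
        rfl
      rw [h, sq]
      rfl
  · intro j hj
    rw [inclY_isX i y hj]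
    ring

/-- Comparison of the Gram matrix with a multiple of another matrix. -/
theorem det_bilinMatrix_le {d : ℕ} {b : (Fin d → ℝ) →L[ℝ] (Fin d → ℝ) →L[ℝ] ℝ}
    (hs : ∀ v w, b v w = b w v) (hp : ∀ v, v ≠ 0 → 0 < b v v) {B : Matrix (Fin d) (Fin d) ℝ}
    (hB : B.IsHermitian) {C : ℝ} (h : ∀ v, b v v ≤ C * (v ⬝ᵥ B.mulVec v)) :
    (bilinMatrix b).det ≤ C ^ d * B.det := by
  have h1 := (posDef_bilinMatrix hs hp).det_le_det (B := C • B) ?_ fun x => ?_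
  · rwa [Matrix.det_smul, Fintype.card_fin] at h1
  · ext a c
    have := congrFun (congrFun hB a) c
    rw [Matrix.conjTranspose_apply, star_trivial] at this ⊢
    rw [Matrix.smul_apply, Matrix.smul_apply, this]
  · rw [← bilin_apply_eq_dotProduct, Matrix.smul_mulVec, dotProduct_smul, smul_eq_mul]
    exact h x

theorem det_le_bilinMatrix {d : ℕ} {b : (Fin d → ℝ) →L[ℝ] (Fin d → ℝ) →L[ℝ] ℝ}
    (hs : ∀ v w, b v w = b w v) (hp : ∀ v, v ≠ 0 → 0 < b v v) {B : Matrix (Fin d) (Fin d) ℝ}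
    (hB : B.IsHermitian) {C : ℝ} (hC : 0 < C) (h : ∀ v, b v v ≤ C * (v ⬝ᵥ B.mulVec v))
    (h' : ∀ v, v ⬝ᵥ B.mulVec v ≤ C * b v v) :
    B.det ≤ C ^ d * (bilinMatrix b).det := by
  have hBp : B.PosDef := by
    refine Matrix.PosDef.of_dotProduct_mulVec_pos hB fun {x} hx => ?_
    rw [star_trivial]
    exact pos_of_mul_pos_right ((hp x hx).trans_le (h x)) hC.le
  have h1 := hBp.det_le_det (B := C • bilinMatrix b) ?_ fun x => ?_
  · rwa [Matrix.det_smul, Fintype.card_fin] at h1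
  · ext a c
    have := congrFun (congrFun (posDef_bilinMatrix hs hp).1 a) c
    rw [Matrix.conjTranspose_apply, star_trivial] at this ⊢
    rw [Matrix.smul_apply, Matrix.smul_apply, this]
  · rw [Matrix.smul_mulVec, dotProduct_smul, smul_eq_mul, ← bilin_apply_eq_dotProduct]
    exact h' x

end Matrices

/-! ### The volume density near the singular point -/

/-- The part of a graph chart that matters for the estimates. -/
def box (i : Fin n) : Set (Fin (n + k) → ℝ) :=
  {u | (∀ j, IsX i j → |u j| ≤ 2) ∧ coordY i u ≠ 0 ∧ sqY (coordY i u) ≤ 1}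

/-- The exponent in the estimate of the volume density. -/
def densityExp (k p q : ℕ) : ℝ := ((q : ℝ) / p - 1 - k) / 2

/-- The weight to be integrated is |y|^{q/p-1-k}; as a power of |y|² its exponent is half of that.
-/
theorem rpow_densityExp_sq {s : ℝ} (hs : 0 < s) :
    (s ^ densityExp k p q) ^ 2 * s ^ (k + 1) = s ^ (q / p : ℝ) := by
  rw [← Real.rpow_natCast, ← Real.rpow_natCast, ← Real.rpow_mul hs.le, ← Real.rpow_add hs]
  congr 1
  rw [densityExp]
  push_cast
  ring

/-- The balance of the exponents is used here: R^{n-1}, the size of the x-sphere, has the order of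
|y|^k, the size of the y-sphere. -/
theorem rpow_div_pow_sub_one (hqp : q < p) (h : p * k = q * (n - 1)) {s : ℝ} (hs : 0 ≤ s) :
    (s ^ (q / p : ℝ)) ^ (n - 1) = s ^ k := by
  have hp : (p : ℝ) ≠ 0 := by
    have : 0 < p := by omega
    positivity
  rw [← Real.rpow_natCast, ← Real.rpow_mul hs, ← Real.rpow_natCast s k]
  congr 1
  have h' : (p : ℝ) * k = q * ((n - 1 : ℕ) : ℝ) := by exact_mod_cast h
  field_simp
  linarith

section Density

variable (hq : 0 < q) (hqp : q < p) (g : RealProjMetric (n + k + 1)) (i : Fin n) {s : ℝ}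
  (hs : s ^ 2 = 1) (x₀ : (regularPart (n := n) (k := k) hq hqp).carrier)

/-- The scalar product in the coordinates. -/
def coordsBilin (u : Fin (n + k) → ℝ) : (Fin (n + k) → ℝ) →L[ℝ] (Fin (n + k) → ℝ) →L[ℝ] ℝ :=
  chartBilin (g.inducedCLM (regularPart (n := n) (k := k) hq hqp)) (coords hq hqp i hs x₀) u

theorem coordsBilin_symm (u v w : Fin (n + k) → ℝ) :
    coordsBilin hq hqp g i hs x₀ u v w = coordsBilin hq hqp g i hs x₀ u w v :=
  (g.isScalarProduct_induced _).chartBilin_symm _ _ _ _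

theorem coordsBilin_pos {u : Fin (n + k) → ℝ} (hu : coordY i u ≠ 0) (v : Fin (n + k) → ℝ)
    (hv : v ≠ 0) : 0 < coordsBilin hq hqp g i hs x₀ u v v :=
  (g.isScalarProduct_induced _).chartBilin_pos (coords_mem_atlas hq hqp i hs x₀)
    ((mem_coords_target hq hqp i hs x₀).2 hu) v hv

theorem coordsBilin_eq {u : Fin (n + k) → ℝ} (hu : coordY i u ≠ 0) (v w : Fin (n + k) → ℝ) :
    coordsBilin hq hqp g i hs x₀ u v w = g.affine (Fin.last (n + k + 1))
      (param i s (radiusW p q) u 0) (fderiv ℝ (fun u => param i s (radiusW p q) u 0) u v)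
        (fderiv ℝ (fun u => param i s (radiusW p q) u 0) u w) := by
  have h1 : ((regularPart (n := n) (k := k) hq hqp).affineMap (Fin.last (n + k + 1)) ∘
      (coords hq hqp i hs x₀).symm) =ᶠ[𝓝 u] fun u => param i s (radiusW p q) u 0 := by
    have : ∀ᶠ u' in 𝓝 u, coordY i u' ≠ 0 :=
      (coordY i).continuous.continuousAt.eventually_ne hu
    filter_upwards [this] with u' hu'
    exact affineMap_coords_symm hq hqp i hs x₀ hu'
  rw [coordsBilin, g.chartBilin_induced_apply _ (Fin.last (n + k + 1))
    (coords_mem_atlas hq hqp i hs x₀) ((mem_coords_target hq hqp i hs x₀).2 hu)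
    (coords_symm_mem_finitePart hq hqp i hs x₀ hu), h1.fderiv_eq, h1.eq_of_nhds]

theorem sqX_param_le (hq : 0 < q) (hqp : q < p) (i : Fin n) {s : ℝ} (hs : s ^ 2 = 1) {u : Fin (n + k) → ℝ} (hu : coordY i u ≠ 0)
    (hu1 : sqY (coordY i u) ≤ 1) : sqX (param i s (radiusW p q) u 0) ≤ 2 := by
  rw [sqX_param, height_sq i s _ hs u (by norm_num)]
  have h1 := radiusW_sq_le hq hqp hu hu1
  have h2 : sqY (coordY i u) ^ (q / p : ℝ) ≤ 1 :=
    Real.rpow_le_one (sqY_nonneg _) hu1 (by positivity)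
  have h3 := sqU_nonneg i u
  have h4 : radiusW p q (coordY i u) ^ 2 * ((1 + 0) / (1 + sqU i u)) * (1 + sqU i u) =
      radiusW p q (coordY i u) ^ 2 := by
    field_simp
    ring
  rw [h4]
  linarith

/-- In the coordinates, the metric is comparable with `quadQ`. -/
theorem exists_coordsBilin_bounds : ∃ C : ℝ, 0 < C ∧ ∀ u ∈ box (k := k) i, ∀ v,
    coordsBilin hq hqp g i hs x₀ u v v ≤ C * quadQ i (radiusW p q) u v ∧
    quadQ i (radiusW p q) u v ≤ C * coordsBilin hq hqp g i hs x₀ u v v := by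
  obtain ⟨C, hC, h⟩ := g.exists_affine_bounds (Fin.last (n + k + 1))
    (isCompact_closedBall (0 : Fin (n + k + 1) → ℝ) 2)
  refine ⟨max (C * (3 + 4 * (n + k)) ^ 2) (((n + k + 1) * quadConst (n + k) ^ 2) * C),
    lt_max_of_lt_left (by positivity), fun u hu v => ?_⟩
  obtain ⟨hx, h0, h1⟩ := hu
  have hR : DifferentiableAt ℝ (radiusW p q) (coordY i u) :=
    (contDiffOn_radiusW.contDiffAt (isOpen_compl_singleton.mem_nhds h0)).differentiableAt (by simp)
  have hpos := radiusW_pos (p := p) (q := q) (coordY i u) h0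
  have hball : param i s (radiusW p q) u 0 ∈ Metric.closedBall (0 : Fin (n + k + 1) → ℝ) 2 := by
    refine abs_le_of_sq_add_le _ ((sqX_param_le hq hqp i hs h0 h1).trans (by norm_num)) ?_
    rw [projY_param]
    linarith
  obtain ⟨h2, h3⟩ := h _ hball (fderiv ℝ (fun u => param i s (radiusW p q) u 0) u v)
  rw [coordsBilin_eq hq hqp g i hs x₀ h0]
  have h4 := norm_fderiv_param_sq_le i s _ hs hR hpos hx v
  have h5 := quadQ_le i s _ hs hR hpos hx v
  set m := ‖fderiv ℝ (fun u => param i s (radiusW p q) u 0) u v‖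
  set b := g.affine (Fin.last (n + k + 1)) (param i s (radiusW p q) u 0)
    (fderiv ℝ (fun u => param i s (radiusW p q) u 0) u v)
    (fderiv ℝ (fun u => param i s (radiusW p q) u 0) u v)
  have hQ : 0 ≤ quadQ i (radiusW p q) u v := by
    refine add_nonneg (Finset.sum_nonneg fun j _ => ?_) (sq_nonneg _)
    split_ifs <;> positivity
  have h6 : m ^ 2 ≤ C * b := by rwa [inv_mul_le_iff₀ hC] at h2
  have hb : 0 ≤ b := nonneg_of_mul_nonneg_right ((sq_nonneg m).trans h6) hC
  constructor
  · calc b ≤ C * m ^ 2 := h3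
      _ ≤ C * ((3 + 4 * (n + k)) ^ 2 * quadQ i (radiusW p q) u v) := by gcongr
      _ = (C * (3 + 4 * (n + k)) ^ 2) * quadQ i (radiusW p q) u v := by ring
      _ ≤ _ := by
        gcongr
        exact le_max_left _ _
  · calc quadQ i (radiusW p q) u v ≤ ((n + k + 1) * quadConst (n + k) ^ 2) * m ^ 2 := h5
      _ ≤ ((n + k + 1) * quadConst (n + k) ^ 2) * (C * b) := by gcongr
      _ = (((n + k + 1) * quadConst (n + k) ^ 2) * C) * b := by ring
      _ ≤ _ := by
        gcongr
        exact le_max_right _ _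

/-- The volume density. -/
def density (u : Fin (n + k) → ℝ) : ℝ :=
  Real.sqrt (bilinMatrix (coordsBilin hq hqp g i hs x₀ u)).det

theorem density_pos {u : Fin (n + k) → ℝ} (hu : coordY i u ≠ 0) :
    0 < density hq hqp g i hs x₀ u :=
  Real.sqrt_pos.2 (posDef_bilinMatrix (coordsBilin_symm hq hqp g i hs x₀ u)
    (coordsBilin_pos hq hqp g i hs x₀ hu)).det_pos

/-- Both |y|² and |y|² |∇R|² are at most R², which is at most twice |y|^{2q/p}. -/
theorem one_add_gradSq_le (hq : 0 < q) (hqp : q < p) {y : Fin (k + 1) → ℝ} (hy : y ≠ 0) (h1 : sqY y ≤ 1) :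
    (1 + gradSq (radiusW p q) y) * sqY y ≤ 4 * sqY y ^ (q / p : ℝ) := by
  have h2 := gradSq_radiusW_le hq hqp hy
  have h3 := sqY_le_radiusW_sq hq hqp hy
  have h4 := radiusW_sq_le hq hqp hy h1
  rw [le_div_iff₀ (sqY_pos hy)] at h2
  linarith

/-- The density has the order of R^{n-1} √(1 + |∇R|²), at most |y|^k |y|^{q/p-1}. The factor
|y|^{-2k} is the growth of the square norm of the pulled back form, so the product is bounded by the
weight |y|^{q/p-1-k}. -/
theorem exists_density_mul_le (h : p * k = q * (n - 1)) : ∃ C : ℝ, 0 ≤ C ∧ ∀ u ∈ box (k := k) i,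
    density hq hqp g i hs x₀ u * (sqY (coordY i u) ^ k)⁻¹ ≤
      C * sqY (coordY i u) ^ densityExp k p q := by
  obtain ⟨C, hC, hb⟩ := exists_coordsBilin_bounds hq hqp g i hs x₀
  refine ⟨Real.sqrt (C ^ (n + k) * 2 ^ (n - 1) * 4), Real.sqrt_nonneg _, fun u hu => ?_⟩
  obtain ⟨hx, h0, h1⟩ := id hu
  set y := coordY i u with hy
  have hspos := sqY_pos h0
  set t := sqY y ^ (q / p : ℝ) with ht
  set w := sqY y ^ densityExp k p q with hw
  have hw0 : 0 < w := Real.rpow_pos_of_pos hspos _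
  have ht0 : 0 < t := Real.rpow_pos_of_pos hspos _
  have h2 : (bilinMatrix (coordsBilin hq hqp g i hs x₀ u)).det ≤
      C ^ (n + k) * (quadMatrix i (radiusW p q) u).det :=
    det_bilinMatrix_le (coordsBilin_symm hq hqp g i hs x₀ u) (coordsBilin_pos hq hqp g i hs x₀ h0)
      (isHermitian_quadMatrix i _ u) fun v => by
        rw [dotProduct_quadMatrix]
        exact (hb u hu v).1
  rw [det_quadMatrix i _ (radiusW_pos y h0).ne'] at h2
  have h3 := one_add_gradSq_le hq hqp h0 h1
  have h4 : (radiusW p q y ^ 2) ^ (n - 1) ≤ 2 ^ (n - 1) * sqY y ^ k := by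
    rw [← rpow_div_pow_sub_one hqp h hspos.le, ← mul_pow]
    exact pow_le_pow_left₀ (sq_nonneg _) (radiusW_sq_le hq hqp h0 h1) _
  have h5 : w ^ 2 * sqY y ^ (k + 1) = t := rpow_densityExp_sq hspos
  have hγ := gradSq_nonneg (radiusW p q) y
  have h6 : (bilinMatrix (coordsBilin hq hqp g i hs x₀ u)).det ≤
      (C ^ (n + k) * 2 ^ (n - 1) * 4) * (w * sqY y ^ k) ^ 2 := by
    refine le_of_mul_le_mul_right ?_ hspos
    calc (bilinMatrix (coordsBilin hq hqp g i hs x₀ u)).det * sqY y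
        ≤ (C ^ (n + k) * ((radiusW p q y ^ 2) ^ (n - 1) * (1 + gradSq (radiusW p q) y))) * sqY y := by
          gcongr
      _ = C ^ (n + k) * ((radiusW p q y ^ 2) ^ (n - 1) * ((1 + gradSq (radiusW p q) y) * sqY y)) := by
          ring
      _ ≤ C ^ (n + k) * ((2 ^ (n - 1) * sqY y ^ k) * (4 * t)) := by gcongr
      _ = _ := by
          rw [← h5]
          ring
  have h7 : density hq hqp g i hs x₀ u ≤
      Real.sqrt (C ^ (n + k) * 2 ^ (n - 1) * 4) * (w * sqY y ^ k) := by
    rw [density]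
    refine (Real.sqrt_le_sqrt h6).trans_eq ?_
    rw [Real.sqrt_mul (by positivity), Real.sqrt_sq (by positivity)]
  rw [← div_eq_mul_inv, div_le_iff₀ (pow_pos hspos k)]
  linarith

/-- The dual estimate. The Gram determinant E of the y-directions is at most of order 1 + |∇R|²,
while the density D is at least of order |y|^k √(1 + |∇R|²). So E / D, which controls the square
norm of the dual form times the volume density, is bounded by the same weight. -/
theorem exists_detY_le (h : p * k = q * (n - 1)) : ∃ C : ℝ, 0 ≤ C ∧ ∀ u ∈ box (k := k) i,
    (bilinMatrix ((coordsBilin hq hqp g i hs x₀ u).bilinearComp (inclY i) (inclY i))).det ≤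
      C * sqY (coordY i u) ^ densityExp k p q * density hq hqp g i hs x₀ u := by
  obtain ⟨C, hC, hb⟩ := exists_coordsBilin_bounds hq hqp g i hs x₀
  refine ⟨Real.sqrt ((C ^ (k + 1)) ^ 2 * 4 * C ^ (n + k)), Real.sqrt_nonneg _, fun u hu => ?_⟩
  obtain ⟨hx, h0, h1⟩ := id hu
  set y := coordY i u with hy
  have hspos := sqY_pos h0
  set t := sqY y ^ (q / p : ℝ) with ht
  set w := sqY y ^ densityExp k p q with hw
  have hw0 : 0 < w := Real.rpow_pos_of_pos hspos _
  have ht0 : 0 < t := Real.rpow_pos_of_pos hspos _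
  set D := (bilinMatrix (coordsBilin hq hqp g i hs x₀ u)).det with hD
  set DY := (bilinMatrix ((coordsBilin hq hqp g i hs x₀ u).bilinearComp
    (inclY i) (inclY i))).det with hDY
  have h2 : (radiusW p q y ^ 2) ^ (n - 1) * (1 + gradSq (radiusW p q) y) ≤ C ^ (n + k) * D := by
    rw [← det_quadMatrix i _ (radiusW_pos y h0).ne']
    refine det_le_bilinMatrix (coordsBilin_symm hq hqp g i hs x₀ u)
      (coordsBilin_pos hq hqp g i hs x₀ h0) (isHermitian_quadMatrix i _ u) hC (fun v => ?_) fun v => ?_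
    · rw [dotProduct_quadMatrix]
      exact (hb u hu v).1
    · rw [dotProduct_quadMatrix]
      exact (hb u hu v).2
  have hinj : ∀ v : Fin (k + 1) → ℝ, v ≠ 0 → inclY (n := n) i v ≠ 0 := by
    intro v hv h
    have := coordY_inclY (n := n) i v
    rw [h, map_zero] at this
    exact hv this.symm
  have hsY : ∀ v w, (coordsBilin hq hqp g i hs x₀ u).bilinearComp (inclY i) (inclY i) v w =
      (coordsBilin hq hqp g i hs x₀ u).bilinearComp (inclY i) (inclY i) w v :=
    fun v w => coordsBilin_symm hq hqp g i hs x₀ u _ _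
  have hpY : ∀ v, v ≠ 0 → 0 <
      (coordsBilin hq hqp g i hs x₀ u).bilinearComp (inclY i) (inclY i) v v :=
    fun v hv => coordsBilin_pos hq hqp g i hs x₀ h0 _ (hinj v hv)
  have h3 : DY ≤ C ^ (k + 1) * (1 + gradSq (radiusW p q) y) := by
    have h4 := det_bilinMatrix_le (B := Matrix.diagonal (fun _ => 1) + Matrix.vecMulVec
      (fun l => fderiv ℝ (radiusW p q) y (Pi.single l 1))
      (fun l => fderiv ℝ (radiusW p q) y (Pi.single l 1))) hsY hpY ?_ (C := C) fun v => ?_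
    · rw [Matrix.det_diagonal_add_vecMulVec fun _ => one_ne_zero] at h4
      simpa [gradSq] using h4
    · refine (Matrix.isHermitian_diagonal _).add ?_
      ext a c
      simp [Matrix.conjTranspose_apply, Matrix.vecMulVec_apply, mul_comm]
    · refine ((hb u hu _).1).trans ?_
      gcongr
      exact quadQ_inclY_le i _ u v
  have hDY0 : 0 < DY := (posDef_bilinMatrix hsY hpY).det_pos
  have hγ := gradSq_nonneg (radiusW p q) y
  have h4 : sqY y ^ k ≤ (radiusW p q y ^ 2) ^ (n - 1) := by
    rw [← rpow_div_pow_sub_one hqp h hspos.le]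
    exact pow_le_pow_left₀ ht0.le (rpow_le_radiusW_sq hq hqp h0) _
  have h5 : w ^ 2 * sqY y ^ (k + 1) = t := rpow_densityExp_sq hspos
  have h6 := one_add_gradSq_le hq hqp h0 h1
  set γ := gradSq (radiusW p q) y
  have hD0 : 0 ≤ D := by
    have : 0 ≤ C ^ (n + k) * D := le_trans (by positivity) h2
    exact nonneg_of_mul_nonneg_right this (by positivity)
  -- One factor 1 + |∇R|² is turned into the weight, the other is absorbed by the determinant of the
  -- full metric.
  have h7 : DY ^ 2 ≤ ((C ^ (k + 1)) ^ 2 * 4 * C ^ (n + k)) * (w ^ 2 * D) := by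
    have h8 : (1 + γ) ≤ 4 * (w ^ 2 * sqY y ^ k) := by
      refine le_of_mul_le_mul_right ?_ hspos
      refine h6.trans_eq ?_
      rw [← ht, ← h5]
      ring
    calc DY ^ 2 ≤ (C ^ (k + 1) * (1 + γ)) ^ 2 := by gcongr
      _ = (C ^ (k + 1)) ^ 2 * ((1 + γ) * (1 + γ)) := by ring
      _ ≤ (C ^ (k + 1)) ^ 2 * (4 * (w ^ 2 * sqY y ^ k) * (1 + γ)) := by gcongr
      _ = (C ^ (k + 1)) ^ 2 * 4 * w ^ 2 * (sqY y ^ k * (1 + γ)) := by ring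
      _ ≤ (C ^ (k + 1)) ^ 2 * 4 * w ^ 2 * ((radiusW p q y ^ 2) ^ (n - 1) * (1 + γ)) := by gcongr
      _ ≤ (C ^ (k + 1)) ^ 2 * 4 * w ^ 2 * (C ^ (n + k) * D) := by gcongr
      _ = _ := by ring
  have h9 := Real.sqrt_le_sqrt h7
  rw [Real.sqrt_sq hDY0.le,
    Real.sqrt_mul (show 0 ≤ (C ^ (k + 1)) ^ 2 * 4 * C ^ (n + k) by positivity),
    Real.sqrt_mul (sq_nonneg w), Real.sqrt_sq hw0.le] at h9
  rw [density, mul_assoc]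
  exact h9

end Density

/-! ### Integrability -/

theorem integrable_indicator_abs_rpow {b : ℝ} (hb : b < 1) :
    Integrable (fun t : ℝ => (Icc (-2 : ℝ) 2).indicator (fun t => |t| ^ (-b)) t) := by
  rw [integrable_indicator_iff measurableSet_Icc, integrableOn_Icc_iff_integrableOn_Ioc,
    ← intervalIntegrable_iff_integrableOn_Ioc_of_le (by norm_num)]
  refine intervalIntegrable_of_even (fun x => by rw [abs_neg]) fun x hx => ?_
  refine (intervalIntegral.intervalIntegrable_rpow' (r := -b) (by linarith)).congr fun t ht => ?_
  rw [uIoc_of_le hx.le] at ht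
  rw [abs_of_pos ht.1]

theorem measurableSet_box (i : Fin n) : MeasurableSet (box (k := k) i) := by
  have h1 : MeasurableSet {u : Fin (n + k) → ℝ | ∀ j, IsX i j → |u j| ≤ 2} := by
    have : {u : Fin (n + k) → ℝ | ∀ j, IsX i j → |u j| ≤ 2} =
        ⋂ j, ⋂ (_ : IsX i j), {u : Fin (n + k) → ℝ | |u j| ≤ 2} := by
      ext u
      simp
    rw [this]
    exact MeasurableSet.iInter fun j => MeasurableSet.iInter fun _ =>
      (isClosed_le (by fun_prop) continuous_const).measurableSet
  have h2 : MeasurableSet {u : Fin (n + k) → ℝ | coordY i u ≠ 0} :=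
    (isOpen_ne_fun (coordY i).continuous continuous_const).measurableSet
  have h3 : MeasurableSet {u : Fin (n + k) → ℝ | sqY (coordY i u) ≤ 1} :=
    (isClosed_le (contDiff_sqY.continuous.comp (coordY i).continuous)
      continuous_const).measurableSet
  exact h1.inter (h2.inter h3)

/-- The weight |y|^{q/p-(k+1)} is integrable at the origin of ℝ^{k+1} since q/p > 0. Instead of
polar coordinates, the exponent is distributed evenly over the k + 1 coordinates: since |y| ≥ |y_l|,
the weight is bounded by a product of one-variable functions |y_l|^{-b} with b < 1. -/
theorem setLIntegral_box_lt_top (hq : 0 < q) (hqp : q < p) (i : Fin n) (C : ℝ) (hC : 0 ≤ C) :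
    ∫⁻ u in box (k := k) i, ENNReal.ofReal (C * sqY (coordY i u) ^ densityExp k p q) < ⊤ := by
  have hp : (0 : ℝ) < p := by
    have : 0 < p := by omega
    positivity
  have hq' : (0 : ℝ) < q := by positivity
  -- This is (k + 1 - q/p) / (k + 1), which is less than 1 because q/p > 0.
  set b : ℝ := -(2 * densityExp k p q) / (k + 1) with hb
  have hqp1 : (q : ℝ) / p < 1 := by
    rw [div_lt_one hp]
    exact_mod_cast hqp
  have hqp0 : 0 < (q : ℝ) / p := by positivity
  have hk : (0 : ℝ) ≤ k := by positivity
  have hb1 : b < 1 := by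
    rw [hb, div_lt_one (by positivity), densityExp]
    linarith
  have hb0 : 0 ≤ b := by
    rw [hb, densityExp]
    refine div_nonneg ?_ (by positivity)
    linarith
  let f : Fin (n + k) → ℝ → ℝ := fun j =>
    (Icc (-2 : ℝ) 2).indicator (fun t => |t| ^ (-(if IsX i j then 0 else b)))
  have hf : Integrable (fun u : Fin (n + k) → ℝ => ∏ j, f j (u j)) := by
    refine Integrable.fintype_prod fun j => ?_
    refine integrable_indicator_abs_rpow ?_
    split_ifs <;> linarith
  have hfin := (hf.const_mul C).lintegral_lt_top
  refine lt_of_le_of_lt ?_ hfin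
  refine (setLIntegral_mono_ae' (measurableSet_box i) ?_).trans (setLIntegral_le_lintegral _ _)
  -- On a coordinate hyperplane the power `0 ^ (-b)` is 0 and the bound would fail, but these
  -- hyperplanes are null sets.
  have hae : ∀ᵐ u : Fin (n + k) → ℝ, ∀ j, u j ≠ 0 :=
    ae_all_iff.2 fun j => Measure.ae_eval_ne _ j 0
  filter_upwards [hae] with u hu hbox
  obtain ⟨hx, h0, h1⟩ := hbox
  refine ENNReal.ofReal_le_ofReal (mul_le_mul_of_nonneg_left ?_ hC)
  have hspos := sqY_pos h0
  have hle : ∀ l, |u (iy i l)| ^ 2 ≤ sqY (coordY i u) := by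
    intro l
    rw [sq_abs]
    exact Finset.single_le_sum (f := fun l => coordY i u l ^ 2) (fun _ _ => sq_nonneg _)
      (Finset.mem_univ l)
  have hfj : ∀ j, f j (u j) = |u j| ^ (-(if IsX i j then 0 else b)) := by
    intro j
    refine indicator_of_mem ?_ _
    rw [mem_Icc, ← abs_le]
    by_cases hj : IsX i j
    · exact hx j hj
    · obtain ⟨l, rfl⟩ := exists_eq_iy i hj
      have := (hle l).trans h1
      nlinarith [abs_nonneg (u (iy i l))]
  have hprod : ∏ j, f j (u j) = ∏ l, |u (iy i l)| ^ (-b) := by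
    simp only [hfj]
    symm
    refine Fintype.prod_of_injective (iy i) (iy_injective i) _ _ (fun j hj => ?_) fun l => ?_
    · have : IsX i j := by
        by_contra h
        obtain ⟨l, rfl⟩ := exists_eq_iy i h
        exact hj ⟨l, rfl⟩
      rw [if_pos this, neg_zero, Real.rpow_zero]
    · rw [if_neg (not_isX_iy i l)]
  rw [hprod]
  calc sqY (coordY i u) ^ densityExp k p q
      = ∏ _l : Fin (k + 1), sqY (coordY i u) ^ (-b / 2) := by
        rw [Finset.prod_const, Finset.card_univ, Fintype.card_fin, ← Real.rpow_natCast,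
          ← Real.rpow_mul hspos.le]
        congr 1
        rw [hb]
        push_cast
        field_simp
    _ ≤ ∏ l, |u (iy i l)| ^ (-b) := by
        refine Finset.prod_le_prod (fun _ _ => Real.rpow_nonneg hspos.le _) fun l _ => ?_
        have hpos : 0 < |u (iy i l)| := abs_pos.2 (hu _)
        have h2 : |u (iy i l)| ^ (-b) = (|u (iy i l)| ^ 2) ^ (-b / 2) := by
          rw [← Real.rpow_natCast, ← Real.rpow_mul hpos.le]
          congr 1
          push_cast
          ring
        rw [h2]
        exact Real.rpow_le_rpow_of_nonpos (by positivity) (hle l) (by linarith)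

end GraphChart

end

/-! ### Square integrability: forms dual to multivectors and pullbacks under y. -/

noncomputable section

/-! ### Forms given by multivector fields in a chart -/

section ChartForm

variable {M : Type} [TopologicalSpace M] {d : ℕ} [ChartedSpace (Fin d → ℝ) M]
variable {g : MetricField M (d := d)} {b : M → (Fin d → ℝ) →L[ℝ] (Fin d → ℝ) →L[ℝ] ℝ}
variable {k : ℕ} {ι : Type} [Fintype ι]

open Classical in
/-- The form dual to the multivector field `∑ c_a X_a` in the chart `e`, extended by zero. -/
def chartForm (b : M → (Fin d → ℝ) →L[ℝ] (Fin d → ℝ) →L[ℝ] ℝ)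
    (e : OpenPartialHomeomorph M (Fin d → ℝ)) (c : ι → (Fin d → ℝ) → ℝ)
    (X : ι → Fin k → Fin d → ℝ) (x : M) : (Fin d → ℝ) [⋀^Fin k]→L[ℝ] ℝ :=
  if x ∈ e.source then
    ∑ a, c a (e x) • flatForm (b x) (fun l => symmDeriv e (e x) (X a l)) else 0

theorem chartForm_of_notMem {e : OpenPartialHomeomorph M (Fin d → ℝ)} {c : ι → (Fin d → ℝ) → ℝ}
    {X : ι → Fin k → Fin d → ℝ} {x : M} (hx : x ∉ e.source) : chartForm b e c X x = 0 := if_neg hx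

theorem chartForm_symm {e : OpenPartialHomeomorph M (Fin d → ℝ)} {c : ι → (Fin d → ℝ) → ℝ}
    {X : ι → Fin k → Fin d → ℝ} {u : Fin d → ℝ} (hu : u ∈ e.target) :
    chartForm b e c X (e.symm u) =
      ∑ a, c a u • flatForm (b (e.symm u)) (fun l => symmDeriv e u (X a l)) := by
  rw [chartForm, if_pos (e.map_target hu), e.right_inv hu]

theorem formInner_sum_right (g : MetricField M (d := d)) (x : M)
    (α : (Fin d → ℝ) [⋀^Fin k]→L[ℝ] ℝ) (β : ι → (Fin d → ℝ) [⋀^Fin k]→L[ℝ] ℝ) (s : Finset ι) :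
    formInner g x α (∑ a ∈ s, β a) = ∑ a ∈ s, formInner g x α (β a) := by
  let f : ((Fin d → ℝ) [⋀^Fin k]→L[ℝ] ℝ) →+ ℝ :=
    { toFun := fun γ => formInner g x α γ
      map_zero' := formInner_zero_right g x α
      map_add' := formInner_add_right g x α }
  exact map_sum f β s

/-- The scalar product with a dual form is the evaluation on the multivector, so the metric
disappears from the integrand. -/
theorem IsScalarProduct.formInner_chartForm (hg : IsScalarProduct g b)
    {e : OpenPartialHomeomorph M (Fin d → ℝ)} {c : ι → (Fin d → ℝ) → ℝ}
    {X : ι → Fin k → Fin d → ℝ} {u : Fin d → ℝ} (hu : u ∈ e.target) (φ : DiffForm M (d := d) k) :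
    formInner g (e.symm u) (φ (e.symm u)) (chartForm b e c X (e.symm u)) =
      ∑ a, c a u * φ.inChart e u (X a) := by
  rw [chartForm_symm hu]
  refine (formInner_sum_right g _ _ _ _).trans (Finset.sum_congr rfl fun a _ => ?_)
  refine (formInner_smul_right g _ _ _ _).trans ?_
  congr 1
  exact hg.formInner_flatForm _ _ _

theorem inChart_chartForm {e : OpenPartialHomeomorph M (Fin d → ℝ)} {c : ι → (Fin d → ℝ) → ℝ}
    {X : ι → Fin k → Fin d → ℝ} {u : Fin d → ℝ} (hu : u ∈ e.target) :
    DiffForm.inChart (d := d) e (chartForm b e c X) u =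
      ∑ a, c a u • flatForm (chartBilin b e u) (X a) := by
  ext w
  have h1 : DiffForm.inChart (d := d) e (chartForm b e c X) u w =
      chartForm b e c X (e.symm u) (fun l => symmDeriv e u (w l)) := rfl
  rw [h1, chartForm_symm hu]
  simp only [ContinuousAlternatingMap.sum_apply, ContinuousAlternatingMap.smul_apply]
  rfl

variable [IsManifold 𝓘(ℝ, Fin d → ℝ) ∞ M] [MeasurableSpace M] [BorelSpace M]

theorem IsScalarProduct.l2Inner_chartForm (hg : IsScalarProduct g b)
    {e : OpenPartialHomeomorph M (Fin d → ℝ)} (he : e ∈ atlas (Fin d → ℝ) M)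
    (hc : ContinuousOn (fun u => (chartGram g e u).det) e.target) (c : ι → (Fin d → ℝ) → ℝ)
    (X : ι → Fin k → Fin d → ℝ) (φ : DiffForm M (d := d) k) :
    l2Inner g φ (chartForm b e c X) =
      ∫ u in e.target, Real.sqrt (chartGram g e u).det * ∑ a, c a u * φ.inChart e u (X a) := by
  change ∫ x, formInner g x (φ x) (chartForm b e c X x) ∂(riemannianVolume g) = _
  rw [hg.integral_eq he hc]
  · exact setIntegral_congr_fun e.open_target.measurableSet fun u hu => by
      simp only [hg.formInner_chartForm hu]
  · intro x hx
    rw [chartForm_of_notMem hx]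
    exact formInner_zero_right g x _

theorem continuousOn_flatForm {A : Set (Fin d → ℝ)}
    {B : (Fin d → ℝ) → (Fin d → ℝ) →L[ℝ] (Fin d → ℝ) →L[ℝ] ℝ} (hB : ContinuousOn B A)
    (X : Fin k → Fin d → ℝ) : ContinuousOn (fun u => flatForm (B u) X) A := by
  have h1 : ContinuousOn (fun u => ContinuousLinearMap.pi fun i => B u (X i)) A := by
    rw [continuousOn_clm_apply]
    intro v
    refine continuousOn_pi.2 fun i => ?_
    exact (hB.clm_apply continuousOn_const).clm_apply continuousOn_const
  exact (ContDiffOn.alternating_compContinuousLinearMap (n := 0)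
    (w := fun _ => detForm k) contDiffOn_const (contDiffOn_zero.2 h1)).continuousOn

theorem continuousOn_bilinMatrix {A : Set (Fin d → ℝ)}
    {B : (Fin d → ℝ) → (Fin d → ℝ) →L[ℝ] (Fin d → ℝ) →L[ℝ] ℝ} (hB : ContinuousOn B A) :
    ContinuousOn (fun u => bilinMatrix (B u)) A :=
  continuousOn_pi.2 fun _ => continuousOn_pi.2 fun _ =>
    (hB.clm_apply continuousOn_const).clm_apply continuousOn_const

theorem IsScalarProduct.continuousOn_det_chartGram (hg : IsScalarProduct g b)
    {e : OpenPartialHomeomorph M (Fin d → ℝ)} (hB : ContinuousOn (chartBilin b e) e.target) :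
    ContinuousOn (fun u => (chartGram g e u).det) e.target := by
  simp only [hg.chartGram_eq]
  exact (continuous_id.matrix_det).comp_continuousOn (continuousOn_bilinMatrix hB)

theorem ofReal_formInner_self_eq_zero (g : MetricField M (d := d)) (x : M)
    {α : (Fin d → ℝ) [⋀^Fin k]→L[ℝ] ℝ} (hα : α = 0) : ENNReal.ofReal (formInner g x α α) = 0 := by
  subst hα
  exact (congrArg ENNReal.ofReal (formInner_zero_right g x 0)).trans ENNReal.ofReal_zero

/-- The pointwise square norm of a `chartForm`. -/
def chartFormSq (b : M → (Fin d → ℝ) →L[ℝ] (Fin d → ℝ) →L[ℝ] ℝ)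
    (e : OpenPartialHomeomorph M (Fin d → ℝ)) (c : ι → (Fin d → ℝ) → ℝ)
    (X : ι → Fin k → Fin d → ℝ) (u : Fin d → ℝ) : ℝ :=
  ∑ a, c a u * (∑ a', c a' u • flatForm (chartBilin b e u) (X a')) (X a)

theorem IsScalarProduct.memL2_chartForm (hg : IsScalarProduct g b)
    {e : OpenPartialHomeomorph M (Fin d → ℝ)} (he : e ∈ atlas (Fin d → ℝ) M)
    (hB : ContinuousOn (chartBilin b e) e.target) {c : ι → (Fin d → ℝ) → ℝ}
    (hcont : ∀ a, ContinuousOn (c a) e.target) {X : ι → Fin k → Fin d → ℝ}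
    (hfin : ∫⁻ u in e.target, ENNReal.ofReal (Real.sqrt (chartGram g e u).det *
      chartFormSq b e c X u) < ⊤) : MemL2 g (chartForm b e c X) := by
  refine ⟨fun e' he' => ?_, ?_⟩
  · refine DiffForm.aestronglyMeasurable_inChart he ?_ (fun x hx => chartForm_of_notMem hx) he'
    refine ContinuousOn.congr (f := fun u => ∑ a, c a u • flatForm (chartBilin b e u) (X a)) ?_
      fun u hu => inChart_chartForm hu
    exact continuousOn_finsetSum _ fun a _ => (hcont a).smul (continuousOn_flatForm hB (X a))
  · have h1 : ∫⁻ x, ENNReal.ofReal (formInner g x (chartForm b e c X x) (chartForm b e c X x))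
        ∂(riemannianVolume g) = ∫⁻ x in e.source,
        ENNReal.ofReal (formInner g x (chartForm b e c X x) (chartForm b e c X x))
        ∂(riemannianVolume g) := by
      refine (setLIntegral_eq_of_support_subset ?_).symm
      intro x hx
      by_contra hxe
      refine hx ?_
      exact ofReal_formInner_self_eq_zero g x (chartForm_of_notMem hxe)
    have h2 := hg.setLIntegral_eq he (hg.continuousOn_det_chartGram hB) fun x =>
      ENNReal.ofReal (formInner g x (chartForm b e c X x) (chartForm b e c X x))
    refine (h1.trans (h2.trans ?_)).trans_lt hfin
    refine setLIntegral_congr_fun e.open_target.measurableSet fun u hu => ?_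
    have h3 := hg.formInner_chartForm (c := c) (X := X) hu (chartForm b e c X)
    simp only [inChart_chartForm hu] at h3
    simp only [h3]
    exact (ENNReal.ofReal_mul (Real.sqrt_nonneg _)).symm

end ChartForm

/-! ### Square integrability of pullbacks near the singular point -/

namespace GraphChart

open RealProj

variable {n k p q : ℕ} (hq : 0 < q) (hqp : q < p)

theorem continuousOn_coordsBilin (g : RealProjMetric (n + k + 1)) (i : Fin n) {s : ℝ}
    (hs : s ^ 2 = 1) (x₀ : (regularPart (n := n) (k := k) hq hqp).carrier) :
    ContinuousOn (coordsBilin hq hqp g i hs x₀) (coords hq hqp i hs x₀).target :=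
  g.continuousOn_chartBilin_induced _ (Fin.last (n + k + 1)) (coords_mem_atlas hq hqp i hs x₀)
    fun _ hu => coords_symm_mem_finitePart hq hqp i hs x₀
      ((mem_coords_target hq hqp i hs x₀).1 hu)

theorem sqrt_det_chartGram (g : RealProjMetric (n + k + 1)) (i : Fin n) {s : ℝ}
    (hs : s ^ 2 = 1) (x₀ : (regularPart (n := n) (k := k) hq hqp).carrier) (u : Fin (n + k) → ℝ) :
    Real.sqrt (chartGram (g.induced (regularPart (n := n) (k := k) hq hqp))
      (coords hq hqp i hs x₀) u).det = density hq hqp g i hs x₀ u := by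
  rw [(g.isScalarProduct_induced _).chartGram_eq]
  rfl

theorem fderiv_mapY_coords (i : Fin n) {s : ℝ} (hs : s ^ 2 = 1)
    (x₀ : (regularPart (n := n) (k := k) hq hqp).carrier) {u : Fin (n + k) → ℝ}
    (hu : coordY i u ≠ 0) :
    fderiv ℝ (mapY hq hqp ∘ (coords hq hqp i hs x₀).symm) u = coordY i := by
  have h1 : (mapY hq hqp ∘ (coords hq hqp i hs x₀).symm) =ᶠ[𝓝 u] coordY i := by
    filter_upwards [(coordY i).continuous.continuousAt.eventually_ne hu] with u' hu'
    exact mapY_coords_symm hq hqp i hs x₀ hu'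
  rw [h1.fderiv_eq]
  exact (coordY i).fderiv

theorem manifoldDeriv_mapY (i : Fin n) {s : ℝ} (hs : s ^ 2 = 1)
    (x₀ : (regularPart (n := n) (k := k) hq hqp).carrier) {u : Fin (n + k) → ℝ}
    (hu : coordY i u ≠ 0) (v : Fin (n + k) → ℝ) :
    manifoldDeriv (mapY hq hqp) ((coords hq hqp i hs x₀).symm u)
      (symmDeriv (coords hq hqp i hs x₀) u v) = coordY i v := by
  have h1 := fderiv_comp_symm (coords_mem_atlas hq hqp i hs x₀)
    ((mem_coords_target hq hqp i hs x₀).2 hu)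
    (mdifferentiableAt_of_contMDiffOn (isOpen_finitePart hq hqp) (contMDiffOn_mapY hq hqp)
      (coords_symm_mem_finitePart hq hqp i hs x₀ hu))
  rw [fderiv_mapY_coords hq hqp i hs x₀ hu] at h1
  rw [h1]
  rfl

theorem pullback_mapY_inChart {j : ℕ} (w : (Fin (k + 1) → ℝ) → (Fin (k + 1) → ℝ) [⋀^Fin j]→L[ℝ] ℝ)
    (i : Fin n) {s : ℝ} (hs : s ^ 2 = 1)
    (x₀ : (regularPart (n := n) (k := k) hq hqp).carrier) {u : Fin (n + k) → ℝ}
    (hu : coordY i u ≠ 0) :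
    (pullbackForm (d := n + k) (mapY hq hqp) w).inChart (coords hq hqp i hs x₀) u =
      (w (coordY i u)).compContinuousLinearMap (coordY i) := by
  rw [pullbackForm_inChart (coords_mem_atlas hq hqp i hs x₀)
    ((mem_coords_target hq hqp i hs x₀).2 hu)
    (mdifferentiableAt_of_contMDiffOn (isOpen_finitePart hq hqp) (contMDiffOn_mapY hq hqp)
      (coords_symm_mem_finitePart hq hqp i hs x₀ hu)), fderiv_mapY_coords hq hqp i hs x₀ hu,
    Function.comp_apply, mapY_coords_symm hq hqp i hs x₀ hu]

/-- The projection to y does not increase lengths for the model form. Pulling back forms under y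
therefore costs only a constant. -/
theorem norm_coordY_sq_le (i : Fin n) (R : (Fin (k + 1) → ℝ) → ℝ) (u v : Fin (n + k) → ℝ) :
    ‖coordY i v‖ ^ 2 ≤ quadQ i R u v := by
  have h0 : ∀ j, 0 ≤ (if IsX i j then R (coordY i u) ^ 2 else 1) * v j ^ 2 := fun j => by
    split_ifs <;> positivity
  have hQ : 0 ≤ quadQ i R u v := add_nonneg (Finset.sum_nonneg fun j _ => h0 j) (sq_nonneg _)
  have h1 : ‖coordY i v‖ ≤ Real.sqrt (quadQ i R u v) := by
    rw [pi_norm_le_iff_of_nonneg (Real.sqrt_nonneg _)]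
    intro l
    refine Real.abs_le_sqrt ?_
    have h2 := Finset.single_le_sum (f := fun j => (if IsX i j then R (coordY i u) ^ 2 else 1) *
      v j ^ 2) (fun j _ => h0 j) (Finset.mem_univ (iy i l))
    simp only [if_neg (not_isX_iy i l), one_mul] at h2
    have h3 := sq_nonneg (fderiv ℝ R (coordY i u) (coordY i v))
    rw [quadQ]
    exact h2.trans (le_add_of_nonneg_right h3)
  calc ‖coordY i v‖ ^ 2 ≤ Real.sqrt (quadQ i R u v) ^ 2 := by gcongr
    _ = _ := Real.sq_sqrt hQ

theorem measurableSet_image_symm {M : Type} [TopologicalSpace M] {d : ℕ}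
    [ChartedSpace (Fin d → ℝ) M] [IsManifold 𝓘(ℝ, Fin d → ℝ) ∞ M] [MeasurableSpace M] [BorelSpace M]
    (e : OpenPartialHomeomorph M (Fin d → ℝ)) {A : Set (Fin d → ℝ)} (hA : MeasurableSet A) :
    MeasurableSet (e.source ∩ e ⁻¹' A) := by
  have h1 := (measurableEmbedding_chart_symm e).measurableSet_image.2
    (measurable_subtype_coe (p := (· ∈ e.target)) hA)
  convert h1 using 1
  ext x
  constructor
  · rintro ⟨hx, hxA⟩
    exact ⟨⟨e x, e.map_source hx⟩, hxA, e.left_inv hx⟩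
  · rintro ⟨⟨u, hu⟩, huA, rfl⟩
    exact ⟨e.map_target hu, by rw [mem_preimage, e.right_inv hu]; exact huA⟩

/-- The points in a graph chart whose coordinates lie in the box. -/
def boxPart (i : Fin n) {s : ℝ} (hs : s ^ 2 = 1)
    (x₀ : (regularPart (n := n) (k := k) hq hqp).carrier) :
    Set (regularPart (n := n) (k := k) hq hqp).carrier :=
  (coords hq hqp i hs x₀).source ∩ (coords hq hqp i hs x₀) ⁻¹' box i

theorem units_sq (ε : ℤˣ) : ((ε : ℤ) : ℝ) ^ 2 = 1 := by
  rcases Int.units_eq_one_or ε with rfl | rfl <;> norm_num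

/-- Taking i with |x_i| maximal gives |x_l / x_i| ≤ 1 for all l. Hence the 2n boxes, one for each i
and each sign, cover the part of W with |y| ≤ 1. -/
theorem exists_mem_boxPart (hn : 0 < n) (x₀ : (regularPart (n := n) (k := k) hq hqp).carrier)
    {x : (regularPart (n := n) (k := k) hq hqp).carrier} (hx : x ∈ finitePart hq hqp)
    (h1 : sqY (mapY hq hqp x) ≤ 1) :
    ∃ (i : Fin n) (ε : ℤˣ), x ∈ boxPart hq hqp i (units_sq ε) x₀ := by
  have : Nonempty (Fin n) := ⟨⟨0, hn⟩⟩
  set w := (regularPart (n := n) (k := k) hq hqp).affineMap (Fin.last (n + k + 1)) x with hw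
  obtain ⟨i, hi⟩ := Finite.exists_max fun i : Fin n => |w (ix i)|
  have hX : 0 < sqX w ^ p := by
    rw [hw, sqX_affineMap hq hqp hx]
    exact profileW_pos (mapY_ne_zero hq hqp hx)
  have hwi : w (ix i) ≠ 0 := by
    intro h0
    have h2 : sqX w = 0 := by
      refine Finset.sum_eq_zero fun l _ => ?_
      have := hi l
      rw [h0, abs_zero] at this
      rw [abs_nonpos_iff.1 this]
      norm_num
    rw [h2, zero_pow (hq.trans hqp).ne'] at hX
    exact lt_irrefl _ hX
  obtain ⟨ε, hε⟩ : ∃ ε : ℤˣ, 0 < ((ε : ℤ) : ℝ) * w (ix i) := by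
    rcases lt_or_gt_of_ne hwi with h | h
    · exact ⟨-1, by push_cast; linarith⟩
    · exact ⟨1, by push_cast; linarith⟩
  refine ⟨i, ε, (mem_coords_source hq hqp i (units_sq ε) x₀).2 ⟨hx, hε⟩, ?_⟩
  rw [mem_preimage, coords_apply]
  refine ⟨fun j hj => ?_, ?_, ?_⟩
  · rw [angular, if_pos hj, abs_div, div_le_iff₀ (abs_pos.2 hwi)]
    have h3 : (ix i).succAbove j = ix ⟨((ix (k := k) i).succAbove j : ℕ), hj⟩ := rfl
    have := hi ⟨((ix (k := k) i).succAbove j : ℕ), hj⟩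
    rw [← h3] at this
    refine this.trans ?_
    have := abs_nonneg (w (ix i))
    linarith
  · rw [coordY_angular]
    exact mapY_ne_zero hq hqp hx
  · rw [coordY_angular]
    exact h1

/-- Pullbacks of forms which grow at most like `|y|^(-k)` are square integrable. -/
theorem memL2_of_pullback (hn : 0 < n) (h : p * k = q * (n - 1)) (g : RealProjMetric (n + k + 1))
    {j : ℕ} {w : (Fin (k + 1) → ℝ) → (Fin (k + 1) → ℝ) [⋀^Fin j]→L[ℝ] ℝ}
    (hw : ContDiffOn ℝ ∞ w {0}ᶜ) (hw1 : ∀ y, 1 < sqY y → w y = 0) {C : ℝ}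
    (hwC : ∀ y, y ≠ 0 → ‖w y‖ ^ 2 ≤ C * (sqY y ^ k)⁻¹)
    {θ : DiffForm (regularPart (n := n) (k := k) hq hqp).carrier (d := n + k) j}
    (hθ : ∀ x ∈ finitePart hq hqp, θ x = pullbackForm (d := n + k) (mapY hq hqp) w x)
    (hθ0 : ∀ x ∉ finitePart hq hqp, θ x = 0) :
    MemL2 (g.induced (regularPart (n := n) (k := k) hq hqp)) θ := by
  have hg := g.isScalarProduct_induced (regularPart (n := n) (k := k) hq hqp)
  refine ⟨fun e he => ?_, ?_⟩
  · have hO : IsOpen (e.target ∩ e.symm ⁻¹' finitePart hq hqp) :=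
      e.isOpen_inter_preimage_symm (isOpen_finitePart hq hqp)
    have h1 := (contDiffOn_pullbackForm (isOpen_finitePart hq hqp) (contMDiffOn_mapY hq hqp)
      hw (fun x hx => mapY_ne_zero hq hqp hx) he).continuousOn
    have h3 : AEStronglyMeasurable ((e.target ∩ e.symm ⁻¹' finitePart hq hqp).indicator
        ((pullbackForm (d := n + k) (mapY hq hqp) w).inChart e))
        ((volume : Measure (Fin (n + k) → ℝ)).restrict e.target) := by
      rw [aestronglyMeasurable_indicator_iff hO.measurableSet, Measure.restrict_restrict
        hO.measurableSet]
      exact (h1.mono inter_subset_left).aestronglyMeasurable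
        (hO.inter e.open_target).measurableSet
    refine h3.congr ?_
    filter_upwards [ae_restrict_mem e.open_target.measurableSet] with u hu
    by_cases hx : e.symm u ∈ finitePart hq hqp
    · have hux : u ∈ e.target ∩ e.symm ⁻¹' finitePart hq hqp := ⟨hu, hx⟩
      rw [indicator_of_mem hux, DiffForm.inChart_eq, DiffForm.inChart_eq]
      have h4 : θ.toFun (e.symm u) = (pullbackForm (d := n + k) (mapY hq hqp) w).toFun (e.symm u) :=
        hθ _ hx
      rw [h4]
    · rw [indicator_of_notMem fun h => hx h.2, DiffForm.inChart_eq]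
      have h4 : θ.toFun (e.symm u) = 0 := hθ0 _ hx
      rw [h4]
      rfl
  · rcases isEmpty_or_nonempty (regularPart (n := n) (k := k) hq hqp).carrier with hem | hne
    · rw [Measure.eq_zero_of_isEmpty (riemannianVolume _), lintegral_zero_measure]
      exact ENNReal.zero_lt_top
    obtain ⟨x₀⟩ := hne
    set f : (regularPart (n := n) (k := k) hq hqp).carrier → ENNReal := fun x =>
      ENNReal.ofReal (formInner (g.induced (regularPart (n := n) (k := k) hq hqp)) x (θ x) (θ x))
      with hf
    have hzero : ∀ x, θ x = 0 → f x = 0 := by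
      intro x hx
      exact ofReal_formInner_self_eq_zero _ x hx
    -- The integrand lives on |y| ≤ 1, so finitely many boxes suffice.
    have hsupp : Function.support f ⊆ ⋃ a : Fin n × ℤˣ, boxPart hq hqp a.1 (units_sq a.2) x₀ := by
      intro x hx
      have hxf : x ∈ finitePart hq hqp := by
        by_contra hxf
        exact hx (hzero x (hθ0 x hxf))
      have hx1 : sqY (mapY hq hqp x) ≤ 1 := by
        by_contra hx1
        refine hx (hzero x ?_)
        rw [hθ x hxf, pullbackForm, hw1 _ (not_le.1 hx1)]
        rfl
      obtain ⟨i, ε, hm⟩ := exists_mem_boxPart hq hqp hn x₀ hxf hx1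
      exact mem_iUnion.2 ⟨(i, ε), hm⟩
    change ∫⁻ x, f x ∂(riemannianVolume _) < ⊤
    rw [← setLIntegral_eq_of_support_subset hsupp]
    refine (lintegral_iUnion_le _ _).trans_lt ?_
    rw [tsum_fintype]
    refine ENNReal.sum_lt_top.2 fun a _ => ?_
    obtain ⟨i, ε⟩ := a
    set e := coords hq hqp i (units_sq ε) x₀ with he
    have hea := coords_mem_atlas hq hqp i (units_sq ε) x₀
    have hbm : MeasurableSet (boxPart hq hqp i (units_sq ε) x₀) :=
      measurableSet_image_symm _ (measurableSet_box i)
    obtain ⟨C₁, hC₁, hb⟩ := exists_coordsBilin_bounds hq hqp g i (units_sq ε) x₀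
    obtain ⟨C₂, hC₂, hd⟩ := exists_density_mul_le hq hqp g i (units_sq ε) x₀ h
    set K : ℝ := ((n + k : ℕ) : ℝ) ^ j * C₁ ^ j * max C 0 with hK
    have hK0 : 0 ≤ K := by positivity
    have hbound : ∀ u ∈ box (k := k) i, density hq hqp g i (units_sq ε) x₀ u *
        formInner (g.induced (regularPart (n := n) (k := k) hq hqp)) (e.symm u)
          (θ (e.symm u)) (θ (e.symm u)) ≤ (K * C₂) * sqY (coordY i u) ^ densityExp k p q := by
      intro u hu
      have h0 := hu.2.1
      have hut := (mem_coords_target hq hqp i (units_sq ε) x₀).2 h0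
      have hxf := coords_symm_mem_finitePart hq hqp i (units_sq ε) x₀ h0
      -- Since y is Lipschitz for the metric up to the constant C₁, the square norm of the pullback
      -- is bounded by that of `w` on ℝ^{k+1}.
      have h1 : formInner (g.induced (regularPart (n := n) (k := k) hq hqp)) (e.symm u)
          (θ (e.symm u)) (θ (e.symm u)) ≤ K * (sqY (coordY i u) ^ k)⁻¹ := by
        rw [hθ _ hxf]
        refine (hg.formInner_eq (e.symm u) _ _).trans_le ?_
        refine (covectorInner_pullback_le (hg.symm _) (hg.pos _)
          (manifoldDeriv (mapY hq hqp) (e.symm u)) (K := C₁) (fun v => ?_)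
          (w (mapY hq hqp (e.symm u)))).trans ?_
        · have h2 : symmDeriv e u (chartDeriv e (e.symm u) v) = v := by
            have := DFunLike.congr_fun (symmDeriv_comp_chartDeriv hea (e.map_target hut)) v
            rw [← he, e.right_inv hut] at this
            exact this
          have h3 := (norm_coordY_sq_le i (radiusW p q) u (chartDeriv e (e.symm u) v)).trans
            (hb u hu _).2
          rw [← manifoldDeriv_mapY hq hqp i (units_sq ε) x₀ h0, ← he, h2] at h3
          refine h3.trans_eq ?_
          congr 1
          change g.inducedCLM _ (e.symm u) (symmDeriv e u (chartDeriv e (e.symm u) v))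
            (symmDeriv e u (chartDeriv e (e.symm u) v)) = _
          rw [h2]
        · rw [hK, mul_assoc (_ * _)]
          refine mul_le_mul_of_nonneg_left ?_ (by positivity)
          rw [he, mapY_coords_symm hq hqp i (units_sq ε) x₀ h0]
          refine (hwC _ h0).trans ?_
          have := sqY_pos h0
          gcongr
          exact le_max_left _ _
      have h2 := hd u hu
      have h3 := (density_pos hq hqp g i (units_sq ε) x₀ h0).le
      calc _ ≤ density hq hqp g i (units_sq ε) x₀ u * (K * (sqY (coordY i u) ^ k)⁻¹) := by gcongr
        _ = K * (density hq hqp g i (units_sq ε) x₀ u * (sqY (coordY i u) ^ k)⁻¹) := by ring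
        _ ≤ K * (C₂ * sqY (coordY i u) ^ densityExp k p q) := by gcongr
        _ = _ := by ring
    have h5 : ∫⁻ x in boxPart hq hqp i (units_sq ε) x₀, f x ∂(riemannianVolume
        (g.induced (regularPart (n := n) (k := k) hq hqp))) ≤
        ∫⁻ x in e.source, (boxPart hq hqp i (units_sq ε) x₀).indicator f x ∂(riemannianVolume
          (g.induced (regularPart (n := n) (k := k) hq hqp))) := by
      rw [setLIntegral_indicator hbm, inter_eq_self_of_subset_left]
      exact inter_subset_left
    refine h5.trans_lt ?_
    rw [hg.setLIntegral_eq hea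
      (hg.continuousOn_det_chartGram (continuousOn_coordsBilin hq hqp g i (units_sq ε) x₀))]
    refine lt_of_le_of_lt ?_ (setLIntegral_box_lt_top (k := k) hq hqp i (K * C₂) (by positivity))
    rw [← lintegral_indicator (measurableSet_box i)]
    refine (setLIntegral_mono_ae' e.open_target.measurableSet (Eventually.of_forall
      fun u hu => ?_)).trans (setLIntegral_le_lintegral e.target _)
    by_cases hub : u ∈ box (k := k) i
    · have hmem : e.symm u ∈ boxPart hq hqp i (units_sq ε) x₀ :=
        ⟨e.map_target hu, by rw [mem_preimage, ← he, e.right_inv hu]; exact hub⟩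
      rw [indicator_of_mem hmem, indicator_of_mem hub, sqrt_det_chartGram, hf,
        ← ENNReal.ofReal_mul (density_pos hq hqp g i (units_sq ε) x₀ hub.2.1).le]
      exact ENNReal.ofReal_le_ofReal (hbound u hub)
    · have hmem : e.symm u ∉ boxPart hq hqp i (units_sq ε) x₀ := fun hm => hub (by
        have := hm.2
        rwa [mem_preimage, ← he, e.right_inv hu] at this)
      rw [indicator_of_notMem hmem, mul_zero]
      exact bot_le

end GraphChart

end

/-! ### The form θ of degree k, closed near P. -/

noncomputable section

theorem extDeriv_zero_apply {E : Type} [NormedAddCommGroup E] [NormedSpace ℝ E] {k : ℕ} (x : E) :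
    extDeriv (fun _ : E => (0 : E [⋀^Fin k]→L[ℝ] ℝ)) x = 0 := by
  rw [extDeriv, fderiv_fun_const]
  exact map_zero (ContinuousAlternatingMap.alternatizeUncurryFinCLM ℝ E ℝ)

/-! ### Rotationally invariant forms of degree one less than the dimension -/

namespace GraphChart

variable {n k p q : ℕ}

/-- The form `ψ(|y|²) ι_y det`. -/
def radialForm (ψ : ℝ → ℝ) (y : Fin (k + 1) → ℝ) : (Fin (k + 1) → ℝ) [⋀^Fin k]→L[ℝ] ℝ :=
  ψ (sqY y) • (detForm (k + 1)).curryLeft y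

theorem radialForm_zero (ψ : ℝ → ℝ) : radialForm (k := k) ψ 0 = 0 := by
  rw [radialForm, map_zero, smul_zero]

theorem det_cons_single (y : Fin (k + 1) → ℝ) (a : Fin (k + 1)) :
    (Matrix.of (Matrix.vecCons y fun l : Fin k =>
      (Pi.single (a.succAbove l) 1 : Fin (k + 1) → ℝ))).det = (-1) ^ (a : ℕ) * y a := by
  rw [Matrix.det_succ_row_zero, Finset.sum_eq_single a]
  · have h1 : (Matrix.of (Matrix.vecCons y fun l : Fin k =>
        (Pi.single (a.succAbove l) 1 : Fin (k + 1) → ℝ))).submatrix Fin.succ a.succAbove = 1 := by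
      ext l c
      simp only [Matrix.submatrix_apply, Matrix.of_apply, Matrix.cons_val_succ, Matrix.one_apply,
        Pi.single_apply, Fin.succAbove_right_inj]
      simp only [eq_comm]
    rw [h1, Matrix.det_one, mul_one]
    rfl
  · intro j _ hj
    obtain ⟨c, hc⟩ := Fin.exists_succAbove_eq (x := a) (y := j) hj.symm
    rw [Matrix.det_eq_zero_of_column_eq_zero c, mul_zero]
    intro l
    simp only [Matrix.submatrix_apply, Matrix.of_apply, Matrix.cons_val_succ, hc]
    rw [Pi.single_apply, if_neg]
    exact (Fin.succAbove_ne a l).symm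
  · simp

theorem radialForm_apply_single (ψ : ℝ → ℝ) (y : Fin (k + 1) → ℝ) (a : Fin (k + 1)) :
    radialForm ψ y (fun l : Fin k => Pi.single (a.succAbove l) 1) =
      ψ (sqY y) * ((-1) ^ (a : ℕ) * y a) := by
  rw [← det_cons_single y a]
  rfl

theorem contDiffOn_radialForm {ψ : ℝ → ℝ} (hψ : ContDiffOn ℝ ∞ ψ (Ioi 0)) :
    ContDiffOn ℝ ∞ (radialForm (k := k) ψ) {0}ᶜ :=
  (hψ.comp contDiff_sqY.contDiffOn fun _ hy => sqY_pos hy).smul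
    (ContinuousLinearMap.contDiff _).contDiffOn

theorem norm_sq_le_sqY (y : Fin (k + 1) → ℝ) : ‖y‖ ^ 2 ≤ sqY y := by
  have h1 : ‖y‖ ≤ Real.sqrt (sqY y) := by
    rw [pi_norm_le_iff_of_nonneg (Real.sqrt_nonneg _)]
    exact fun l => Real.abs_le_sqrt (Finset.single_le_sum (f := fun l => y l ^ 2)
      (fun _ _ => sq_nonneg _) (Finset.mem_univ l))
  calc ‖y‖ ^ 2 ≤ Real.sqrt (sqY y) ^ 2 := by gcongr
    _ = _ := Real.sq_sqrt (sqY_nonneg y)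

theorem norm_radialForm_sq_le (ψ : ℝ → ℝ) (y : Fin (k + 1) → ℝ) :
    ‖radialForm ψ y‖ ^ 2 ≤ ‖(detForm (k + 1)).curryLeft‖ ^ 2 * (ψ (sqY y) ^ 2 * sqY y) := by
  have h1 := (detForm (k + 1)).curryLeft.le_opNorm y
  have h2 := norm_sq_le_sqY y
  rw [radialForm, norm_smul, mul_pow, Real.norm_eq_abs, sq_abs]
  calc ψ (sqY y) ^ 2 * ‖(detForm (k + 1)).curryLeft y‖ ^ 2
      ≤ ψ (sqY y) ^ 2 * (‖(detForm (k + 1)).curryLeft‖ * ‖y‖) ^ 2 := by gcongr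
    _ = ‖(detForm (k + 1)).curryLeft‖ ^ 2 * (ψ (sqY y) ^ 2 * ‖y‖ ^ 2) := by ring
    _ ≤ _ := by gcongr

/-- The standard basis of `ℝ^m`, as a tuple of vectors. -/
def stdTuple (m : ℕ) (l : Fin m) : Fin m → ℝ := Pi.single l 1

/-- A form of top degree vanishes if it vanishes on the standard basis. -/
theorem eq_zero_of_apply_stdTuple {m : ℕ} {α : (Fin m → ℝ) [⋀^Fin m]→L[ℝ] ℝ}
    (h : α (stdTuple m) = 0) : α = 0 := by
  have h1 := AlternatingMap.eq_smul_basis_det (Pi.basisFun ℝ (Fin m)) α.toAlternatingMap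
  have h2 : α.toAlternatingMap (Pi.basisFun ℝ (Fin m)) = 0 := by
    refine Eq.trans ?_ h
    change α (fun l => Pi.basisFun ℝ (Fin m) l) = _
    congr 1
    funext l
    exact Pi.basisFun_apply ℝ (Fin m) l
  rw [h2, zero_smul] at h1
  ext v
  exact DFunLike.congr_fun h1 v

/-- The form is the contraction of the volume form with the vector field ψ(|y|²) y, so its exterior
derivative is the divergence of that field. -/
theorem extDeriv_radialForm_apply {ψ : ℝ → ℝ} {c : ℝ} {y : Fin (k + 1) → ℝ}
    (hd : DifferentiableAt ℝ (radialForm (k := k) ψ) y) (hψ : HasDerivAt ψ c (sqY y)) :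
    extDeriv (radialForm ψ) y (stdTuple (k + 1)) = (k + 1) * ψ (sqY y) + 2 * sqY y * c := by
  rw [extDeriv_apply hd]
  have h1 : ∀ a : Fin (k + 1), (-1 : ℤ) ^ (a : ℕ) • fderiv ℝ (fun y : Fin (k + 1) → ℝ =>
      radialForm ψ y (a.removeNth (stdTuple (k + 1)))) y (stdTuple (k + 1) a) =
      ψ (sqY y) + 2 * y a ^ 2 * c := by
    intro a
    have h2 : (fun y : Fin (k + 1) → ℝ => radialForm ψ y (a.removeNth (stdTuple (k + 1)))) =
        fun y => ψ (sqY y) * ((-1) ^ (a : ℕ) * y a) :=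
      funext fun y => radialForm_apply_single ψ y a
    have h3 : HasFDerivAt (fun y : Fin (k + 1) → ℝ => (-1 : ℝ) ^ (a : ℕ) * y a)
        ((-1 : ℝ) ^ (a : ℕ) • ContinuousLinearMap.proj (R := ℝ) (φ := fun _ : Fin (k + 1) => ℝ) a)
        y := (ContinuousLinearMap.proj (R := ℝ) (φ := fun _ : Fin (k + 1) => ℝ) a).hasFDerivAt.const_mul _
    have h4 : HasFDerivAt (fun y => ψ (sqY y) * ((-1 : ℝ) ^ (a : ℕ) * y a)) _ y :=
      (hψ.comp_hasFDerivAt y (hasFDerivAt_sqY y)).mul h3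
    have h5 : ((-1 : ℝ) ^ (a : ℕ)) * (-1) ^ (a : ℕ) = 1 := by
      rw [← mul_pow]
      norm_num
    rw [h2, h4.fderiv, zsmul_eq_mul, Int.cast_pow, Int.cast_neg, Int.cast_one]
    simp only [stdTuple, add_apply, smul_apply, sum_apply, ContinuousLinearMap.proj_apply,
      smul_eq_mul, Function.comp_apply, Pi.single_apply]
    simp only [mul_ite, mul_one, mul_zero, Finset.sum_ite_eq', Finset.mem_univ, if_true]
    linear_combination (ψ (sqY y) + 2 * y a ^ 2 * c) * h5
  refine (Finset.sum_congr rfl fun a _ => h1 a).trans ?_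
  rw [Finset.sum_add_distrib, Finset.sum_const,
    Finset.card_univ, Fintype.card_fin, nsmul_eq_mul, ← Finset.sum_mul, ← Finset.mul_sum]
  push_cast
  rfl

/-! ### The profile functions -/

/-- A cutoff at `s = 1` of the function `s^(-(k+1)/2)`. -/
def innerProfile (k : ℕ) (s : ℝ) : ℝ :=
  Real.smoothTransition (2 - 2 * s) * s ^ (-((k : ℝ) + 1) / 2)

/-- A further cutoff at `s = δ`. -/
def cutProfile (k : ℕ) (δ s : ℝ) : ℝ := Real.smoothTransition (s / δ - 1) * innerProfile k s

theorem contDiffOn_innerProfile : ContDiffOn ℝ ∞ (innerProfile k) (Ioi 0) := by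
  refine ContDiffOn.mul ?_ ?_
  · exact (Real.smoothTransition.contDiff.comp (by fun_prop)).contDiffOn
  · exact fun s hs => (Real.contDiffAt_rpow_const_of_ne (ne_of_gt hs)).contDiffWithinAt

theorem contDiffOn_cutProfile (δ : ℝ) : ContDiffOn ℝ ∞ (cutProfile k δ) (Ioi 0) := by
  refine ContDiffOn.mul ?_ contDiffOn_innerProfile
  exact (Real.smoothTransition.contDiff.comp (by fun_prop)).contDiffOn

theorem innerProfile_of_one_le {s : ℝ} (hs : 1 ≤ s) : innerProfile k s = 0 := by
  rw [innerProfile, Real.smoothTransition.zero_of_nonpos (by linarith), zero_mul]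

theorem innerProfile_of_le_half {s : ℝ} (hs : s ≤ 1 / 2) :
    innerProfile k s = s ^ (-((k : ℝ) + 1) / 2) := by
  rw [innerProfile, Real.smoothTransition.one_of_one_le (by linarith), one_mul]

theorem cutProfile_of_le {δ s : ℝ} (hδ : 0 < δ) (hs : s ≤ δ) : cutProfile k δ s = 0 := by
  have : s / δ ≤ 1 := (div_le_one hδ).2 hs
  rw [cutProfile, Real.smoothTransition.zero_of_nonpos (by linarith), zero_mul]

theorem cutProfile_of_ge {δ s : ℝ} (hδ : 0 < δ) (hs : 2 * δ ≤ s) :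
    cutProfile k δ s = innerProfile k s := by
  have : 2 ≤ s / δ := (le_div_iff₀ hδ).2 hs
  rw [cutProfile, Real.smoothTransition.one_of_one_le (by linarith), one_mul]

/-- Without the cutoff this is an equality; it is the growth condition |y|^{-2k} required for square
integrability. -/
theorem innerProfile_sq_mul_le {s : ℝ} (hs : 0 < s) : innerProfile k s ^ 2 * s ≤ (s ^ k)⁻¹ := by
  have h1 : (s ^ (-((k : ℝ) + 1) / 2)) ^ 2 * s = (s ^ k)⁻¹ := by
    rw [← Real.rpow_natCast, ← Real.rpow_mul hs.le, ← Real.rpow_natCast s k,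
      ← Real.rpow_neg hs.le]
    conv_lhs => rw [← Real.rpow_one s, ← Real.rpow_mul hs.le, ← Real.rpow_add hs]
    congr 1
    push_cast
    ring
  have h2 := Real.smoothTransition.le_one (2 - 2 * s)
  have h3 := Real.smoothTransition.nonneg (2 - 2 * s)
  have h4 : Real.smoothTransition (2 - 2 * s) ^ 2 ≤ 1 := pow_le_one₀ h3 h2
  rw [innerProfile, mul_pow, mul_assoc, h1]
  exact mul_le_of_le_one_left (by positivity) h4

/-- The form `|y|^(-(k+1)) ι_y det` is closed. -/
theorem extDeriv_radialForm_innerProfile_eq_zero {y : Fin (k + 1) → ℝ} (hy : y ≠ 0)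
    (h1 : sqY y < 1 / 2) : extDeriv (radialForm (innerProfile k)) y = 0 := by
  have hs := sqY_pos hy
  refine eq_zero_of_apply_stdTuple ?_
  have hd : DifferentiableAt ℝ (radialForm (k := k) (innerProfile k)) y :=
    ((contDiffOn_radialForm contDiffOn_innerProfile).contDiffAt
      (isOpen_compl_singleton.mem_nhds hy)).differentiableAt (by simp)
  -- The power with exponent -(k+1)/2 is the solution of (k + 1) ψ + 2 s ψ' = 0.
  have h2 : HasDerivAt (fun s : ℝ => s ^ (-((k : ℝ) + 1) / 2))
      ((-((k : ℝ) + 1) / 2) * sqY y ^ (-((k : ℝ) + 1) / 2 - 1)) (sqY y) :=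
    Real.hasDerivAt_rpow_const (Or.inl hs.ne')
  have h3 : innerProfile k =ᶠ[𝓝 (sqY y)] fun s : ℝ => s ^ (-((k : ℝ) + 1) / 2) := by
    filter_upwards [gt_mem_nhds h1] with s hs
    exact innerProfile_of_le_half hs.le
  rw [extDeriv_radialForm_apply hd (h2.congr_of_eventuallyEq h3), innerProfile_of_le_half h1.le,
    Real.rpow_sub_one hs.ne']
  field_simp
  ring

theorem extDeriv_radialForm_of_one_lt {y : Fin (k + 1) → ℝ} (h1 : 1 < sqY y) :
    extDeriv (radialForm (innerProfile k)) y = 0 := by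
  have h2 : radialForm (k := k) (innerProfile k) =ᶠ[𝓝 y] fun _ => 0 := by
    filter_upwards [contDiff_sqY.continuous.continuousAt.eventually (lt_mem_nhds h1)] with y' hy'
    rw [radialForm, innerProfile_of_one_le hy'.le, zero_smul]
  rw [h2.extDeriv_eq]
  exact extDeriv_zero_apply y

theorem isCompact_sqY_annulus (a c : ℝ) :
    IsCompact {y : Fin (k + 1) → ℝ | a ≤ sqY y ∧ sqY y ≤ c} := by
  refine (isCompact_closedBall (0 : Fin (k + 1) → ℝ) (Real.sqrt c)).of_isClosed_subset ?_ ?_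
  · exact (isClosed_le continuous_const contDiff_sqY.continuous).inter
      (isClosed_le contDiff_sqY.continuous continuous_const)
  · rintro y ⟨-, hy⟩
    rw [mem_closedBall_zero_iff]
    refine (Real.abs_le_sqrt ((norm_sq_le_sqY y).trans hy)).trans_eq' ?_
    rw [abs_norm]

theorem contDiffOn_extDeriv_radialForm :
    ContDiffOn ℝ ∞ (extDeriv (radialForm (k := k) (innerProfile k))) {0}ᶜ := by
  have h1 := (contDiffOn_radialForm (k := k) (contDiffOn_innerProfile (k := k))).fderiv_of_isOpen
    (m := ∞) isOpen_compl_singleton (by simp)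
  exact (ContinuousAlternatingMap.alternatizeUncurryFinCLM ℝ (Fin (k + 1) → ℝ) ℝ).contDiff.comp_contDiffOn h1

/-- The derivative lives on the compact annulus 1/2 ≤ |y|² ≤ 1, where it is bounded and |y|^{-2k} is
at least 1. -/
theorem exists_norm_extDeriv_radialForm_le : ∃ C : ℝ, ∀ y : Fin (k + 1) → ℝ, y ≠ 0 →
    ‖extDeriv (radialForm (innerProfile k)) y‖ ^ 2 ≤ C * (sqY y ^ k)⁻¹ := by
  obtain ⟨C, hC⟩ := (isCompact_sqY_annulus (k := k) (1 / 2) 1).exists_bound_of_continuousOn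
    (f := extDeriv (radialForm (innerProfile k))) (contDiffOn_extDeriv_radialForm.continuousOn.mono
      fun y hy h0 => by
        have := hy.1
        rw [sqY_eq_zero_iff.2 h0] at this
        norm_num at this)
  refine ⟨C ^ 2, fun y hy => ?_⟩
  have hs := sqY_pos hy
  have hpos : 0 ≤ C ^ 2 * (sqY y ^ k)⁻¹ := by positivity
  rcases lt_or_ge (sqY y) (1 / 2) with h | h
  · rw [extDeriv_radialForm_innerProfile_eq_zero hy h, norm_zero]
    simpa using hpos
  rcases lt_or_ge 1 (sqY y) with h1 | h1
  · rw [extDeriv_radialForm_of_one_lt h1, norm_zero]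
    simpa using hpos
  · have h2 := hC y ⟨h, h1⟩
    have h3 : 1 ≤ (sqY y ^ k)⁻¹ := (one_le_inv₀ (by positivity)).2 (pow_le_one₀ hs.le h1)
    calc ‖extDeriv (radialForm (innerProfile k)) y‖ ^ 2 ≤ C ^ 2 := by gcongr
      _ ≤ C ^ 2 * (sqY y ^ k)⁻¹ := le_mul_of_one_le_right (sq_nonneg _) h3

end GraphChart

/-! ### Congruence for the exterior derivative and the scalar product -/

section Congr

variable {M : Type} [TopologicalSpace M] {d : ℕ} [ChartedSpace (Fin d → ℝ) M]
  {k : ℕ}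

theorem DiffForm.extD_zero (x : M) : DiffForm.extD (d := d) (k := k) (fun _ : M => 0) x = 0 := by
  have h1 : DiffForm.inChart (d := d) (k := k) (chartAt (Fin d → ℝ) x) (fun _ : M => 0) =
      fun _ => 0 := rfl
  have h2 : extDeriv (fun _ : Fin d → ℝ => (0 : (Fin d → ℝ) [⋀^Fin k]→L[ℝ] ℝ))
      (chartAt (Fin d → ℝ) x x) = 0 := extDeriv_zero_apply _
  unfold DiffForm.extD
  rw [h1, h2]
  rfl

theorem DiffForm.extD_eq_zero [IsManifold 𝓘(ℝ, Fin d → ℝ) ∞ M] {θ : DiffForm M (d := d) k} {x : M}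
    (h : ∀ᶠ y in 𝓝 x, θ y = 0) : θ.extD x = 0 :=
  (DiffForm.extD_congr (θ' := fun _ => 0) h).trans (DiffForm.extD_zero x)

theorem l2Inner_congr_left [MeasurableSpace M] (g : MetricField M (d := d))
    {θ θ' ψ : DiffForm M (d := d) k} (h : ∀ x, ψ x ≠ 0 → θ x = θ' x) :
    l2Inner g θ ψ = l2Inner g θ' ψ := by
  refine integral_congr_ae (Eventually.of_forall fun x => ?_)
  by_cases hx : ψ x = 0
  · have h1 : ∀ α : (Fin d → ℝ) [⋀^Fin k]→L[ℝ] ℝ, formInner g x α (ψ x) = 0 := by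
      intro α
      rw [hx]
      exact formInner_zero_right g x α
    exact (h1 _).trans (h1 _).symm
  · simp only [h x hx]

end Congr

/-! ### An element of the domain of `d_max` -/

namespace GraphChart

open RealProj

variable {n k p q : ℕ} (hq : 0 < q) (hqp : q < p)

/-- The pullback of a rotationally invariant form under `y`. -/
def radialPullback (ψ : ℝ → ℝ) :
    DiffForm (regularPart (n := n) (k := k) hq hqp).carrier (d := n + k) k :=
  pullbackForm (d := n + k) (mapY hq hqp) (radialForm ψ)

/-- Points with z = 0 are included: `mapY` has the default value 0 there, and `radialForm` vanishes
at 0 because of the factor y. -/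
theorem radialPullback_eq_zero {ψ : ℝ → ℝ} (hψ : ∀ s, 1 ≤ s → ψ s = 0)
    {x : (regularPart (n := n) (k := k) hq hqp).carrier}
    (hx : x ∈ finitePart hq hqp → 1 ≤ sqY (mapY hq hqp x)) :
    radialPullback hq hqp ψ x = 0 := by
  have h1 : radialForm ψ (mapY hq hqp x) = 0 := by
    by_cases hxf : x ∈ finitePart hq hqp
    · rw [radialForm, hψ _ (hx hxf), zero_smul]
    · rw [mapY_eq_zero hq hqp hxf, radialForm_zero]
  rw [radialPullback, pullbackForm, h1]
  rfl

theorem eventually_radialPullback_eq_zero {ψ : ℝ → ℝ} (hψ : ∀ s, 1 ≤ s → ψ s = 0)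
    {x : (regularPart (n := n) (k := k) hq hqp).carrier} (hx : x ∉ finitePart hq hqp) :
    ∀ᶠ y in 𝓝 x, radialPullback hq hqp ψ y = 0 := by
  filter_upwards [eventually_one_lt_sqY hq hqp hx] with y hy
  exact radialPullback_eq_zero hq hqp hψ fun h => (hy h).le

theorem extD_radialPullback {ψ : ℝ → ℝ} (hψ : ContDiffOn ℝ ∞ ψ (Ioi 0))
    {x : (regularPart (n := n) (k := k) hq hqp).carrier} (hx : x ∈ finitePart hq hqp) :
    (radialPullback hq hqp ψ).extD x =
      pullbackForm (d := n + k) (mapY hq hqp) (extDeriv (radialForm ψ)) x :=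
  extD_pullbackForm (isOpen_finitePart hq hqp) (contMDiffOn_mapY hq hqp) isOpen_compl_singleton
    (contDiffOn_radialForm hψ) (fun _ hx => mapY_ne_zero hq hqp hx) hx

theorem cutProfile_of_one_le {δ s : ℝ} (hs : 1 ≤ s) : cutProfile k δ s = 0 := by
  rw [cutProfile, innerProfile_of_one_le hs, mul_zero]

theorem isTest_radialPullback_cutProfile {δ : ℝ} (hδ : 0 < δ) :
    (radialPullback (n := n) (k := k) hq hqp (cutProfile k δ)).IsTest := by
  refine ⟨isSmooth_pullbackForm (isOpen_finitePart hq hqp) (contMDiffOn_mapY hq hqp)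
    (contDiffOn_radialForm (contDiffOn_cutProfile δ)) (fun _ hx => mapY_ne_zero hq hqp hx)
    fun x hx => eventually_radialPullback_eq_zero hq hqp (fun s hs => cutProfile_of_one_le hs) hx,
    ?_⟩
  refine (isCompact_annulus (n := n) (k := k) hq hqp hδ).closure_of_subset fun x hx => ?_
  have h0 : radialPullback (n := n) (k := k) hq hqp (cutProfile k δ) x ≠ 0 := hx
  refine ⟨?_, ?_, ?_⟩
  · by_contra hxf
    exact h0 (radialPullback_eq_zero hq hqp (fun s hs => cutProfile_of_one_le hs)
      fun h => absurd h hxf)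
  · by_contra hlt
    refine h0 ?_
    have h1 : radialForm (cutProfile k δ) (mapY hq hqp x) = 0 := by
      rw [radialForm, cutProfile_of_le hδ (not_le.1 hlt).le, zero_smul]
    rw [radialPullback, pullbackForm, h1]
    rfl
  · by_contra hlt
    exact h0 (radialPullback_eq_zero hq hqp (fun s hs => cutProfile_of_one_le hs)
      fun _ => (not_le.1 hlt).le)

/-- The test forms have compact support in W \ {P}. Near these supports θ coincides with a compactly
supported smooth form, for which the identity is the definition of the formal adjoint. Only square
integrability of θ and dθ is a condition at P. -/
theorem isDMax_radialPullback (hn : 0 < n) (h : p * k = q * (n - 1))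
    (g : RealProjMetric (n + k + 1)) :
    IsDMax (g.induced (regularPart (n := n) (k := k) hq hqp))
      (radialPullback hq hqp (innerProfile k)) (radialPullback hq hqp (innerProfile k)).extD := by
  have hψ1 : ∀ s : ℝ, 1 ≤ s → innerProfile k s = 0 := fun s hs => innerProfile_of_one_le hs
  refine ⟨?_, ?_, fun ψ χ hψχ => ?_⟩
  · refine memL2_of_pullback hq hqp hn h g (contDiffOn_radialForm contDiffOn_innerProfile)
      (C := ‖(detForm (k + 1)).curryLeft‖ ^ 2) (fun y hy => ?_) (fun y hy => ?_) (fun _ _ => rfl)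
      fun x hx => (eventually_radialPullback_eq_zero hq hqp hψ1 hx).self_of_nhds
    · rw [radialForm, innerProfile_of_one_le hy.le, zero_smul]
    · refine (norm_radialForm_sq_le _ y).trans ?_
      have := innerProfile_sq_mul_le (k := k) (sqY_pos hy)
      gcongr
  · obtain ⟨C, hC⟩ := exists_norm_extDeriv_radialForm_le (k := k)
    exact memL2_of_pullback hq hqp hn h g contDiffOn_extDeriv_radialForm
      (fun y hy => extDeriv_radialForm_of_one_lt hy) hC
      (fun x hx => extD_radialPullback hq hqp contDiffOn_innerProfile hx)
      fun x hx => DiffForm.extD_eq_zero (eventually_radialPullback_eq_zero hq hqp hψ1 hx)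
  · obtain ⟨⟨-, hψK⟩, ⟨-, hχK⟩, hadj⟩ := hψχ
    -- Both supports stay in the region |y|² > δ.
    obtain ⟨δ, hδ, hKδ⟩ := exists_le_sqY hq hqp (hψK.union hχK)
    have hev : ∀ x ∈ closure {x | ψ x ≠ 0} ∪ closure {x | χ x ≠ 0}, ∀ᶠ y in 𝓝 x,
        radialPullback hq hqp (innerProfile k) y =
          radialPullback hq hqp (cutProfile k (δ / 2)) y := by
      intro x hx
      filter_upwards [hKδ x hx] with y hy
      by_cases hyf : y ∈ finitePart hq hqp
      · have h1 : radialForm (innerProfile k) (mapY hq hqp y) =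
            radialForm (cutProfile k (δ / 2)) (mapY hq hqp y) := by
          rw [radialForm, radialForm, cutProfile_of_ge (by positivity)
            (by linarith [hy hyf])]
        rw [radialPullback, radialPullback, pullbackForm, pullbackForm, h1]
      · rw [radialPullback_eq_zero hq hqp hψ1 fun h => absurd h hyf,
          radialPullback_eq_zero hq hqp (fun s hs => cutProfile_of_one_le hs) fun h => absurd h hyf]
    -- The cutoff at δ/2 is complete at twice this value, so nothing changes for |y|² ≥ δ.
    have h1 := hadj _ (isTest_radialPullback_cutProfile hq hqp (half_pos hδ))
    rw [l2Inner_congr_left _ (θ' := (radialPullback hq hqp (cutProfile k (δ / 2))).extD)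
      fun x hx => DiffForm.extD_congr (hev x (Or.inl (subset_closure hx))), h1]
    exact (l2Inner_congr_left _ fun x hx => (hev x (Or.inr (subset_closure hx))).self_of_nhds).symm

end GraphChart

end

/-! ### The form η of degree k + 1, localised in a graph chart. -/

noncomputable section

namespace GraphChart

open RealProj

variable {n k p q : ℕ}

/-! ### Cutoff functions in a graph chart -/

/-- A cutoff in the variables other than `y`. -/
def cutU (i : Fin n) (u : Fin (n + k) → ℝ) : ℝ := Real.smoothTransition (2 - sqU i u)

/-- A cutoff between `1 / 4` and `1 / 2`. -/
def outerProfile (s : ℝ) : ℝ := Real.smoothTransition (2 - 4 * s)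

/-- The product of the two cutoffs. -/
def cutUY (i : Fin n) (u : Fin (n + k) → ℝ) : ℝ := cutU i u * outerProfile (sqY (coordY i u))

theorem contDiff_cutU (i : Fin n) : ContDiff ℝ ∞ (cutU (k := k) i) :=
  Real.smoothTransition.contDiff.comp (contDiff_const.sub (contDiff_sqU i))

theorem contDiff_outerProfile : ContDiff ℝ ∞ outerProfile :=
  Real.smoothTransition.contDiff.comp (by fun_prop)

theorem contDiff_sqY_coordY (i : Fin n) :
    ContDiff ℝ ∞ fun u : Fin (n + k) → ℝ => sqY (coordY i u) :=
  contDiff_sqY.comp (coordY i).contDiff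

theorem contDiff_cutUY (i : Fin n) : ContDiff ℝ ∞ (cutUY (k := k) i) :=
  (contDiff_cutU i).mul (contDiff_outerProfile.comp (contDiff_sqY_coordY i))

theorem cutU_eq_zero {i : Fin n} {u : Fin (n + k) → ℝ} (h : 2 ≤ sqU i u) : cutU i u = 0 :=
  Real.smoothTransition.zero_of_nonpos (by linarith)

theorem outerProfile_eq_zero {s : ℝ} (h : 1 / 2 ≤ s) : outerProfile s = 0 :=
  Real.smoothTransition.zero_of_nonpos (by linarith)

theorem outerProfile_eq_one {s : ℝ} (h : s ≤ 1 / 4) : outerProfile s = 1 :=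
  Real.smoothTransition.one_of_one_le (by linarith)

theorem cutUY_eq_zero_left {i : Fin n} {u : Fin (n + k) → ℝ} (h : 2 ≤ sqU i u) :
    cutUY i u = 0 := by
  rw [cutUY, cutU_eq_zero h, zero_mul]

theorem cutUY_eq_zero_right {i : Fin n} {u : Fin (n + k) → ℝ} (h : 1 / 2 ≤ sqY (coordY i u)) :
    cutUY i u = 0 := by
  rw [cutUY, outerProfile_eq_zero h, mul_zero]

theorem cutUY_sq_le_one (i : Fin n) (u : Fin (n + k) → ℝ) : cutUY i u ^ 2 ≤ 1 :=
  pow_le_one₀ (mul_nonneg (Real.smoothTransition.nonneg _) (Real.smoothTransition.nonneg _))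
    (mul_le_one₀ (Real.smoothTransition.le_one _) (Real.smoothTransition.nonneg _)
      (Real.smoothTransition.le_one _))

theorem continuous_deriv_outerProfile : Continuous (deriv outerProfile) :=
  contDiff_outerProfile.continuous_deriv (by simp)

theorem deriv_outerProfile_nonpos (s : ℝ) : deriv outerProfile s ≤ 0 :=
  Antitone.deriv_nonpos fun _ _ h => Real.smoothTransition.monotone (by linarith)

theorem deriv_outerProfile_of_lt {s : ℝ} (h : s < 1 / 4) : deriv outerProfile s = 0 := by
  have h1 : outerProfile =ᶠ[𝓝 s] fun _ => 1 := by
    filter_upwards [gt_mem_nhds h] with t ht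
    exact outerProfile_eq_one (le_of_lt ht)
  rw [h1.deriv_eq, deriv_const]

theorem deriv_outerProfile_of_gt {s : ℝ} (h : 1 / 2 < s) : deriv outerProfile s = 0 := by
  have h1 : outerProfile =ᶠ[𝓝 s] fun _ => 0 := by
    filter_upwards [lt_mem_nhds h] with t ht
    exact outerProfile_eq_zero (le_of_lt ht)
  rw [h1.deriv_eq, deriv_const]

theorem exists_deriv_outerProfile_ne_zero : ∃ s : ℝ, 0 < s ∧ s ≤ 1 / 2 ∧
    deriv outerProfile s ≠ 0 := by
  obtain ⟨s, hs, h⟩ := exists_deriv_eq_slope outerProfile (a := 1 / 4) (b := 1 / 2) (by norm_num)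
    contDiff_outerProfile.continuous.continuousOn
    (contDiff_outerProfile.differentiable (by simp)).differentiableOn
  refine ⟨s, by linarith [hs.1], hs.2.le, ?_⟩
  rw [h, outerProfile_eq_zero le_rfl, outerProfile_eq_one le_rfl]
  norm_num

theorem abs_le_two {i : Fin n} {u : Fin (n + k) → ℝ} (h : sqU i u ≤ 2) {j : Fin (n + k)}
    (hj : IsX i j) : |u j| ≤ 2 := by
  have h1 : u j ^ 2 ≤ 2 := by
    refine le_trans ?_ h
    have := Finset.single_le_sum (f := fun j => if IsX i j then u j ^ 2 else 0)
      (fun _ _ => by split_ifs <;> positivity) (Finset.mem_univ j)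
    rwa [if_pos hj] at this
  exact abs_le_of_sq_le_sq (by linarith) (by norm_num)

theorem mem_closedBall_two {i : Fin n} {u : Fin (n + k) → ℝ} (h : sqU i u ≤ 2)
    (h1 : sqY (coordY i u) ≤ 1) : u ∈ Metric.closedBall (0 : Fin (n + k) → ℝ) 2 := by
  rw [mem_closedBall_zero_iff, pi_norm_le_iff_of_nonneg (by norm_num)]
  intro j
  by_cases hj : IsX i j
  · exact abs_le_two h hj
  · obtain ⟨l, rfl⟩ := exists_eq_iy i hj
    have h2 : u (iy i l) ^ 2 ≤ sqY (coordY i u) :=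
      Finset.single_le_sum (f := fun l => coordY i u l ^ 2) (fun _ _ => sq_nonneg _)
        (Finset.mem_univ l)
    exact abs_le_of_sq_le_sq (by linarith) (by norm_num)

theorem mem_box_of_cutUY_ne_zero {i : Fin n} {u : Fin (n + k) → ℝ} (h0 : coordY i u ≠ 0)
    (h : cutUY i u ≠ 0) : u ∈ box i := by
  refine ⟨fun j hj => abs_le_two ?_ hj, h0, ?_⟩
  · by_contra h1
    exact h (cutUY_eq_zero_left (not_le.1 h1).le)
  · by_contra h1
    exact h (cutUY_eq_zero_right (by linarith [not_le.1 h1]))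

theorem fderiv_cutUY (i : Fin n) (u : Fin (n + k) → ℝ) (a : Fin (k + 1)) :
    fderiv ℝ (cutUY i) u (Pi.single (iy i a) 1) =
      cutU i u * (deriv outerProfile (sqY (coordY i u)) * (2 * u (iy i a))) := by
  have h1 : HasFDerivAt (cutU (k := k) i) _ u :=
    ((Real.smoothTransition.contDiff (n := 1)).differentiable (by simp) _).hasDerivAt.comp_hasFDerivAt
      u ((hasFDerivAt_sqU i u).const_sub 2)
  have h2 : HasFDerivAt (fun u : Fin (n + k) → ℝ => outerProfile (sqY (coordY i u))) _ u :=
    (contDiff_outerProfile.differentiable (by simp) _).hasDerivAt.comp_hasFDerivAt u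
      ((hasFDerivAt_sqY (coordY i u)).comp u (coordY i).hasFDerivAt)
  have h3 : HasFDerivAt (cutUY (k := k) i) _ u := h1.mul h2
  rw [h3.fderiv]
  simp only [add_apply, smul_apply, neg_apply, sum_apply, ContinuousLinearMap.proj_apply,
    ContinuousLinearMap.comp_apply, smul_eq_mul, coordY_single_iy]
  have h4 : ∑ j, (if IsX i j then 2 * u j else 0) * (Pi.single (iy i a) 1 : Fin (n + k) → ℝ) j = 0 :=
    Finset.sum_eq_zero fun j _ => by
      by_cases hj : IsX i j
      · have : j ≠ iy i a := by
          rintro rfl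
          exact not_isX_iy i a hj
        rw [Pi.single_eq_of_ne this, mul_zero]
      · rw [if_neg hj, zero_mul]
  have h5 : ∑ l, 2 * coordY i u l * (Pi.single a 1 : Fin (k + 1) → ℝ) l = 2 * u (iy i a) := by
    rw [Finset.sum_eq_single a]
    · rw [Pi.single_eq_same, mul_one, coordY_apply]
    · intro l _ hl
      rw [Pi.single_eq_of_ne hl, mul_zero]
    · simp
  rw [h4, h5]
  ring

end GraphChart

/-- The integral of a derivative of a compactly supported function vanishes. -/
theorem integral_fderiv_eq_zero {d : ℕ} {f : (Fin d → ℝ) → ℝ} (hf : ContDiff ℝ ∞ f)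
    (hc : HasCompactSupport f) (v : Fin d → ℝ) : ∫ u, fderiv ℝ f u v = 0 := by
  have hi : Integrable fun u => fderiv ℝ f u v := by
    refine Continuous.integrable_of_hasCompactSupport ?_ ?_
    · exact (hf.continuous_fderiv (by simp)).clm_apply continuous_const
    · exact (hc.fderiv (𝕜 := ℝ)).comp_left (g := fun L : (Fin d → ℝ) →L[ℝ] ℝ => L v) rfl
  have h := integral_mul_fderiv_eq_neg_fderiv_mul_of_integrable (μ := volume)
    (f := fun _ : Fin d → ℝ => (1 : ℝ)) (g := f) (v := v)
    (by simp) (by simpa using hi)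
    (by simpa using hf.continuous.integrable_of_hasCompactSupport hc)
    (fun _ _ => differentiableAt_const _) fun u _ => hf.differentiable (by simp) u
  simpa using h

namespace GraphChart

variable {n k p q : ℕ}

/-! ### An element of the domain of `d^t_max` -/

/-- The basis of the `y`-directions. -/
def tupleY (i : Fin n) (_ : Unit) (l : Fin (k + 1)) : Fin (n + k) → ℝ := Pi.single (iy i l) 1

/-- The basis of the `y`-directions without one element. -/
def tupleYRemove (i : Fin n) (a : Fin (k + 1)) (l : Fin k) : Fin (n + k) → ℝ :=
  Pi.single (iy i (a.succAbove l)) 1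

/-- The divergence of the multivector field `cutUY • ∂y`. -/
def divCoeff (i : Fin n) (a : Fin (k + 1)) (u : Fin (n + k) → ℝ) : ℝ :=
  -((-1) ^ (a : ℕ) * (cutU i u * (deriv outerProfile (sqY (coordY i u)) * (2 * u (iy i a)))))

theorem continuous_divCoeff (i : Fin n) (a : Fin (k + 1)) : Continuous (divCoeff (k := k) i a) := by
  have h1 := (contDiff_cutU (k := k) i).continuous
  have h2 := continuous_deriv_outerProfile.comp (contDiff_sqY_coordY (k := k) i).continuous
  have h3 : Continuous fun u : Fin (n + k) → ℝ => u (iy i a) := by fun_prop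
  exact (continuous_const.mul (h1.mul (h2.mul (continuous_const.mul h3)))).neg

/-- A compact set that contains the support of `divCoeff`. -/
def divSupport (k : ℕ) (i : Fin n) : Set (Fin (n + k) → ℝ) :=
  {u | sqU i u ≤ 2 ∧ 1 / 4 ≤ sqY (coordY i u) ∧ sqY (coordY i u) ≤ 1 / 2}

theorem isCompact_divSupport (i : Fin n) : IsCompact (divSupport k i) := by
  refine (isCompact_closedBall (0 : Fin (n + k) → ℝ) 2).of_isClosed_subset ?_ ?_
  · have h1 := (contDiff_sqY_coordY (k := k) i).continuous
    exact (isClosed_le (contDiff_sqU i).continuous continuous_const).inter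
      ((isClosed_le continuous_const h1).inter (isClosed_le h1 continuous_const))
  · exact fun u hu => mem_closedBall_two hu.1 (by linarith [hu.2.2])

theorem divCoeff_eq_zero {i : Fin n} {a : Fin (k + 1)} {u : Fin (n + k) → ℝ}
    (hu : u ∉ divSupport k i) : divCoeff i a u = 0 := by
  rw [divCoeff]
  by_cases h1 : sqU i u ≤ 2
  · have h2 : deriv outerProfile (sqY (coordY i u)) = 0 := by
      by_cases h3 : 1 / 4 ≤ sqY (coordY i u)
      · exact deriv_outerProfile_of_gt (not_le.1 fun h4 => hu ⟨h1, h3, h4⟩)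
      · exact deriv_outerProfile_of_lt (not_le.1 h3)
    rw [h2]
    ring
  · rw [cutU_eq_zero (not_le.1 h1).le]
    ring

section Forms

variable (hq : 0 < q) (hqp : q < p) (g : RealProjMetric (n + k + 1)) (i : Fin n) {s : ℝ}
  (hs : s ^ 2 = 1) (x₀ : (regularPart (n := n) (k := k) hq hqp).carrier)

/-- The form dual to the multivector field `cutUY • ∂y`. -/
def coForm : DiffForm (regularPart (n := n) (k := k) hq hqp).carrier (d := n + k) (k + 1) :=
  chartForm (g.inducedCLM (regularPart (n := n) (k := k) hq hqp)) (coords hq hqp i hs x₀)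
    (fun _ u => cutUY i u / density hq hqp g i hs x₀ u) (tupleY i)

/-- The codifferential of `coForm`. -/
def codiffForm : DiffForm (regularPart (n := n) (k := k) hq hqp).carrier (d := n + k) k :=
  chartForm (g.inducedCLM (regularPart (n := n) (k := k) hq hqp)) (coords hq hqp i hs x₀)
    (fun a u => divCoeff i a u / density hq hqp g i hs x₀ u) (tupleYRemove i)

theorem continuousOn_density :
    ContinuousOn (density hq hqp g i hs x₀) (coords hq hqp i hs x₀).target :=
  Real.continuous_sqrt.comp_continuousOn (continuous_id.matrix_det.comp_continuousOn
    (continuousOn_bilinMatrix (continuousOn_coordsBilin hq hqp g i hs x₀)))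

theorem continuousOn_div_density {f : (Fin (n + k) → ℝ) → ℝ} (hf : Continuous f) :
    ContinuousOn (fun u => f u / density hq hqp g i hs x₀ u) (coords hq hqp i hs x₀).target :=
  hf.continuousOn.div (continuousOn_density hq hqp g i hs x₀) fun _ hu =>
    (density_pos hq hqp g i hs x₀ ((mem_coords_target hq hqp i hs x₀).1 hu)).ne'

/-- Division of the coefficients by the density cancels the volume element: the pairing is a
Lebesgue integral in which the metric no longer occurs. -/
theorem l2Inner_chartForm_div {j : ℕ} {ι : Type} [Fintype ι] (c : ι → (Fin (n + k) → ℝ) → ℝ)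
    (X : ι → Fin j → Fin (n + k) → ℝ)
    (φ : DiffForm (regularPart (n := n) (k := k) hq hqp).carrier (d := n + k) j) :
    l2Inner (g.induced (regularPart (n := n) (k := k) hq hqp)) φ
      (chartForm (g.inducedCLM (regularPart (n := n) (k := k) hq hqp)) (coords hq hqp i hs x₀)
        (fun a u => c a u / density hq hqp g i hs x₀ u) X) =
      ∫ u in (coords hq hqp i hs x₀).target,
        ∑ a, c a u * φ.inChart (coords hq hqp i hs x₀) u (X a) := by
  have hg := g.isScalarProduct_induced (regularPart (n := n) (k := k) hq hqp)
  refine (hg.l2Inner_chartForm (coords_mem_atlas hq hqp i hs x₀)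
    (hg.continuousOn_det_chartGram (continuousOn_coordsBilin hq hqp g i hs x₀)) _ X φ).trans ?_
  refine setIntegral_congr_fun (coords hq hqp i hs x₀).open_target.measurableSet fun u hu => ?_
  have h1 := (density_pos hq hqp g i hs x₀ ((mem_coords_target hq hqp i hs x₀).1 hu)).ne'
  simp only [sqrt_det_chartGram, Finset.mul_sum]
  refine Finset.sum_congr rfl fun a _ => ?_
  rw [← mul_assoc, mul_div_cancel₀ _ h1]

theorem flatForm_tupleY (u : Fin (n + k) → ℝ) :
    flatForm (coordsBilin hq hqp g i hs x₀ u) (tupleY i ()) (tupleY i ()) =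
      (bilinMatrix ((coordsBilin hq hqp g i hs x₀ u).bilinearComp (inclY i) (inclY i))).det := by
  rw [flatForm_apply]
  congr 1
  ext a c
  simp only [Matrix.of_apply, bilinMatrix, ContinuousLinearMap.bilinearComp_apply, inclY_single]
  exact coordsBilin_symm hq hqp g i hs x₀ u _ _

/-- With D the density and E the Gram determinant of the y-directions, the integrand is cutUY² E /
D, which `exists_detY_le` bounds by the integrable weight. -/
theorem memL2_coForm (h : p * k = q * (n - 1)) :
    MemL2 (g.induced (regularPart (n := n) (k := k) hq hqp)) (coForm hq hqp g i hs x₀) := by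
  have hg := g.isScalarProduct_induced (regularPart (n := n) (k := k) hq hqp)
  refine hg.memL2_chartForm (coords_mem_atlas hq hqp i hs x₀)
    (continuousOn_coordsBilin hq hqp g i hs x₀)
    (fun _ => continuousOn_div_density hq hqp g i hs x₀ (contDiff_cutUY i).continuous) ?_
  obtain ⟨C, hC, hd⟩ := exists_detY_le hq hqp g i hs x₀ h
  refine lt_of_le_of_lt ?_ (setLIntegral_box_lt_top (k := k) hq hqp i C hC)
  rw [← lintegral_indicator (measurableSet_box i)]
  refine (setLIntegral_mono_ae' (coords hq hqp i hs x₀).open_target.measurableSet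
    (Eventually.of_forall fun u hu => ?_)).trans (setLIntegral_le_lintegral _ _)
  have h0 := (mem_coords_target hq hqp i hs x₀).1 hu
  have hpos := density_pos hq hqp g i hs x₀ h0
  have h1 : chartFormSq (g.inducedCLM (regularPart (n := n) (k := k) hq hqp))
      (coords hq hqp i hs x₀) (fun (_ : Unit) u => cutUY i u / density hq hqp g i hs x₀ u)
      (tupleY i) u = cutUY i u / density hq hqp g i hs x₀ u *
        (cutUY i u / density hq hqp g i hs x₀ u * flatForm (coordsBilin hq hqp g i hs x₀ u)
          (tupleY i ()) (tupleY i ())) := by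
    rw [chartFormSq, Fintype.sum_unique, Fintype.sum_unique]
    rfl
  rw [h1, sqrt_det_chartGram, flatForm_tupleY]
  by_cases hc : cutUY i u = 0
  · rw [hc]
    simp
  have hb := mem_box_of_cutUY_ne_zero h0 hc
  rw [indicator_of_mem hb]
  refine ENNReal.ofReal_le_ofReal ?_
  have h2 := hd u hb
  set D := density hq hqp g i hs x₀ u
  set E := (bilinMatrix ((coordsBilin hq hqp g i hs x₀ u).bilinearComp (inclY i) (inclY i))).det
  have hw := Real.rpow_nonneg (sqY_nonneg (coordY i u)) (densityExp k p q)
  calc D * (cutUY i u / D * (cutUY i u / D * E)) = cutUY i u ^ 2 * (E / D) := by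
        field_simp
    _ ≤ cutUY i u ^ 2 * (C * sqY (coordY i u) ^ densityExp k p q) := by
        gcongr
        exact (div_le_iff₀ hpos).2 h2
    _ ≤ C * sqY (coordY i u) ^ densityExp k p q :=
        mul_le_of_le_one_left (by positivity) (cutUY_sq_le_one i u)

theorem divSupport_subset_target : divSupport k i ⊆ (coords hq hqp i hs x₀).target := fun u hu =>
  (mem_coords_target hq hqp i hs x₀).2 fun h0 => by
    have := hu.2.1
    rw [h0, sqY_eq_zero_iff.2 rfl] at this
    norm_num at this

/-- No estimate at P is needed. The coefficients involve the derivative of the cutoff in |y|, hence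
are supported in a compact subset of the chart where |y|² ≥ 1/4. -/
theorem memL2_codiffForm :
    MemL2 (g.induced (regularPart (n := n) (k := k) hq hqp)) (codiffForm hq hqp g i hs x₀) := by
  have hg := g.isScalarProduct_induced (regularPart (n := n) (k := k) hq hqp)
  have hB := continuousOn_coordsBilin hq hqp g i hs x₀
  have hc : ∀ a, ContinuousOn (fun u => divCoeff i a u / density hq hqp g i hs x₀ u)
      (coords hq hqp i hs x₀).target :=
    fun a => continuousOn_div_density hq hqp g i hs x₀ (continuous_divCoeff i a)
  refine hg.memL2_chartForm (coords_mem_atlas hq hqp i hs x₀) hB hc ?_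
  simp only [sqrt_det_chartGram]
  set F : (Fin (n + k) → ℝ) → ℝ := fun u => density hq hqp g i hs x₀ u *
    chartFormSq (g.inducedCLM (regularPart (n := n) (k := k) hq hqp)) (coords hq hqp i hs x₀)
      (fun a u => divCoeff i a u / density hq hqp g i hs x₀ u) (tupleYRemove i) u with hF
  have hcont : ContinuousOn F (coords hq hqp i hs x₀).target := by
    refine (continuousOn_density hq hqp g i hs x₀).mul
      (continuousOn_finsetSum _ fun a _ => (hc a).mul ?_)
    have h1 : ContinuousOn (fun u => ∑ a', (divCoeff i a' u / density hq hqp g i hs x₀ u) •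
        flatForm (chartBilin (g.inducedCLM (regularPart (n := n) (k := k) hq hqp))
          (coords hq hqp i hs x₀) u) (tupleYRemove i a')) (coords hq hqp i hs x₀).target :=
      continuousOn_finsetSum _ fun a' _ => (hc a').smul (continuousOn_flatForm hB _)
    exact (ContinuousAlternatingMap.apply ℝ (Fin (n + k) → ℝ) ℝ (tupleYRemove i a)).continuous.comp_continuousOn h1
  have hint := (hcont.mono (divSupport_subset_target hq hqp i hs x₀)).integrableOn_compact (isCompact_divSupport i) (μ := volume)
  refine lt_of_le_of_lt ?_ hint.lintegral_lt_top
  rw [← lintegral_indicator (isCompact_divSupport i).isClosed.measurableSet]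
  refine (setLIntegral_mono_ae' (coords hq hqp i hs x₀).open_target.measurableSet
    (Eventually.of_forall fun u hu => ?_)).trans (setLIntegral_le_lintegral _ _)
  by_cases hm : u ∈ divSupport k i
  · rw [indicator_of_mem hm]
  · have h1 : F u = 0 := by
      rw [hF]
      simp only [chartFormSq, divCoeff_eq_zero hm, zero_div, zero_mul, Finset.sum_const_zero,
        mul_zero]
    change ENNReal.ofReal (F u) ≤ _
    rw [h1, ENNReal.ofReal_zero]
    exact bot_le

end Forms

end GraphChart

end

/-! ### Integration by parts and the violation of the Stokes identity. -/

noncomputable section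

namespace GraphChart

open RealProj

variable {n k p q : ℕ}

section Adjoint

variable (hq : 0 < q) (hqp : q < p) (g : RealProjMetric (n + k + 1)) (i : Fin n) {s : ℝ}
  (hs : s ^ 2 = 1) (x₀ : (regularPart (n := n) (k := k) hq hqp).carrier)

/-- A coefficient of `cutUY • φ` in the coordinates, extended by zero. -/
def testCoeff (φ : DiffForm (regularPart (n := n) (k := k) hq hqp).carrier (d := n + k) k)
    (a : Fin (k + 1)) : (Fin (n + k) → ℝ) → ℝ :=
  (coords hq hqp i hs x₀).target.indicator fun u =>
    cutUY i u * φ.inChart (coords hq hqp i hs x₀) u (tupleYRemove i a)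

/-- A compact subset of W \ {P} stays away from y = 0, the only boundary of the coordinate domain at
finite distance. -/
theorem inChart_eq_zero_of_isTest
    {φ : DiffForm (regularPart (n := n) (k := k) hq hqp).carrier (d := n + k) k} (hφ : φ.IsTest) :
    ∃ δ > 0, ∀ u ∈ (coords hq hqp i hs x₀).target, sqY (coordY i u) < δ →
      φ.inChart (coords hq hqp i hs x₀) u = 0 := by
  obtain ⟨δ, hδ, h⟩ := exists_le_sqY hq hqp hφ.2
  refine ⟨δ, hδ, fun u hu hlt => ?_⟩
  have h0 := (mem_coords_target hq hqp i hs x₀).1 hu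
  have h1 : φ.toFun ((coords hq hqp i hs x₀).symm u) = 0 := by
    by_contra hne
    have h2 := (h _ (subset_closure hne)).self_of_nhds
      (coords_symm_mem_finitePart hq hqp i hs x₀ h0)
    rw [mapY_coords_symm hq hqp i hs x₀ h0] at h2
    exact lt_asymm h2 hlt
  rw [DiffForm.inChart_eq, h1]
  rfl

theorem eventually_mem_target {u : Fin (n + k) → ℝ} (hu : u ∈ (coords hq hqp i hs x₀).target) :
    ∀ᶠ u' in 𝓝 u, u' ∈ (coords hq hqp i hs x₀).target :=
  (coords hq hqp i hs x₀).open_target.mem_nhds hu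

theorem testCoeff_eventuallyEq
    (φ : DiffForm (regularPart (n := n) (k := k) hq hqp).carrier (d := n + k) k)
    (a : Fin (k + 1)) {u : Fin (n + k) → ℝ} (hu : u ∈ (coords hq hqp i hs x₀).target) :
    testCoeff hq hqp i hs x₀ φ a =ᶠ[𝓝 u] fun u =>
      cutUY i u * φ.inChart (coords hq hqp i hs x₀) u (tupleYRemove i a) := by
  filter_upwards [eventually_mem_target hq hqp i hs x₀ hu] with u' hu'
  exact indicator_of_mem hu' _

theorem contDiffAt_inChart_apply
    {φ : DiffForm (regularPart (n := n) (k := k) hq hqp).carrier (d := n + k) k} (hφ : φ.IsTest)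
    (X : Fin k → Fin (n + k) → ℝ) {u : Fin (n + k) → ℝ}
    (hu : u ∈ (coords hq hqp i hs x₀).target) :
    ContDiffAt ℝ ∞ (fun u => φ.inChart (coords hq hqp i hs x₀) u X) u :=
  (ContinuousAlternatingMap.apply ℝ (Fin (n + k) → ℝ) ℝ X).contDiff.contDiffAt.comp u
    (hφ.1.contDiffAt (coords_mem_atlas hq hqp i hs x₀) hu)

/-- The complement of the coordinate domain is y = 0. Test forms vanish near it, so the extension by
zero is smooth on the whole space. -/
theorem contDiff_testCoeff
    {φ : DiffForm (regularPart (n := n) (k := k) hq hqp).carrier (d := n + k) k} (hφ : φ.IsTest)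
    (a : Fin (k + 1)) : ContDiff ℝ ∞ (testCoeff hq hqp i hs x₀ φ a) := by
  obtain ⟨δ, hδ, h⟩ := inChart_eq_zero_of_isTest hq hqp i hs x₀ hφ
  refine contDiff_iff_contDiffAt.2 fun u => ?_
  by_cases hu : u ∈ (coords hq hqp i hs x₀).target
  · refine ContDiffAt.congr_of_eventuallyEq ?_ (testCoeff_eventuallyEq hq hqp i hs x₀ φ a hu)
    exact (contDiff_cutUY i).contDiffAt.mul (contDiffAt_inChart_apply hq hqp i hs x₀ hφ _ hu)
  · refine (contDiffAt_const (c := (0 : ℝ))).congr_of_eventuallyEq ?_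
    have h0 : coordY i u = 0 := not_not.1 fun h0 => hu ((mem_coords_target hq hqp i hs x₀).2 h0)
    have h1 : sqY (coordY i u) < δ := by rwa [h0, sqY_eq_zero_iff.2 rfl]
    filter_upwards [(contDiff_sqY_coordY (k := k) i).continuous.continuousAt.eventually
      (gt_mem_nhds h1)] with u' hu'
    by_cases hm : u' ∈ (coords hq hqp i hs x₀).target
    · rw [testCoeff, indicator_of_mem hm, h u' hm hu']
      exact mul_zero _
    · exact indicator_of_notMem hm _

theorem hasCompactSupport_testCoeff
    (φ : DiffForm (regularPart (n := n) (k := k) hq hqp).carrier (d := n + k) k)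
    (a : Fin (k + 1)) : HasCompactSupport (testCoeff hq hqp i hs x₀ φ a) := by
  refine HasCompactSupport.of_support_subset_isCompact
    (isCompact_closedBall (0 : Fin (n + k) → ℝ) 2) fun u hu => ?_
  by_cases hm : u ∈ (coords hq hqp i hs x₀).target
  · have h1 : cutUY i u ≠ 0 := by
      intro h0
      refine hu ?_
      rw [testCoeff, indicator_of_mem hm, h0, zero_mul]
    refine mem_closedBall_two (i := i) ?_ ?_
    · by_contra h2
      exact h1 (cutUY_eq_zero_left (not_le.1 h2).le)
    · by_contra h2
      exact h1 (cutUY_eq_zero_right (by linarith [not_le.1 h2]))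
  · exact absurd (indicator_of_notMem hm _) hu

/-- The product rule, moving the derivatives onto cutUY φ. The first sum is a divergence and will
integrate to zero; the second is the integrand of the pairing with `codiffForm`. -/
theorem cutUY_mul_extD
    {φ : DiffForm (regularPart (n := n) (k := k) hq hqp).carrier (d := n + k) k} (hφ : φ.IsTest)
    {u : Fin (n + k) → ℝ} (hu : u ∈ (coords hq hqp i hs x₀).target) :
    cutUY i u * φ.extD.inChart (coords hq hqp i hs x₀) u (tupleY i ()) =
      ∑ a : Fin (k + 1), (-1) ^ (a : ℕ) *
        fderiv ℝ (testCoeff hq hqp i hs x₀ φ a) u (Pi.single (iy i a) 1) +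
      ∑ a, divCoeff i a u * φ.inChart (coords hq hqp i hs x₀) u (tupleYRemove i a) := by
  have hd : DifferentiableAt ℝ (φ.inChart (coords hq hqp i hs x₀)) u :=
    (hφ.1.contDiffAt (coords_mem_atlas hq hqp i hs x₀) hu).differentiableAt (by simp)
  rw [DiffForm.extD_inChart (coords_mem_atlas hq hqp i hs x₀) hu hd, extDeriv_apply hd,
    Finset.mul_sum, ← Finset.sum_add_distrib]
  refine Finset.sum_congr rfl fun a _ => ?_
  have h1 : DifferentiableAt ℝ
      (fun u => φ.inChart (coords hq hqp i hs x₀) u (tupleYRemove i a)) u :=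
    (contDiffAt_inChart_apply hq hqp i hs x₀ hφ _ hu).differentiableAt (by simp)
  have h2 : fderiv ℝ (testCoeff hq hqp i hs x₀ φ a) u (Pi.single (iy i a) 1) =
      cutUY i u * fderiv ℝ (fun u => φ.inChart (coords hq hqp i hs x₀) u (tupleYRemove i a)) u
        (Pi.single (iy i a) 1) +
      φ.inChart (coords hq hqp i hs x₀) u (tupleYRemove i a) *
        (cutU i u * (deriv outerProfile (sqY (coordY i u)) * (2 * u (iy i a)))) := by
    rw [(testCoeff_eventuallyEq hq hqp i hs x₀ φ a hu).fderiv_eq,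
      fderiv_fun_mul ((contDiff_cutUY i).differentiable (by simp) u) h1, ← fderiv_cutUY i u a]
    rfl
  have h3 : a.removeNth (tupleY (n := n) i ()) = tupleYRemove i a := rfl
  rw [h2, h3, divCoeff, zsmul_eq_mul, Int.cast_pow, Int.cast_neg, Int.cast_one]
  change cutUY i u * ((-1) ^ (a : ℕ) * fderiv ℝ (fun u => φ.inChart (coords hq hqp i hs x₀) u
    (tupleYRemove i a)) u (Pi.single (iy i a) 1)) = _
  ring

/-- Integration by parts in the y-variables. There is no boundary term at y = 0 because φ vanishes
near P; θ does not, and for θ the identity fails. -/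
theorem isDTMax_coForm (h : p * k = q * (n - 1)) :
    IsDTMax (g.induced (regularPart (n := n) (k := k) hq hqp)) (coForm hq hqp g i hs x₀)
      (codiffForm hq hqp g i hs x₀) := by
  refine ⟨memL2_coForm hq hqp g i hs x₀ h, memL2_codiffForm hq hqp g i hs x₀, fun φ hφ => ?_⟩
  set e := coords hq hqp i hs x₀ with he
  set f : Fin (k + 1) → (Fin (n + k) → ℝ) → ℝ := testCoeff hq hqp i hs x₀ φ with hf
  have hsm := contDiff_testCoeff hq hqp i hs x₀ hφ
  have hcs := hasCompactSupport_testCoeff hq hqp i hs x₀ φ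
  set F : (Fin (n + k) → ℝ) → ℝ := fun u => ∑ a : Fin (k + 1), (-1) ^ (a : ℕ) *
    fderiv ℝ (f a) u (Pi.single (iy i a) 1) with hF
  have hint : ∀ a : Fin (k + 1), Integrable fun u => (-1) ^ (a : ℕ) *
      fderiv ℝ (f a) u (Pi.single (iy i a) 1) := fun a => by
    refine (Continuous.integrable_of_hasCompactSupport ?_ ?_).const_mul _
    · exact ((hsm a).continuous_fderiv (by simp)).clm_apply continuous_const
    · exact ((hcs a).fderiv (𝕜 := ℝ)).comp_left
        (g := fun L : (Fin (n + k) → ℝ) →L[ℝ] ℝ => L (Pi.single (iy i a) 1)) rfl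
  -- This turns the integral over the chart into one over the whole space, where the divergence
  -- theorem for compact supports applies.
  have hF0 : ∀ u ∉ e.target, F u = 0 := by
    intro u hu
    obtain ⟨δ, hδ, hz⟩ := inChart_eq_zero_of_isTest hq hqp i hs x₀ hφ
    refine Finset.sum_eq_zero fun a _ => ?_
    have h0 : coordY i u = 0 := not_not.1 fun h0 => hu ((mem_coords_target hq hqp i hs x₀).2 h0)
    have h1 : sqY (coordY i u) < δ := by rwa [h0, sqY_eq_zero_iff.2 rfl]
    have h2 : f a =ᶠ[𝓝 u] fun _ => 0 := by
      filter_upwards [(contDiff_sqY_coordY (k := k) i).continuous.continuousAt.eventually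
        (gt_mem_nhds h1)] with u' hu'
      by_cases hm : u' ∈ (coords hq hqp i hs x₀).target
      · rw [hf, testCoeff, indicator_of_mem hm, hz u' hm hu']
        exact mul_zero _
      · exact indicator_of_notMem hm _
    rw [h2.fderiv_eq, fderiv_fun_const]
    exact mul_zero _
  have hFint : ∫ u in e.target, F u = 0 := by
    rw [setIntegral_eq_integral_of_forall_compl_eq_zero hF0, hF,
      integral_finsetSum _ fun a _ => hint a]
    refine Finset.sum_eq_zero fun a _ => ?_
    rw [integral_const_mul, integral_fderiv_eq_zero (hsm a) (hcs a), mul_zero]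
  set G : (Fin (n + k) → ℝ) → ℝ := fun u =>
    ∑ a, divCoeff i a u * φ.inChart e u (tupleYRemove i a) with hG
  have hFi : IntegrableOn F e.target := (integrable_finsetSum _ fun a _ => hint a).integrableOn
  have hGc : ContinuousOn G e.target := continuousOn_finsetSum _ fun a _ =>
    (continuous_divCoeff i a).continuousOn.mul fun u hu =>
      (contDiffAt_inChart_apply hq hqp i hs x₀ hφ _ hu).continuousAt.continuousWithinAt
  have hGi : IntegrableOn G e.target := by
    refine ((hGc.mono (divSupport_subset_target hq hqp i hs x₀)).integrableOn_compact (isCompact_divSupport i)).of_forall_sdiff_eq_zero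
      e.open_target.measurableSet fun u hu => ?_
    refine Finset.sum_eq_zero fun a _ => ?_
    rw [divCoeff_eq_zero hu.2, zero_mul]
  refine (l2Inner_chartForm_div hq hqp g i hs x₀ (fun (_ : Unit) u => cutUY i u) (tupleY i)
    φ.extD).trans (Eq.trans ?_ (l2Inner_chartForm_div hq hqp g i hs x₀ (divCoeff i)
    (tupleYRemove i) φ).symm)
  have h1 : ∫ u in e.target, ∑ _a : Unit, cutUY i u * φ.extD.inChart e u (tupleY i ()) =
      ∫ u in e.target, (F u + G u) := by
    refine setIntegral_congr_fun e.open_target.measurableSet fun u hu => ?_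
    simp only [Fintype.sum_unique]
    exact cutUY_mul_extD hq hqp i hs x₀ hφ hu
  refine h1.trans ?_
  rw [integral_add hFi hGi, hFint, zero_add]

/-! ### Failure of the `L²`-Stokes theorem -/

theorem radialForm_comp_coordY (ψ : ℝ → ℝ) (u : Fin (n + k) → ℝ) (a : Fin (k + 1)) :
    (radialForm ψ (coordY i u)).compContinuousLinearMap (coordY (n := n) i) (tupleYRemove i a) =
      ψ (sqY (coordY i u)) * ((-1) ^ (a : ℕ) * u (iy i a)) := by
  refine Eq.trans ?_ (radialForm_apply_single ψ (coordY i u) a)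
  refine congrArg (radialForm ψ (coordY i u)) ?_
  funext l
  exact coordY_single_iy i _

/-- The supports do not meet in an essential way: dθ vanishes for |y|² < 1/2, and the cutoff in η
for |y|² ≥ 1/2. -/
theorem l2Inner_extD_coForm :
    l2Inner (g.induced (regularPart (n := n) (k := k) hq hqp))
      (radialPullback hq hqp (innerProfile k)).extD (coForm hq hqp g i hs x₀) = 0 := by
  refine (l2Inner_chartForm_div hq hqp g i hs x₀ (fun (_ : Unit) u => cutUY i u) (tupleY i)
    _).trans ?_
  refine setIntegral_eq_zero_of_forall_eq_zero fun u hu => ?_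
  rw [Fintype.sum_unique]
  have h0 := (mem_coords_target hq hqp i hs x₀).1 hu
  rcases lt_or_ge (sqY (coordY i u)) (1 / 2) with h1 | h1
  · have h2 : (radialPullback hq hqp (innerProfile k)).extD.inChart (coords hq hqp i hs x₀) u =
        (pullbackForm (d := n + k) (mapY hq hqp)
          (extDeriv (radialForm (innerProfile k)))).inChart (coords hq hqp i hs x₀) u :=
      congrArg (fun w : (Fin (n + k) → ℝ) [⋀^Fin (k + 1)]→L[ℝ] ℝ =>
        w.compContinuousLinearMap (symmDeriv (coords hq hqp i hs x₀) u))
        (extD_radialPullback hq hqp contDiffOn_innerProfile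
          (coords_symm_mem_finitePart hq hqp i hs x₀ h0))
    rw [h2, pullback_mapY_inChart hq hqp _ i hs x₀ h0,
      extDeriv_radialForm_innerProfile_eq_zero h0 h1]
    exact mul_zero _
  · rw [cutUY_eq_zero_right h1, zero_mul]

/-- The integrand of the scalar product of the two forms. -/
def pairing (u : Fin (n + k) → ℝ) : ℝ :=
  cutU i u * (-deriv outerProfile (sqY (coordY i u)) *
    (2 * (sqY (coordY i u) * innerProfile k (sqY (coordY i u)))))

/-- The two alternating signs cancel, and the squares of the y-coordinates add up to |y|². -/
theorem sum_divCoeff_mul (u : Fin (n + k) → ℝ) :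
    ∑ a, divCoeff i a u * (innerProfile k (sqY (coordY i u)) * ((-1) ^ (a : ℕ) * u (iy i a))) =
      pairing i u := by
  have h1 : ∀ a : Fin (k + 1), divCoeff i a u * (innerProfile k (sqY (coordY i u)) *
      ((-1) ^ (a : ℕ) * u (iy i a))) = cutU i u * (-deriv outerProfile (sqY (coordY i u)) *
        (2 * (coordY i u a ^ 2 * innerProfile k (sqY (coordY i u))))) := by
    intro a
    have h5 : ((-1 : ℝ) ^ (a : ℕ)) * (-1) ^ (a : ℕ) = 1 := by
      rw [← mul_pow]
      norm_num
    rw [divCoeff, coordY_apply]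
    linear_combination (-(cutU i u * (deriv outerProfile (sqY (coordY i u)) *
      (2 * (u (iy i a) ^ 2 * innerProfile k (sqY (coordY i u))))))) * h5
  rw [Finset.sum_congr rfl fun a _ => h1 a, ← Finset.mul_sum, ← Finset.mul_sum, ← Finset.mul_sum,
    ← Finset.sum_mul]
  rfl

theorem innerProfile_nonneg {s : ℝ} (hs : 0 ≤ s) : 0 ≤ innerProfile k s :=
  mul_nonneg (Real.smoothTransition.nonneg _) (Real.rpow_nonneg hs _)

theorem pairing_nonneg (u : Fin (n + k) → ℝ) : 0 ≤ pairing i u := by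
  have h1 := sqY_nonneg (coordY i u)
  have h2 := innerProfile_nonneg (k := k) h1
  exact mul_nonneg (Real.smoothTransition.nonneg _)
    (mul_nonneg (neg_nonneg.2 (deriv_outerProfile_nonpos _)) (by positivity))

theorem pairing_of_lt {u : Fin (n + k) → ℝ} (h : sqY (coordY i u) < 1 / 4) : pairing i u = 0 := by
  rw [pairing, deriv_outerProfile_of_lt h]
  ring

/-- The profile of θ is singular at y = 0, but the derivative of the cutoff removes the region |y|²
< 1/4. -/
theorem continuous_pairing : Continuous (pairing (k := k) i) := by
  have hc := (contDiff_sqY_coordY (k := k) i).continuous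
  refine continuous_iff_continuousAt.2 fun u => ?_
  rcases lt_or_ge (sqY (coordY i u)) (1 / 4) with h | h
  · refine (continuousAt_const (y := (0 : ℝ))).congr ?_
    filter_upwards [hc.continuousAt.eventually (gt_mem_nhds h)] with u' hu'
    exact (pairing_of_lt i hu').symm
  · have h1 : ContinuousAt (innerProfile k) (sqY (coordY i u)) :=
      contDiffOn_innerProfile.continuousOn.continuousAt (Ioi_mem_nhds (by linarith))
    have h2 : ContinuousAt (fun u : Fin (n + k) → ℝ => innerProfile k (sqY (coordY i u))) u :=
      ContinuousAt.comp (f := fun u : Fin (n + k) → ℝ => sqY (coordY i u)) h1 hc.continuousAt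
    exact (contDiff_cutU i).continuous.continuousAt.mul
      ((continuous_deriv_outerProfile.comp hc).neg.continuousAt.mul
        (continuousAt_const.mul (hc.continuousAt.mul h2)))

theorem hasCompactSupport_pairing : HasCompactSupport (pairing (k := k) i) := by
  refine HasCompactSupport.of_support_subset_isCompact (isCompact_divSupport (k := k) i)
    fun u hu => ?_
  by_contra hm
  refine hu ?_
  rw [← sum_divCoeff_mul]
  exact Finset.sum_eq_zero fun a _ => by rw [divCoeff_eq_zero hm, zero_mul]

theorem sqU_inclY (y : Fin (k + 1) → ℝ) : sqU i (inclY (n := n) i y) = 0 :=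
  Finset.sum_eq_zero fun j _ => by
    split_ifs with hj
    · rw [inclY_isX i y hj]
      norm_num
    · rfl

/-- The outer cutoff falls from 1 to 0 between 1/4 and 1/2, so its derivative is non-zero at some
value c of |y|² there; the point has u-part zero and y = √c e_0. -/
theorem exists_pairing_ne_zero : ∃ u : Fin (n + k) → ℝ, pairing i u ≠ 0 := by
  obtain ⟨c, hc, hc2, hd⟩ := exists_deriv_outerProfile_ne_zero
  refine ⟨inclY i (Pi.single 0 (Real.sqrt c)), ?_⟩
  have h1 : sqY (coordY i (inclY (n := n) i (Pi.single (0 : Fin (k + 1)) (Real.sqrt c)))) = c := by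
    rw [coordY_inclY, sqY, Finset.sum_eq_single 0]
    · rw [Pi.single_eq_same, Real.sq_sqrt hc.le]
    · intro l _ hl
      rw [Pi.single_eq_of_ne hl]
      norm_num
    · simp
  have h2 : innerProfile k c ≠ 0 := by
    rw [innerProfile_of_le_half hc2]
    exact (Real.rpow_pos_of_pos hc _).ne'
  rw [pairing, h1, cutU, sqU_inclY, Real.smoothTransition.one_of_one_le (by norm_num), one_mul]
  exact mul_ne_zero (neg_ne_zero.2 hd) (mul_ne_zero two_ne_zero (mul_ne_zero hc.ne' h2))

/-- This is the boundary term at P. The outer cutoff is decreasing and all other factors of the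
integrand are non-negative, so no cancellation can occur. -/
theorem l2Inner_codiffForm_pos :
    0 < l2Inner (g.induced (regularPart (n := n) (k := k) hq hqp))
      (radialPullback hq hqp (innerProfile k)) (codiffForm hq hqp g i hs x₀) := by
  have h1 := l2Inner_chartForm_div hq hqp g i hs x₀ (divCoeff i) (tupleYRemove i)
    (radialPullback hq hqp (innerProfile k))
  have h2 : ∫ u in (coords hq hqp i hs x₀).target, ∑ a, divCoeff i a u *
      (radialPullback hq hqp (innerProfile k)).inChart (coords hq hqp i hs x₀) u
        (tupleYRemove i a) = ∫ u, pairing (k := k) i u := by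
    refine Eq.trans ?_ (setIntegral_eq_integral_of_forall_compl_eq_zero
      (s := (coords hq hqp i hs x₀).target) (f := pairing (k := k) i) ?_)
    · refine setIntegral_congr_fun (coords hq hqp i hs x₀).open_target.measurableSet
        fun u hu => ?_
      have h0 := (mem_coords_target hq hqp i hs x₀).1 hu
      change ∑ a, divCoeff i a u * (pullbackForm (d := n + k) (mapY hq hqp)
        (radialForm (innerProfile k))).inChart (coords hq hqp i hs x₀) u (tupleYRemove i a) = _
      rw [pullback_mapY_inChart hq hqp _ i hs x₀ h0]
      simp only [radialForm_comp_coordY]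
      exact sum_divCoeff_mul i u
    · intro u hu
      refine pairing_of_lt i ?_
      have h0 : coordY i u = 0 := not_not.1 fun h0 => hu ((mem_coords_target hq hqp i hs x₀).2 h0)
      rw [h0, sqY_eq_zero_iff.2 rfl]
      norm_num
  obtain ⟨u, hu⟩ := exists_pairing_ne_zero (k := k) i
  refine lt_of_lt_of_eq ?_ (h1.trans h2).symm
  exact (continuous_pairing i).integral_pos_of_hasCompactSupport_nonneg_nonzero
    (hasCompactSupport_pairing i) (pairing_nonneg i) hu

end Adjoint

/-- A single chart, that of the first x-coordinate with positive sign, suffices. The point of W only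
serves as the irrelevant base point of this chart. -/
theorem not_l2StokesHolds (hn : 0 < n) (hq : 0 < q) (hqp : q < p) (h : p * k = q * (n - 1))
    (g : RealProjMetric (n + k + 1)) :
    ¬ L2StokesHolds (g.induced (regularPart (n := n) (k := k) hq hqp)) := by
  intro hst
  obtain ⟨x, hx⟩ := varietyW_diff_nonempty (k := k) hn hq hqp
  have h1 := hst k _ _ _ _ (isDMax_radialPullback hq hqp hn h g)
    (isDTMax_coForm hq hqp g ⟨0, hn⟩ (one_pow 2) ⟨x, hx⟩ h)
  rw [l2Inner_extD_coForm] at h1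
  exact (l2Inner_codiffForm_pos hq hqp g ⟨0, hn⟩ (one_pow 2) ⟨x, hx⟩).ne h1

end GraphChart

end
open GraphChart

theorem proposition2p10 :
    (∀ n m p q : ℕ, 0 < n → 0 < m → 0 < q → q < p →
      singularLocus (n + m - 1) (varietyW n m p q) = {pointP n m} ∧
      (∀ g : RealProjMetric (n + m), HaveQuasiIsometricPointedNhds (n + m - 1) g
        (varietyW n m p q) (varietyV n m p q) (pointP n m)) ∧
      ∃ M : EmbeddedSubmanifold (RealProj (n + m)) (N := n + m) (n + m - 1),
        M.carrier = varietyW n m p q \ singularLocus (n + m - 1) (varietyW n m p q) ∧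
        M.carrier.Nonempty ∧
        (p * (m - 1) = q * (n - 1) →
          ∀ g : RealProjMetric (n + m), ¬ L2StokesHolds (g.induced M))) ∧
    ∃ n m p q : ℕ, 0 < n ∧ 0 < m ∧ 0 < q ∧ q < p ∧ Even (n + m - 1) ∧
      p * (m - 1) = q * (n - 1) ∧
      ∃ (P : RealProj (n + m))
        (M : EmbeddedSubmanifold (RealProj (n + m)) (N := n + m) (n + m - 1)),
        singularLocus (n + m - 1) (varietyW n m p q) = {P} ∧
        M.carrier = varietyW n m p q \ {P} ∧
        ∀ g : RealProjMetric (n + m), ¬ L2StokesHolds (g.induced M) := by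
  refine ⟨?_, ?_⟩
  · intro n m p q hn hm hq hqp
    obtain ⟨k, rfl⟩ := Nat.exists_eq_succ_of_ne_zero hm.ne'
    refine ⟨singularLocus_varietyW hn hq hqp, haveQuasiIsometricPointedNhds hq hqp,
      regularPart hq hqp, ?_, varietyW_diff_nonempty hn hq hqp, fun h g => ?_⟩
    · exact (congrArg (fun s => varietyW n (k + 1) p q \ s)
        (singularLocus_varietyW (k := k) hn hq hqp)).symm
    · exact not_l2StokesHolds hn hq hqp h g
  -- Here 2 (2 - 1) = 1 (3 - 1), and the dimension 3 + 2 - 1 = 4 is even.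
  · exact ⟨3, 2, 2, 1, by norm_num, by norm_num, by norm_num, by norm_num, by decide, by norm_num,
      pointP 3 2, regularPart (n := 3) (k := 1) (by norm_num) (by norm_num),
      singularLocus_varietyW (n := 3) (k := 1) (by norm_num) (by norm_num) (by norm_num), rfl,
      fun g => not_l2StokesHolds (n := 3) (k := 1) (by norm_num) (by norm_num) (by norm_num)
        (by norm_num) g⟩
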